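/- **Setting.** Let $T>0$, $q\in(1,2]$, and let $D\subset\mathbb R^3$ be a bounded $C^1$-domain or $D=\mathbb R^3$. Let $(\Omega,\mathfrak F,(\mathcal F_t)_{t\ge 0},\mathbb P)$ be a filtered probability space satisfying the usual conditions and $\beta_1,\dots,\beta_N$ independent real-valued standard $(\mathcal F_t)$-Brownian motions. Let $B_1,\dots,B_N\in W^{1,\infty}(D)$ be real-valued, $u_0:\Omega\to L^2(D)^6$ be $\mathcal F_0$-measurable, and let $J,b_1,\dots,b_N\in L^2(\Omega\times[0,T]\times D)^6$ be progressively measurable (functions are $\mathbb C^6$-valued, $v=(v_1,v_2)$ with $v_1,v_2\in\mathbb C^3$). Let $M(v_1,v_2)=(\operatorname{curl}v_2,-\operatorname{curl}v_1)$ with domain $D(M)=\{v\in L^2(D)^6:\operatorname{curl}v_1,\operatorname{curl}v_2\in L^2(D)^3,\ v_1\times\nu=0\text{ on }\partial D\}$ (no boundary condition if $D=\mathbb R^3$). For a general $v\in L^2(D)^6$, $Mv$ is understood in the sense of distributions on $D$. **Solutions.** An adapted process $v:\Omega\times[0,T]\to L^2(D)^6$ solves $dv=[Mv+f]\,dt+\sum_{j=1}^N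 g_j\,d\beta_j$, $v(0)=u_0$, if for every $\phi\in D(M)\cap L^{q+2}(D)^6$, almost surely for all $t\in[0,T]$, $$\langle v(t)-u_0,\phi\rangle=\int_0^t\big(-\langle v(s),M\phi\rangle+\langle f(s),\phi\rangle\big)\,ds+\sum_{j=1}^N\int_0^t\langle g_j(s),\phi\rangle\,d\beta_j(s),$$ where $\langle\cdot,\cdot\rangle$ is the $L^2(D)^6$ pairing. A *strong solution of (MSEE) with $G\equiv0$* is an adapted process $u$ with almost surely continuous paths in $L^2(D)^6$ such that $$\mathbb E\sup_{t\in[0,T]}\|u(t)\|_{L^2(D)^6}^2+\mathbb E\int_0^T\!\!\int_D|u(t,x)|^{q+2}\,dx\,dt<\infty,$$ $$Mu\in L^2(\Omega;L^\infty(0,T;L^2(D)))^6+L^{\frac{q+2}{q+1}}(\Omega\times[0,T]\times D)^6,$$ and which solves, in the sense above, $$du=\big[Mu-|u|^qu+J\big]\,dt+\sum_{j=1}^N\big[b_j+iB_ju\big]\,d\beta_j,\qquad u(0)=u_0 .$$ **Proposition.** Let $u:\Omega\times[0,T]\to L^2(D)^6$ be a stochastic process with almost surely continuous paths, and put $y(t):=e^{-i\sum_{l=1}^NB_l\beta_l(t)}u(t)$.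 Then $u$ is a strong solution of (MSEE) with $G\equiv0$ if and only if $y$ has almost surely continuous paths in $L^2(D)^6$, satisfies 1. $\displaystyle\mathbb E\sup_{t\in[0,T]}\|y(t)\|_{L^2(D)^6}^2+\mathbb E\int_0^T\!\!\int_D|y(t,x)|^{q+2}\,dx\,dt<\infty$, 2. $\displaystyle My+i\sum_{j=1}^N\beta_j\binom{\nabla B_j\times y_2}{-\nabla B_j\times y_1}\in L^{\frac{q+2}{q+1}}(\Omega\times[0,T]\times D)^6+L^2(\Omega;L^\infty(0,T;L^2(D)))^6$, and is adapted and solves, in the sense above, the transformed equation with purely additive noise $$(\mathrm{TSEE})\qquad dy=\big[My-|y|^qy+A(t)y+\widetilde J\,\big]\,dt+\sum_{j=1}^N\widetilde b_j\,d\beta_j,\qquad y(0)=u_0,$$ where $$A(t)y=\tfrac12\sum_{j=1}^NB_j^2\,y+i\sum_{j=1}^N\beta_j(t)\binom{\nabla B_j\times y_2}{-\nabla B_j\times y_1},\qquad \widetilde b_j(t)=b_j(t)\,e^{-i\sum_{l=1}^NB_l\beta_l(t)},$$ $$\widetilde J(t)=\Big(J(t)-i\sum_{j=1}^NB_j\,b_j(t)\Big)e^{-i\sum_{l=1}^NB_l\beta_l(t)}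 .$$ -/

import Mathlib

open MeasureTheory ProbabilityTheory Filter Topology Set
open scoped NNReal ENNReal Matrix

namespace StochasticMaxwell

/-! ### Space, fields, and the operator curl -/

/-- Physical space `ℝ³` with the Euclidean norm. -/
abbrev E3 := EuclideanSpace ℝ (Fin 3)

/-- `ℂ⁶ = ℂ³ × ℂ³` with the Euclidean (Hermitian) norm. -/
abbrev C6 := EuclideanSpace ℂ (Fin 3 ⊕ Fin 3)

/-- The first `ℂ³`-component `v₁` of `v = (v₁, v₂)`. -/
def fstC (v : C6) : Fin 3 → ℂ := fun i => v (Sum.inl i)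

/-- The second `ℂ³`-component `v₂` of `v = (v₁, v₂)`. -/
def sndC (v : C6) : Fin 3 → ℂ := fun i => v (Sum.inr i)

/-- The vector `(a, b) ∈ ℂ³ × ℂ³`. -/
def pairC (a b : Fin 3 → ℂ) : C6 := WithLp.toLp 2 (Sum.elim a b)

/-- The Hilbert space `L²(D)⁶` of square integrable functions `D → ℂ⁶`. -/
noncomputable abbrev H (D : Set E3) := Lp C6 2 (volume.restrict D)

/-- A bounded `C¹`-domain: a bounded, open, connected set that near each boundary point is, after
a rigid change of coordinates, the region strictly above the graph of a `C¹` function. -/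
structure IsBoundedC1Domain (D : Set E3) : Prop where
  isOpen : IsOpen D
  isConnected : IsConnected D
  isBounded : Bornology.IsBounded D
  boundary : ∀ p ∈ frontier D, ∃ r > 0, ∃ L : E3 ≃ₗᵢ[ℝ] E3, ∃ γ : ℝ × ℝ → ℝ, ContDiff ℝ 1 γ ∧
    D ∩ Metric.ball p r = {x | x ∈ Metric.ball p r ∧ γ (L x 0, L x 1) < L x 2}

/-- The classical curl of a differentiable field `Φ : ℝ³ → ℂ³`. -/
noncomputable def curl (Φ : E3 → Fin 3 → ℂ) (x : E3) : Fin 3 → ℂ :=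
  let d : Fin 3 → Fin 3 → ℂ := fun i k => fderiv ℝ Φ x (EuclideanSpace.single i 1) k
  ![d 1 2 - d 2 1, d 2 0 - d 0 2, d 0 1 - d 1 0]

/-- `curl g = h` on `D` in the sense of distributions, for locally integrable `g` and `h`. -/
def HasWeakCurl (D : Set E3) (g h : E3 → Fin 3 → ℂ) : Prop :=
  LocallyIntegrableOn g D ∧ LocallyIntegrableOn h D ∧
    ∀ Φ : E3 → Fin 3 → ℂ, ContDiff ℝ (⊤ : ℕ∞) Φ → HasCompactSupport Φ → tsupport Φ ⊆ D →
      ∫ x in D, curl Φ x ⬝ᵥ g x = ∫ x in D, Φ x ⬝ᵥ h x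

/-- `g × ν = 0` on `∂D`, where `h = curl g`: the integration by parts formula
`∫_D curl Φ · g = ∫_D Φ · curl g` holds for all `Φ ∈ C^∞(closure D)³`, that is, for all
restrictions to `D` of smooth compactly supported fields on `ℝ³`. For `D = ℝ³` this is implied by
`curl g = h`, so that there is no boundary condition in that case. -/
def HasZeroTangentialTrace (D : Set E3) (g h : E3 → Fin 3 → ℂ) : Prop :=
  ∀ Φ : E3 → Fin 3 → ℂ, ContDiff ℝ (⊤ : ℕ∞) Φ → HasCompactSupport Φ →
    ∫ x in D, curl Φ x ⬝ᵥ g x = ∫ x in D, Φ x ⬝ᵥ h x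

/-- `M v = z` in the sense of distributions on `D`, where `M (v₁, v₂) = (curl v₂, - curl v₁)`. -/
def IsDistribMaxwell (D : Set E3) (v z : E3 → C6) : Prop :=
  HasWeakCurl D (fun x => sndC (v x)) (fun x => fstC (z x)) ∧
    HasWeakCurl D (fun x => fstC (v x)) (fun x => -sndC (z x))

/-- The graph of the Maxwell operator `M` with domain `D(M) = H(curl,0)(D) × H(curl)(D)`:
`φ ∈ D(M)` and `M φ = ψ`. -/
def MaxwellGraph (D : Set E3) (φ ψ : H D) : Prop :=
  IsDistribMaxwell D φ ψ ∧
    HasZeroTangentialTrace D (fun x => fstC (φ x)) (fun x => -sndC (ψ x))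

/-! ### The coefficients `B_j ∈ W^{1,∞}(D)` -/

/-- `∇ B = g` on `D` in the sense of distributions. -/
def HasWeakGradient (D : Set E3) (B : E3 → ℝ) (g : E3 → E3) : Prop :=
  ∀ φ : E3 → ℝ, ContDiff ℝ (⊤ : ℕ∞) φ → HasCompactSupport φ → tsupport φ ⊆ D →
    ∀ i : Fin 3, ∫ x in D, B x * fderiv ℝ φ x (EuclideanSpace.single i 1)
      = -∫ x in D, g x i * φ x

/-- Real-valued elements of `L^∞(D)`. -/
noncomputable abbrev LInf (D : Set E3) := Lp ℝ ⊤ (volume.restrict D)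

/-- `B ∈ W^{1,∞}(D)`: the bounded function `B` has a bounded weak gradient. -/
def MemW1Inf (D : Set E3) (B : LInf D) : Prop :=
  ∃ g : Lp E3 ⊤ (volume.restrict D), HasWeakGradient D B g

open Classical in
/-- The weak gradient `∇ B ∈ L^∞(D)³` of `B ∈ W^{1,∞}(D)`. -/
noncomputable def weakGrad (D : Set E3) (B : LInf D) : Lp E3 ⊤ (volume.restrict D) :=
  if h : MemW1Inf D B then h.choose else 0

theorem hasWeakGradient_weakGrad {D : Set E3} {B : LInf D} (h : MemW1Inf D B) :
    HasWeakGradient D B (weakGrad D B) := by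
  rw [weakGrad, dif_pos h]
  exact h.choose_spec

/-- The vector `(g × v₂, - g × v₁)` for `g ∈ ℝ³` and `v = (v₁, v₂) ∈ ℂ⁶`. -/
noncomputable def crossTerm (g : E3) (v : C6) : C6 :=
  pairC (crossProduct (fun i => (g i : ℂ)) (sndC v)) (-crossProduct (fun i => (g i : ℂ)) (fstC v))

/-- The phase factor `exp (- i ∑_l B_l(x) c_l)`. -/
noncomputable def phase {D : Set E3} {N : ℕ} (B : Fin N → LInf D) (c : Fin N → ℝ) (x : E3) : ℂ :=
  Complex.exp (-Complex.I * ∑ l, (B l x : ℂ) * (c l : ℂ))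

theorem norm_phase {D : Set E3} {N : ℕ} (B : Fin N → LInf D) (c : Fin N → ℝ) (x : E3) :
    ‖phase B c x‖ = 1 := by
  have h : -Complex.I * ∑ l, (B l x : ℂ) * (c l : ℂ)
      = ((-∑ l, B l x * c l : ℝ) : ℂ) * Complex.I := by
    push_cast
    ring
  rw [phase, h, Complex.norm_exp_ofReal_mul_I]

theorem memLp_phase_smul {D : Set E3} {N : ℕ} (B : Fin N → LInf D) (c : Fin N → ℝ) (f : H D) :
    MemLp (fun x => phase B c x • f x) 2 (volume.restrict D) := by
  have hB : ∀ l, AEStronglyMeasurable (fun x => (B l x : ℂ)) (volume.restrict D) := fun l =>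
    Complex.continuous_ofReal.comp_aestronglyMeasurable (Lp.aestronglyMeasurable (B l))
  have hs : AEStronglyMeasurable (fun x => ∑ l, (B l x : ℂ) * (c l : ℂ)) (volume.restrict D) :=
    Finset.aestronglyMeasurable_fun_sum _ fun l _ => (hB l).mul_const _
  have hp : AEStronglyMeasurable (fun x => phase B c x) (volume.restrict D) :=
    Complex.continuous_exp.comp_aestronglyMeasurable (hs.const_mul _)
  refine (Lp.memLp f).of_le (hp.smul (Lp.aestronglyMeasurable f)) (ae_of_all _ fun x => ?_)
  rw [norm_smul, norm_phase, one_mul]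

/-- Multiplication of `f ∈ L²(D)⁶` by the phase factor `exp (- i ∑_l B_l c_l)`. -/
noncomputable def rescale {D : Set E3} {N : ℕ} (B : Fin N → LInf D) (c : Fin N → ℝ) (f : H D) :
    H D :=
  (memLp_phase_smul B c f).toLp _

/-! ### The stochastic basis and the Itô integral -/

/-- Lebesgue measure on the time axis `[0, ∞)`. -/
noncomputable def leb : Measure ℝ≥0 := Measure.comap ((↑) : ℝ≥0 → ℝ) volume

theorem measurableEmbedding_coe_nnreal : MeasurableEmbedding ((↑) : ℝ≥0 → ℝ) :=
  MeasurableEmbedding.subtype_coe measurableSet_Ici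

theorem leb_Icc (a b : ℝ≥0) : leb (Icc a b) = ENNReal.ofReal (b - a) := by
  have h : ((↑) : ℝ≥0 → ℝ) '' Icc a b = Icc (a : ℝ) b := by
    ext x
    constructor
    · rintro ⟨y, hy, rfl⟩
      exact ⟨NNReal.coe_le_coe.2 hy.1, NNReal.coe_le_coe.2 hy.2⟩
    · intro hx
      exact ⟨⟨x, a.2.trans hx.1⟩, ⟨NNReal.coe_le_coe.1 hx.1, NNReal.coe_le_coe.1 hx.2⟩, rfl⟩
  rw [leb, measurableEmbedding_coe_nnreal.comap_apply, h, Real.volume_Icc]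

section Stochastic

variable {Ω : Type*} {mΩ : MeasurableSpace Ω}

/-- The usual conditions: right-continuity, and `ℱ₀` contains all `P`-null sets. -/
def UsualConditions (P : Measure Ω) (F : Filtration ℝ≥0 mΩ) : Prop :=
  F.IsRightContinuous ∧ ∀ s : Set Ω, P s = 0 → MeasurableSet[F 0] s

/-- `β₁, …, β_N` are independent real-valued standard Brownian motions with respect to the
filtration `F`. -/
structure IsBrownianFamily (P : Measure Ω) (F : Filtration ℝ≥0 mΩ) {N : ℕ}
    (β : Fin N → ℝ≥0 → Ω → ℝ) : Prop where
  brownian : ∀ j, IsBrownianReal (β j) P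
  adapted : ∀ j, StronglyAdapted F (β j)
  indep : iIndepFun (fun j ω (t : ℝ≥0) => β j t ω) P
  indep_increments : ∀ s t : ℝ≥0, s ≤ t →
    Indep (MeasurableSpace.comap (fun ω (j : Fin N) => β j t ω - β j s ω) inferInstance) (F s) P

/-- A simple process `∑_k ξ_k 1_{(τ_k, τ_{k+1}]}` with deterministic times `τ_0 ≤ … ≤ τ_n` and
bounded `ℱ_{τ_k}`-measurable coefficients `ξ_k`. -/
structure SimpleProc (F : Filtration ℝ≥0 mΩ) where
  n : ℕ
  τ : Fin (n + 1) → ℝ≥0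
  mono : Monotone τ
  ξ : Fin n → Ω → ℂ
  meas : ∀ k, StronglyMeasurable[F (τ k.castSucc)] (ξ k)
  bdd : ∃ C : ℝ, ∀ k ω, ‖ξ k ω‖ ≤ C

/-- The value of a simple process. -/
noncomputable def SimpleProc.val {F : Filtration ℝ≥0 mΩ} (S : SimpleProc F) (t : ℝ≥0) (ω : Ω) :
    ℂ :=
  ∑ k, (Ioc (S.τ k.castSucc) (S.τ k.succ)).indicator (fun _ => S.ξ k ω) t

/-- The elementary stochastic integral `∫_0^t S dW` of a simple process. -/
noncomputable def SimpleProc.integral {F : Filtration ℝ≥0 mΩ} (S : SimpleProc F)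
    (W : ℝ≥0 → Ω → ℝ) (t : ℝ≥0) (ω : Ω) : ℂ :=
  ∑ k, S.ξ k ω * ((W (min (S.τ k.succ) t) ω - W (min (S.τ k.castSucc) t) ω : ℝ) : ℂ)

/-- `I t = ∫_0^t X dW` for `t ∈ [0,T]`, as an Itô integral: there are simple processes `S n` with
`∫_0^T |S n - X|² ds → 0` in probability whose elementary integrals converge to `I` uniformly on
`[0,T]` in probability. This determines `I` on `[0,T]` up to indistinguishability. -/
def IsItoIntegral (P : Measure Ω) (F : Filtration ℝ≥0 mΩ) (W : ℝ≥0 → Ω → ℝ) (T : ℝ≥0)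
    (X I : ℝ≥0 → Ω → ℂ) : Prop :=
  (∀ᵐ ω ∂P, AEStronglyMeasurable (fun s => X s ω) (leb.restrict (Icc 0 T))) ∧
  ∃ S : ℕ → SimpleProc F,
    (∀ ε : ℝ≥0∞, 0 < ε → Tendsto
      (fun n => P {ω | ε ≤ ∫⁻ s in Icc 0 T, ‖(S n).val s ω - X s ω‖ₑ ^ 2 ∂leb}) atTop (𝓝 0)) ∧
    (∀ ε : ℝ≥0∞, 0 < ε → Tendsto
      (fun n => P {ω | ε ≤ ⨆ t ∈ Icc 0 T, ‖(S n).integral W t ω - I t ω‖ₑ}) atTop (𝓝 0))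

/-! ### Solutions of stochastic evolution equations with the Maxwell operator -/

/-- Almost all paths are continuous on `[0,T]`. -/
def ContinuousPaths {D : Set E3} (P : Measure Ω) (T : ℝ≥0) (u : ℝ≥0 → Ω → H D) : Prop :=
  ∀ᵐ ω ∂P, ContinuousOn (fun t => u t ω) (Icc 0 T)

/-- `E sup_{t ≤ T} ‖u(t)‖²_{L²(D)⁶} + E ∫_0^T ∫_D |u(t,x)|^{q+2} dx dt < ∞`. -/
def FiniteEnergy {D : Set E3} (P : Measure Ω) (T : ℝ≥0) (q : ℝ) (u : ℝ≥0 → Ω → H D) : Prop :=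
  (∫⁻ ω, ⨆ t ∈ Icc 0 T, ‖u t ω‖ₑ ^ 2 ∂P)
    + (∫⁻ ω, ∫⁻ t in Icc 0 T, (∫⁻ x in D, ‖u t ω x‖ₑ ^ (q + 2)) ∂leb ∂P) < ∞

/-- `M u + R ∈ L²(Ω; L^∞(0,T; L²(D)))⁶ + L^{(q+2)/(q+1)}(Ω × [0,T] × D)⁶`, where `M u` is taken in
the sense of distributions on `D`. -/
def MaxwellRegular (P : Measure Ω) (D : Set E3) (T : ℝ≥0) (q : ℝ) (u : ℝ≥0 → Ω → H D)
    (R : ℝ≥0 → Ω → E3 → C6) : Prop :=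
  ∃ z₁ z₂ : Ω × ℝ≥0 × E3 → C6,
    AEStronglyMeasurable z₁ (P.prod ((leb.restrict (Icc 0 T)).prod (volume.restrict D))) ∧
    ∫⁻ ω, (essSup (fun t => eLpNorm (fun x => z₁ (ω, t, x)) 2 (volume.restrict D))
      (leb.restrict (Icc 0 T))) ^ 2 ∂P < ∞ ∧
    MemLp z₂ (ENNReal.ofReal ((q + 2) / (q + 1)))
      (P.prod ((leb.restrict (Icc 0 T)).prod (volume.restrict D))) ∧
    ∀ᵐ ω ∂P, ∀ᵐ t ∂(leb.restrict (Icc 0 T)),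
      IsDistribMaxwell D (u t ω) (fun x => z₁ (ω, t, x) + z₂ (ω, t, x) - R t ω x)

/-- The adapted process `u` solves `du = [M u + f] dt + ∑_j g_j dβ_j`, `u(0) = u₀`, on `[0,T]` in
the weak sense: for every `φ ∈ D(M) ∩ L^{q+2}(D)⁶`, almost surely for all `t ∈ [0,T]`,
`⟨u(t) - u₀, φ⟩ = ∫_0^t (- ⟨u(s), M φ⟩ + ⟨f(s), φ⟩) ds + ∑_j ∫_0^t ⟨g_j(s), φ⟩ dβ_j(s)`.
Mathlib's inner product is conjugate-linear in its first slot, so `⟨v, φ⟩` is `inner ℂ φ v`. -/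
def SolvesWeakly (P : Measure Ω) (F : Filtration ℝ≥0 mΩ) {N : ℕ} (β : Fin N → ℝ≥0 → Ω → ℝ)
    (D : Set E3) (T : ℝ≥0) (q : ℝ) (u₀ : Ω → H D) (f : ℝ≥0 → Ω → E3 → C6)
    (g : Fin N → ℝ≥0 → Ω → E3 → C6) (u : ℝ≥0 → Ω → H D) : Prop :=
  (∀ t ≤ T, StronglyMeasurable[F t] (u t)) ∧
  ∀ φ ψ : H D, MaxwellGraph D φ ψ → MemLp φ (ENNReal.ofReal (q + 2)) (volume.restrict D) →
    ∃ I : Fin N → ℝ≥0 → Ω → ℂ,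
      (∀ j, IsItoIntegral P F (β j) T
        (fun s ω => ∫ x in D, inner ℂ (φ x) (g j s ω x)) (I j)) ∧
      ∀ᵐ ω ∂P, ∀ t ≤ T,
        inner ℂ φ (u t ω - u₀ ω)
          = (∫ s in Icc 0 t, (-inner ℂ ψ (u s ω) + ∫ x in D, inner ℂ (φ x) (f s ω x)) ∂leb)
            + ∑ j, I j t ω

/-- The nonlinearity `|v|^q v`. -/
noncomputable def powerNL (q : ℝ) (v : C6) : C6 := ((‖v‖ ^ q : ℝ) : ℂ) • v

/-- The retarded material law `(G ∗ u)(t) = ∫_0^t G(t - s) u(s) ds`. -/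
noncomputable def retarded {D : Set E3} (G : ℝ≥0 → Ω → (H D →L[ℂ] H D)) (u : ℝ≥0 → Ω → H D)
    (t : ℝ≥0) (ω : Ω) : H D :=
  ∫ s in Icc 0 t, G (t - s) ω (u s ω) ∂leb

/-- Weak solutions of
`du = [M u - |u|^q u + G ∗ u + J] dt + ∑_j [b_j + i B_j u] dβ_j`, `u(0) = u₀`. -/
structure IsWeakSolutionMSEE (P : Measure Ω) (F : Filtration ℝ≥0 mΩ) {N : ℕ}
    (β : Fin N → ℝ≥0 → Ω → ℝ) (D : Set E3) (T : ℝ≥0) (q : ℝ) (B : Fin N → LInf D)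
    (u₀ : Ω → H D) (G : ℝ≥0 → Ω → (H D →L[ℂ] H D)) (J : ℝ≥0 → Ω → H D)
    (b : Fin N → ℝ≥0 → Ω → H D) (u : ℝ≥0 → Ω → H D) : Prop where
  continuousPaths : ContinuousPaths P T u
  finiteEnergy : FiniteEnergy P T q u
  solves : SolvesWeakly P F β D T q u₀
    (fun t ω x => -powerNL q (u t ω x) + retarded G u t ω x + J t ω x)
    (fun j t ω x => b j t ω x + (Complex.I * (B j x : ℂ)) • u t ω x) u

/-- Strong solutions: weak solutions `u` such that in addition
`M u ∈ L²(Ω; L^∞(0,T; L²(D)))⁶ + L^{(q+2)/(q+1)}(Ω × [0,T] × D)⁶`. -/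
structure IsStrongSolutionMSEE (P : Measure Ω) (F : Filtration ℝ≥0 mΩ) {N : ℕ}
    (β : Fin N → ℝ≥0 → Ω → ℝ) (D : Set E3) (T : ℝ≥0) (q : ℝ) (B : Fin N → LInf D)
    (u₀ : Ω → H D) (G : ℝ≥0 → Ω → (H D →L[ℂ] H D)) (J : ℝ≥0 → Ω → H D)
    (b : Fin N → ℝ≥0 → Ω → H D) (u : ℝ≥0 → Ω → H D) : Prop
    extends IsWeakSolutionMSEE P F β D T q B u₀ G J b u where
  regular : MaxwellRegular P D T q u (fun _ _ _ => 0)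

/-! ### The transformed equation -/

/-- The term `i ∑_j β_j(t) (∇B_j × y₂, - ∇B_j × y₁)`. -/
noncomputable def gradTerm {D : Set E3} {N : ℕ} (β : Fin N → ℝ≥0 → Ω → ℝ) (B : Fin N → LInf D)
    (y : ℝ≥0 → Ω → H D) (t : ℝ≥0) (ω : Ω) (x : E3) : C6 :=
  ∑ j, (Complex.I * (β j t ω : ℂ)) • crossTerm (weakGrad D (B j) x) (y t ω x)

/-- `A(t) y(t) = ½ ∑_j B_j² y(t) + i ∑_j β_j(t) (∇B_j × y₂(t), - ∇B_j × y₁(t))`. -/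
noncomputable def opA {D : Set E3} {N : ℕ} (β : Fin N → ℝ≥0 → Ω → ℝ) (B : Fin N → LInf D)
    (y : ℝ≥0 → Ω → H D) (t : ℝ≥0) (ω : Ω) (x : E3) : C6 :=
  ((1 / 2 : ℂ) * ∑ j, (B j x : ℂ) ^ 2) • y t ω x + gradTerm β B y t ω x

/-- `J̃(t) = (J(t) - i ∑_j B_j b_j(t)) exp (- i ∑_l B_l β_l(t))`. -/
noncomputable def tildeJ {D : Set E3} {N : ℕ} (β : Fin N → ℝ≥0 → Ω → ℝ) (B : Fin N → LInf D)
    (J : ℝ≥0 → Ω → H D) (b : Fin N → ℝ≥0 → Ω → H D) (t : ℝ≥0) (ω : Ω) (x : E3) : C6 :=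
  phase B (fun l => β l t ω) x • (J t ω x - ∑ j, (Complex.I * (B j x : ℂ)) • b j t ω x)

/-- `b̃_j(t) = b_j(t) exp (- i ∑_l B_l β_l(t))`. -/
noncomputable def tildeB {D : Set E3} {N : ℕ} (β : Fin N → ℝ≥0 → Ω → ℝ) (B : Fin N → LInf D)
    (b : Fin N → ℝ≥0 → Ω → H D) (j : Fin N) (t : ℝ≥0) (ω : Ω) (x : E3) : C6 :=
  phase B (fun l => β l t ω) x • b j t ω x

/-- `y` solves `dy = [M y - |y|^q y + A(t) y + J̃] dt + ∑_j b̃_j dβ_j`, `y(0) = u₀`. -/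
def SolvesTSEE (P : Measure Ω) (F : Filtration ℝ≥0 mΩ) {N : ℕ}
    (β : Fin N → ℝ≥0 → Ω → ℝ) (D : Set E3) (T : ℝ≥0) (q : ℝ) (B : Fin N → LInf D)
    (u₀ : Ω → H D) (J : ℝ≥0 → Ω → H D) (b : Fin N → ℝ≥0 → Ω → H D) (y : ℝ≥0 → Ω → H D) : Prop :=
  SolvesWeakly P F β D T q u₀
    (fun t ω x => -powerNL q (y t ω x) + opA β B y t ω x + tildeJ β B J b t ω x)
    (fun j t ω x => tildeB β B b j t ω x) y

/-- The transformed process `y(t) = exp (- i ∑_l B_l β_l(t)) u(t)`. -/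
noncomputable def transform {D : Set E3} {N : ℕ} (β : Fin N → ℝ≥0 → Ω → ℝ) (B : Fin N → LInf D)
    (u : ℝ≥0 → Ω → H D) (t : ℝ≥0) (ω : Ω) : H D :=
  rescale B (fun l => β l t ω) (u t ω)

/-- A progressively measurable process in `L²(Ω × [0,T] × D)⁶`. -/
def IsL2Process {D : Set E3} (P : Measure Ω) (F : Filtration ℝ≥0 mΩ) (T : ℝ≥0)
    (J : ℝ≥0 → Ω → H D) : Prop :=
  IsStronglyProgressive F J ∧ ∫⁻ ω, ∫⁻ t in Icc 0 T, ‖J t ω‖ₑ ^ 2 ∂leb ∂P < ∞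

end Stochastic

end StochasticMaxwell

open StochasticMaxwell

/-! Let Θ = i ∑ C_l β_l with real C_l in W^{1,∞}(D). If dv = [Mv + f] dt + ∑ g_l dβ_l, then Itô's
formula gives w = e^Θ v the noise coefficients e^Θ (g_l + i C_l v) and, besides M w, the drift e^Θ
f, the Itô terms e^Θ (½ ∑ (i C_l)² v + ∑ i C_l g_l), and the commutator of M with e^Θ, which is -i ∑
β_l (∇C_l × w₂, -∇C_l × w₁). For C = -B and g_l = b_l + i B_l u the multiplicative noise cancels and
-½ B_l² u + B_l² u = ½ B_l² u remains, which is the drift of the transformed equation. For C = B the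
transformation is undone. Since |e^Θ| = 1, norms are preserved and the nonlinearity commutes with
the phase. A single statement, `SolvesWeakly.transform`, therefore serves both directions.

Solutions are only weak, so Itô's formula is proved after pairing with a test function. A factor i
C_l can be moved to the test side, ⟨i C_l v, φ⟩ = ⟨v, -i C_l φ⟩, hence ⟨Θ p(Θ) v, φ⟩ = ∑ β_l ⟨p(Θ)
v, -i C_l φ⟩ for every polynomial p. Induction on the degree (`PairingData.itoRep_polynomial`) then
needs no more than the scalar product rule for a Brownian motion and an Itô process
(`ItoRep.brownian_mul`). Taylor polynomials converge to exp locally uniformly together with two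
derivatives, and the formula passes to the limit (`PairingData.itoRep_exp`).

The test functions stay admissible because D(M) is stable under multiplication by Lipschitz
functions, with M(Cφ) = C Mφ + (∇C × φ₂, -∇C × φ₁) (`MaxwellGraph.mul`). The proof mollifies the
coefficient. As the boundary condition is tested with fields that do not vanish on ∂D, the
mollifiers are shifted into D in a direction transversal to the boundary (`ShiftCover`,
`leibniz_local`), so that no extension of the coefficient across ∂D is needed.

The scalar stochastic calculus is built from the definition of the Itô integral as a limit of simple
integrals. A maximal inequality makes the integral continuous in probability, which gives existence
and stability under limits. The product rule comes from summation by parts along meshes, where the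
products of increments of β_l and β_j sum up to t if l = j and to 0 otherwise.

The regularity of the distribution M u is a statement for fixed time and path: it follows from the
same Leibniz rule applied to the smooth function s ↦ e^{is}. -/

namespace StochasticMaxwell

/-! ### Convergence to zero in probability, without measurability -/

section PNull

variable {Ω : Type*} {mΩ : MeasurableSpace Ω} {P : Measure Ω}

/-- The nonnegative functions `f n` converge to `0` in (outer) probability. -/
def PNull (P : Measure Ω) (f : ℕ → Ω → ℝ≥0∞) : Prop :=
  ∀ ε : ℝ≥0∞, 0 < ε → Tendsto (fun n => P {ω | ε ≤ f n ω}) atTop (𝓝 0)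

theorem PNull.mono {f g : ℕ → Ω → ℝ≥0∞} (hg : PNull P g) (h : ∀ n, ∀ᵐ ω ∂P, f n ω ≤ g n ω) :
    PNull P f := by
  intro ε hε
  refine tendsto_of_tendsto_of_tendsto_of_le_of_le tendsto_const_nhds (hg ε hε)
    (fun _ => zero_le) fun n => measure_mono_ae ?_
  filter_upwards [h n] with ω hω h1
  exact le_trans h1 hω

theorem PNull.add {f g : ℕ → Ω → ℝ≥0∞} (hf : PNull P f) (hg : PNull P g) :
    PNull P (fun n ω => f n ω + g n ω) := by
  intro ε hε
  have h2 : 0 < ε / 2 := ENNReal.half_pos hε.ne'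
  refine tendsto_of_tendsto_of_tendsto_of_le_of_le tendsto_const_nhds
    (by simpa using (hf _ h2).add (hg _ h2)) (fun _ => zero_le) fun n => ?_
  refine (measure_mono ?_).trans (measure_union_le _ _)
  intro ω (h : ε ≤ f n ω + g n ω)
  by_contra hc
  simp only [mem_union, mem_ofPred_eq, not_or, not_le] at hc
  have := ENNReal.add_lt_add hc.1 hc.2
  rw [ENNReal.add_halves] at this
  exact absurd h this.not_ge

theorem PNull.zero : PNull P (fun _ _ => 0) := by
  intro ε hε
  simp [hε.ne']

theorem PNull.comp {f : ℕ → Ω → ℝ≥0∞} (hf : PNull P f) {φ : ℕ → ℕ} (hφ : Tendsto φ atTop atTop) :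
    PNull P (fun n => f (φ n)) := fun ε hε => (hf ε hε).comp hφ

theorem PNull.sum {ι : Type*} {f : ι → ℕ → Ω → ℝ≥0∞} (s : Finset ι) (hf : ∀ i ∈ s, PNull P (f i)) :
    PNull P (fun n ω => ∑ i ∈ s, f i n ω) := by
  classical
  induction s using Finset.induction_on with
  | empty => simpa using PNull.zero
  | insert a s ha ih =>
    simp_rw [Finset.sum_insert ha]
    exact (hf a (Finset.mem_insert_self _ _)).add
      (ih fun i hi => hf i (Finset.mem_insert_of_mem hi))

/-- Localization: what happens off `s` costs at most η in probability, so a domination on `s`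
suffices. The dominating sequence may depend on η, which is what allows bounds by random constants.
-/
theorem PNull.of_tight {f : ℕ → Ω → ℝ≥0∞}
    (h : ∀ η : ℝ≥0∞, 0 < η → ∃ s : Set Ω, P sᶜ ≤ η ∧ ∃ g : ℕ → Ω → ℝ≥0∞, PNull P g ∧
      ∀ n, ∀ᵐ ω ∂P, ω ∈ s → f n ω ≤ g n ω) : PNull P f := by
  intro ε hε
  rw [ENNReal.tendsto_nhds_zero]
  intro η hη
  have h2 : 0 < η / 2 := ENNReal.half_pos hη.ne'
  obtain ⟨s, hs, g, hg, hfg⟩ := h _ h2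
  filter_upwards [(ENNReal.tendsto_nhds_zero.1 (hg ε hε)) _ h2] with n hn
  calc P {ω | ε ≤ f n ω} ≤ P ({ω | ε ≤ g n ω} ∪ sᶜ) := by
        refine measure_mono_ae ?_
        filter_upwards [hfg n] with ω hω (h1 : ε ≤ f n ω)
        by_cases hs : ω ∈ s
        · exact Or.inl (h1.trans (hω hs))
        · exact Or.inr hs
    _ ≤ _ := measure_union_le _ _
    _ ≤ η / 2 + η / 2 := add_le_add hn hs
    _ = η := ENNReal.add_halves η

theorem PNull.const {c : ℕ → ℝ≥0∞} (hc : Tendsto c atTop (𝓝 0)) :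
    PNull P (fun n _ => c n) := by
  intro ε hε
  have : ∀ᶠ n in atTop, P {ω : Ω | ε ≤ c n} = 0 := by
    filter_upwards [hc.eventually (gt_mem_nhds hε)] with n hn
    simp [not_le.2 hn]
  exact (tendsto_congr' this).2 tendsto_const_nhds

theorem PNull.const_mul {f : ℕ → Ω → ℝ≥0∞} (hf : PNull P f) {c : ℝ≥0∞} (hc : c ≠ ∞) :
    PNull P (fun n ω => c * f n ω) := by
  intro ε hε
  by_cases h0 : c = 0
  · simp [h0, hε.ne']
  have := hf (ε / c) (ENNReal.div_pos hε.ne' hc)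
  refine this.congr fun n => ?_
  congr 1
  ext ω
  simp only [mem_ofPred_eq]
  rw [ENNReal.div_le_iff_le_mul (Or.inl h0) (Or.inl hc), mul_comm]

/-- Borel–Cantelli: indices are picked so that the event 2⁻ⁿ ≤ f has outer probability at most 2⁻ⁿ.
Countable subadditivity is all that enters, hence no measurability. -/
theorem PNull.exists_seq {f : ℕ → Ω → ℝ≥0∞} (hf : PNull P f) :
    ∃ φ : ℕ → ℕ, StrictMono φ ∧ ∀ᵐ ω ∂P, Tendsto (fun n => f (φ n) ω) atTop (𝓝 0) := by
  have hp : ∀ n : ℕ, 0 < (2⁻¹ : ℝ≥0∞) ^ n := fun n => ENNReal.pow_pos (by simp) n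
  have h : ∀ n : ℕ, ∀ᶠ m in atTop, P {ω | (2⁻¹ : ℝ≥0∞) ^ n ≤ f m ω} ≤ (2⁻¹ : ℝ≥0∞) ^ n := fun n =>
    ENNReal.tendsto_nhds_zero.1 (hf _ (hp n)) _ (hp n)
  obtain ⟨φ, hφ, hφ'⟩ := extraction_forall_of_eventually h
  refine ⟨φ, hφ, ?_⟩
  have hs : ∑' n, P {ω | (2⁻¹ : ℝ≥0∞) ^ n ≤ f (φ n) ω} ≠ ∞ :=
    ne_top_of_le_ne_top (by simp [ENNReal.tsum_geometric]) (ENNReal.tsum_le_tsum hφ')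
  filter_upwards [ae_eventually_notMem hs] with ω hω
  refine tendsto_of_tendsto_of_tendsto_of_le_of_le' tendsto_const_nhds
    (ENNReal.tendsto_pow_atTop_nhds_zero_of_lt_one (r := 2⁻¹) (by simp))
    (Eventually.of_forall fun _ => zero_le) ?_
  filter_upwards [hω] with n hn
  exact (not_le.1 hn).le

/-- The events n < K decrease to a null set. Continuity from above requires measurable sets, so the
argument runs on a measurable version of `K`. -/
theorem tight_of_aemeasurable [IsFiniteMeasure P] {K : Ω → ℝ≥0∞} (hK : AEMeasurable K P)
    (hfin : ∀ᵐ ω ∂P, K ω < ∞) {η : ℝ≥0∞} (hη : 0 < η) :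
    ∃ R : ℝ≥0, P {ω | K ω ≤ R}ᶜ ≤ η := by
  have hm : Measurable (hK.mk K) := hK.measurable_mk
  have h1 : Tendsto (fun n : ℕ => P {ω | (n : ℝ≥0∞) < hK.mk K ω}) atTop
      (𝓝 (P (⋂ n : ℕ, {ω | (n : ℝ≥0∞) < hK.mk K ω}))) := by
    refine tendsto_measure_iInter_atTop (fun n => (measurableSet_lt measurable_const hm).nullMeasurableSet)
      (fun m n hmn ω (h : (n : ℝ≥0∞) < _) => lt_of_le_of_lt (by exact_mod_cast hmn) h)
      ⟨0, measure_ne_top _ _⟩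
  have h2 : P (⋂ n : ℕ, {ω | (n : ℝ≥0∞) < hK.mk K ω}) = 0 := by
    rw [← nonpos_iff_eq_zero]
    calc _ ≤ P {ω | ¬ K ω < ∞} := by
          refine measure_mono_ae ?_
          filter_upwards [hK.ae_eq_mk] with ω hω h
          change ¬ K ω < ∞
          intro hlt
          rw [hω] at hlt
          obtain ⟨n, hn⟩ := ENNReal.exists_nat_gt hlt.ne
          exact absurd (mem_iInter.1 h n) (not_lt.2 hn.le)
      _ = 0 := hfin
      _ ≤ 0 := le_rfl
  rw [h2, ENNReal.tendsto_nhds_zero] at h1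
  obtain ⟨n, hn⟩ := (h1 η hη).exists
  refine ⟨n, le_trans (measure_mono_ae ?_) hn⟩
  filter_upwards [hK.ae_eq_mk] with ω hω h
  change ¬ K ω ≤ _ at h
  change (n : ℝ≥0∞) < _
  rw [← hω]
  exact not_le.1 h

theorem PNull.mul_tight [IsFiniteMeasure P] {f : ℕ → Ω → ℝ≥0∞} (hf : PNull P f) {K : Ω → ℝ≥0∞}
    (hK : AEMeasurable K P) (hfin : ∀ᵐ ω ∂P, K ω < ∞) :
    PNull P (fun n ω => K ω * f n ω) := by
  refine PNull.of_tight fun η hη => ?_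
  obtain ⟨R, hR⟩ := tight_of_aemeasurable hK hfin hη
  refine ⟨_, hR, fun n ω => R * f n ω, hf.const_mul ENNReal.coe_ne_top, fun n => ae_of_all _ ?_⟩
  intro ω hω
  exact mul_le_mul_left hω _

/-- Continuity from above for the tail events that some f m with m ≥ n exceeds ε; measurability
cannot be dispensed with here. -/
theorem PNull.of_ae_tendsto [IsFiniteMeasure P] {f : ℕ → Ω → ℝ≥0∞} (hf : ∀ n, AEMeasurable (f n) P)
    (h : ∀ᵐ ω ∂P, Tendsto (fun n => f n ω) atTop (𝓝 0)) : PNull P f := by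
  have h1 : ∀ ε : ℝ≥0∞, 0 < ε → ∀ᵐ ω ∂P, ∃ n, ∀ m ≥ n, f m ω < ε := by
    intro ε hε
    filter_upwards [h] with ω hω
    exact eventually_atTop.1 (hω.eventually (gt_mem_nhds hε))
  intro ε hε
  have hm : ∀ n, NullMeasurableSet (⋃ m ≥ n, {ω | ε ≤ f m ω}) P := fun n =>
    .iUnion fun m => .iUnion fun _ => nullMeasurableSet_le aemeasurable_const (hf m)
  have h2 : Tendsto (fun n : ℕ => P (⋃ m ≥ n, {ω | ε ≤ f m ω})) atTop
      (𝓝 (P (⋂ n : ℕ, ⋃ m ≥ n, {ω | ε ≤ f m ω}))) := by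
    refine tendsto_measure_iInter_atTop hm (fun m n hmn => ?_) ⟨0, measure_ne_top _ _⟩
    exact biUnion_subset_biUnion_left fun k (hk : n ≤ k) => hmn.trans hk
  have h3 : P (⋂ n : ℕ, ⋃ m ≥ n, {ω | ε ≤ f m ω}) = 0 := by
    rw [← nonpos_iff_eq_zero]
    calc _ ≤ P {ω | ¬ ∃ n, ∀ m ≥ n, f m ω < ε} := by
          refine measure_mono fun ω hω ⟨n, hn⟩ => ?_
          have := mem_iInter.1 hω n
          simp only [mem_iUnion, mem_ofPred_eq] at this
          obtain ⟨m, hm, hmε⟩ := this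
          exact absurd (hn m hm) (not_lt.2 hmε)
      _ = 0 := h1 ε hε
      _ ≤ 0 := le_rfl
  rw [h3] at h2
  refine tendsto_of_tendsto_of_tendsto_of_le_of_le tendsto_const_nhds h2 (fun _ => zero_le)
    fun n => measure_mono ?_
  intro ω hω
  exact mem_biUnion (le_refl n) hω

/-- Turns an identity obtained as a limit in probability, whose two sides do not depend on n, into
an almost sure identity. -/
theorem ae_eq_zero_of_pnull_const {f : Ω → ℝ≥0∞} (hf : PNull P (fun _ => f)) :
    ∀ᵐ ω ∂P, f ω = 0 := by
  obtain ⟨φ, -, h⟩ := hf.exists_seq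
  filter_upwards [h] with ω hω
  exact tendsto_nhds_unique tendsto_const_nhds hω

theorem PNull.exists_seq_diag {f : ℕ → ℕ → Ω → ℝ≥0∞} (hf : ∀ n, PNull P (f n)) :
    ∃ φ : ℕ → ℕ, PNull P (fun n => f n (φ n)) := by
  have h : ∀ n : ℕ, ∃ m, P {ω | ((n : ℝ≥0∞) + 1)⁻¹ ≤ f n m ω} ≤ ((n : ℝ≥0∞) + 1)⁻¹ := by
    intro n
    have hp : 0 < ((n : ℝ≥0∞) + 1)⁻¹ := ENNReal.inv_pos.2 (by finiteness)
    exact ((ENNReal.tendsto_nhds_zero.1 (hf n _ hp)) _ hp).exists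
  choose φ hφ using h
  refine ⟨φ, fun ε hε => ?_⟩
  have ht : Tendsto (fun n : ℕ => ((n : ℝ≥0∞) + 1)⁻¹) atTop (𝓝 0) := by
    have := (tendsto_add_atTop_iff_nat 1).2 ENNReal.tendsto_inv_nat_nhds_zero
    simpa using this
  refine tendsto_of_tendsto_of_tendsto_of_le_of_le' tendsto_const_nhds ht
    (Eventually.of_forall fun _ => zero_le) ?_
  filter_upwards [ht.eventually (gt_mem_nhds hε)] with n hn
  exact (measure_mono fun ω (h : ε ≤ _) => hn.le.trans h).trans (hφ n)

end PNull

/-! ### Martingale transforms with independent increments -/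

section Transform

variable {Ω : Type*} {mΩ : MeasurableSpace Ω} {P : Measure Ω} {F : Filtration ℝ≥0 mΩ}

theorem stronglyMeasurable_transform {r : ℕ → ℝ≥0} (hr : Monotone r) {ξ : ℕ → Ω → ℂ}
    {η : ℕ → Ω → ℝ} (hξ : ∀ i, StronglyMeasurable[F (r i)] (ξ i))
    (hη : ∀ i, Measurable[F (r (i + 1))] (η i)) (n : ℕ) :
    StronglyMeasurable[F (r n)] (fun ω => ∑ i ∈ Finset.range n, ξ i ω * (η i ω : ℂ)) := by
  refine Finset.stronglyMeasurable_fun_sum _ fun i hi => ?_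
  have hi := Finset.mem_range.1 hi
  refine ((hξ i).mono (F.mono (hr hi.le))).mul ?_
  exact (Complex.measurable_ofReal.comp ((hη i).mono (F.mono (hr hi)) le_rfl)).stronglyMeasurable

theorem norm_add_mul_ofReal_sq (a x : ℂ) (y : ℝ) :
    ‖a + x * (y : ℂ)‖ ^ 2 = ‖a‖ ^ 2 + 2 * (((starRingEnd ℂ a) * x).re * y) + ‖x‖ ^ 2 * y ^ 2 := by
  simp only [← Complex.normSq_eq_norm_sq, Complex.normSq_apply, Complex.add_re, Complex.add_im,
    Complex.mul_re, Complex.mul_im, Complex.ofReal_re, Complex.ofReal_im, Complex.conj_re,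
    Complex.conj_im]
  ring

theorem memLp_transform {ξ : ℕ → Ω → ℂ}
    {η : ℕ → Ω → ℝ} (hξ : ∀ i, StronglyMeasurable (ξ i)) {C : ℝ} (hC : ∀ i ω, ‖ξ i ω‖ ≤ C)
    (hη2 : ∀ i, MemLp (η i) 2 P) (n : ℕ) :
    MemLp (fun ω => ∑ i ∈ Finset.range n, ξ i ω * (η i ω : ℂ)) 2 P := by
  refine memLp_finsetSum _ fun i _ => ?_
  have h1 : MemLp (fun ω => (η i ω : ℂ)) 2 P := (hη2 i).ofReal
  have h2 : MemLp (ξ i) ∞ P := memLp_top_of_bound (hξ i).aestronglyMeasurable C (ae_of_all _ (hC i))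
  exact h1.mul (p := ∞) (q := 2) h2

/-- Orthogonality of increments, by adding one increment at a time: the partial sum and ξ n are
known at time r n, while η n is centred and independent of that σ-algebra, so the mixed term has
mean zero. Independence replaces conditional expectations throughout. -/
theorem integral_norm_sq_transform_le {r : ℕ → ℝ≥0} (hr : Monotone r) {ξ : ℕ → Ω → ℂ}
    {η : ℕ → Ω → ℝ} {v : ℕ → ℝ} (hξ : ∀ i, StronglyMeasurable[F (r i)] (ξ i)) {C : ℝ}
    (hC : ∀ i ω, ‖ξ i ω‖ ≤ C) (hη : ∀ i, Measurable[F (r (i + 1))] (η i))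
    (hind : ∀ i, Indep (MeasurableSpace.comap (η i) inferInstance) (F (r i)) P)
    (hη2 : ∀ i, MemLp (η i) 2 P) (hmean : ∀ i, ∫ ω, η i ω ∂P = 0)
    (hvar : ∀ i, ∫ ω, η i ω ^ 2 ∂P ≤ v i) (n : ℕ) :
    ∫ ω, ‖∑ i ∈ Finset.range n, ξ i ω * (η i ω : ℂ)‖ ^ 2 ∂P
      ≤ ∑ i ∈ Finset.range n, v i * ∫ ω, ‖ξ i ω‖ ^ 2 ∂P := by
  have hξ' : ∀ i, StronglyMeasurable (ξ i) := fun i => (hξ i).mono (F.le _)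
  induction n with
  | zero => simp
  | succ n ih =>
    have hM := memLp_transform hξ' hC hη2 n
    have hMm := stronglyMeasurable_transform hr hξ hη n
    set M : Ω → ℂ := fun ω => ∑ i ∈ Finset.range n, ξ i ω * (η i ω : ℂ) with hMdef
    have hηm : Measurable (η n) := (hη n).mono (F.le _) le_rfl
    have hxb : MemLp (ξ n) ∞ P :=
      memLp_top_of_bound (hξ' n).aestronglyMeasurable C (ae_of_all _ (hC n))
    have hre : MemLp (fun ω => ((starRingEnd ℂ (M ω)) * ξ n ω).re) 2 P := by
      have : MemLp (fun ω => (starRingEnd ℂ (M ω)) * ξ n ω) 2 P := hxb.mul (p := 2) (q := ∞) hM.star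
      exact this.re
    have hi1 : Integrable (fun ω => ‖M ω‖ ^ 2) P := hM.integrable_norm_pow (by norm_num)
    have hi2 : Integrable (fun ω => ((starRingEnd ℂ (M ω)) * ξ n ω).re * η n ω) P :=
      hre.integrable_mul (hη2 n)
    have hi3' : Integrable (fun ω => η n ω ^ 2) P := (hη2 n).integrable_sq
    have hi3 : Integrable (fun ω => ‖ξ n ω‖ ^ 2 * η n ω ^ 2) P := by
      refine hi3'.bdd_mul (c := C ^ 2) ((hξ' n).norm.pow 2).aestronglyMeasurable (ae_of_all _ fun ω => ?_)
      rw [norm_pow, norm_norm]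
      exact pow_le_pow_left₀ (norm_nonneg _) (hC n ω) 2
    have hindep : ∀ g : Ω → ℝ, Measurable[F (r n)] g → ∀ φ : ℝ → ℝ, Measurable φ →
        IndepFun g (fun ω => φ (η n ω)) P := by
      intro g hg φ hφ
      refine IndepFun.symm ((IndepFun_iff_Indep _ _ _).2 ?_)
      refine indep_of_indep_of_le_left (indep_of_indep_of_le_right (hind n) ?_) ?_
      · exact hg.comap_le
      · rw [show (fun ω => φ (η n ω)) = φ ∘ η n from rfl, ← MeasurableSpace.comap_comp]
        exact MeasurableSpace.comap_mono hφ.comap_le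
    have hgre : Measurable[F (r n)] (fun ω => ((starRingEnd ℂ (M ω)) * ξ n ω).re) :=
      Complex.measurable_re.comp
        (((Complex.continuous_conj.comp_stronglyMeasurable hMm).mul (hξ n)).measurable)
    have hgsq : Measurable[F (r n)] (fun ω => ‖ξ n ω‖ ^ 2) := ((hξ n).norm.pow 2).measurable
    have e2 : ∫ ω, ((starRingEnd ℂ (M ω)) * ξ n ω).re * η n ω ∂P = 0 := by
      have := (hindep _ hgre id measurable_id).integral_fun_mul_eq_mul_integral
        hre.aestronglyMeasurable hηm.aestronglyMeasurable
      simp only [id] at this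
      rw [this, hmean, mul_zero]
    have e3 : ∫ ω, ‖ξ n ω‖ ^ 2 * η n ω ^ 2 ∂P ≤ v n * ∫ ω, ‖ξ n ω‖ ^ 2 ∂P := by
      have := (hindep _ hgsq (fun x => x ^ 2) (by fun_prop)).integral_fun_mul_eq_mul_integral
        ((hξ' n).norm.pow 2).aestronglyMeasurable (by fun_prop)
      rw [this, mul_comm]
      exact mul_le_mul_of_nonneg_right (hvar n) (integral_nonneg fun ω => by positivity)
    calc ∫ ω, ‖∑ i ∈ Finset.range (n + 1), ξ i ω * (η i ω : ℂ)‖ ^ 2 ∂P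
        = ∫ ω, (‖M ω‖ ^ 2 + 2 * (((starRingEnd ℂ (M ω)) * ξ n ω).re * η n ω)
            + ‖ξ n ω‖ ^ 2 * η n ω ^ 2) ∂P := by
          refine integral_congr_ae (ae_of_all _ fun ω => ?_)
          simp only [Finset.sum_range_succ]
          exact norm_add_mul_ofReal_sq _ _ _
      _ = ∫ ω, ‖M ω‖ ^ 2 ∂P + 2 * ∫ ω, ((starRingEnd ℂ (M ω)) * ξ n ω).re * η n ω ∂P
            + ∫ ω, ‖ξ n ω‖ ^ 2 * η n ω ^ 2 ∂P := by
          have hi12 : Integrable (fun ω => ‖M ω‖ ^ 2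
              + 2 * (((starRingEnd ℂ (M ω)) * ξ n ω).re * η n ω)) P := hi1.add (hi2.const_mul 2)
          rw [integral_add hi12 hi3, integral_add hi1 (hi2.const_mul 2),
            integral_const_mul]
      _ ≤ _ := by
          rw [e2, Finset.sum_range_succ]
          linarith

variable [IsProbabilityMeasure P]

/-- Kolmogorov's maximal inequality for martingale transforms, localized in the quadratic
variation. -/
theorem measure_exists_le_norm_transform_le {r : ℕ → ℝ≥0} (hr : Monotone r) {ξ : ℕ → Ω → ℂ}
    {η : ℕ → Ω → ℝ} {v : ℕ → ℝ} (hv : ∀ i, 0 ≤ v i) (hξ : ∀ i, StronglyMeasurable[F (r i)] (ξ i))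
    {C : ℝ} (hC : ∀ i ω, ‖ξ i ω‖ ≤ C) (hη : ∀ i, Measurable[F (r (i + 1))] (η i))
    (hind : ∀ i, Indep (MeasurableSpace.comap (η i) inferInstance) (F (r i)) P)
    (hη2 : ∀ i, MemLp (η i) 2 P) (hmean : ∀ i, ∫ ω, η i ω ∂P = 0)
    (hvar : ∀ i, ∫ ω, η i ω ^ 2 ∂P ≤ v i) {ε δ : ℝ} (hε : 0 < ε) (hδ : 0 ≤ δ) (n : ℕ) :
    P {ω | ∃ k ≤ n, ε ≤ ‖∑ i ∈ Finset.range k, ξ i ω * (η i ω : ℂ)‖}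
      ≤ ENNReal.ofReal (δ / ε ^ 2)
        + P {ω | δ < ∑ i ∈ Finset.range n, v i * ‖ξ i ω‖ ^ 2} := by
  classical
  set M : ℕ → Ω → ℂ := fun k ω => ∑ i ∈ Finset.range k, ξ i ω * (η i ω : ℂ) with hM
  -- The event that by step i the quadratic variation has not exceeded δ and no partial sum has
  -- reached ε. It is known at time r i, so cutting ξ i off outside of it keeps the transform
  -- adapted, and the stopped transform has quadratic variation at most δ surely.
  let E : ℕ → Set Ω := fun i => {ω | ∑ j ∈ Finset.range (i + 1), v j * ‖ξ j ω‖ ^ 2 ≤ δ} ∩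
    ⋂ k ∈ Finset.range (i + 1), {ω | ‖M k ω‖ < ε}
  have hE : ∀ i, MeasurableSet[F (r i)] (E i) := by
    intro i
    have h1 : StronglyMeasurable[F (r i)] (fun ω => ∑ j ∈ Finset.range (i + 1), v j * ‖ξ j ω‖ ^ 2) :=
      Finset.stronglyMeasurable_fun_sum _ fun j hj =>
        (((hξ j).mono (F.mono (hr (Nat.lt_succ_iff.1 (Finset.mem_range.1 hj))))).norm.pow 2).const_mul _
    refine MeasurableSet.inter (h1.measurable measurableSet_Iic) ?_
    refine Finset.measurableSet_biInter _ fun k hk => ?_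
    have h2 := (stronglyMeasurable_transform hr hξ hη k).mono
      (F.mono (hr (Nat.lt_succ_iff.1 (Finset.mem_range.1 hk))))
    exact h2.norm.measurable measurableSet_Iio
  let χ : ℕ → Ω → ℂ := fun i => (E i).indicator (ξ i)
  have hχ : ∀ i, StronglyMeasurable[F (r i)] (χ i) := fun i => (hξ i).indicator (hE i)
  have hχle : ∀ i ω, ‖χ i ω‖ ≤ ‖ξ i ω‖ := fun i ω => norm_indicator_le_norm_self _ _
  have hχC : ∀ i ω, ‖χ i ω‖ ≤ C := fun i ω => (hχle i ω).trans (hC i ω)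
  have hle : ∀ m ω, ∑ i ∈ Finset.range m, v i * ‖χ i ω‖ ^ 2 ≤ δ := by
    intro m ω
    induction m with
    | zero => simpa using hδ
    | succ m ih =>
      by_cases h : ω ∈ E m
      · refine le_trans (Finset.sum_le_sum fun i _ => ?_) h.1
        exact mul_le_mul_of_nonneg_left (pow_le_pow_left₀ (norm_nonneg _) (hχle i ω) 2) (hv i)
      · have : χ m ω = 0 := indicator_of_notMem h _
        rw [Finset.sum_range_succ, this]
        simpa using ih
  have hsq := integral_norm_sq_transform_le hr hχ hχC hη hind hη2 hmean hvar n
  have hint : ∀ i, Integrable (fun ω => ‖χ i ω‖ ^ 2) P := fun i =>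
    (memLp_top_of_bound ((hχ i).mono (F.le _)).aestronglyMeasurable C
      (ae_of_all _ (hχC i))).mono_exponent (p := 2) le_top |>.integrable_norm_pow (by norm_num)
  have hsq' : ∫ ω, ‖∑ i ∈ Finset.range n, χ i ω * (η i ω : ℂ)‖ ^ 2 ∂P ≤ δ := by
    refine hsq.trans ?_
    calc ∑ i ∈ Finset.range n, v i * ∫ ω, ‖χ i ω‖ ^ 2 ∂P
        = ∫ ω, ∑ i ∈ Finset.range n, v i * ‖χ i ω‖ ^ 2 ∂P := by
          rw [integral_finsetSum _ fun i _ => (hint i).const_mul _]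
          simp_rw [integral_const_mul]
      _ ≤ ∫ _, δ ∂P := integral_mono (integrable_finsetSum _ fun i _ => (hint i).const_mul _)
          (integrable_const _) fun ω => hle n ω
      _ = δ := by simp
  have hcheb : P {ω | ε ^ 2 ≤ ‖∑ i ∈ Finset.range n, χ i ω * (η i ω : ℂ)‖ ^ 2}
      ≤ ENNReal.ofReal (δ / ε ^ 2) := by
    have h0 := mul_meas_ge_le_integral_of_nonneg (μ := P)
      (f := fun ω => ‖∑ i ∈ Finset.range n, χ i ω * (η i ω : ℂ)‖ ^ 2)
      (ae_of_all _ fun ω => by positivity)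
      ((memLp_transform (fun i => (hχ i).mono (F.le _)) hχC hη2 n).integrable_norm_pow
        (by norm_num)) (ε ^ 2)
    rw [← ofReal_measureReal]
    refine ENNReal.ofReal_le_ofReal ?_
    rw [le_div_iff₀ (by positivity), mul_comm]
    exact h0.trans hsq'
  refine le_trans (measure_mono ?_) ((measure_union_le _ _).trans (add_le_add_left hcheb _))
  intro ω hω
  by_cases hd : δ < ∑ i ∈ Finset.range n, v i * ‖ξ i ω‖ ^ 2
  · exact Or.inr hd
  left
  have hd := not_lt.1 hd
  have hex : ∃ k, ε ≤ ‖M k ω‖ := by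
    obtain ⟨k, -, hk⟩ := hω
    exact ⟨k, hk⟩
  have hkn : Nat.find hex ≤ n := by
    obtain ⟨k, hk, hk'⟩ := hω
    exact (Nat.find_min' hex hk').trans hk
  -- As long as the total quadratic variation is at most δ, the stopped transform is the original
  -- one frozen at its first passage of level ε. Its terminal value therefore has norm at least ε
  -- and Chebyshev's inequality applies to it.
  have key : ∀ m ≤ n, ∑ i ∈ Finset.range m, χ i ω * (η i ω : ℂ) = M (min m (Nat.find hex)) ω := by
    intro m hm
    induction m with
    | zero => simp [hM]
    | succ m ih =>
      rw [Finset.sum_range_succ, ih (by omega)]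
      rcases lt_or_ge m (Nat.find hex) with h | h
      · have hmem : ω ∈ E m := by
          refine ⟨le_trans ?_ hd, ?_⟩
          · exact Finset.sum_le_sum_of_subset_of_nonneg (by simpa using hm)
              fun i _ _ => mul_nonneg (hv i) (by positivity)
          · simp only [mem_iInter]
            intro k hk
            exact not_le.1 (Nat.find_min hex (by have := Finset.mem_range.1 hk; omega))
        have : χ m ω = ξ m ω := indicator_of_mem hmem _
        rw [this, min_eq_left h.le, min_eq_left (by omega)]
        simp [hM, Finset.sum_range_succ]
      · have hmem : ω ∉ E m := by
          intro hmem
          have h1 := hmem.2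
          simp only [mem_iInter] at h1
          exact absurd (h1 (Nat.find hex) (by simpa using Nat.lt_succ_of_le h))
            (not_lt.2 (Nat.find_spec hex))
        have : χ m ω = 0 := indicator_of_notMem hmem _
        rw [this, min_eq_right h, min_eq_right (by omega)]
        simp
  change ε ^ 2 ≤ _
  rw [key n le_rfl, min_eq_right hkn]
  exact pow_le_pow_left₀ hε.le (Nat.find_spec hex) 2

end Transform

/-! ### Lebesgue measure on the time axis -/

instance : IsLocallyFiniteMeasure leb where
  finiteAtNhds x := by
    refine ⟨Iio (x + 1), Iio_mem_nhds (by simp), ?_⟩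
    refine (measure_mono (t := Icc 0 (x + 1)) fun y hy => ⟨zero_le, le_of_lt hy⟩).trans_lt ?_
    rw [leb_Icc]
    exact ENNReal.ofReal_lt_top

instance : NullSingletonClass leb where
  measure_singleton x := by
    rw [← Icc_self, leb_Icc]
    simp

theorem leb_Ioc (a b : ℝ≥0) : leb (Ioc a b) = ENNReal.ofReal (b - a) := by
  rw [measure_congr Ioc_ae_eq_Icc, leb_Icc]

instance (T : ℝ≥0) : IsFiniteMeasure (leb.restrict (Icc 0 T)) := by
  refine ⟨?_⟩
  rw [Measure.restrict_apply_univ, leb_Icc]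
  exact ENNReal.ofReal_lt_top

/-! ### Increments of a Brownian family -/

section Increments

variable {Ω : Type*} {mΩ : MeasurableSpace Ω} {P : Measure Ω} {F : Filtration ℝ≥0 mΩ}
  {N : ℕ} {β : Fin N → ℝ≥0 → Ω → ℝ}

theorem IsBrownianFamily.measurable_sub (hβ : IsBrownianFamily P F β) (j : Fin N) {s t : ℝ≥0}
    (hst : s ≤ t) : Measurable[F t] (fun ω => β j t ω - β j s ω) :=
  (hβ.adapted j t).measurable.sub ((hβ.adapted j s).measurable.mono (F.mono hst) le_rfl)

theorem IsBrownianFamily.indep_comap (hβ : IsBrownianFamily P F β) {s t : ℝ≥0} (hst : s ≤ t)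
    {φ : (Fin N → ℝ) → ℝ} (hφ : Measurable φ) :
    Indep (MeasurableSpace.comap (fun ω => φ fun j => β j t ω - β j s ω) inferInstance) (F s) P := by
  refine indep_of_indep_of_le_left (hβ.indep_increments s t hst) ?_
  rw [show (fun ω => φ fun j => β j t ω - β j s ω) = φ ∘ fun ω j => β j t ω - β j s ω from rfl,
    ← MeasurableSpace.comap_comp]
  exact MeasurableSpace.comap_mono hφ.comap_le

theorem IsBrownianFamily.hasLaw_sub (hβ : IsBrownianFamily P F β) (j : Fin N) {s t : ℝ≥0}
    (hst : s ≤ t) : HasLaw (fun ω => β j t ω - β j s ω) (gaussianReal 0 (t - s)) P := by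
  have h := (hβ.brownian j).hasLaw_sub t s
  have e : nndist (t : ℝ≥0).1 s.1 = t - s := by
    rw [← NNReal.coe_inj, coe_nndist, NNReal.coe_sub hst, Real.dist_eq, abs_of_nonneg]
    · rfl
    · exact sub_nonneg.2 hst
  rw [e] at h
  exact h

theorem _root_.ProbabilityTheory.HasLaw.memLp_gaussian {X : Ω → ℝ} {v : ℝ≥0} (h : HasLaw X (gaussianReal 0 v) P)
    (p : ℝ≥0) : MemLp X p P := by
  have := memLp_id_gaussianReal (μ := 0) (v := v) p
  rw [← h.map_eq] at this
  exact this.comp_of_map h.aemeasurable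

theorem _root_.ProbabilityTheory.HasLaw.integral_gaussian_sq {X : Ω → ℝ} {v : ℝ≥0} (h : HasLaw X (gaussianReal 0 v) P) :
    ∫ ω, X ω ^ 2 ∂P = v := by
  have h1 := h.integral_comp (f := fun x : ℝ => x ^ 2) (by fun_prop)
  have h2 := variance_fun_id_gaussianReal (μ := 0) (v := v)
  rw [variance_eq_integral (by fun_prop)] at h2
  simp only [integral_id_gaussianReal, sub_zero] at h2
  rw [← h2, ← h1]
  rfl

/-- The fourth moment of the standard Gaussian. -/
noncomputable def gaussianFourthMoment : ℝ := ∫ x, x ^ 4 ∂(gaussianReal 0 1)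

/-- Scaling from the standard Gaussian. Only the order v² matters, so the constant is left
unevaluated. -/
theorem _root_.ProbabilityTheory.HasLaw.integral_gaussian_pow_four {X : Ω → ℝ} {v : ℝ≥0}
    (h : HasLaw X (gaussianReal 0 v) P) : ∫ ω, X ω ^ 4 ∂P = gaussianFourthMoment * v ^ 2 := by
  have h1 := h.integral_comp (f := fun x : ℝ => x ^ 4) (by fun_prop)
  have h2 := gaussianReal_map_const_mul (μ := 0) (v := 1) (√(v : ℝ))
  have h3 : (NNReal.mk (√(v : ℝ) ^ 2) (sq_nonneg _) * 1 : ℝ≥0) = v := by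
    rw [mul_one, ← NNReal.coe_inj]
    exact Real.sq_sqrt v.2
  rw [mul_zero, h3] at h2
  rw [← h2, integral_map (by fun_prop) (by fun_prop)] at h1
  simp only [Function.comp_def] at h1
  rw [h1]
  have h4 : ∀ x : ℝ, (√(v : ℝ) * x) ^ 4 = v ^ 2 * x ^ 4 := by
    intro x
    calc (√(v : ℝ) * x) ^ 4 = (√(v : ℝ) ^ 2) ^ 2 * x ^ 4 := by ring
      _ = _ := by rw [Real.sq_sqrt v.coe_nonneg]
  simp_rw [h4]
  rw [integral_const_mul, gaussianFourthMoment, mul_comm]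

variable [IsProbabilityMeasure P]

theorem IsBrownianFamily.indepFun_sub (hβ : IsBrownianFamily P F β) {l j : Fin N} (hlj : l ≠ j)
    (s t : ℝ≥0) :
    IndepFun (fun ω => β l t ω - β l s ω) (fun ω => β j t ω - β j s ω) P := by
  have h := hβ.indep.indepFun hlj
  have hm : Measurable (fun f : ℝ≥0 → ℝ => f t - f s) :=
    (measurable_pi_apply t).sub (measurable_pi_apply s)
  exact h.comp hm hm

/-- The centered product of the increments of `β l` and `β j`. -/
noncomputable def crossIncrement (β : Fin N → ℝ≥0 → Ω → ℝ) (l j : Fin N) (s t : ℝ≥0) (ω : Ω) : ℝ :=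
  (β l t ω - β l s ω) * (β j t ω - β j s ω) - if l = j then (t - s : ℝ) else 0

theorem IsBrownianFamily.integral_mul_sub (hβ : IsBrownianFamily P F β) (l j : Fin N) {s t : ℝ≥0}
    (hst : s ≤ t) : ∫ ω, (β l t ω - β l s ω) * (β j t ω - β j s ω) ∂P
      = if l = j then (t - s : ℝ) else 0 := by
  split_ifs with h
  · subst h
    have := (hβ.hasLaw_sub l hst).integral_gaussian_sq
    rw [NNReal.coe_sub hst] at this
    rw [← this]
    simp_rw [sq]
  · have hl := hβ.hasLaw_sub l hst
    have hj := hβ.hasLaw_sub j hst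
    rw [(hβ.indepFun_sub h s t).integral_fun_mul_eq_mul_integral
      hl.aemeasurable.aestronglyMeasurable hj.aemeasurable.aestronglyMeasurable]
    rw [hl.integral_eq, integral_id_gaussianReal, zero_mul]

theorem IsBrownianFamily.memLp_mul_sub (hβ : IsBrownianFamily P F β) (l j : Fin N) {s t : ℝ≥0}
    (hst : s ≤ t) : MemLp (fun ω => (β l t ω - β l s ω) * (β j t ω - β j s ω)) 2 P := by
  have hl : MemLp (fun ω => β l t ω - β l s ω) 4 P := (hβ.hasLaw_sub l hst).memLp_gaussian 4
  have hj : MemLp (fun ω => β j t ω - β j s ω) 4 P := (hβ.hasLaw_sub j hst).memLp_gaussian 4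
  have : ENNReal.HolderTriple 4 4 2 := ⟨by
    rw [show (4 : ℝ≥0∞) = 2 * 2 by norm_num, ENNReal.mul_inv (by simp) (by simp), ← mul_add,
      ENNReal.inv_two_add_inv_two, mul_one]⟩
  exact hj.mul (p := 4) (q := 4) hl

theorem IsBrownianFamily.memLp_crossIncrement (hβ : IsBrownianFamily P F β) (l j : Fin N)
    {s t : ℝ≥0} (hst : s ≤ t) : MemLp (crossIncrement β l j s t) 2 P :=
  (hβ.memLp_mul_sub l j hst).sub (memLp_const _)

theorem IsBrownianFamily.integral_crossIncrement (hβ : IsBrownianFamily P F β) (l j : Fin N)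
    {s t : ℝ≥0} (hst : s ≤ t) : ∫ ω, crossIncrement β l j s t ω ∂P = 0 := by
  simp only [crossIncrement]
  rw [integral_sub ((hβ.memLp_mul_sub l j hst).integrable one_le_two) (integrable_const _),
    hβ.integral_mul_sub l j hst]
  simp

/-- A variance is at most the second moment, and (xy)² ≤ (x⁴ + y⁴)/2. The quadratic order in t - s
makes sums along a fine mesh vanish. -/
theorem IsBrownianFamily.integral_crossIncrement_sq (hβ : IsBrownianFamily P F β) (l j : Fin N)
    {s t : ℝ≥0} (hst : s ≤ t) :
    ∫ ω, crossIncrement β l j s t ω ^ 2 ∂P ≤ gaussianFourthMoment * (t - s) ^ 2 := by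
  have hm := hβ.memLp_mul_sub l j hst
  have hl : MemLp (fun ω => β l t ω - β l s ω) 4 P := (hβ.hasLaw_sub l hst).memLp_gaussian 4
  have hj : MemLp (fun ω => β j t ω - β j s ω) 4 P := (hβ.hasLaw_sub j hst).memLp_gaussian 4
  have h4 : ∀ {f : Ω → ℝ}, MemLp f 4 P → Integrable (fun ω => f ω ^ 4) P := by
    intro f hf
    refine (hf.integrable_norm_pow (by norm_num)).congr (ae_of_all _ fun ω => ?_)
    simp only [Real.norm_eq_abs]
    exact Even.pow_abs (by decide) _
  have e1 := variance_eq_integral (μ := P) hm.aestronglyMeasurable.aemeasurable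
  rw [hβ.integral_mul_sub l j hst] at e1
  have e2 := variance_le_expectation_sq (μ := P) hm.aestronglyMeasurable
  simp only [crossIncrement]
  rw [← e1]
  refine e2.trans ?_
  have e3 : ∫ ω, ((β l t ω - β l s ω) ^ 4 + (β j t ω - β j s ω) ^ 4) / 2 ∂P
      = gaussianFourthMoment * (t - s) ^ 2 := by
    rw [integral_div, integral_add (h4 hl) (h4 hj), (hβ.hasLaw_sub l hst).integral_gaussian_pow_four,
      (hβ.hasLaw_sub j hst).integral_gaussian_pow_four, NNReal.coe_sub hst]
    ring
  rw [← e3]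
  refine integral_mono hm.integrable_sq (((h4 hl).add (h4 hj)).div_const 2) fun ω => ?_
  simp only [Pi.pow_apply]
  nlinarith [sq_nonneg ((β l t ω - β l s ω) ^ 2 - (β j t ω - β j s ω) ^ 2)]

theorem IsBrownianFamily.measurable_crossIncrement (hβ : IsBrownianFamily P F β) (l j : Fin N)
    {s t : ℝ≥0} (hst : s ≤ t) : Measurable[F t] (crossIncrement β l j s t) :=
  ((hβ.measurable_sub l hst).mul (hβ.measurable_sub j hst)).sub measurable_const

theorem IsBrownianFamily.indep_crossIncrement (hβ : IsBrownianFamily P F β) (l j : Fin N)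
    {s t : ℝ≥0} (hst : s ≤ t) :
    Indep (MeasurableSpace.comap (crossIncrement β l j s t) inferInstance) (F s) P :=
  hβ.indep_comap hst (φ := fun x => x l * x j - if l = j then (t - s : ℝ) else 0) (by fun_prop)

end Increments

/-! ### Elementary integrands -/

/-- The grid enumerates 0, T and the points of `s` below T in increasing order, and stays at T from
then on. The alternative a ≤ r i or r (i + 1) ≤ a says that no point of `s` is interior to a cell,
so that processes jumping only in `s` are constant on cells. -/
theorem exists_grid (T : ℝ≥0) (s : Finset ℝ≥0) : ∃ (n : ℕ) (r : ℕ → ℝ≥0), Monotone r ∧ r 0 = 0 ∧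
    (∀ i, n ≤ i → r i = T) ∧ (∀ a ∈ s, ∀ i, a ≤ r i ∨ r (i + 1) ≤ a) ∧
    ∀ a ∈ s, a ≤ T → ∃ i ≤ n, r i = a := by
  classical
  set s' : Finset ℝ≥0 := insert 0 (insert T (s.filter (· ≤ T))) with hs'
  have hle : ∀ a ∈ s', a ≤ T := by
    intro a ha
    simp only [hs', Finset.mem_insert, Finset.mem_filter] at ha
    rcases ha with rfl | rfl | h
    · exact zero_le
    · exact le_rfl
    · exact h.2
  set m := s'.card with hm
  have hpos : 0 < m := Finset.card_pos.2 ⟨0, by simp [hs']⟩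
  let e := s'.orderEmbOfFin hm.symm
  let r : ℕ → ℝ≥0 := fun i => if h : i < m then e ⟨i, h⟩ else T
  have hrT : ∀ i, r i ≤ T := by
    intro i
    by_cases h : i < m
    · simp only [r, h, dif_pos]
      exact hle _ (Finset.orderEmbOfFin_mem _ _ _)
    · simp [r, h]
  have hmono : Monotone r := by
    intro i k hik
    by_cases hk : k < m
    · have hi : i < m := lt_of_le_of_lt hik hk
      simp only [r, hi, hk, dif_pos]
      exact e.monotone hik
    · rw [show r k = T by simp [r, hk]]
      exact hrT i
  have hex : ∀ a ∈ s', ∃ k, ∃ h : k < m, e ⟨k, h⟩ = a := by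
    intro a ha
    have : a ∈ Set.range e := by
      rw [Finset.range_orderEmbOfFin]
      exact ha
    obtain ⟨⟨k, h⟩, hk⟩ := this
    exact ⟨k, h, hk⟩
  refine ⟨m, r, hmono, ?_, ?_, ?_, ?_⟩
  · obtain ⟨k, h, hk⟩ := hex 0 (by simp [hs'])
    have h0 : r 0 ≤ r k := hmono (Nat.zero_le _)
    have : r k = 0 := by simp [r, h, hk]
    rw [this] at h0
    exact le_antisymm h0 zero_le
  · intro i hi
    simp [r, not_lt.2 hi]
  · intro a ha i
    rcases lt_or_ge T a with h | h
    · exact Or.inr ((hrT _).trans h.le)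
    obtain ⟨k, hkm, hk⟩ := hex a (by simp [hs', ha, h])
    have hrk : r k = a := by simp [r, hkm, hk]
    rcases le_or_gt k i with hki | hki
    · exact Or.inl (hrk ▸ hmono hki)
    · exact Or.inr (hrk ▸ hmono hki)
  · intro a ha h
    obtain ⟨k, hkm, hk⟩ := hex a (by simp [hs', ha, h])
    exact ⟨k, hkm.le, by simp [r, hkm, hk]⟩

section Elem

variable {Ω : Type*} {mΩ : MeasurableSpace Ω} {P : Measure Ω} {F : Filtration ℝ≥0 mΩ}

/-- `sup_{t ≤ T} |Y t|`. -/
noncomputable def usup (T : ℝ≥0) (Y : ℝ≥0 → Ω → ℂ) (ω : Ω) : ℝ≥0∞ := ⨆ t ∈ Icc 0 T, ‖Y t ω‖ₑ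

/-- `∫_0^T |X s|² ds`. -/
noncomputable def engy (T : ℝ≥0) (X : ℝ≥0 → Ω → ℂ) (ω : Ω) : ℝ≥0∞ :=
  ∫⁻ s in Icc 0 T, ‖X s ω‖ₑ ^ 2 ∂leb

/-- `V` is a finite sum of processes `ξ 1_{(a,∞)}` with bounded `ℱ_a`-measurable `ξ`, and
`I = ∫ V dW`. -/
inductive Elem (F : Filtration ℝ≥0 mΩ) (W : ℝ≥0 → Ω → ℝ) :
    (ℝ≥0 → Ω → ℂ) → (ℝ≥0 → Ω → ℂ) → Prop
  | single (a : ℝ≥0) (ξ : Ω → ℂ) (hξ : StronglyMeasurable[F a] ξ) (C : ℝ) (hC : ∀ ω, ‖ξ ω‖ ≤ C) :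
      Elem F W (fun t ω => if a < t then ξ ω else 0)
        (fun t ω => ξ ω * ((W t ω - W (min a t) ω : ℝ) : ℂ))
  | add {V V' I I' : ℝ≥0 → Ω → ℂ} (h : Elem F W V I) (h' : Elem F W V' I') :
      Elem F W (fun t ω => V t ω + V' t ω) (fun t ω => I t ω + I' t ω)

variable {W : ℝ≥0 → Ω → ℝ} {V V' I I' : ℝ≥0 → Ω → ℂ}

theorem Elem.congr (h : Elem F W V I) (hV : V = V') (hI : I = I') : Elem F W V' I' := by
  subst hV hI
  exact h

theorem Elem.zero : Elem F W (fun _ _ => 0) (fun _ _ => 0) :=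
  (Elem.single (F := F) (W := W) 0 (fun _ => 0) stronglyMeasurable_const 0 (by simp)).congr
    (by simp) (by simp)

theorem Elem.sum {ι : Type*} (s : Finset ι) {V I : ι → ℝ≥0 → Ω → ℂ}
    (h : ∀ i ∈ s, Elem F W (V i) (I i)) :
    Elem F W (fun t ω => ∑ i ∈ s, V i t ω) (fun t ω => ∑ i ∈ s, I i t ω) := by
  classical
  induction s using Finset.induction_on with
  | empty => simpa using Elem.zero
  | insert a s ha ih =>
    simp_rw [Finset.sum_insert ha]
    exact (h a (Finset.mem_insert_self _ _)).add (ih fun i hi => h i (Finset.mem_insert_of_mem hi))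

/-- Multiplication of an elementary process by `ξ 1_{(a,∞)}`. -/
theorem Elem.restart (h : Elem F W V I) (a : ℝ≥0) {ξ : Ω → ℂ} (hξ : StronglyMeasurable[F a] ξ)
    {C : ℝ} (hC : ∀ ω, ‖ξ ω‖ ≤ C) :
    Elem F W (fun t ω => if a < t then ξ ω * V t ω else 0)
      (fun t ω => ξ ω * (I t ω - I (min a t) ω)) := by
  induction h with
  | single b ζ hζ C' hC' =>
    have hm : StronglyMeasurable[F (max a b)] (fun ω => ξ ω * ζ ω) :=
      (hξ.mono (F.mono (le_max_left _ _))).mul (hζ.mono (F.mono (le_max_right _ _)))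
    have hb : ∀ ω, ‖ξ ω * ζ ω‖ ≤ C * C' := fun ω => by
      rw [norm_mul]
      exact mul_le_mul (hC ω) (hC' ω) (norm_nonneg _) ((norm_nonneg _).trans (hC ω))
    refine (Elem.single (F := F) (W := W) (max a b) _ hm _ hb).congr ?_ ?_
    · funext t ω
      by_cases h1 : a < t <;> by_cases h2 : b < t <;> simp [h1, h2]
    · funext t ω
      beta_reduce
      rcases le_total a b with hab | hab
      · rw [max_eq_right hab, ← min_assoc, min_eq_right hab]
        push_cast
        ring
      · rw [max_eq_left hab]
        rcases le_total a t with hat | hat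
        · rw [min_eq_left hat, min_eq_left hab, min_eq_left (hab.trans hat)]
          push_cast
          ring
        · rw [min_eq_right hat]
          simp
  | add h h' ih ih' =>
    refine (ih.add ih').congr ?_ ?_
    · funext t ω
      by_cases h1 : a < t <;> simp [h1, mul_add]
    · funext t ω
      ring

theorem Elem.const_mul (h : Elem F W V I) (c : ℂ) :
    Elem F W (fun t ω => c * V t ω) (fun t ω => c * I t ω) := by
  induction h with
  | single b ζ hζ C' hC' =>
    refine (Elem.single (F := F) (W := W) b (fun ω => c * ζ ω) (hζ.const_mul c) (‖c‖ * C')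
      fun ω => ?_).congr ?_ ?_
    · rw [norm_mul]
      exact mul_le_mul_of_nonneg_left (hC' ω) (norm_nonneg _)
    · funext t ω
      simp
    · funext t ω
      ring
  | add h h' ih ih' =>
    refine (ih.add ih').congr ?_ ?_
    · funext t ω
      ring
    · funext t ω
      ring

theorem Elem.sub (h : Elem F W V I) (h' : Elem F W V' I') :
    Elem F W (fun t ω => V t ω - V' t ω) (fun t ω => I t ω - I' t ω) :=
  (h.add (h'.const_mul (-1))).congr (by funext t ω; ring) (by funext t ω; ring)

theorem Elem.eval_zero (h : Elem F W V I) (ω : Ω) : I 0 ω = 0 := by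
  induction h with
  | single b ζ hζ C' hC' => simp
  | add h h' ih ih' => simp [ih, ih']

theorem Elem.val_zero (h : Elem F W V I) (ω : Ω) : V 0 ω = 0 := by
  induction h with
  | single b ζ hζ C' hC' => simp
  | add h h' ih ih' => simp [ih, ih']

theorem Elem.continuous (h : Elem F W V I) {ω : Ω} (hW : Continuous fun t => W t ω) :
    Continuous fun t => I t ω := by
  induction h with
  | single b ζ hζ C' hC' => fun_prop
  | add h h' ih ih' => exact ih.add ih'

theorem Elem.measurable_val (h : Elem F W V I) (ω : Ω) : Measurable fun t => V t ω := by
  induction h with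
  | single b ζ hζ C' hC' => exact Measurable.ite measurableSet_Ioi measurable_const measurable_const
  | add h h' ih ih' => exact ih.add ih'

theorem Elem.bounded (h : Elem F W V I) : ∃ C : ℝ, ∀ t ω, ‖V t ω‖ ≤ C := by
  induction h with
  | single b ζ hζ C hC =>
    refine ⟨max C 0, fun t ω => ?_⟩
    by_cases h : b < t
    · simp [h, hC ω]
    · simp [h]
  | add h h' ih ih' =>
    obtain ⟨C, hC⟩ := ih
    obtain ⟨C', hC'⟩ := ih'
    exact ⟨C + C', fun t ω => norm_add_le_of_le (hC t ω) (hC' t ω)⟩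

theorem Elem.adapted (hW : StronglyAdapted F W) (h : Elem F W V I) : StronglyAdapted F I := by
  induction h with
  | single b ζ hζ C hC =>
    intro t
    beta_reduce
    rcases le_total b t with hbt | hbt
    · rw [min_eq_left hbt]
      refine (hζ.mono (F.mono hbt)).mul ?_
      exact Complex.continuous_ofReal.comp_stronglyMeasurable
        ((hW t).sub ((hW b).mono (F.mono hbt)))
    · rw [min_eq_right hbt]
      simpa using stronglyMeasurable_const
  | add h h' ih ih' => exact fun t => (ih t).add (ih' t)

/-- Elementary processes jump at finitely many times; on any grid without jumps inside its cells
they are constant on cells and their integrals are linear in the increments of W. Allowing every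
such grid, instead of producing one, lets two processes share a grid in the additive step of the
induction. -/
theorem Elem.exists_grid (h : Elem F W V I) : ∃ s : Finset ℝ≥0, ∀ r : ℕ → ℝ≥0, Monotone r →
    (∀ a ∈ s, ∀ i, a ≤ r i ∨ r (i + 1) ≤ a) → ∃ ξ : ℕ → Ω → ℂ,
      (∀ i, StronglyMeasurable[F (r i)] (ξ i)) ∧ (∃ C : ℝ, ∀ i ω, ‖ξ i ω‖ ≤ C) ∧
      (∀ i t, r i < t → t ≤ r (i + 1) → ∀ ω, V t ω = ξ i ω) ∧
      ∀ i t, r i ≤ t → t ≤ r (i + 1) → ∀ ω,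
        I t ω = I (r i) ω + ξ i ω * ((W t ω - W (r i) ω : ℝ) : ℂ) := by
  induction h with
  | single b ζ hζ C hC =>
    refine ⟨{b}, fun r hr hs => ⟨fun i => if b ≤ r i then ζ else fun _ => 0, ?_, ?_, ?_, ?_⟩⟩
    · intro i
      by_cases h : b ≤ r i
      · simpa [h] using hζ.mono (F.mono h)
      · simpa [h] using stronglyMeasurable_const
    · refine ⟨max C 0, fun i ω => ?_⟩
      by_cases h : b ≤ r i
      · simp [h, hC ω]
      · simp [h]
    · intro i t h1 h2 ω
      by_cases h : b ≤ r i
      · simp [h, h.trans_lt h1]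
      · have := (hs b (by simp) i).resolve_left h
        simp [h, h2.trans this]
    · intro i t h1 h2 ω
      by_cases h : b ≤ r i
      · simp only [h, if_pos, min_eq_left h, min_eq_left (h.trans h1)]
        push_cast
        ring
      · have := (hs b (by simp) i).resolve_left h
        simp [h, min_eq_right (h2.trans this), min_eq_right (h1.trans (h2.trans this))]
  | add h h' ih ih' =>
    classical
    obtain ⟨s, hs⟩ := ih
    obtain ⟨s', hs'⟩ := ih'
    refine ⟨s ∪ s', fun r hr hr' => ?_⟩
    obtain ⟨ξ, h1, ⟨C, hC⟩, h3, h4⟩ := hs r hr fun a ha => hr' a (Finset.mem_union_left _ ha)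
    obtain ⟨ξ', h1', ⟨C', hC'⟩, h3', h4'⟩ :=
      hs' r hr fun a ha => hr' a (Finset.mem_union_right _ ha)
    refine ⟨fun i ω => ξ i ω + ξ' i ω, fun i => (h1 i).add (h1' i),
      ⟨C + C', fun i ω => norm_add_le_of_le (hC i ω) (hC' i ω)⟩, fun i t ht ht' ω => ?_,
      fun i t ht ht' ω => ?_⟩
    · beta_reduce
      rw [h3 i t ht ht', h3' i t ht ht']
    · beta_reduce
      rw [h4 i t ht ht', h4' i t ht ht']
      ring

theorem lintegral_Ioc_grid {r : ℕ → ℝ≥0} (hr : Monotone r) (f : ℝ≥0 → ℝ≥0∞) (n : ℕ) :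
    ∫⁻ s in Ioc (r 0) (r n), f s ∂leb = ∑ i ∈ Finset.range n, ∫⁻ s in Ioc (r i) (r (i + 1)), f s ∂leb := by
  induction n with
  | zero => simp
  | succ n ih =>
    rw [Finset.sum_range_succ, ← ih, ← lintegral_union measurableSet_Ioc,
      Ioc_union_Ioc_eq_Ioc (hr (Nat.zero_le _)) (hr (Nat.le_succ _))]
    exact Set.disjoint_left.2 fun x hx hx' => absurd hx.2 (not_le.2 hx'.1)

theorem lintegral_Icc_eq_Ioc (T : ℝ≥0) (f : ℝ≥0 → ℝ≥0∞) :
    ∫⁻ s in Icc 0 T, f s ∂leb = ∫⁻ s in Ioc 0 T, f s ∂leb :=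
  setLIntegral_congr Ioc_ae_eq_Icc.symm

variable [IsProbabilityMeasure P] {N : ℕ} {β : Fin N → ℝ≥0 → Ω → ℝ}

/-- Along a grid containing Q and the jump times, the integral is a discrete martingale transform
whose quadratic variation at the last step is exactly the energy on [0,T]; the discrete maximal
inequality applies. -/
theorem Elem.measure_finset_le (hβ : IsBrownianFamily P F β) {j : Fin N}
    (h : Elem F (β j) V I) (T : ℝ≥0) {ε δ : ℝ} (hε : 0 < ε) (hδ : 0 ≤ δ) (Q : Finset ℝ≥0)
    (hQ : ∀ t ∈ Q, t ≤ T) :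
    P {ω | ∃ t ∈ Q, ε ≤ ‖I t ω‖}
      ≤ ENNReal.ofReal (δ / ε ^ 2) + P {ω | ENNReal.ofReal δ < engy T V ω} := by
  classical
  obtain ⟨s, hs⟩ := h.exists_grid
  obtain ⟨n, r, hr, hr0, hrT, hgap, hmem⟩ := StochasticMaxwell.exists_grid T (s ∪ Q)
  obtain ⟨ξ, hξ, ⟨C, hC⟩, hval, hint⟩ := hs r hr fun a ha => hgap a (Finset.mem_union_left _ ha)
  have hstep : ∀ i, r i ≤ r (i + 1) := fun i => hr (Nat.le_succ i)
  have hI : ∀ k ω, I (r k) ω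
      = ∑ i ∈ Finset.range k, ξ i ω * ((β j (r (i + 1)) ω - β j (r i) ω : ℝ) : ℂ) := by
    intro k ω
    induction k with
    | zero => simp [hr0, h.eval_zero]
    | succ k ih => rw [Finset.sum_range_succ, ← ih, hint k _ (hstep k) le_rfl]
  have key := measure_exists_le_norm_transform_le (P := P) hr (v := fun i => (r (i + 1) - r i : ℝ))
    (fun i => sub_nonneg.2 (hstep i)) hξ hC (fun i => hβ.measurable_sub j (hstep i))
    (fun i => hβ.indep_comap (hstep i) (φ := fun x => x j) (by fun_prop))
    (fun i => (hβ.hasLaw_sub j (hstep i)).memLp_gaussian 2)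
    (fun i => by rw [(hβ.hasLaw_sub j (hstep i)).integral_eq, integral_id_gaussianReal])
    (fun i => by rw [(hβ.hasLaw_sub j (hstep i)).integral_gaussian_sq, NNReal.coe_sub (hstep i)])
    hε hδ n
  refine (measure_mono ?_).trans (key.trans (add_le_add_right (measure_mono ?_) _))
  · rintro ω ⟨t, ht, htε⟩
    obtain ⟨i, hi, rfl⟩ := hmem t (Finset.mem_union_right _ ht) (hQ t ht)
    exact ⟨i, hi, (hI i ω) ▸ htε⟩
  · intro ω (hω : δ < _)
    change _ < engy T V ω
    have e1 : engy T V ω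
        = ENNReal.ofReal (∑ i ∈ Finset.range n, (r (i + 1) - r i : ℝ) * ‖ξ i ω‖ ^ 2) := by
      rw [engy, lintegral_Icc_eq_Ioc, ← hr0, ← hrT n le_rfl, lintegral_Ioc_grid hr,
        ENNReal.ofReal_sum_of_nonneg (f := fun i => (r (i + 1) - r i : ℝ) * ‖ξ i ω‖ ^ 2)
          fun i _ => mul_nonneg (sub_nonneg.2 (hstep i)) (by positivity)]
      refine Finset.sum_congr rfl fun i _ => ?_
      rw [setLIntegral_congr_fun (g := fun _ => ‖ξ i ω‖ₑ ^ 2) measurableSet_Ioc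
        fun t ht => by simp only [hval i t ht.1 ht.2 ω]]
      rw [setLIntegral_const, leb_Ioc,
        ENNReal.ofReal_mul (p := (r (i + 1) - r i : ℝ)) (sub_nonneg.2 (hstep i)), mul_comm,
        ENNReal.ofReal_pow (norm_nonneg _), ofReal_norm]
    rw [e1]
    exact (ENNReal.ofReal_lt_ofReal_iff_of_nonneg hδ).2 hω

/-- Finite sets of times exhaust a dense sequence, and path continuity carries the bound to all
times. The level drops to ε/2 because a supremum of at least ε only yields a nonempty open set of
times with values above ε/2, which the dense sequence must meet. -/
theorem Elem.measure_usup_le (hβ : IsBrownianFamily P F β) {j : Fin N}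
    (h : Elem F (β j) V I) (T : ℝ≥0) {ε δ : ℝ} (hε : 0 < ε) (hδ : 0 ≤ δ) :
    P {ω | ENNReal.ofReal ε ≤ usup T I ω}
      ≤ ENNReal.ofReal (δ / (ε / 2) ^ 2) + P {ω | ENNReal.ofReal δ < engy T V ω} := by
  classical
  have : Nonempty (Icc 0 T) := ⟨⟨0, ⟨le_rfl, zero_le⟩⟩⟩
  let d : ℕ → Icc 0 T := TopologicalSpace.denseSeq (Icc 0 T)
  let A : ℕ → Set Ω := fun n => {ω | ∃ t ∈ (Finset.range n).image (fun k => (d k : ℝ≥0)),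
    ε / 2 ≤ ‖I t ω‖}
  have hA : Monotone A := by
    intro m n hmn ω ⟨t, ht, h2⟩
    exact ⟨t, Finset.image_subset_image (Finset.range_mono hmn) ht, h2⟩
  have h1 : ∀ n, P (A n) ≤ ENNReal.ofReal (δ / (ε / 2) ^ 2)
      + P {ω | ENNReal.ofReal δ < engy T V ω} := fun n => by
    refine h.measure_finset_le hβ T (half_pos hε) hδ _ fun t ht => ?_
    obtain ⟨k, -, rfl⟩ := Finset.mem_image.1 ht
    exact (d k).2.2
  have h2 : P (⋃ n, A n) ≤ ENNReal.ofReal (δ / (ε / 2) ^ 2)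
      + P {ω | ENNReal.ofReal δ < engy T V ω} := by
    rw [hA.measure_iUnion]
    exact iSup_le h1
  refine (measure_mono_ae ?_).trans h2
  filter_upwards [(hβ.brownian j).cont] with ω hω (hsup : _ ≤ _)
  have hc := h.continuous hω
  have hlt : ENNReal.ofReal (ε / 2) < usup T I ω :=
    ((ENNReal.ofReal_lt_ofReal_iff hε).2 (half_lt_self hε)).trans_le hsup
  simp only [usup, lt_iSup_iff] at hlt
  obtain ⟨t, ht, hlt⟩ := hlt
  rw [← ofReal_norm] at hlt
  have hlt := (ENNReal.ofReal_lt_ofReal_iff_of_nonneg (half_pos hε).le).1 hlt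
  have hopen : IsOpen {t : Icc 0 T | ε / 2 < ‖I t ω‖} :=
    isOpen_lt continuous_const (hc.comp continuous_subtype_val).norm
  obtain ⟨k, hk⟩ := (TopologicalSpace.denseRange_denseSeq (Icc 0 T)).exists_mem_open hopen ⟨⟨t, ht⟩, hlt⟩
  exact mem_iUnion.2 ⟨k + 1, _, Finset.mem_image_of_mem _ (Finset.self_mem_range_succ k), le_of_lt hk⟩

end Elem

/-! ### The Itô integral -/

section Ito

variable {Ω : Type*} {mΩ : MeasurableSpace Ω} {P : Measure Ω} {F : Filtration ℝ≥0 mΩ}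
  {W : ℝ≥0 → Ω → ℝ} {V V' I I' X X' : ℝ≥0 → Ω → ℂ} {T : ℝ≥0}

theorem usup_le_add {A B Y : ℝ≥0 → Ω → ℂ} {ω : Ω}
    (h : ∀ t ≤ T, ‖Y t ω‖ₑ ≤ ‖A t ω‖ₑ + ‖B t ω‖ₑ) : usup T Y ω ≤ usup T A ω + usup T B ω := by
  refine iSup₂_le fun t ht => (h t ht.2).trans (add_le_add ?_ ?_)
  · exact le_iSup₂ (f := fun t (_ : t ∈ Icc 0 T) => ‖A t ω‖ₑ) t ht
  · exact le_iSup₂ (f := fun t (_ : t ∈ Icc 0 T) => ‖B t ω‖ₑ) t ht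

theorem le_usup {Y : ℝ≥0 → Ω → ℂ} {ω : Ω} {t : ℝ≥0} (ht : t ≤ T) : ‖Y t ω‖ₑ ≤ usup T Y ω :=
  le_iSup₂ (f := fun t (_ : t ∈ Icc 0 T) => ‖Y t ω‖ₑ) t ⟨zero_le, ht⟩

theorem usup_le_mul {A Y : ℝ≥0 → Ω → ℂ} {ω : Ω} {c : ℝ≥0∞}
    (h : ∀ t ≤ T, ‖Y t ω‖ₑ ≤ c * ‖A t ω‖ₑ) : usup T Y ω ≤ c * usup T A ω :=
  iSup₂_le fun t ht => (h t ht.2).trans (mul_le_mul_right (le_usup ht.2) _)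

theorem usup_congr {A B : ℝ≥0 → Ω → ℂ} {ω : Ω}
    (h : ∀ t ≤ T, ‖A t ω‖ₑ = ‖B t ω‖ₑ) : usup T A ω = usup T B ω :=
  biSup_congr fun t ht => h t ht.2

/-- Measurability is asked of one summand only: this is enough for additivity of the lower integral,
and it lets the other process be arbitrary. The constant 4 is not optimal. -/
theorem engy_le_add {A B Y : ℝ≥0 → Ω → ℂ} {ω : Ω}
    (hA : AEStronglyMeasurable (fun s => A s ω) (leb.restrict (Icc 0 T)))
    (h : ∀ᵐ s ∂leb.restrict (Icc 0 T), ‖Y s ω‖ₑ ≤ ‖A s ω‖ₑ + ‖B s ω‖ₑ) :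
    engy T Y ω ≤ 4 * engy T A ω + 4 * engy T B ω := by
  have hsq : ∀ a b : ℝ≥0∞, (a + b) ^ 2 ≤ 4 * a ^ 2 + 4 * b ^ 2 := by
    intro a b
    have : a + b ≤ 2 * max a b := by
      rw [two_mul]
      exact add_le_add (le_max_left _ _) (le_max_right _ _)
    calc (a + b) ^ 2 ≤ (2 * max a b) ^ 2 := pow_le_pow_left' this 2
      _ = 4 * (max a b) ^ 2 := by rw [mul_pow]; norm_num
      _ ≤ 4 * (a ^ 2 + b ^ 2) := by
          gcongr
          rcases le_total a b with h | h
          · rw [max_eq_right h]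
            exact le_add_self
          · rw [max_eq_left h]
            exact le_self_add
      _ = _ := mul_add _ _ _
  unfold engy
  rw [← lintegral_const_mul' _ _ (by norm_num), ← lintegral_const_mul' _ _ (by norm_num),
    ← lintegral_add_left' ((hA.enorm.pow_const 2).const_mul 4)]
  exact lintegral_mono_ae (h.mono fun s hs => (pow_le_pow_left' hs 2).trans (hsq _ _))

theorem engy_le_mul {A Y : ℝ≥0 → Ω → ℂ} {ω : Ω} {c : ℝ≥0∞}
    (h : ∀ᵐ s ∂leb.restrict (Icc 0 T), ‖Y s ω‖ₑ ≤ c * ‖A s ω‖ₑ) (hc : c ≠ ∞) :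
    engy T Y ω ≤ c ^ 2 * engy T A ω := by
  unfold engy
  rw [← lintegral_const_mul' _ _ (by finiteness)]
  refine lintegral_mono_ae (h.mono fun s hs => ?_)
  rw [← mul_pow]
  exact pow_le_pow_left' hs 2

theorem engy_le_usup (A : ℝ≥0 → Ω → ℂ) (ω : Ω) : engy T A ω ≤ ENNReal.ofReal T * usup T A ω ^ 2 := by
  calc engy T A ω ≤ ∫⁻ s in Icc 0 T, usup T A ω ^ 2 ∂leb :=
        setLIntegral_mono measurable_const fun s hs => pow_le_pow_left' (le_usup hs.2) 2
    _ = _ := by rw [setLIntegral_const, leb_Icc, mul_comm]; simp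

theorem engy_congr {A B : ℝ≥0 → Ω → ℂ} {ω : Ω}
    (h : ∀ᵐ s ∂leb.restrict (Icc 0 T), ‖A s ω‖ₑ = ‖B s ω‖ₑ) : engy T A ω = engy T B ω :=
  lintegral_congr_ae (h.mono fun s hs => by simp only [hs])

theorem PNull.engy_zero : PNull P (fun _ => engy T (fun _ _ => (0 : ℂ))) := by
  refine PNull.zero.mono fun n => ae_of_all _ fun ω => ?_
  simp [engy]

theorem PNull.usup_zero : PNull P (fun _ => usup T (fun _ _ => (0 : ℂ))) := by
  refine PNull.zero.mono fun n => ae_of_all _ fun ω => ?_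
  simp [usup]

theorem PNull.sq {f : ℕ → Ω → ℝ≥0∞} (hf : PNull P f) : PNull P (fun n ω => f n ω ^ 2) := by
  intro ε hε
  have h1 : 0 < min ε 1 := lt_min hε one_pos
  refine tendsto_of_tendsto_of_tendsto_of_le_of_le tendsto_const_nhds (hf _ h1)
    (fun _ => zero_le) fun n => measure_mono fun ω (hω : ε ≤ f n ω ^ 2) => ?_
  by_contra hc
  have hc : f n ω < min ε 1 := not_le.1 hc
  have : f n ω ^ 2 ≤ f n ω := by
    rw [_root_.sq]
    exact mul_le_of_le_one_right' (hc.le.trans (min_le_right _ _))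
  exact absurd (hω.trans this) (not_le.2 (hc.trans_le (min_le_left _ _)))

/-- The indicator of (a, b] is the difference of those of (a, ∞) and (b, ∞). -/
theorem SimpleProc.elem (S : SimpleProc F) : Elem F W S.val (S.integral W) := by
  have h : ∀ k : Fin S.n, Elem F W (fun t ω => (Ioc (S.τ k.castSucc) (S.τ k.succ)).indicator
      (fun _ => S.ξ k ω) t) (fun t ω => S.ξ k ω *
        ((W (min (S.τ k.succ) t) ω - W (min (S.τ k.castSucc) t) ω : ℝ) : ℂ)) := by
    intro k
    obtain ⟨C, hC⟩ := S.bdd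
    have hle : S.τ k.castSucc ≤ S.τ k.succ := S.mono (Fin.castSucc_le_succ k)
    refine ((Elem.single (F := F) (W := W) (S.τ k.castSucc) (S.ξ k) (S.meas k) C (hC k)).sub
      (Elem.single (S.τ k.succ) (S.ξ k) ((S.meas k).mono (F.mono hle)) C (hC k))).congr ?_ ?_
    · funext t ω
      by_cases h1 : S.τ k.castSucc < t
      · by_cases h2 : S.τ k.succ < t
        · simp [h1, h2, indicator, not_le.2 h2]
        · simp [h1, h2, indicator, not_lt.1 h2]
      · have h2 : ¬ S.τ k.succ < t := fun h => h1 (hle.trans_lt h)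
        simp [h1, h2, indicator]
    · funext t ω
      push_cast
      ring
  exact Elem.sum Finset.univ fun k _ => h k

theorem Elem.exists_simpleProc (h : Elem F W V I) (T : ℝ≥0) : ∃ S : SimpleProc F,
    (∀ t ≤ T, ∀ ω, S.val t ω = V t ω) ∧ ∀ t ≤ T, ∀ ω, S.integral W t ω = I t ω := by
  obtain ⟨s, hs⟩ := h.exists_grid
  obtain ⟨n, r, hr, hr0, hrT, hgap, -⟩ := StochasticMaxwell.exists_grid T s
  obtain ⟨ξ, hξ, ⟨C, hC⟩, hval, hint⟩ := hs r hr hgap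
  let S : SimpleProc F :=
    { n := n
      τ := fun k => r k
      mono := fun i j hij => hr hij
      ξ := fun k => ξ k
      meas := fun k => hξ k
      bdd := ⟨C, fun k ω => hC k ω⟩ }
  refine ⟨S, fun t ht ω => ?_, fun t ht ω => ?_⟩
  -- The first m cells reproduce V up to time r m and vanish afterwards. At time 0 the two sides
  -- agree because elementary processes are supported on left-open intervals.
  · have key : ∀ m, ∑ k ∈ Finset.range m, (Ioc (r k) (r (k + 1))).indicator (fun _ => ξ k ω) t
        = if t ≤ r m then V t ω else 0 := by
      intro m
      induction m with
      | zero =>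
        by_cases h0 : t ≤ r 0
        · have : t = 0 := le_antisymm (hr0 ▸ h0) zero_le
          simp [this, h.val_zero]
        · simp [h0]
      | succ m ih =>
        rw [Finset.sum_range_succ, ih]
        have hm := hr (Nat.le_succ m)
        by_cases h1 : t ≤ r m
        · simp [h1, h1.trans hm, indicator, not_lt.2 h1]
        · by_cases h2 : t ≤ r (m + 1)
          · simp [h1, h2, indicator, not_le.1 h1, hval m t (not_le.1 h1) h2]
          · simp [h1, h2, indicator]
    have := key n
    rw [Finset.sum_range, if_pos (ht.trans (hrT n le_rfl).ge)] at this
    exact this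
  · have key : ∀ m, ∑ k ∈ Finset.range m, ξ k ω *
        ((W (min (r (k + 1)) t) ω - W (min (r k) t) ω : ℝ) : ℂ) = I (min (r m) t) ω := by
      intro m
      induction m with
      | zero => simp [hr0, h.eval_zero]
      | succ m ih =>
        rw [Finset.sum_range_succ, ih]
        have hm := hr (Nat.le_succ m)
        rcases le_total t (r m) with h1 | h1
        · simp [min_eq_right h1, min_eq_right (h1.trans hm)]
        · rw [min_eq_left h1, hint m (min (r (m + 1)) t) (le_min hm h1) (min_le_left _ _)]
    have := key n
    rw [Finset.sum_range, hrT n le_rfl, min_eq_right ht] at this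
    exact this

/-- Elementary processes are closed under sums and restarts by construction, which spares common
refinements of partitions. From here on the Itô integral is handled only through this form. -/
theorem isItoIntegral_iff : IsItoIntegral P F W T X I ↔
    (∀ᵐ ω ∂P, AEStronglyMeasurable (fun s => X s ω) (leb.restrict (Icc 0 T))) ∧
    ∃ V J : ℕ → ℝ≥0 → Ω → ℂ, (∀ n, Elem F W (V n) (J n)) ∧
      PNull P (fun n => engy T (fun s ω => V n s ω - X s ω)) ∧
      PNull P (fun n => usup T (fun s ω => J n s ω - I s ω)) := by
  refine and_congr Iff.rfl ⟨?_, ?_⟩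
  · rintro ⟨S, h1, h2⟩
    exact ⟨fun n => (S n).val, fun n => (S n).integral W, fun n => (S n).elem, h1, h2⟩
  · rintro ⟨V, J, hVJ, h1, h2⟩
    choose S hS hS' using fun n => (hVJ n).exists_simpleProc T
    refine ⟨S, ?_, ?_⟩
    · refine PNull.mono h1 fun n => ae_of_all _ fun ω => le_of_eq ?_
      refine setLIntegral_congr_fun measurableSet_Icc fun t ht => ?_
      simp only [hS n t ht.2]
    · refine PNull.mono h2 fun n => ae_of_all _ fun ω => le_of_eq ?_
      refine biSup_congr fun t ht => ?_
      simp only [hS' n t ht.2]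

theorem IsItoIntegral.aesm (h : IsItoIntegral P F W T X I) :
    ∀ᵐ ω ∂P, AEStronglyMeasurable (fun s => X s ω) (leb.restrict (Icc 0 T)) := h.1

theorem Elem.isItoIntegral (h : Elem F W V I) : IsItoIntegral P F W T V I := by
  refine isItoIntegral_iff.2 ⟨ae_of_all _ fun ω => (h.measurable_val ω).aestronglyMeasurable,
    fun _ => V, fun _ => I, fun _ => h, ?_, ?_⟩
  · simpa using PNull.engy_zero
  · simpa using PNull.usup_zero

theorem IsItoIntegral.congr (h : IsItoIntegral P F W T X I)
    (hX : ∀ᵐ ω ∂P, ∀ᵐ s ∂leb.restrict (Icc 0 T), X s ω = X' s ω)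
    (hI : ∀ᵐ ω ∂P, ∀ t ≤ T, I t ω = I' t ω) : IsItoIntegral P F W T X' I' := by
  obtain ⟨hm, V, J, hVJ, h1, h2⟩ := isItoIntegral_iff.1 h
  refine isItoIntegral_iff.2 ⟨?_, V, J, hVJ, ?_, ?_⟩
  · filter_upwards [hm, hX] with ω h3 h4 using h3.congr h4
  · refine h1.mono fun n => ?_
    filter_upwards [hX] with ω hω
    exact (engy_congr (hω.mono fun s hs => by rw [hs])).le
  · refine h2.mono fun n => ?_
    filter_upwards [hI] with ω hω
    exact (usup_congr fun t ht => by rw [hω t ht]).le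

theorem IsItoIntegral.add (h : IsItoIntegral P F W T X I) (h' : IsItoIntegral P F W T X' I') :
    IsItoIntegral P F W T (fun s ω => X s ω + X' s ω) (fun s ω => I s ω + I' s ω) := by
  obtain ⟨hm, V, J, hVJ, h1, h2⟩ := isItoIntegral_iff.1 h
  obtain ⟨hm', V', J', hVJ', h1', h2'⟩ := isItoIntegral_iff.1 h'
  refine isItoIntegral_iff.2 ⟨?_, _, _, fun n => (hVJ n).add (hVJ' n), ?_, ?_⟩
  · filter_upwards [hm, hm'] with ω h3 h4 using h3.add h4
  · refine ((h1.const_mul (c := 4) (by norm_num)).add (h1'.const_mul (c := 4) (by norm_num))).mono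
      fun n => ?_
    filter_upwards [hm] with ω hω
    refine engy_le_add (((hVJ n).measurable_val ω).aestronglyMeasurable.sub hω)
      (ae_of_all _ fun s => ?_)
    rw [add_sub_add_comm]
    exact enorm_add_le _ _
  · refine (h2.add h2').mono fun n => ae_of_all _ fun ω => usup_le_add fun t _ => ?_
    rw [add_sub_add_comm]
    exact enorm_add_le _ _

theorem IsItoIntegral.const_mul (h : IsItoIntegral P F W T X I) (c : ℂ) :
    IsItoIntegral P F W T (fun s ω => c * X s ω) (fun s ω => c * I s ω) := by
  obtain ⟨hm, V, J, hVJ, h1, h2⟩ := isItoIntegral_iff.1 h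
  refine isItoIntegral_iff.2 ⟨?_, _, _, fun n => (hVJ n).const_mul c, ?_, ?_⟩
  · filter_upwards [hm] with ω h3 using h3.const_mul c
  · refine (h1.const_mul (c := ‖c‖ₑ ^ 2) (by finiteness)).mono fun n => ae_of_all _ fun ω =>
      engy_le_mul (ae_of_all _ fun s => ?_) enorm_ne_top
    rw [← mul_sub, enorm_mul]
  · refine (h2.const_mul (c := ‖c‖ₑ) enorm_ne_top).mono fun n => ae_of_all _ fun ω =>
      usup_le_mul fun t _ => ?_
    rw [← mul_sub, enorm_mul]

theorem IsItoIntegral.sub (h : IsItoIntegral P F W T X I) (h' : IsItoIntegral P F W T X' I') :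
    IsItoIntegral P F W T (fun s ω => X s ω - X' s ω) (fun s ω => I s ω - I' s ω) := by
  refine (h.add (h'.const_mul (-1))).congr ?_ ?_
  · exact ae_of_all _ fun ω => ae_of_all _ fun s => by ring
  · exact ae_of_all _ fun ω t _ => by ring

theorem IsItoIntegral.zero : IsItoIntegral P F W T (fun _ _ => 0) (fun _ _ => 0) :=
  Elem.zero.isItoIntegral

theorem IsItoIntegral.sum {ι : Type*} (s : Finset ι) {X I : ι → ℝ≥0 → Ω → ℂ}
    (h : ∀ i ∈ s, IsItoIntegral P F W T (X i) (I i)) :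
    IsItoIntegral P F W T (fun t ω => ∑ i ∈ s, X i t ω) (fun t ω => ∑ i ∈ s, I i t ω) := by
  classical
  induction s using Finset.induction_on with
  | empty => simpa using IsItoIntegral.zero
  | insert a s ha ih =>
    simp_rw [Finset.sum_insert ha]
    exact (h a (Finset.mem_insert_self _ _)).add (ih fun i hi => h i (Finset.mem_insert_of_mem hi))

/-- Closedness of the integral by a diagonal choice: for each n one elementary approximation, good
for the integrand and for the integral simultaneously. -/
theorem isItoIntegral_of_tendsto {Xn In : ℕ → ℝ≥0 → Ω → ℂ}
    (h : ∀ n, IsItoIntegral P F W T (Xn n) (In n))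
    (hm : ∀ᵐ ω ∂P, AEStronglyMeasurable (fun s => X s ω) (leb.restrict (Icc 0 T)))
    (hX : PNull P (fun n => engy T (fun s ω => Xn n s ω - X s ω)))
    (hI : PNull P (fun n => usup T (fun s ω => In n s ω - I s ω))) :
    IsItoIntegral P F W T X I := by
  choose hmn V J hVJ h1 h2 using fun n => isItoIntegral_iff.1 (h n)
  obtain ⟨φ, hφ⟩ := PNull.exists_seq_diag fun n => (h1 n).add (h2 n)
  have hφ1 : PNull P (fun n => engy T (fun s ω => V n (φ n) s ω - Xn n s ω)) :=
    hφ.mono fun n => ae_of_all _ fun ω => le_self_add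
  have hφ2 : PNull P (fun n => usup T (fun s ω => J n (φ n) s ω - In n s ω)) :=
    hφ.mono fun n => ae_of_all _ fun ω => le_add_self
  refine isItoIntegral_iff.2 ⟨hm, fun n => V n (φ n), fun n => J n (φ n), fun n => hVJ _ _, ?_, ?_⟩
  · refine ((hφ1.const_mul (c := 4) (by norm_num)).add (hX.const_mul (c := 4) (by norm_num))).mono
      fun n => ?_
    filter_upwards [hmn n] with ω hω
    refine engy_le_add (((hVJ n _).measurable_val ω).aestronglyMeasurable.sub hω)
      (ae_of_all _ fun s => ?_)
    rw [← sub_add_sub_cancel _ (Xn n s ω) _]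
    exact enorm_add_le _ _
  · refine (hφ2.add hI).mono fun n => ae_of_all _ fun ω => usup_le_add fun t _ => ?_
    rw [← sub_add_sub_cancel _ (In n t ω) _]
    exact enorm_add_le _ _

variable [IsProbabilityMeasure P] {N : ℕ} {β : Fin N → ℝ≥0 → Ω → ℝ} {j : Fin N}

/-- The maximal inequality is inherited from the approximations. One halving of ε pays for the error
of the integrals and one comes from the elementary case, hence ε/4; the constants 4 of `engy_le_add`
split δ as 4·(δ/8) + 4·(δ/8). -/
theorem IsItoIntegral.measure_usup_le (hβ : IsBrownianFamily P F β)
    (h : IsItoIntegral P F (β j) T X I) {ε δ : ℝ} (hε : 0 < ε) (hδ : 0 < δ) :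
    P {ω | ENNReal.ofReal ε ≤ usup T I ω}
      ≤ ENNReal.ofReal (δ / (ε / 4) ^ 2) + P {ω | ENNReal.ofReal (δ / 8) ≤ engy T X ω} := by
  obtain ⟨hm, V, J, hVJ, h1, h2⟩ := isItoIntegral_iff.1 h
  have hb : ∀ n, P {ω | ENNReal.ofReal ε ≤ usup T I ω} ≤
      (ENNReal.ofReal (δ / (ε / 4) ^ 2) + P {ω | ENNReal.ofReal (δ / 8) ≤ engy T X ω})
      + (P {ω | ENNReal.ofReal (δ / 8) ≤ engy T (fun s ω => V n s ω - X s ω) ω}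
        + P {ω | ENNReal.ofReal (ε / 2) ≤ usup T (fun s ω => J n s ω - I s ω) ω}) := by
    intro n
    have e1 : P {ω | ENNReal.ofReal ε ≤ usup T I ω} ≤
        P {ω | ENNReal.ofReal (ε / 2) ≤ usup T (J n) ω}
        + P {ω | ENNReal.ofReal (ε / 2) ≤ usup T (fun s ω => J n s ω - I s ω) ω} := by
      refine (measure_mono ?_).trans (measure_union_le _ _)
      intro ω (hω : ENNReal.ofReal ε ≤ usup T I ω)
      by_contra hc
      simp only [mem_union, mem_ofPred_eq, not_or, not_le] at hc
      have h3 : usup T I ω ≤ usup T (J n) ω + usup T (fun s ω => J n s ω - I s ω) ω := by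
        refine usup_le_add fun t _ => ?_
        have : I t ω = J n t ω + -(J n t ω - I t ω) := by ring
        rw [this]
        refine (enorm_add_le _ _).trans (by rw [enorm_neg]; simp)
      have h4 := h3.trans_lt (ENNReal.add_lt_add hc.1 hc.2)
      rw [← ENNReal.ofReal_add (by positivity) (by positivity), add_halves] at h4
      exact absurd hω (not_le.2 h4)
    have e2 := (hVJ n).measure_usup_le hβ T (half_pos hε) hδ.le
    rw [show ε / 2 / 2 = ε / 4 by ring] at e2
    have e3 : P {ω | ENNReal.ofReal δ < engy T (V n) ω} ≤
        P {ω | ENNReal.ofReal (δ / 8) ≤ engy T X ω}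
        + P {ω | ENNReal.ofReal (δ / 8) ≤ engy T (fun s ω => V n s ω - X s ω) ω} := by
      refine (measure_mono_ae ?_).trans (measure_union_le _ _)
      filter_upwards [hm] with ω hω (hlt : ENNReal.ofReal δ < engy T (V n) ω)
      by_contra hc'
      have hc : engy T X ω < ENNReal.ofReal (δ / 8) ∧
          engy T (fun s ω => V n s ω - X s ω) ω < ENNReal.ofReal (δ / 8) :=
        ⟨not_le.1 fun h => hc' (Or.inl h), not_le.1 fun h => hc' (Or.inr h)⟩
      have h3 : engy T (V n) ω ≤ 4 * engy T X ω + 4 * engy T (fun s ω => V n s ω - X s ω) ω := by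
        refine engy_le_add hω (ae_of_all _ fun s => ?_)
        have : V n s ω = X s ω + (V n s ω - X s ω) := by ring
        conv_lhs => rw [this]
        exact enorm_add_le _ _
      have h4 : ENNReal.ofReal δ = 4 * ENNReal.ofReal (δ / 8) + 4 * ENNReal.ofReal (δ / 8) := by
        rw [show (4 : ℝ≥0∞) = ENNReal.ofReal 4 by norm_num,
          ← ENNReal.ofReal_mul (by norm_num), ← ENNReal.ofReal_add (by positivity) (by positivity)]
        congr 1
        ring
      rw [h4] at hlt
      refine absurd (h3.trans (add_le_add ?_ ?_)) (not_le.2 hlt)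
      · exact mul_le_mul_right hc.1.le _
      · exact mul_le_mul_right hc.2.le _
    calc _ ≤ _ := e1
      _ ≤ _ := add_le_add_left (e2.trans (add_le_add_right e3 _)) _
      _ = _ := by ring
  have hlim := (h1 _ (ENNReal.ofReal_pos.2 (show 0 < δ / 8 by positivity))).add
    (h2 _ (ENNReal.ofReal_pos.2 (half_pos hε)))
  have hlim' := hlim.const_add
    (ENNReal.ofReal (δ / (ε / 4) ^ 2) + P {ω | ENNReal.ofReal (δ / 8) ≤ engy T X ω})
  rw [add_zero, add_zero] at hlim'
  exact ge_of_tendsto' hlim' hb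

/-- Continuity in probability of the Itô integral at zero, with δ independent of the integrand; by
linearity it makes the integral map Cauchy sequences to Cauchy sequences. -/
theorem IsItoIntegral.exists_measure_usup_le (hβ : IsBrownianFamily P F β) (j : Fin N) (T : ℝ≥0)
    {ε η : ℝ≥0∞} (hε : 0 < ε) (hη : 0 < η) : ∃ δ : ℝ≥0∞, 0 < δ ∧ ∀ X I : ℝ≥0 → Ω → ℂ,
      IsItoIntegral P F (β j) T X I → P {ω | δ ≤ engy T X ω} ≤ δ → P {ω | ε ≤ usup T I ω} ≤ η := by
  obtain ⟨ε', hε'0, hε'⟩ : ∃ ε' : ℝ, 0 < ε' ∧ ENNReal.ofReal ε' ≤ ε := by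
    obtain ⟨r, hr0, hr⟩ := ENNReal.lt_iff_exists_nnreal_btwn.1 hε
    exact ⟨r, by exact_mod_cast hr0, by simpa using hr.le⟩
  have hη2 : 0 < η / 2 := ENNReal.half_pos hη.ne'
  obtain ⟨η', hη'0, hη'⟩ : ∃ η' : ℝ, 0 < η' ∧ ENNReal.ofReal η' ≤ η / 2 := by
    obtain ⟨r, hr0, hr⟩ := ENNReal.lt_iff_exists_nnreal_btwn.1 hη2
    exact ⟨r, by exact_mod_cast hr0, by simpa using hr.le⟩
  have hδ : 0 < η' * (ε' / 4) ^ 2 := by positivity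
  refine ⟨min (ENNReal.ofReal (η' * (ε' / 4) ^ 2 / 8)) (η / 2),
    lt_min (ENNReal.ofReal_pos.2 (by positivity)) hη2, fun X I h hX => ?_⟩
  calc P {ω | ε ≤ usup T I ω} ≤ P {ω | ENNReal.ofReal ε' ≤ usup T I ω} :=
        measure_mono fun ω (hω : ε ≤ _) => hε'.trans hω
    _ ≤ _ := h.measure_usup_le hβ hε'0 hδ
    _ ≤ η / 2 + η / 2 := by
        refine add_le_add ?_ ?_
        · rw [mul_div_cancel_right₀ _ (by positivity)]
          exact hη'
        · refine le_trans (measure_mono ?_) (hX.trans (min_le_right _ _))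
          intro ω (hω : ENNReal.ofReal _ ≤ _)
          exact (min_le_left _ _).trans hω
    _ = η := ENNReal.add_halves η

/-- Completeness for uniform convergence in probability. Along a subsequence consecutive differences
are below 2⁻ᵏ off an event of probability at most 2⁻ᵏ; off the union of the later exceptional events
the subsequence is uniformly Cauchy with geometric rate. The Cauchy property then controls the full
sequence. -/
theorem exists_usup_limit {J : ℕ → ℝ≥0 → Ω → ℂ}
    (hJ : ∀ ε : ℝ≥0∞, 0 < ε → ∃ n₀, ∀ m ≥ n₀, ∀ n ≥ n₀,
      P {ω | ε ≤ usup T (fun s ω => J m s ω - J n s ω) ω} ≤ ε) :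
    ∃ I : ℝ≥0 → Ω → ℂ, PNull P (fun n => usup T (fun s ω => J n s ω - I s ω)) := by
  have hp : ∀ n : ℕ, 0 < (2⁻¹ : ℝ≥0∞) ^ n := fun n => ENNReal.pow_pos (by simp) n
  have hev : ∀ k : ℕ, ∀ᶠ m in atTop, ∀ n ≥ m,
      P {ω | (2⁻¹ : ℝ≥0∞) ^ k ≤ usup T (fun s ω => J m s ω - J n s ω) ω} ≤ (2⁻¹ : ℝ≥0∞) ^ k := by
    intro k
    obtain ⟨n₀, h⟩ := hJ _ (hp k)
    filter_upwards [eventually_ge_atTop n₀] with m hm n hn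
    exact h m hm n (le_trans hm hn)
  obtain ⟨φ, hφ, hφ'⟩ := extraction_forall_of_eventually hev
  let E : ℕ → Set Ω := fun k =>
    {ω | (2⁻¹ : ℝ≥0∞) ^ k ≤ usup T (fun s ω => J (φ k) s ω - J (φ (k + 1)) s ω) ω}
  have hE : ∀ k, P (E k) ≤ (2⁻¹ : ℝ≥0∞) ^ k := fun k =>
    hφ' k _ (hφ.monotone (Nat.le_succ k))
  classical
  -- Defined for all ω and t; where the subsequence diverges the value is arbitrary and irrelevant.
  let I : ℝ≥0 → Ω → ℂ := fun t ω => limUnder atTop fun k => J (φ k) t ω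
  have hdist : ∀ k ω, ω ∉ ⋃ i ≥ k, E i → ∀ t ≤ T, ∀ i ≥ k,
      edist (J (φ i) t ω) (J (φ (i + 1)) t ω) ≤ (2⁻¹ : ℝ≥0∞) ^ i := by
    intro k ω hω t ht i hi
    have : ω ∉ E i := fun h => hω (mem_biUnion (show i ≥ k from hi) h)
    rw [edist_eq_enorm_sub]
    exact (le_usup (Y := fun s ω => J (φ i) s ω - J (φ (i + 1)) s ω) ht).trans (not_le.1 this).le
  have hlim : ∀ k ω, ω ∉ ⋃ i ≥ k, E i → ∀ t ≤ T, edist (J (φ k) t ω) (I t ω) ≤ 2 * (2⁻¹ : ℝ≥0∞) ^ k := by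
    intro k ω hω t ht
    have hd : ∀ n, edist (J (φ (n + k)) t ω) (J (φ (n + 1 + k)) t ω)
        ≤ (2⁻¹ : ℝ≥0∞) ^ k / 2 ^ n := by
      intro n
      have := hdist k ω hω t ht (n + k) (by omega)
      rw [show n + 1 + k = n + k + 1 by ring]
      refine this.trans (le_of_eq ?_)
      rw [pow_add, mul_comm, ENNReal.div_eq_inv_mul, mul_comm, ENNReal.inv_pow]
    have hc : CauchySeq (fun n => J (φ (n + k)) t ω) :=
      cauchySeq_of_edist_le_geometric_two _ (by finiteness) hd
    obtain ⟨a, ha⟩ := cauchySeq_tendsto_of_complete hc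
    have ha' : Tendsto (fun n => J (φ n) t ω) atTop (𝓝 a) :=
      (tendsto_add_atTop_iff_nat (f := fun n => J (φ n) t ω) k).1 ha
    have hIa : I t ω = a := ha'.limUnder_eq
    rw [hIa, mul_comm]
    have := edist_le_of_edist_le_geometric_two_of_tendsto₀ _ hd ha
    simpa [mul_comm] using this
  have hsub : PNull P (fun k => usup T (fun s ω => J (φ k) s ω - I s ω)) := by
    intro ε hε
    have ht1 : Tendsto (fun k : ℕ => 2 * (2⁻¹ : ℝ≥0∞) ^ k) atTop (𝓝 0) := by
      have := ENNReal.Tendsto.const_mul (a := 2)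
        (ENNReal.tendsto_pow_atTop_nhds_zero_of_lt_one (r := 2⁻¹) (by simp)) (Or.inr (by simp))
      simpa using this
    have hPk : ∀ k, P (⋃ i ≥ k, E i) ≤ 2 * (2⁻¹ : ℝ≥0∞) ^ k := by
      intro k
      calc P (⋃ i ≥ k, E i) ≤ P (⋃ i, E (i + k)) := by
            refine measure_mono fun ω hω => ?_
            simp only [mem_iUnion] at hω ⊢
            obtain ⟨i, hi, h⟩ := hω
            exact ⟨i - k, by rwa [Nat.sub_add_cancel hi]⟩
        _ ≤ ∑' i, P (E (i + k)) := measure_iUnion_le _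
        _ ≤ ∑' i, (2⁻¹ : ℝ≥0∞) ^ (i + k) := ENNReal.tsum_le_tsum fun i => hE _
        _ = 2 * (2⁻¹ : ℝ≥0∞) ^ k := by
            simp_rw [pow_add]
            rw [ENNReal.tsum_mul_right, ENNReal.tsum_geometric]
            simp
    refine tendsto_of_tendsto_of_tendsto_of_le_of_le' tendsto_const_nhds ht1
      (Eventually.of_forall fun _ => zero_le) ?_
    filter_upwards [ht1.eventually (gt_mem_nhds hε)] with k hk
    refine (measure_mono fun ω (hω : ε ≤ _) => ?_).trans (hPk k)
    by_contra hc
    refine absurd hω (not_le.2 (lt_of_le_of_lt (iSup₂_le fun t ht => ?_) hk))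
    rw [← edist_eq_enorm_sub]
    exact hlim k ω hc t ht.2
  refine ⟨I, fun ε hε => ?_⟩
  rw [ENNReal.tendsto_nhds_zero]
  intro η hη
  have hε2 : 0 < ε / 2 := ENNReal.half_pos hε.ne'
  have hη2 : 0 < η / 2 := ENNReal.half_pos hη.ne'
  obtain ⟨n₀, hn₀⟩ := hJ (min (ε / 2) (η / 2)) (lt_min hε2 hη2)
  obtain ⟨k, hk1, hk2⟩ := (((ENNReal.tendsto_nhds_zero.1 (hsub _ hε2)) _ hη2).and
    (hφ.tendsto_atTop.eventually_ge_atTop n₀)).exists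
  filter_upwards [eventually_ge_atTop n₀] with n hn
  calc P {ω | ε ≤ usup T (fun s ω => J n s ω - I s ω) ω}
      ≤ P ({ω | min (ε / 2) (η / 2) ≤ usup T (fun s ω => J n s ω - J (φ k) s ω) ω} ∪
          {ω | ε / 2 ≤ usup T (fun s ω => J (φ k) s ω - I s ω) ω}) := by
        refine measure_mono fun ω (hω : ε ≤ _) => ?_
        by_contra hc
        simp only [mem_union, mem_ofPred_eq, not_or, not_le] at hc
        have h3 : usup T (fun s ω => J n s ω - I s ω) ω ≤
            usup T (fun s ω => J n s ω - J (φ k) s ω) ω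
            + usup T (fun s ω => J (φ k) s ω - I s ω) ω := by
          refine usup_le_add fun t _ => ?_
          rw [← sub_add_sub_cancel _ (J (φ k) t ω) _]
          exact enorm_add_le _ _
        have h4 := h3.trans_lt (ENNReal.add_lt_add (hc.1.trans_le (min_le_left _ _)) hc.2)
        rw [ENNReal.add_halves] at h4
        exact absurd hω (not_le.2 h4)
    _ ≤ _ := measure_union_le _ _
    _ ≤ η / 2 + η / 2 := add_le_add ((hn₀ n hn _ hk2).trans (min_le_right _ _)) hk1
    _ = η := ENNReal.add_halves η

/-- Integrands converging in energy are Cauchy in energy, so their integrals are Cauchy uniformly in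
probability; the limit is an integral by closedness. -/
theorem exists_isItoIntegral_of_tendsto (hβ : IsBrownianFamily P F β) {Xn In : ℕ → ℝ≥0 → Ω → ℂ}
    (h : ∀ n, IsItoIntegral P F (β j) T (Xn n) (In n))
    (hm : ∀ᵐ ω ∂P, AEStronglyMeasurable (fun s => X s ω) (leb.restrict (Icc 0 T)))
    (hX : PNull P (fun n => engy T (fun s ω => Xn n s ω - X s ω))) :
    ∃ I, IsItoIntegral P F (β j) T X I ∧ PNull P (fun n => usup T (fun s ω => In n s ω - I s ω)) := by
  obtain ⟨I, hI⟩ := exists_usup_limit (P := P) (T := T) (J := In) (by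
    intro ε hε
    obtain ⟨δ, hδ, hb⟩ := IsItoIntegral.exists_measure_usup_le (P := P) hβ j T hε hε
    have hδ8 : 0 < δ / 8 := ENNReal.div_pos hδ.ne' (by norm_num)
    have hδ2 : 0 < δ / 2 := ENNReal.half_pos hδ.ne'
    obtain ⟨n₀, hn₀⟩ := eventually_atTop.1 ((ENNReal.tendsto_nhds_zero.1 (hX _ hδ8)) _ hδ2)
    refine ⟨n₀, fun m hmn n hn => hb _ _ ((h m).sub (h n)) ?_⟩
    calc P {ω | δ ≤ engy T (fun s ω => Xn m s ω - Xn n s ω) ω}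
        ≤ P ({ω | δ / 8 ≤ engy T (fun s ω => Xn m s ω - X s ω) ω} ∪
          {ω | δ / 8 ≤ engy T (fun s ω => Xn n s ω - X s ω) ω}) := by
          refine measure_mono_ae ?_
          filter_upwards [hm, (h m).aesm] with ω hω hω' (hle : δ ≤ _)
          by_contra hc'
          have hc : engy T (fun s ω => Xn m s ω - X s ω) ω < δ / 8 ∧
              engy T (fun s ω => Xn n s ω - X s ω) ω < δ / 8 :=
            ⟨not_le.1 fun h => hc' (Or.inl h), not_le.1 fun h => hc' (Or.inr h)⟩
          have h3 : engy T (fun s ω => Xn m s ω - Xn n s ω) ω ≤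
              4 * engy T (fun s ω => Xn m s ω - X s ω) ω
              + 4 * engy T (fun s ω => Xn n s ω - X s ω) ω := by
            refine engy_le_add (hω'.sub hω) (ae_of_all _ fun s => ?_)
            have : Xn m s ω - Xn n s ω = (Xn m s ω - X s ω) + -(Xn n s ω - X s ω) := by ring
            rw [this]
            refine (enorm_add_le _ _).trans (by rw [enorm_neg])
          have h4 : 4 * engy T (fun s ω => Xn m s ω - X s ω) ω
              + 4 * engy T (fun s ω => Xn n s ω - X s ω) ω < 4 * (δ / 8) + 4 * (δ / 8) :=
            ENNReal.add_lt_add ((ENNReal.mul_lt_mul_iff_right (by norm_num) (by norm_num)).2 hc.1)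
              ((ENNReal.mul_lt_mul_iff_right (by norm_num) (by norm_num)).2 hc.2)
          have h5 : 4 * (δ / 8) + 4 * (δ / 8) = δ := by
            rw [← mul_add, ← two_mul, ← mul_assoc, show (4 : ℝ≥0∞) * 2 = 8 by norm_num]
            exact ENNReal.mul_div_cancel (by norm_num) (by norm_num)
          rw [h5] at h4
          exact absurd hle (not_le.2 (h3.trans_lt h4))
      _ ≤ _ := measure_union_le _ _
      _ ≤ δ / 2 + δ / 2 := add_le_add (hn₀ m hmn) (hn₀ n hn)
      _ = δ := ENNReal.add_halves δ)
  exact ⟨I, isItoIntegral_of_tendsto h hm hX hI, hI⟩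

end Ito

/-! ### Continuous versions and null sets -/

section Paths

variable {Ω : Type*} {mΩ : MeasurableSpace Ω} {P : Measure Ω} {F : Filtration ℝ≥0 mΩ}
  {W : ℝ≥0 → Ω → ℝ} {V V' I I' X X' : ℝ≥0 → Ω → ℂ} {T : ℝ≥0}

/-- Every P-null set lies in ℱ₀, so a modification on a null set does not affect adaptedness. -/
theorem UsualConditions.stronglyMeasurable_congr (hF : UsualConditions P F) {t : ℝ≥0} {f g : Ω → ℂ}
    (hg : StronglyMeasurable[F t] g) (h : f =ᵐ[P] g) : StronglyMeasurable[F t] f := by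
  refine Measurable.stronglyMeasurable fun s hs => ?_
  have hnull : ∀ A : Set Ω, P A = 0 → MeasurableSet[F t] A := fun A hA =>
    F.mono zero_le _ (hF.2 A hA)
  have hN : P {ω | f ω ≠ g ω} = 0 := h
  have e : f ⁻¹' s = (g ⁻¹' s \ {ω | f ω ≠ g ω}) ∪ (f ⁻¹' s ∩ {ω | f ω ≠ g ω}) := by
    ext ω
    by_cases hω : f ω = g ω <;> simp [hω]
  rw [e]
  exact ((hg.measurable hs).diff (hnull _ hN)).union
    (hnull _ (measure_mono_null inter_subset_right hN))

theorem UsualConditions.stronglyMeasurable_of_tendsto (hF : UsualConditions P F) {t : ℝ≥0}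
    {f : ℕ → Ω → ℂ} {g : Ω → ℂ} (hf : ∀ n, StronglyMeasurable[F t] (f n))
    (h : ∀ᵐ ω ∂P, Tendsto (fun n => f n ω) atTop (𝓝 (g ω))) : StronglyMeasurable[F t] g := by
  classical
  have hN : MeasurableSet[F t] {ω | Tendsto (fun n => f n ω) atTop (𝓝 (g ω))}ᶜ :=
    F.mono zero_le _ (hF.2 _ h)
  set N := {ω | Tendsto (fun n => f n ω) atTop (𝓝 (g ω))}ᶜ with hNdef
  have h1 : StronglyMeasurable[F t] (Nᶜ.indicator g) := by
    refine _root_.stronglyMeasurable_of_tendsto (m := F t) (f := fun n => Nᶜ.indicator (f n)) atTop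
      (fun n => (hf n).indicator hN.compl) ?_
    rw [tendsto_pi_nhds]
    intro ω
    by_cases hω : ω ∈ N
    · simp [hω]
    · simpa [hω] using not_not.1 hω
  refine hF.stronglyMeasurable_congr h1 ?_
  filter_upwards [h] with ω hω
  have : ω ∈ Nᶜ := not_not.2 hω
  rw [indicator_of_mem this]

/-- The process is set to zero on a measurable null set containing the bad paths and frozen after T.
Continuity of every path then yields joint measurability in time and ω. -/
theorem exists_continuous_version {E : Type*} [NormedAddCommGroup E] {X : ℝ≥0 → Ω → E}
    (hm : ∀ t ≤ T, StronglyMeasurable (X t))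
    (hc : ∀ᵐ ω ∂P, ContinuousOn (fun t => X t ω) (Icc 0 T)) :
    ∃ Y : ℝ≥0 → Ω → E, StronglyMeasurable (Function.uncurry Y) ∧ (∀ ω, Continuous fun t => Y t ω) ∧
      ∀ᵐ ω ∂P, ∀ t ≤ T, X t ω = Y t ω := by
  classical
  let N := toMeasurable P {ω | ¬ ContinuousOn (fun t => X t ω) (Icc 0 T)}
  have hN : MeasurableSet N := measurableSet_toMeasurable _ _
  have hN0 : P N = 0 := (measure_toMeasurable _).trans hc
  have hN' : ∀ ω ∉ N, ContinuousOn (fun t => X t ω) (Icc 0 T) := by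
    intro ω hω
    by_contra h
    exact hω (subset_toMeasurable P _ h)
  let Y : ℝ≥0 → Ω → E := fun t => Nᶜ.indicator (X (min t T))
  have hYc : ∀ ω, Continuous fun t => Y t ω := by
    intro ω
    by_cases hω : ω ∈ N
    · simpa [Y, hω] using continuous_const
    · have : Continuous fun t => X (min t T) ω :=
        (hN' ω hω).comp_continuous (by fun_prop) fun t => ⟨zero_le, min_le_right _ _⟩
      simpa [Y, hω] using this
  refine ⟨Y, ?_, hYc, ?_⟩
  · exact stronglyMeasurable_uncurry_of_continuous_of_stronglyMeasurable hYc
      fun t => (hm _ (min_le_right _ _)).indicator hN.compl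
  · have : ∀ᵐ ω ∂P, ω ∉ N := measure_eq_zero_iff_ae_notMem.1 hN0
    filter_upwards [this] with ω hω t ht
    simp [Y, hω, min_eq_left ht]

theorem aemeasurable_usup (hm : ∀ t ≤ T, StronglyMeasurable (X t))
    (hc : ∀ᵐ ω ∂P, ContinuousOn (fun t => X t ω) (Icc 0 T)) :
    AEMeasurable (usup T X) P ∧ ∀ᵐ ω ∂P, usup T X ω < ∞ := by
  obtain ⟨Y, hYm, hYc, hXY⟩ := exists_continuous_version hm hc
  have hus : ∀ᵐ ω ∂P, usup T X ω = usup T Y ω := by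
    filter_upwards [hXY] with ω hω
    exact usup_congr fun t ht => by rw [hω t ht]
  have : Nonempty (Icc 0 T) := ⟨⟨0, ⟨le_rfl, zero_le⟩⟩⟩
  let d : ℕ → Icc 0 T := TopologicalSpace.denseSeq (Icc 0 T)
  have e : usup T Y = fun ω => ⨆ k, ‖Y (d k) ω‖ₑ := by
    funext ω
    refine le_antisymm (iSup₂_le fun t ht => ?_) (iSup_le fun k => le_usup (d k).2.2)
    have hcl : IsClosed {t : Icc 0 T | ‖Y t ω‖ₑ ≤ ⨆ k, ‖Y (d k) ω‖ₑ} :=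
      isClosed_le (((hYc ω).comp continuous_subtype_val).enorm) continuous_const
    have hd : closure (range d) ⊆ {t : Icc 0 T | ‖Y t ω‖ₑ ≤ ⨆ k, ‖Y (d k) ω‖ₑ} := by
      refine closure_minimal ?_ hcl
      rintro _ ⟨k, rfl⟩
      exact le_iSup (fun k => ‖Y (d k) ω‖ₑ) k
    have := (TopologicalSpace.denseRange_denseSeq (Icc 0 T)).closure_range
    exact hd (this ▸ mem_univ (⟨t, ht⟩ : Icc 0 T))
  have hY : ∀ t, Measurable (Y t) := fun t =>
    (hYm.comp_measurable measurable_prodMk_left).measurable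
  refine ⟨⟨usup T Y, ?_, hus⟩, ?_⟩
  · rw [e]
    exact Measurable.iSup fun k => (hY _).enorm
  · filter_upwards [hus] with ω hω
    rw [hω]
    obtain ⟨C, hC⟩ := (isCompact_Icc (a := (0 : ℝ≥0)) (b := T)).exists_bound_of_continuousOn
      (hYc ω).continuousOn
    refine lt_of_le_of_lt (iSup₂_le fun t ht => ?_) (ENNReal.ofReal_lt_top (r := C))
    rw [← ofReal_norm]
    exact ENNReal.ofReal_le_ofReal (hC t ht)

theorem aemeasurable_engy (hX : StronglyMeasurable (Function.uncurry X)) :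
    Measurable (engy T X) := by
  have : Measurable fun p : Ω × ℝ≥0 => ‖X p.2 p.1‖ₑ ^ 2 :=
    (hX.comp_measurable measurable_swap).enorm.pow_const 2
  exact this.lintegral_prod_right'

/-- The exceptional sets depend on t; continuity reduces all times to countably many. -/
theorem ae_forall_eq_of_forall_ae_eq (hX : ∀ᵐ ω ∂P, ContinuousOn (fun t => X t ω) (Icc 0 T))
    (hX' : ∀ᵐ ω ∂P, ContinuousOn (fun t => X' t ω) (Icc 0 T))
    (h : ∀ t ≤ T, ∀ᵐ ω ∂P, X t ω = X' t ω) : ∀ᵐ ω ∂P, ∀ t ≤ T, X t ω = X' t ω := by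
  have : Nonempty (Icc 0 T) := ⟨⟨0, ⟨le_rfl, zero_le⟩⟩⟩
  let d : ℕ → Icc 0 T := TopologicalSpace.denseSeq (Icc 0 T)
  have hd : ∀ᵐ ω ∂P, ∀ k, X (d k) ω = X' (d k) ω := ae_all_iff.2 fun k => h _ (d k).2.2
  filter_upwards [hX, hX', hd] with ω h1 h2 h3 t ht
  have := (TopologicalSpace.denseRange_denseSeq (Icc 0 T)).equalizer
    (continuousOn_iff_continuous_domRestrict.1 h1) (continuousOn_iff_continuous_domRestrict.1 h2)
    (funext fun k => h3 k)
  exact congrFun this (⟨t, ⟨zero_le, ht⟩⟩ : Icc 0 T)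

/-! ### Path properties of the Itô integral -/

variable {N : ℕ} {β : Fin N → ℝ≥0 → Ω → ℝ} {j : Fin N}

theorem IsItoIntegral.exists_ae_tendsto (h : IsItoIntegral P F W T X I) :
    ∃ V J : ℕ → ℝ≥0 → Ω → ℂ, (∀ n, Elem F W (V n) (J n)) ∧
      PNull P (fun n => engy T (fun s ω => V n s ω - X s ω)) ∧
      PNull P (fun n => usup T (fun s ω => J n s ω - I s ω)) ∧
      (∀ᵐ ω ∂P, Tendsto (fun n => engy T (fun s ω => V n s ω - X s ω) ω) atTop (𝓝 0)) ∧
      ∀ᵐ ω ∂P, Tendsto (fun n => usup T (fun s ω => J n s ω - I s ω) ω) atTop (𝓝 0) := by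
  obtain ⟨hm, V, J, hVJ, h1, h2⟩ := isItoIntegral_iff.1 h
  obtain ⟨φ, hφ, hae⟩ := (h1.add h2).exists_seq
  refine ⟨fun n => V (φ n), fun n => J (φ n), fun n => hVJ _, h1.comp hφ.tendsto_atTop,
    h2.comp hφ.tendsto_atTop, ?_, ?_⟩
  · filter_upwards [hae] with ω hω
    exact tendsto_of_tendsto_of_tendsto_of_le_of_le tendsto_const_nhds hω (fun _ => zero_le)
      fun n => le_self_add
  · filter_upwards [hae] with ω hω
    exact tendsto_of_tendsto_of_tendsto_of_le_of_le tendsto_const_nhds hω (fun _ => zero_le)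
      fun n => le_add_self

theorem tendsto_of_usup {J : ℕ → ℝ≥0 → Ω → ℂ} {ω : Ω}
    (h : Tendsto (fun n => usup T (fun s ω => J n s ω - I s ω) ω) atTop (𝓝 0)) {t : ℝ≥0}
    (ht : t ≤ T) : Tendsto (fun n => J n t ω) atTop (𝓝 (I t ω)) := by
  rw [tendsto_iff_edist_tendsto_0]
  refine tendsto_of_tendsto_of_tendsto_of_le_of_le tendsto_const_nhds h (fun _ => zero_le)
    fun n => ?_
  rw [edist_eq_enorm_sub]
  exact le_usup (Y := fun s ω => J n s ω - I s ω) ht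

theorem continuousOn_of_usup {J : ℕ → ℝ≥0 → Ω → ℂ} {ω : Ω}
    (h : Tendsto (fun n => usup T (fun s ω => J n s ω - I s ω) ω) atTop (𝓝 0))
    (hJ : ∀ n, ContinuousOn (fun t => J n t ω) (Icc 0 T)) :
    ContinuousOn (fun t => I t ω) (Icc 0 T) := by
  have hu : TendstoUniformlyOn (fun n t => J n t ω) (fun t => I t ω) atTop (Icc 0 T) := by
    rw [EMetric.tendstoUniformlyOn_iff]
    intro ε hε
    filter_upwards [h.eventually (gt_mem_nhds hε)] with n hn t ht
    rw [edist_comm, edist_eq_enorm_sub]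
    exact (le_usup (Y := fun s ω => J n s ω - I s ω) ht.2).trans_lt hn
  exact hu.continuousOn (Eventually.of_forall hJ).frequently

theorem IsItoIntegral.continuousOn (hW : ∀ᵐ ω ∂P, Continuous fun t => W t ω)
    (h : IsItoIntegral P F W T X I) : ∀ᵐ ω ∂P, ContinuousOn (fun t => I t ω) (Icc 0 T) := by
  obtain ⟨V, J, hVJ, -, -, -, h2⟩ := h.exists_ae_tendsto
  filter_upwards [hW, h2] with ω h3 h4
  exact continuousOn_of_usup h4 fun n => ((hVJ n).continuous h3).continuousOn

theorem IsItoIntegral.eval_zero (h : IsItoIntegral P F W T X I) : ∀ᵐ ω ∂P, I 0 ω = 0 := by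
  obtain ⟨V, J, hVJ, -, -, -, h2⟩ := h.exists_ae_tendsto
  filter_upwards [h2] with ω h4
  have := tendsto_of_usup h4 (zero_le (a := T))
  simp only [(hVJ _).eval_zero] at this
  exact (tendsto_nhds_unique this tendsto_const_nhds)

theorem IsItoIntegral.adapted (hF : UsualConditions P F) (hW : StronglyAdapted F W)
    (h : IsItoIntegral P F W T X I) {t : ℝ≥0} (ht : t ≤ T) : StronglyMeasurable[F t] (I t) := by
  obtain ⟨V, J, hVJ, -, -, -, h2⟩ := h.exists_ae_tendsto
  exact hF.stronglyMeasurable_of_tendsto (fun n => (hVJ n).adapted hW t)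
    (h2.mono fun ω hω => tendsto_of_usup hω ht)

theorem Elem.engy_lt_top (h : Elem F W V I) (ω : Ω) : engy T V ω < ∞ := by
  obtain ⟨C, hC⟩ := h.bounded
  refine (engy_le_mul (A := fun _ _ => 1) (c := ENNReal.ofReal C) (ae_of_all _ fun s => ?_)
    (by finiteness)).trans_lt ?_
  · rw [← ofReal_norm]
    simpa using ENNReal.ofReal_le_ofReal (hC s ω)
  · simp only [engy, enorm_one, one_pow, lintegral_one, Measure.restrict_apply_univ, leb_Icc]
    finiteness

theorem IsItoIntegral.engy_lt_top (h : IsItoIntegral P F W T X I) : ∀ᵐ ω ∂P, engy T X ω < ∞ := by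
  obtain ⟨V, J, hVJ, -, -, h1, -⟩ := h.exists_ae_tendsto
  filter_upwards [h1, h.aesm] with ω h1 hm
  obtain ⟨n, hn⟩ := (h1.eventually (gt_mem_nhds one_pos)).exists
  have : engy T X ω ≤ 4 * engy T (V n) ω + 4 * engy T (fun s ω => V n s ω - X s ω) ω := by
    refine engy_le_add ((hVJ n).measurable_val ω).aestronglyMeasurable (ae_of_all _ fun s => ?_)
    have : X s ω = V n s ω + -(V n s ω - X s ω) := by ring
    conv_lhs => rw [this]
    exact (enorm_add_le _ _).trans (by rw [enorm_neg])
  refine this.trans_lt ?_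
  have := (hVJ n).engy_lt_top (T := T) ω
  exact ENNReal.add_lt_top.2 ⟨ENNReal.mul_lt_top (by simp) this,
    ENNReal.mul_lt_top (by simp) (hn.trans (by simp))⟩

theorem integrableOn_of_engy {f : ℝ≥0 → ℂ} (hm : AEStronglyMeasurable f (leb.restrict (Icc 0 T)))
    (h : ∫⁻ s in Icc 0 T, ‖f s‖ₑ ^ 2 ∂leb < ∞) : IntegrableOn f (Icc 0 T) leb := by
  refine MemLp.integrable (q := 2) one_le_two ⟨hm, ?_⟩
  rw [eLpNorm_lt_top_iff_lintegral_rpow_enorm_lt_top (by norm_num) (by norm_num)]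
  simpa using h

variable [IsProbabilityMeasure P]

theorem ofReal_brownian_version (hβ : IsBrownianFamily P F β) (j : Fin N) (T : ℝ≥0) :
    AEMeasurable (usup T (fun t ω => (β j t ω : ℂ))) P ∧
      ∀ᵐ ω ∂P, usup T (fun t ω => (β j t ω : ℂ)) ω < ∞ := by
  refine aemeasurable_usup (fun t _ => ?_) ?_
  · exact Complex.continuous_ofReal.comp_stronglyMeasurable ((hβ.adapted j t).mono (F.le t))
  · filter_upwards [(hβ.brownian j).cont] with ω hω
    exact (Complex.continuous_ofReal.comp hω).continuousOn

/-- A bounded factor passes through the elementary approximations. An arbitrary ℱ_a-measurable ξ is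
truncated at level R; for each ω the truncation is exact from some R on, so both errors are
eventually zero. -/
theorem IsItoIntegral.restart (h : IsItoIntegral P F W T X I)
    (a : ℝ≥0) {ξ : Ω → ℂ} (hξ : StronglyMeasurable[F a] ξ) :
    IsItoIntegral P F W T (fun t ω => if a < t then ξ ω * X t ω else 0)
      (fun t ω => ξ ω * (I t ω - I (min a t) ω)) := by
  classical
  obtain ⟨hm, V, J, hVJ, h1, h2⟩ := isItoIntegral_iff.1 h
  have hmt : ∀ ζ : Ω → ℂ, ∀ᵐ ω ∂P, AEStronglyMeasurable
      (fun t => if a < t then ζ ω * X t ω else 0) (leb.restrict (Icc 0 T)) := by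
    intro ζ
    filter_upwards [hm] with ω hω
    exact ((hω.const_mul (ζ ω)).indicator (measurableSet_Ioi (a := a))).congr
      (ae_of_all _ fun t => by simp [indicator])
  have hIle : ∀ (K K' : ℝ≥0 → Ω → ℂ) (z : ℂ) (ω : Ω), usup T (fun t ω => z *
      ((K t ω - K (min a t) ω) - (K' t ω - K' (min a t) ω))) ω
      ≤ 2 * ‖z‖ₑ * usup T (fun t ω => K t ω - K' t ω) ω := by
    intro K K' z ω
    refine iSup₂_le fun t ht => ?_
    rw [enorm_mul, sub_sub_sub_comm]
    calc _ ≤ ‖z‖ₑ * (‖K t ω - K' t ω‖ₑ + ‖K (min a t) ω - K' (min a t) ω‖ₑ) := by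
          gcongr
          exact enorm_sub_le
      _ ≤ ‖z‖ₑ * (usup T (fun t ω => K t ω - K' t ω) ω + usup T (fun t ω => K t ω - K' t ω) ω) := by
          gcongr
          · exact le_usup (Y := fun t ω => K t ω - K' t ω) ht.2
          · exact le_usup (Y := fun t ω => K t ω - K' t ω) ((min_le_right _ _).trans ht.2)
      _ = _ := by ring
  have hbdd : ∀ (ζ : Ω → ℂ) (C : ℝ), StronglyMeasurable[F a] ζ → (∀ ω, ‖ζ ω‖ ≤ C) →
      IsItoIntegral P F W T (fun t ω => if a < t then ζ ω * X t ω else 0)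
        (fun t ω => ζ ω * (I t ω - I (min a t) ω)) := by
    intro ζ C hζ hC
    have hCe : ∀ ω, ‖ζ ω‖ₑ ≤ ENNReal.ofReal C := fun ω => by
      rw [← ofReal_norm]
      exact ENNReal.ofReal_le_ofReal (hC ω)
    refine isItoIntegral_iff.2 ⟨hmt ζ, _, _, fun n => (hVJ n).restart a hζ hC, ?_, ?_⟩
    · refine (h1.const_mul (c := ENNReal.ofReal C ^ 2) (by finiteness)).mono fun n =>
        ae_of_all _ fun ω => engy_le_mul (ae_of_all _ fun s => ?_) (by finiteness)
      by_cases hs : a < s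
      · simp only [hs, if_true, ← mul_sub, enorm_mul]
        exact mul_le_mul_left (hCe ω) _
      · simp [hs]
    · refine (h2.const_mul (c := 2 * ENNReal.ofReal C) (by finiteness)).mono fun n =>
        ae_of_all _ fun ω => ?_
      calc _ = usup T (fun t ω' => ζ ω * ((J n t ω' - J n (min a t) ω') - (I t ω' - I (min a t) ω'))) ω :=
            usup_congr fun t _ => by rw [← mul_sub]
        _ ≤ _ := hIle _ _ _ _
        _ ≤ _ := by gcongr; exact hCe ω
  let c : ℕ → Ω → ℂ := fun R ω => if ‖ξ ω‖ ≤ R then ξ ω else 0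
  have hcm : ∀ R, StronglyMeasurable[F a] (c R) := fun R =>
    StronglyMeasurable.ite (hξ.norm.measurable measurableSet_Iic) hξ stronglyMeasurable_const
  have hcb : ∀ R ω, ‖c R ω‖ ≤ R := by
    intro R ω
    by_cases h : ‖ξ ω‖ ≤ R <;> simp [c, h]
  -- A sequence that vanishes once its index exceeds |ξ| tends to zero in probability: where |ξ| ≤ R
  -- it is dominated by the deterministic sequence equal to ∞ before R and to 0 afterwards.
  have htail : ∀ Y : ℕ → Ω → ℝ≥0∞, (∀ (R : ℕ) ω, ‖ξ ω‖ ≤ R → Y R ω = 0) → PNull P Y := by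
    intro Y hY
    refine PNull.of_tight fun η hη => ?_
    obtain ⟨R, hR⟩ := tight_of_aemeasurable (P := P) (K := fun ω => ‖ξ ω‖ₑ)
      (hξ.mono (F.le _)).enorm.aemeasurable (ae_of_all _ fun ω => enorm_lt_top) hη
    refine ⟨_, hR, fun n ω => if n < R then ∞ else 0, PNull.const ?_, fun n =>
      ae_of_all _ fun ω (hω : ‖ξ ω‖ₑ ≤ R) => ?_⟩
    · refine tendsto_const_nhds.congr' ?_
      filter_upwards [eventually_ge_atTop ⌈R⌉₊] with n hn
      rw [if_neg (not_lt.2 ((Nat.le_ceil R).trans (by exact_mod_cast hn)))]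
    · by_cases h : (n : ℝ≥0) < R
      · simp [h]
      · rw [hY n ω]
        · exact zero_le
        · have h2 : ‖ξ ω‖₊ ≤ R := by exact_mod_cast hω
          exact_mod_cast h2.trans (not_lt.1 h)
  refine isItoIntegral_of_tendsto (fun R : ℕ => hbdd (c R) R (hcm R) (hcb R)) (hmt ξ) ?_ ?_
  · refine htail _ fun R ω hR => ?_
    have : c R ω = ξ ω := by simp [c, hR]
    simp [engy, this]
  · refine htail _ fun R ω hR => ?_
    have : c R ω = ξ ω := by simp [c, hR]
    simp [usup, this]

end Paths

/-! ### Riemann sums -/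

/-- The uniform grid of mesh `1 / (n + 1)`, stopped at `T`. -/
noncomputable def mesh (T : ℝ≥0) (n i : ℕ) : ℝ≥0 := min ((i : ℝ≥0) / ((n : ℝ≥0) + 1)) T

/-- A number of steps after which the grid `mesh T n` has reached `T`. -/
noncomputable def meshCount (T : ℝ≥0) (n : ℕ) : ℕ := (n + 1) * (⌈T⌉₊ + 1)

theorem mesh_zero (T : ℝ≥0) (n : ℕ) : mesh T n 0 = 0 := by simp [mesh]

theorem mesh_le (T : ℝ≥0) (n i : ℕ) : mesh T n i ≤ T := min_le_right _ _

theorem mesh_mono (T : ℝ≥0) (n : ℕ) : Monotone (mesh T n) := by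
  intro i k h
  unfold mesh
  gcongr

theorem mesh_meshCount (T : ℝ≥0) (n : ℕ) : mesh T n (meshCount T n) = T := by
  refine min_eq_right ?_
  rw [meshCount]
  push_cast
  rw [mul_div_cancel_left₀ _ (by positivity)]
  exact (Nat.le_ceil T).trans (by simp)

theorem mesh_succ_sub_le (T : ℝ≥0) (n i : ℕ) :
    (mesh T n (i + 1) : ℝ) - mesh T n i ≤ 1 / ((n : ℝ) + 1) := by
  have h : mesh T n (i + 1) ≤ mesh T n i + 1 / ((n : ℝ≥0) + 1) := by
    unfold mesh
    rw [← min_add_add_right]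
    refine min_le_min (le_of_eq ?_) le_self_add
    rw [← add_div]
    push_cast
    rfl
  have h' : (mesh T n (i + 1) : ℝ) ≤ mesh T n i + 1 / ((n : ℝ) + 1) := by exact_mod_cast h
  linarith

theorem exists_mesh_lt_le {T s : ℝ≥0} (hs : 0 < s) (hsT : s ≤ T) (n : ℕ) :
    ∃ i < meshCount T n, mesh T n i < s ∧ s ≤ mesh T n (i + 1) := by
  classical
  have hex : ∃ k, s ≤ mesh T n k := ⟨_, hsT.trans (mesh_meshCount T n).ge⟩
  have hpos : Nat.find hex ≠ 0 := by
    intro h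
    have := Nat.find_spec hex
    rw [h, mesh_zero] at this
    exact absurd this (not_le.2 hs)
  obtain ⟨i, hi⟩ := Nat.exists_eq_succ_of_ne_zero hpos
  refine ⟨i, ?_, ?_, ?_⟩
  · have : Nat.find hex ≤ meshCount T n := Nat.find_min' hex (hsT.trans (mesh_meshCount T n).ge)
    omega
  · exact not_le.1 (Nat.find_min hex (by omega))
  · have := Nat.find_spec hex
    rwa [hi] at this

section Riemann

variable {Ω : Type*} {mΩ : MeasurableSpace Ω} {P : Measure Ω} {F : Filtration ℝ≥0 mΩ}
  {W : ℝ≥0 → Ω → ℝ} {V V' I I' X X' : ℝ≥0 → Ω → ℂ} {T : ℝ≥0}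

/-- The step process with value `X (mesh T n i)` on `(mesh T n i, mesh T n (i + 1)]`. -/
noncomputable def stepProc (T : ℝ≥0) (X : ℝ≥0 → Ω → ℂ) (n : ℕ) (s : ℝ≥0) (ω : Ω) : ℂ :=
  ∑ i ∈ Finset.range (meshCount T n), ((if mesh T n i < s then X (mesh T n i) ω else 0)
    - (if mesh T n (i + 1) < s then X (mesh T n i) ω else 0))

/-- The Riemann sums of `∫ X dW`. -/
noncomputable def riemannSum (T : ℝ≥0) (X : ℝ≥0 → Ω → ℂ) (W : ℝ≥0 → Ω → ℝ) (n : ℕ) (t : ℝ≥0)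
    (ω : Ω) : ℂ :=
  ∑ i ∈ Finset.range (meshCount T n), X (mesh T n i) ω *
    ((W (min (mesh T n (i + 1)) t) ω - W (min (mesh T n i) t) ω : ℝ) : ℂ)

theorem stepProc_eq {i n : ℕ} {s : ℝ≥0} (hi : i < meshCount T n) (h1 : mesh T n i < s)
    (h2 : s ≤ mesh T n (i + 1)) (X : ℝ≥0 → Ω → ℂ) (ω : Ω) :
    stepProc T X n s ω = X (mesh T n i) ω := by
  rw [stepProc, Finset.sum_eq_single i]
  · simp [h1, not_lt.2 h2]
  · intro k _ hk
    rcases lt_or_gt_of_ne hk with h | h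
    · have e1 : mesh T n k < s := (mesh_mono T n h.le).trans_lt h1
      have e2 : mesh T n (k + 1) < s := (mesh_mono T n h).trans_lt h1
      simp [e1, e2]
    · have e1 : s ≤ mesh T n k := h2.trans (mesh_mono T n h)
      have e2 : s ≤ mesh T n (k + 1) := e1.trans (mesh_mono T n (Nat.le_succ k))
      simp [not_lt.2 e1, not_lt.2 e2]
  · intro h
    exact absurd (Finset.mem_range.2 hi) h

theorem isItoIntegral_stepProc [IsProbabilityMeasure P] (hX : ∀ t ≤ T, StronglyMeasurable[F t] (X t)) (n : ℕ) :
    IsItoIntegral P F W T (stepProc T X n) (riemannSum T X W n) := by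
  have h1 : IsItoIntegral P F W T (fun t _ => if 0 < t then 1 else 0)
      (fun t ω => 1 * ((W t ω - W (min 0 t) ω : ℝ) : ℂ)) :=
    (Elem.single 0 (fun _ => 1) stronglyMeasurable_const 1 (by simp)).isItoIntegral
  have hr : ∀ (a : ℝ≥0) (ξ : Ω → ℂ), StronglyMeasurable[F a] ξ → IsItoIntegral P F W T
      (fun t ω => if a < t then ξ ω else 0)
      (fun t ω => ξ ω * ((W t ω - W (min a t) ω : ℝ) : ℂ)) := by
    intro a ξ hξ
    refine (h1.restart a hξ).congr ?_ ?_
    · refine ae_of_all _ fun ω => ae_of_all _ fun s => ?_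
      by_cases h : a < s
      · simp [h, zero_le.trans_lt h]
      · simp [h]
    · refine ae_of_all _ fun ω t _ => ?_
      rw [min_eq_left (zero_le : 0 ≤ t), min_eq_left zero_le]
      push_cast
      ring
  have hs : ∀ i ∈ Finset.range (meshCount T n), IsItoIntegral P F W T
      (fun s ω => (if mesh T n i < s then X (mesh T n i) ω else 0)
        - (if mesh T n (i + 1) < s then X (mesh T n i) ω else 0))
      (fun t ω => X (mesh T n i) ω *
        ((W (min (mesh T n (i + 1)) t) ω - W (min (mesh T n i) t) ω : ℝ) : ℂ)) := by
    intro i _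
    have hm := hX _ (mesh_le T n i)
    have hle := mesh_mono T n (Nat.le_succ i)
    refine ((hr _ _ hm).sub (hr _ _ (hm.mono (F.mono hle)))).congr ?_ ?_
    · exact ae_of_all _ fun ω => ae_of_all _ fun s => rfl
    · refine ae_of_all _ fun ω t _ => ?_
      push_cast
      ring
  exact IsItoIntegral.sum _ hs

theorem exists_norm_stepProc_sub_le {ω : Ω} (hc : ContinuousOn (fun t => X t ω) (Icc 0 T)) {ε : ℝ}
    (hε : 0 < ε) : ∀ᶠ n in atTop, ∀ s, 0 < s → s ≤ T → ‖stepProc T X n s ω - X s ω‖ ≤ ε := by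
  obtain ⟨δ, hδ, h⟩ := Metric.uniformContinuousOn_iff.1
    (isCompact_Icc.uniformContinuousOn_of_continuous hc) ε hε
  have ht := tendsto_one_div_add_atTop_nhds_zero_nat (𝕜 := ℝ)
  filter_upwards [ht.eventually (gt_mem_nhds hδ)] with n hn s hs hsT
  obtain ⟨i, hi, h1, h2⟩ := exists_mesh_lt_le hs hsT n
  rw [stepProc_eq hi h1 h2, ← dist_eq_norm]
  refine (h _ ⟨zero_le, mesh_le T n i⟩ s ⟨zero_le, hsT⟩ ?_).le
  have h1' : (0 : ℝ) ≤ (s : ℝ) - mesh T n i := sub_nonneg.2 (NNReal.coe_le_coe.2 h1.le)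
  rw [NNReal.dist_eq, abs_sub_comm, abs_of_nonneg h1']
  have h2' : (s : ℝ) ≤ mesh T n (i + 1) := h2
  linarith [mesh_succ_sub_le T n i]

theorem ae_pos_Icc (T : ℝ≥0) : ∀ᵐ s ∂leb.restrict (Icc 0 T), 0 < s ∧ s ≤ T := by
  rw [← restrict_Ioc_eq_restrict_Icc]
  exact ae_restrict_mem measurableSet_Ioc

theorem tendsto_engy_stepProc {ω : Ω} (hc : ContinuousOn (fun t => X t ω) (Icc 0 T)) :
    Tendsto (fun n => engy T (fun s ω => stepProc T X n s ω - X s ω) ω) atTop (𝓝 0) := by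
  rw [ENNReal.tendsto_nhds_zero]
  intro η hη
  have hlim : Tendsto (fun k : ℕ => ENNReal.ofReal (1 / ((k : ℝ) + 1)) ^ 2 * engy T (fun _ _ => 1) ω)
      atTop (𝓝 0) := by
    have h1 := ENNReal.tendsto_ofReal (tendsto_one_div_add_atTop_nhds_zero_nat (𝕜 := ℝ))
    rw [ENNReal.ofReal_zero] at h1
    have h2 := ENNReal.Tendsto.mul_const (b := engy T (fun _ _ => 1) ω)
      (ENNReal.Tendsto.pow (n := 2) h1) (Or.inr (by simp [engy, leb_Icc]))
    simpa using h2
  obtain ⟨k, hk⟩ := ((ENNReal.tendsto_nhds_zero.1 hlim) η hη).exists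
  filter_upwards [exists_norm_stepProc_sub_le hc (ε := 1 / ((k : ℝ) + 1)) (by positivity)] with n hn
  refine le_trans (engy_le_mul ?_ (by finiteness)) hk
  filter_upwards [ae_pos_Icc T] with s hs
  rw [enorm_one, mul_one, ← ofReal_norm]
  exact ENNReal.ofReal_le_ofReal (hn s hs.1 hs.2)

variable [IsProbabilityMeasure P] {N : ℕ} {β : Fin N → ℝ≥0 → Ω → ℝ} {j l : Fin N}

/-- Uniform continuity gives convergence path by path; a jointly measurable version is needed to
convert this into convergence in probability. -/
theorem pnull_engy_stepProc (hX : ∀ t ≤ T, StronglyMeasurable (X t))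
    (hc : ∀ᵐ ω ∂P, ContinuousOn (fun t => X t ω) (Icc 0 T)) :
    PNull P (fun n => engy T (fun s ω => stepProc T X n s ω - X s ω)) := by
  obtain ⟨Y, hYm, hYc, hXY⟩ := exists_continuous_version hX hc
  have hY : PNull P (fun n => engy T (fun s ω => stepProc T Y n s ω - Y s ω)) := by
    refine PNull.of_ae_tendsto (fun n => Measurable.aemeasurable ?_)
      (ae_of_all _ fun ω => tendsto_engy_stepProc (hYc ω).continuousOn)
    refine aemeasurable_engy (StronglyMeasurable.sub ?_ hYm)
    refine Finset.stronglyMeasurable_fun_sum _ fun i _ => ?_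
    have h1 : StronglyMeasurable fun p : ℝ≥0 × Ω => Y (mesh T n i) p.2 :=
      hYm.comp_measurable (by fun_prop : Measurable fun p : ℝ≥0 × Ω => (mesh T n i, p.2))
    refine StronglyMeasurable.sub ?_ ?_
    · exact StronglyMeasurable.ite (measurableSet_lt measurable_const measurable_fst) h1
        stronglyMeasurable_const
    · exact StronglyMeasurable.ite (measurableSet_lt measurable_const measurable_fst) h1
        stronglyMeasurable_const
  refine hY.mono fun n => ?_
  filter_upwards [hXY] with ω hω
  refine (engy_congr ?_).le
  filter_upwards [ae_pos_Icc T] with s hs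
  have : stepProc T X n s ω = stepProc T Y n s ω := by
    simp only [stepProc]
    refine Finset.sum_congr rfl fun i _ => ?_
    rw [hω _ (mesh_le T n i)]
  rw [this, hω s hs.2]

/-- Adapted continuous processes are integrable and their integrals are limits of left Riemann sums;
every explicit stochastic integral in the product rules is identified in this way. -/
theorem exists_isItoIntegral_riemannSum (hβ : IsBrownianFamily P F β) (j : Fin N)
    (hX : ∀ t ≤ T, StronglyMeasurable[F t] (X t))
    (hc : ∀ᵐ ω ∂P, ContinuousOn (fun t => X t ω) (Icc 0 T)) :
    ∃ I, IsItoIntegral P F (β j) T X I ∧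
      PNull P (fun n => usup T (fun s ω => riemannSum T X (β j) n s ω - I s ω)) := by
  refine exists_isItoIntegral_of_tendsto hβ (fun n => isItoIntegral_stepProc hX n) ?_
    (pnull_engy_stepProc (fun t ht => (hX t ht).mono (F.le t)) hc)
  filter_upwards [hc] with ω hω
  exact hω.aestronglyMeasurable measurableSet_Icc

theorem riemannSum_eq (n : ℕ) (t : ℝ≥0) (ω : Ω) : riemannSum T X W n t ω
    = ∑ i ∈ Finset.range (meshCount T n), X (min (mesh T n i) t) ω *
      ((W (min (mesh T n (i + 1)) t) ω - W (min (mesh T n i) t) ω : ℝ) : ℂ) := by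
  refine Finset.sum_congr rfl fun i _ => ?_
  rcases le_total (mesh T n i) t with h | h
  · rw [min_eq_left h]
  · rw [min_eq_right h, min_eq_right (h.trans (mesh_mono T n (Nat.le_succ i)))]
    simp

/-! ### Products of Brownian motions -/

/-- Covariation of Brownian motions: the centred products of increments are orthogonal with second
moments of order (Δt)², so the second moment of their sum is at most a constant times t times the
mesh size. Chebyshev's inequality concludes. -/
theorem pnull_sum_crossIncrement (hβ : IsBrownianFamily P F β) (l j : Fin N) (t : ℝ≥0) :
    PNull P (fun n ω => ‖∑ i ∈ Finset.range (meshCount T n),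
      ((crossIncrement β l j (min (mesh T n i) t) (min (mesh T n (i + 1)) t) ω : ℝ) : ℂ)‖ₑ) := by
  have hmono : ∀ n, Monotone fun i => min (mesh T n i) t := fun n i k h =>
    min_le_min (mesh_mono T n h) le_rfl
  have hstep : ∀ n i, min (mesh T n i) t ≤ min (mesh T n (i + 1)) t := fun n i =>
    hmono n (Nat.le_succ i)
  have hg : 0 ≤ gaussianFourthMoment := integral_nonneg fun x => by positivity
  have hbound : ∀ n, ∫ ω, ‖∑ i ∈ Finset.range (meshCount T n), (1 : ℂ) *
      ((crossIncrement β l j (min (mesh T n i) t) (min (mesh T n (i + 1)) t) ω : ℝ) : ℂ)‖ ^ 2 ∂P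
      ≤ gaussianFourthMoment * t * (1 / ((n : ℝ) + 1)) := by
    intro n
    refine (integral_norm_sq_transform_le (hmono n) (ξ := fun _ _ => 1)
      (fun i => stronglyMeasurable_const) (C := 1) (by simp)
      (fun i => hβ.measurable_crossIncrement l j (hstep n i))
      (fun i => hβ.indep_crossIncrement l j (hstep n i))
      (fun i => hβ.memLp_crossIncrement l j (hstep n i))
      (fun i => hβ.integral_crossIncrement l j (hstep n i))
      (fun i => hβ.integral_crossIncrement_sq l j (hstep n i)) (meshCount T n)).trans ?_
    have hΔ : ∀ i, (0 : ℝ) ≤ (min (mesh T n (i + 1)) t : ℝ≥0) - (min (mesh T n i) t : ℝ≥0) :=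
      fun i => sub_nonneg.2 (hstep n i)
    have hΔ' : ∀ i, ((min (mesh T n (i + 1)) t : ℝ≥0) : ℝ) - (min (mesh T n i) t : ℝ≥0)
        ≤ 1 / ((n : ℝ) + 1) := by
      intro i
      have h1 := mesh_succ_sub_le T n i
      have h2 : (0 : ℝ) ≤ 1 / ((n : ℝ) + 1) := by positivity
      rcases le_total (mesh T n i) t with h | h
      · rw [min_eq_left h]
        have : ((min (mesh T n (i + 1)) t : ℝ≥0) : ℝ) ≤ mesh T n (i + 1) := min_le_left _ _
        linarith
      · rw [min_eq_right h, min_eq_right (h.trans (mesh_mono T n (Nat.le_succ i)))]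
        simpa using h2
    calc _ ≤ ∑ i ∈ Finset.range (meshCount T n), gaussianFourthMoment * (1 / ((n : ℝ) + 1)) *
          (((min (mesh T n (i + 1)) t : ℝ≥0) : ℝ) - (min (mesh T n i) t : ℝ≥0)) := by
          refine Finset.sum_le_sum fun i _ => ?_
          simp only [norm_one, one_pow, integral_const, probReal_univ, smul_eq_mul, mul_one]
          rw [mul_assoc, sq]
          gcongr
          · exact hΔ i
          · exact hΔ' i
      _ = gaussianFourthMoment * (1 / ((n : ℝ) + 1)) *
          (((min (mesh T n (meshCount T n)) t : ℝ≥0) : ℝ) - (min (mesh T n 0) t : ℝ≥0)) := by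
          rw [← Finset.mul_sum, Finset.sum_range_sub (fun i => ((min (mesh T n i) t : ℝ≥0) : ℝ))]
      _ ≤ gaussianFourthMoment * (1 / ((n : ℝ) + 1)) * t := by
          gcongr
          have h1 : ((min (mesh T n (meshCount T n)) t : ℝ≥0) : ℝ) ≤ t := min_le_right _ _
          have h2 : (0 : ℝ) ≤ (min (mesh T n 0) t : ℝ≥0) := NNReal.coe_nonneg _
          linarith
      _ = _ := by ring
  simp only [one_mul] at hbound
  intro ε hε
  -- The level ε may be infinite, whereas Chebyshev's inequality wants a finite one; hence min ε 1.
  have hlim : Tendsto (fun n : ℕ => ENNReal.ofReal (gaussianFourthMoment * t * (1 / ((n : ℝ) + 1)))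
      / (min ε 1) ^ 2) atTop (𝓝 0) := by
    have h1 := (tendsto_one_div_add_atTop_nhds_zero_nat (𝕜 := ℝ)).const_mul
      (gaussianFourthMoment * t)
    rw [mul_zero] at h1
    have h2 := ENNReal.tendsto_ofReal h1
    rw [ENNReal.ofReal_zero] at h2
    have h3 := ENNReal.Tendsto.div_const (b := (min ε 1) ^ 2) h2
      (Or.inr (pow_ne_zero _ (lt_min hε one_pos).ne'))
    simpa using h3
  refine tendsto_of_tendsto_of_tendsto_of_le_of_le tendsto_const_nhds hlim (fun _ => zero_le)
    fun n => ?_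
  have hL2 : MemLp (fun ω => ∑ i ∈ Finset.range (meshCount T n), (1 : ℂ) *
      ((crossIncrement β l j (min (mesh T n i) t) (min (mesh T n (i + 1)) t) ω : ℝ) : ℂ)) 2 P :=
    memLp_transform (ξ := fun _ _ => 1) (fun _ => stronglyMeasurable_const) (C := 1) (by simp)
      (fun i => hβ.memLp_crossIncrement l j (hstep n i)) _
  simp only [one_mul] at hL2
  set S : Ω → ℂ := fun ω => ∑ i ∈ Finset.range (meshCount T n),
      ((crossIncrement β l j (min (mesh T n i) t) (min (mesh T n (i + 1)) t) ω : ℝ) : ℂ)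
  have hmin : min ε 1 ^ 2 ≠ 0 := pow_ne_zero _ (lt_min hε one_pos).ne'
  calc P {ω | ε ≤ ‖S ω‖ₑ} ≤ P {ω | min ε 1 ^ 2 ≤ ‖S ω‖ₑ ^ 2} := by
        refine measure_mono fun ω (hω : ε ≤ _) => ?_
        exact pow_le_pow_left' ((min_le_left _ _).trans hω) 2
    _ ≤ (∫⁻ ω, ‖S ω‖ₑ ^ 2 ∂P) / min ε 1 ^ 2 :=
        meas_ge_le_lintegral_div (hL2.aestronglyMeasurable.enorm.pow_const 2) hmin
          (ENNReal.pow_ne_top (ne_top_of_le_ne_top ENNReal.one_ne_top (min_le_right _ _)))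
    _ ≤ _ := by
        gcongr
        have he : ∀ ω, ‖S ω‖ₑ ^ 2 = ENNReal.ofReal (‖S ω‖ ^ 2) := fun ω => by
          rw [ENNReal.ofReal_pow (norm_nonneg _), ofReal_norm]
        simp only [he]
        rw [← ofReal_integral_eq_lintegral_ofReal ((memLp_two_iff_integrable_sq_norm hL2.1).1 hL2)
          (ae_of_all _ fun ω => by positivity)]
        exact ENNReal.ofReal_le_ofReal (hbound n)

end Riemann

section ItoRep

variable {Ω : Type*} {mΩ : MeasurableSpace Ω} {P : Measure Ω} {F : Filtration ℝ≥0 mΩ}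
  {T : ℝ≥0} {N : ℕ} {β : Fin N → ℝ≥0 → Ω → ℝ} {j l : Fin N}

/-- Summation by parts along a mesh. -/
theorem sum_mesh_mul (A B : ℝ≥0 → ℂ) (n : ℕ) {t : ℝ≥0} (ht : t ≤ T) :
    A t * B t - A 0 * B 0 = ∑ i ∈ Finset.range (meshCount T n),
      (A (min (mesh T n i) t) * (B (min (mesh T n (i + 1)) t) - B (min (mesh T n i) t))
        + B (min (mesh T n (i + 1)) t)
          * (A (min (mesh T n (i + 1)) t) - A (min (mesh T n i) t))) := by
  have h := Finset.sum_range_sub (fun i => A (min (mesh T n i) t) * B (min (mesh T n i) t))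
    (meshCount T n)
  rw [mesh_meshCount, mesh_zero, min_eq_right ht, min_eq_left zero_le] at h
  rw [← h]
  exact Finset.sum_congr rfl fun i _ => by ring

variable [IsProbabilityMeasure P]

theorem IsBrownianFamily.continuous (hβ : IsBrownianFamily P F β) (j : Fin N) :
    ∀ᵐ ω ∂P, Continuous fun t => (β j t ω : ℂ) :=
  (hβ.brownian j).cont.mono fun _ h => Complex.continuous_ofReal.comp h

theorem IsBrownianFamily.adapted_ofReal (hβ : IsBrownianFamily P F β) (j : Fin N) (t : ℝ≥0) :
    StronglyMeasurable[F t] fun ω => (β j t ω : ℂ) :=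
  Complex.continuous_ofReal.comp_stronglyMeasurable (hβ.adapted j t)

/-- Summation by parts writes the product as two left Riemann sums plus the sum of products of
increments. The former converge to stochastic integrals, the latter to t or 0. The identity is
obtained at a fixed time and extended to all times by continuity. -/
theorem IsBrownianFamily.exists_mul_eq (hβ : IsBrownianFamily P F β) (l j : Fin N) (T : ℝ≥0) :
    ∃ I I', IsItoIntegral P F (β j) T (fun t ω => (β l t ω : ℂ)) I ∧
      IsItoIntegral P F (β l) T (fun t ω => (β j t ω : ℂ)) I' ∧
      ∀ᵐ ω ∂P, ∀ t ≤ T, (β l t ω : ℂ) * β j t ω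
        = (β l 0 ω : ℂ) * β j 0 ω + I t ω + I' t ω + if l = j then (t : ℂ) else 0 := by
  obtain ⟨I, hI, hIr⟩ := exists_isItoIntegral_riemannSum (T := T) hβ j
    (fun t _ => hβ.adapted_ofReal l t) ((hβ.continuous l).mono fun _ h => h.continuousOn)
  obtain ⟨I', hI', hIr'⟩ := exists_isItoIntegral_riemannSum (T := T) hβ l
    (fun t _ => hβ.adapted_ofReal j t) ((hβ.continuous j).mono fun _ h => h.continuousOn)
  refine ⟨I, I', hI, hI', ae_forall_eq_of_forall_ae_eq ?_ ?_ fun t ht => ?_⟩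
  · filter_upwards [hβ.continuous l, hβ.continuous j] with ω h1 h2
    exact (h1.mul h2).continuousOn
  · filter_upwards [hI.continuousOn (hβ.brownian j).cont, hI'.continuousOn (hβ.brownian l).cont]
      with ω h1 h2
    refine ((continuousOn_const.add h1).add h2).add ?_
    by_cases h : l = j
    · simp only [h, if_true]
      exact (Complex.continuous_ofReal.comp NNReal.continuous_coe).continuousOn
    · simp only [h, if_false]
      exact continuousOn_const
  have h0 := (hIr.add hIr').add (pnull_sum_crossIncrement (T := T) hβ l j t)
  have h1 : PNull P (fun _ : ℕ => fun ω => ‖(β l t ω : ℂ) * β j t ω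
      - ((β l 0 ω : ℂ) * β j 0 ω + I t ω + I' t ω + if l = j then (t : ℂ) else 0)‖ₑ) := by
    refine h0.mono fun n => ae_of_all _ fun ω => ?_
    have e1 := sum_mesh_mul (fun t => (β l t ω : ℂ)) (fun t => (β j t ω : ℂ)) n ht
    have e2 : ∑ i ∈ Finset.range (meshCount T n),
        (((min (mesh T n (i + 1)) t : ℝ≥0) : ℂ) - ((min (mesh T n i) t : ℝ≥0) : ℂ)) = (t : ℂ) := by
      rw [Finset.sum_range_sub (fun i => ((min (mesh T n i) t : ℝ≥0) : ℂ)), mesh_meshCount,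
        mesh_zero, min_eq_right ht, min_eq_left zero_le]
      simp
    have e3 : (if l = j then (t : ℂ) else 0) = ∑ i ∈ Finset.range (meshCount T n),
        if l = j then (((min (mesh T n (i + 1)) t : ℝ≥0) : ℂ) - ((min (mesh T n i) t : ℝ≥0) : ℂ))
          else 0 := by
      by_cases h : l = j
      · simp only [h, if_true, e2]
      · simp [h]
    have key : (β l t ω : ℂ) * β j t ω
        - ((β l 0 ω : ℂ) * β j 0 ω + I t ω + I' t ω + if l = j then (t : ℂ) else 0)
        = (riemannSum T (fun t ω => (β l t ω : ℂ)) (β j) n t ω - I t ω)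
          + (riemannSum T (fun t ω => (β j t ω : ℂ)) (β l) n t ω - I' t ω)
          + ∑ i ∈ Finset.range (meshCount T n),
            ((crossIncrement β l j (min (mesh T n i) t) (min (mesh T n (i + 1)) t) ω : ℝ) : ℂ) := by
      -- A right end point value is the left one plus an increment. The resulting product of
      -- increments equals the centred one plus, for l = j, the length of the cell, and these
      -- lengths add up to t.
      have e4 : riemannSum T (fun t ω => (β l t ω : ℂ)) (β j) n t ω
          + riemannSum T (fun t ω => (β j t ω : ℂ)) (β l) n t ω
          + ∑ i ∈ Finset.range (meshCount T n),
            ((crossIncrement β l j (min (mesh T n i) t) (min (mesh T n (i + 1)) t) ω : ℝ) : ℂ)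
          = (β l t ω : ℂ) * β j t ω - (β l 0 ω : ℂ) * β j 0 ω
            - if l = j then (t : ℂ) else 0 := by
        rw [e1, e3, riemannSum_eq, riemannSum_eq, ← Finset.sum_add_distrib,
          ← Finset.sum_add_distrib, ← Finset.sum_sub_distrib]
        refine Finset.sum_congr rfl fun i _ => ?_
        simp only [crossIncrement]
        by_cases h : l = j
        · simp only [h, if_true]
          push_cast
          ring
        · simp only [h, if_false]
          push_cast
          ring
      linear_combination -e4
    rw [key]
    refine (enorm_add_le _ _).trans (add_le_add_left ((enorm_add_le _ _).trans
      (add_le_add ?_ ?_)) _)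
    · exact le_usup (Y := fun s ω => riemannSum T (fun t ω => (β l t ω : ℂ)) (β j) n s ω - I s ω) ht
    · exact le_usup (Y := fun s ω => riemannSum T (fun t ω => (β j t ω : ℂ)) (β l) n s ω - I' s ω) ht
  filter_upwards [ae_eq_zero_of_pnull_const h1] with ω hω
  exact sub_eq_zero.1 (by simpa using hω)

/-! ### Itô processes -/

/-- `dX = a dt + ∑_k h_k dβ_k` on `[0,T]`, with `X` adapted and continuous. -/
structure ItoRep (P : Measure Ω) (F : Filtration ℝ≥0 mΩ) (β : Fin N → ℝ≥0 → Ω → ℝ) (T : ℝ≥0)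
    (X a : ℝ≥0 → Ω → ℂ) (h : Fin N → ℝ≥0 → Ω → ℂ) : Prop where
  adapted : ∀ t ≤ T, StronglyMeasurable[F t] (X t)
  cont : ∀ᵐ ω ∂P, ContinuousOn (fun t => X t ω) (Icc 0 T)
  drift : ∀ᵐ ω ∂P, IntegrableOn (fun s => a s ω) (Icc 0 T) leb
  repr : ∃ I : Fin N → ℝ≥0 → Ω → ℂ, (∀ k, IsItoIntegral P F (β k) T (h k) (I k)) ∧
    ∀ᵐ ω ∂P, ∀ t ≤ T, X t ω = X 0 ω + ∫ s in Icc 0 t, a s ω ∂leb + ∑ k, I k t ω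

variable {X X' a a' : ℝ≥0 → Ω → ℂ} {h h' : Fin N → ℝ≥0 → Ω → ℂ}

theorem ItoRep.congr (hX : ItoRep P F β T X a h)
    (ha : ∀ᵐ ω ∂P, ∀ᵐ s ∂leb.restrict (Icc 0 T), a s ω = a' s ω)
    (hh : ∀ k, ∀ᵐ ω ∂P, ∀ᵐ s ∂leb.restrict (Icc 0 T), h k s ω = h' k s ω) :
    ItoRep P F β T X a' h' where
  adapted := hX.adapted
  cont := hX.cont
  drift := by
    filter_upwards [hX.drift, ha] with ω h1 h2 using h1.congr h2
  repr := by
    obtain ⟨I, hI, hr⟩ := hX.repr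
    refine ⟨I, fun k => (hI k).congr (hh k) (ae_of_all _ fun ω t _ => rfl), ?_⟩
    filter_upwards [hr, ha] with ω h1 h2 t ht
    rw [h1 t ht]
    congr 2
    exact integral_congr_ae (ae_mono (Measure.restrict_mono (Icc_subset_Icc_right ht) le_rfl) h2)

theorem ItoRep.congr_process (hF : UsualConditions P F) (hX : ItoRep P F β T X a h)
    (hXX : ∀ᵐ ω ∂P, ∀ t ≤ T, X t ω = X' t ω) : ItoRep P F β T X' a h where
  adapted t ht := hF.stronglyMeasurable_congr (hX.adapted t ht)
    (hXX.mono fun ω hω => (hω t ht).symm)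
  cont := by
    filter_upwards [hX.cont, hXX] with ω h1 h2
    exact h1.congr fun t ht => (h2 t ht.2).symm
  drift := hX.drift
  repr := by
    obtain ⟨I, hI, hr⟩ := hX.repr
    refine ⟨I, hI, ?_⟩
    filter_upwards [hr, hXX] with ω h1 h2 t ht
    rw [← h2 t ht, ← h2 0 zero_le, h1 t ht]

theorem ItoRep.congr_of_eqOn (hX : ItoRep P F β T X a h) (hXX : ∀ t ≤ T, ∀ ω, X' t ω = X t ω) :
    ItoRep P F β T X' a h where
  adapted t ht := (funext (hXX t ht) : X' t = X t) ▸ hX.adapted t ht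
  cont := hX.cont.mono fun ω h1 => h1.congr fun t ht => hXX t ht.2 ω
  drift := hX.drift
  repr := by
    obtain ⟨I, hI, hr⟩ := hX.repr
    refine ⟨I, hI, hr.mono fun ω h1 t ht => ?_⟩
    rw [hXX t ht, hXX 0 zero_le, h1 t ht]

theorem ItoRep.zero : ItoRep P F β T (fun _ _ => 0) (fun _ _ => 0) (fun _ _ _ => 0) where
  adapted t _ := stronglyMeasurable_const
  cont := ae_of_all _ fun ω => continuousOn_const
  drift := ae_of_all _ fun ω => integrableOn_zero
  repr := ⟨fun _ _ _ => 0, fun _ => IsItoIntegral.zero, by simp⟩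

theorem ItoRep.add (hX : ItoRep P F β T X a h) (hX' : ItoRep P F β T X' a' h') :
    ItoRep P F β T (fun t ω => X t ω + X' t ω) (fun t ω => a t ω + a' t ω)
      (fun k t ω => h k t ω + h' k t ω) where
  adapted t ht := (hX.adapted t ht).add (hX'.adapted t ht)
  cont := by
    filter_upwards [hX.cont, hX'.cont] with ω h1 h2 using h1.add h2
  drift := by
    filter_upwards [hX.drift, hX'.drift] with ω h1 h2 using h1.add h2
  repr := by
    obtain ⟨I, hI, hr⟩ := hX.repr
    obtain ⟨I', hI', hr'⟩ := hX'.repr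
    refine ⟨fun k t ω => I k t ω + I' k t ω, fun k => (hI k).add (hI' k), ?_⟩
    filter_upwards [hr, hr', hX.drift, hX'.drift] with ω h1 h2 h3 h4 t ht
    rw [h1 t ht, h2 t ht, integral_add (h3.mono_set (Icc_subset_Icc_right ht))
      (h4.mono_set (Icc_subset_Icc_right ht)), Finset.sum_add_distrib]
    ring

theorem ItoRep.const_mul (hX : ItoRep P F β T X a h) (c : ℂ) :
    ItoRep P F β T (fun t ω => c * X t ω) (fun t ω => c * a t ω) (fun k t ω => c * h k t ω) where
  adapted t ht := (hX.adapted t ht).const_mul c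
  cont := by
    filter_upwards [hX.cont] with ω h1 using continuousOn_const.mul h1
  drift := by
    filter_upwards [hX.drift] with ω h1 using h1.const_mul c
  repr := by
    obtain ⟨I, hI, hr⟩ := hX.repr
    refine ⟨fun k t ω => c * I k t ω, fun k => (hI k).const_mul c, ?_⟩
    filter_upwards [hr] with ω h1 t ht
    rw [h1 t ht, integral_const_mul, ← Finset.mul_sum]
    ring

theorem ItoRep.sum {ι : Type*} (s : Finset ι) {X a : ι → ℝ≥0 → Ω → ℂ}
    {h : ι → Fin N → ℝ≥0 → Ω → ℂ} (hX : ∀ i ∈ s, ItoRep P F β T (X i) (a i) (h i)) :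
    ItoRep P F β T (fun t ω => ∑ i ∈ s, X i t ω) (fun t ω => ∑ i ∈ s, a i t ω)
      (fun k t ω => ∑ i ∈ s, h i k t ω) := by
  classical
  induction s using Finset.induction_on with
  | empty => simpa using ItoRep.zero
  | insert i s hi ih =>
    simp_rw [Finset.sum_insert hi]
    exact (hX i (Finset.mem_insert_self _ _)).add
      (ih fun k hk => hX k (Finset.mem_insert_of_mem hk))

theorem integral_Icc_sub_integral_Icc {g : ℝ≥0 → ℂ} (hg : IntegrableOn g (Icc 0 T) leb)
    {s t : ℝ≥0} (hst : s ≤ t) (ht : t ≤ T) :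
    ∫ r in Icc 0 t, g r ∂leb - ∫ r in Icc 0 s, g r ∂leb = ∫ r in Ioc s t, g r ∂leb := by
  have e : Icc 0 t = Icc 0 s ∪ Ioc s t := (Icc_union_Ioc_eq_Icc zero_le hst).symm
  rw [e, setIntegral_union, add_sub_cancel_left]
  · exact disjoint_left.2 fun x h1 h2 => absurd h1.2 (not_le.2 h2.1)
  · exact measurableSet_Ioc
  · exact hg.mono_set (Icc_subset_Icc_right (hst.trans ht))
  · exact hg.mono_set (Ioc_subset_Icc_self.trans (Icc_subset_Icc zero_le ht))

theorem integral_restart {g : ℝ≥0 → ℂ} (hg : IntegrableOn g (Icc 0 T) leb) (c : ℝ≥0) (z : ℂ)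
    {t : ℝ≥0} (ht : t ≤ T) : ∫ s in Icc 0 t, (if c < s then z * g s else 0) ∂leb
      = z * (∫ r in Icc 0 t, g r ∂leb - ∫ r in Icc 0 (min c t), g r ∂leb) := by
  have e : ∀ s, (if c < s then z * g s else 0) = (Ioi c).indicator (fun s => z * g s) s := fun s => by
    simp [indicator]
  simp only [e]
  rw [setIntegral_indicator measurableSet_Ioi, integral_const_mul,
    integral_Icc_sub_integral_Icc hg (min_le_right _ _) ht]
  congr 2
  congr 1
  ext s
  simp only [mem_inter_iff, mem_Icc, mem_Ioi, mem_Ioc, min_lt_iff]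
  constructor
  · rintro ⟨⟨_, h1⟩, h2⟩
    exact ⟨Or.inl h2, h1⟩
  · rintro ⟨h1 | h1, h2⟩
    · exact ⟨⟨zero_le, h2⟩, h1⟩
    · exact absurd h2 (not_le.2 h1)

/-- Products of β_l with elementary integrals are assembled from such restarts. The restriction c ≤
T is there because X is adapted only up to T. -/
theorem ItoRep.restart (hX : ItoRep P F β T X a h) (c : ℝ≥0) (hc : c ≤ T) {ξ : Ω → ℂ}
    (hξ : StronglyMeasurable[F c] ξ) :
    ItoRep P F β T (fun t ω => if c < t then ξ ω * (X t ω - X (min c t) ω) else 0)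
      (fun t ω => if c < t then ξ ω * a t ω else 0)
      (fun k t ω => if c < t then ξ ω * h k t ω else 0) where
  adapted t ht := by
    by_cases hct : c < t
    · simp only [hct, if_true, min_eq_left hct.le]
      exact (hξ.mono (F.mono hct.le)).mul ((hX.adapted t ht).sub
        ((hX.adapted c hc).mono (F.mono hct.le)))
    · simp only [hct, if_false]
      exact stronglyMeasurable_const
  cont := by
    filter_upwards [hX.cont] with ω h1
    have : (fun t => if c < t then ξ ω * (X t ω - X (min c t) ω) else 0)
        = fun t => ξ ω * (X t ω - X (min c t) ω) := by
      funext t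
      by_cases hct : c < t
      · simp [hct]
      · simp [hct, min_eq_right (not_lt.1 hct)]
    rw [this]
    refine continuousOn_const.mul (h1.sub (h1.comp (by fun_prop) fun t ht => ?_))
    exact ⟨zero_le, (min_le_left _ _).trans hc⟩
  drift := by
    filter_upwards [hX.drift] with ω h1
    exact ((h1.const_mul (ξ ω)).indicator (measurableSet_Ioi (a := c))).congr
      (ae_of_all _ fun t => by simp [indicator])
  repr := by
    obtain ⟨I, hI, hr⟩ := hX.repr
    refine ⟨_, fun k => (hI k).restart c hξ, ?_⟩
    filter_upwards [hr, hX.drift] with ω h1 h2 t ht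
    rw [integral_restart h2 c _ ht, ← Finset.mul_sum]
    have e : (if c < t then ξ ω * (X t ω - X (min c t) ω) else 0)
        = ξ ω * (X t ω - X (min c t) ω) := by
      by_cases hct : c < t
      · simp [hct]
      · simp [hct, min_eq_right (not_lt.1 hct)]
    rw [e, h1 t ht, h1 (min c t) ((min_le_right _ _).trans ht)]
    simp only [not_lt.2 (zero_le : 0 ≤ c), if_false, Finset.sum_sub_distrib]
    ring

theorem IsBrownianFamily.itoRep_mul (hβ : IsBrownianFamily P F β) (l j : Fin N) (T : ℝ≥0) :
    ItoRep P F β T (fun t ω => (β l t ω : ℂ) * β j t ω) (fun _ _ => if l = j then 1 else 0)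
      (fun k t ω => (if k = j then (β l t ω : ℂ) else 0) + if k = l then (β j t ω : ℂ) else 0) where
  adapted t _ := (hβ.adapted_ofReal l t).mul (hβ.adapted_ofReal j t)
  cont := by
    filter_upwards [hβ.continuous l, hβ.continuous j] with ω h1 h2 using (h1.mul h2).continuousOn
  drift := ae_of_all _ fun ω => integrableOn_const (by simp [leb_Icc])
  repr := by
    obtain ⟨I, I', hI, hI', hr⟩ := hβ.exists_mul_eq l j T
    refine ⟨fun k t ω => (if k = j then I t ω else 0) + if k = l then I' t ω else 0, fun k => ?_, ?_⟩
    · refine IsItoIntegral.add (X := fun t ω => if k = j then (β l t ω : ℂ) else 0)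
        (X' := fun t ω => if k = l then (β j t ω : ℂ) else 0)
        (I := fun t ω => if k = j then I t ω else 0)
        (I' := fun t ω => if k = l then I' t ω else 0) ?_ ?_
      · by_cases hk : k = j
        · subst hk
          simpa using hI
        · simpa [hk] using IsItoIntegral.zero
      · by_cases hk : k = l
        · subst hk
          simpa using hI'
        · simpa [hk] using IsItoIntegral.zero
    · filter_upwards [hr] with ω h1 t ht
      rw [h1 t ht, setIntegral_const, Measure.real, leb_Icc]
      simp only [Finset.sum_add_distrib, Finset.sum_ite_eq', Finset.mem_univ, if_true]
      by_cases hlj : l = j <;> simp [hlj] <;> ring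

theorem IsBrownianFamily.itoRep (hβ : IsBrownianFamily P F β) (j : Fin N) (T : ℝ≥0) :
    ItoRep P F β T (fun t ω => (β j t ω : ℂ)) (fun _ _ => 0) (fun k _ _ => if k = j then 1 else 0) where
  adapted t _ := hβ.adapted_ofReal j t
  cont := by
    filter_upwards [hβ.continuous j] with ω h1 using h1.continuousOn
  drift := ae_of_all _ fun ω => integrableOn_zero
  repr := by
    refine ⟨fun k t ω => if k = j then (β k t ω : ℂ) - β k 0 ω else 0, fun k => ?_, ?_⟩
    · by_cases hk : k = j
      · simp only [hk, if_true]
        have h1 : IsItoIntegral P F (β j) T (fun t _ => if 0 < t then 1 else 0)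
            (fun t ω => 1 * ((β j t ω - β j (min 0 t) ω : ℝ) : ℂ)) :=
          (Elem.single 0 (fun _ => 1) stronglyMeasurable_const 1 (by simp)).isItoIntegral
        refine h1.congr (ae_of_all _ fun ω => ?_) (ae_of_all _ fun ω t _ => ?_)
        · filter_upwards [ae_pos_Icc T] with s hs
          simp [hs.1]
        · simp
      · simpa [hk] using IsItoIntegral.zero
    · refine ae_of_all _ fun ω t _ => ?_
      simp

end ItoRep

/-! ### Product rule for a Brownian motion and an Itô process -/

section ProductRule

variable {Ω : Type*} {mΩ : MeasurableSpace Ω} {P : Measure Ω} {F : Filtration ℝ≥0 mΩ}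
  {T : ℝ≥0} {N : ℕ} {β : Fin N → ℝ≥0 → Ω → ℝ} {j l : Fin N}
  {X X' a a' : ℝ≥0 → Ω → ℂ} {h h' : Fin N → ℝ≥0 → Ω → ℂ}

theorem lintegral_enorm_le_engy {f : ℝ≥0 → ℂ}
    (hf : AEStronglyMeasurable f (leb.restrict (Icc 0 T))) :
    ∫⁻ s in Icc 0 T, ‖f s‖ₑ ∂leb
      ≤ (∫⁻ s in Icc 0 T, ‖f s‖ₑ ^ 2 ∂leb) ^ (1 / 2 : ℝ) * ENNReal.ofReal T ^ (1 / 2 : ℝ) := by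
  have h1 := eLpNorm_le_eLpNorm_mul_rpow_measure_univ (p := 1) (q := 2) one_le_two hf
  rw [eLpNorm_one_eq_lintegral_enorm, Measure.restrict_apply_univ, leb_Icc,
    eLpNorm_eq_lintegral_rpow_enorm_toReal (by norm_num) (by norm_num)] at h1
  have e : (1 : ℝ) / ENNReal.toReal 1 - 1 / ENNReal.toReal 2 = 1 / 2 := by norm_num
  rw [e] at h1
  simpa using h1

theorem tendsto_lintegral_enorm_of_engy {f : ℕ → ℝ≥0 → ℂ}
    (hf : ∀ n, AEStronglyMeasurable (f n) (leb.restrict (Icc 0 T)))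
    (h : Tendsto (fun n => ∫⁻ s in Icc 0 T, ‖f n s‖ₑ ^ 2 ∂leb) atTop (𝓝 0)) :
    Tendsto (fun n => ∫⁻ s in Icc 0 T, ‖f n s‖ₑ ∂leb) atTop (𝓝 0) := by
  have h1 : Tendsto (fun n => (∫⁻ s in Icc 0 T, ‖f n s‖ₑ ^ 2 ∂leb) ^ (1 / 2 : ℝ)
      * ENNReal.ofReal T ^ (1 / 2 : ℝ)) atTop (𝓝 0) := by
    have := ENNReal.Tendsto.mul_const (b := ENNReal.ofReal T ^ (1 / 2 : ℝ))
      ((ENNReal.continuous_rpow_const (y := 1 / 2)).continuousAt.tendsto.comp h)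
      (Or.inr (ENNReal.rpow_ne_top_of_nonneg (by norm_num) ENNReal.ofReal_ne_top))
    simpa [Function.comp_def] using this
  exact tendsto_of_tendsto_of_tendsto_of_le_of_le tendsto_const_nhds h1 (fun _ => zero_le)
    fun n => lintegral_enorm_le_engy (hf n)

variable [IsProbabilityMeasure P]

/-- Stability of Itô processes: the limiting noise integrals exist by continuity of the Itô
integral, and the integral identity is passed to the limit along a subsequence on which they
converge almost surely. -/
theorem ItoRep.of_tendsto (hF : UsualConditions P F) (hβ : IsBrownianFamily P F β)
    {Xn an : ℕ → ℝ≥0 → Ω → ℂ} {hn : ℕ → Fin N → ℝ≥0 → Ω → ℂ}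
    (H : ∀ n, ItoRep P F β T (Xn n) (an n) (hn n))
    (hc : ∀ᵐ ω ∂P, ContinuousOn (fun t => X t ω) (Icc 0 T))
    (hX : ∀ᵐ ω ∂P, ∀ t ≤ T, Tendsto (fun n => Xn n t ω) atTop (𝓝 (X t ω)))
    (had : ∀ᵐ ω ∂P, IntegrableOn (fun s => a s ω) (Icc 0 T) leb)
    (ha : ∀ᵐ ω ∂P, Tendsto (fun n => ∫⁻ s in Icc 0 T, ‖an n s ω - a s ω‖ₑ ∂leb) atTop (𝓝 0))
    (hm : ∀ k, ∀ᵐ ω ∂P, AEStronglyMeasurable (fun s => h k s ω) (leb.restrict (Icc 0 T)))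
    (hh : ∀ k, PNull P (fun n => engy T (fun s ω => hn n k s ω - h k s ω))) :
    ItoRep P F β T X a h where
  adapted t ht := hF.stronglyMeasurable_of_tendsto (fun n => (H n).adapted t ht)
    (hX.mono fun ω hω => hω t ht)
  cont := hc
  drift := had
  repr := by
    choose In hIn hrn using fun n => (H n).repr
    choose I hI hIlim using fun k =>
      exists_isItoIntegral_of_tendsto hβ (fun n => hIn n k) (hm k) (hh k)
    obtain ⟨φ, hφ, hlim⟩ := (PNull.sum Finset.univ fun k _ => hIlim k).exists_seq
    refine ⟨I, hI, ?_⟩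
    filter_upwards [hlim, hX, ha, had, ae_all_iff.2 hrn, ae_all_iff.2 fun n => (H n).drift]
      with ω h1 h2 h3 h4 h5 h6 t ht
    have h7 : Tendsto (fun n => ∑ k, In (φ n) k t ω) atTop (𝓝 (∑ k, I k t ω)) := by
      refine tendsto_finsetSum _ fun k _ => ?_
      refine tendsto_of_usup (tendsto_of_tendsto_of_tendsto_of_le_of_le tendsto_const_nhds h1
        (fun _ => zero_le) fun n => ?_) ht
      exact Finset.single_le_sum (f := fun k => usup T (fun s ω => In (φ n) k s ω - I k s ω) ω)
        (fun _ _ => zero_le) (Finset.mem_univ k)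
    have h8 : Tendsto (fun n => ∫ s in Icc 0 t, an n s ω ∂leb) atTop
        (𝓝 (∫ s in Icc 0 t, a s ω ∂leb)) := by
      refine tendsto_integral_of_L1 _ (h4.mono_set (Icc_subset_Icc_right ht)).1
        (Eventually.of_forall fun n => (h6 n).mono_set (Icc_subset_Icc_right ht)) ?_
      exact tendsto_of_tendsto_of_tendsto_of_le_of_le tendsto_const_nhds h3 (fun _ => zero_le)
        fun n => lintegral_mono_set (Icc_subset_Icc_right ht)
    have h9 := (((h2 0 zero_le).comp hφ.tendsto_atTop).add (h8.comp hφ.tendsto_atTop)).add h7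
    refine tendsto_nhds_unique ((h2 t ht).comp hφ.tendsto_atTop) (h9.congr fun n => ?_)
    exact (h5 (φ n) t ht).symm

/-- Because β_l(t) ξ (β_j(t) - β_j(c)) = ξ (β_lβ_j(t) - β_lβ_j(c)) - ξ β_j(c) (β_l(t) - β_l(c)) for
t > c, the product is a sum of restarts of β_l β_j and of β_l. -/
theorem Elem.itoRep_mul (hβ : IsBrownianFamily P F β) (l j : Fin N) {V I : ℝ≥0 → Ω → ℂ}
    (H : Elem F (β j) V I) :
    ItoRep P F β T (fun t ω => (β l t ω : ℂ) * I t ω) (fun t ω => if l = j then V t ω else 0)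
      (fun k t ω => (if k = j then (β l t ω : ℂ) * V t ω else 0) + if k = l then I t ω else 0) := by
  induction H with
  | single c ξ hξ C hC =>
    by_cases hc : c ≤ T
    · have hξ' : StronglyMeasurable[F c] fun ω => -(ξ ω * β j c ω) :=
        (hξ.mul (hβ.adapted_ofReal j c)).neg
      have h1 := ((hβ.itoRep_mul l j T).restart c hc hξ).add ((hβ.itoRep l T).restart c hc hξ')
      have e : (fun t ω => (β l t ω : ℂ) * (ξ ω * ((β j t ω - β j (min c t) ω : ℝ) : ℂ)))
          = fun t ω => (if c < t then ξ ω * ((β l t ω : ℂ) * β j t ω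
              - (β l (min c t) ω : ℂ) * β j (min c t) ω) else 0)
            + if c < t then -(ξ ω * β j c ω) * ((β l t ω : ℂ) - β l (min c t) ω) else 0 := by
        funext t ω
        by_cases hct : c < t
        · simp only [hct, if_true, min_eq_left hct.le]
          push_cast
          ring
        · simp [hct, min_eq_right (not_lt.1 hct)]
      beta_reduce
      rw [e]
      refine h1.congr ?_ fun k => ?_
      · refine ae_of_all _ fun ω => ae_of_all _ fun s => ?_
        by_cases hct : c < s <;> by_cases hlj : l = j <;> simp [hct, hlj]
      · refine ae_of_all _ fun ω => ae_of_all _ fun s => ?_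
        by_cases hct : c < s
        · simp only [hct, if_true, min_eq_left hct.le]
          split_ifs <;> push_cast <;> ring
        · simp [hct, min_eq_right (not_lt.1 hct)]
    -- A process starting after T is zero on [0,T].
    · refine (ItoRep.zero.congr ?_ fun k => ?_ : ItoRep P F β T (fun _ _ => 0) _ _).congr_of_eqOn ?_
      · refine ae_of_all _ fun ω => ?_
        filter_upwards [ae_pos_Icc T] with s hs
        have : ¬ c < s := fun h => hc (h.le.trans hs.2)
        simp [this]
      · refine ae_of_all _ fun ω => ?_
        filter_upwards [ae_pos_Icc T] with s hs
        have : s ≤ c := hs.2.trans (not_le.1 hc).le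
        simp [not_lt.2 this, min_eq_right this]
      · intro t ht ω
        have : t ≤ c := ht.trans (not_le.1 hc).le
        simp [min_eq_right this]
  | add h1 h2 ih1 ih2 =>
    have e := ih1.add ih2
    beta_reduce
    simp_rw [mul_add]
    refine e.congr ?_ fun k => ?_
    · refine ae_of_all _ fun ω => ae_of_all _ fun s => ?_
      by_cases hlj : l = j <;> simp [hlj]
    · refine ae_of_all _ fun ω => ae_of_all _ fun s => ?_
      split_ifs <;> ring

theorem aestronglyMeasurable_ite {α : Type*} {mα : MeasurableSpace α} {μ : Measure α} (p : Prop)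
    [Decidable p] {f g : α → ℂ} (hf : AEStronglyMeasurable f μ) (hg : AEStronglyMeasurable g μ) :
    AEStronglyMeasurable (fun x => if p then f x else g x) μ := by
  by_cases hp : p <;> simpa [hp]

/-- Approximation by elementary integrals. The factor β_l is bounded on [0,T] only path by path, so
the error of the integrands carries the random constant sup |β_l|², which tightness absorbs. -/
theorem IsItoIntegral.itoRep_mul (hF : UsualConditions P F) (hβ : IsBrownianFamily P F β)
    (l j : Fin N) {V I : ℝ≥0 → Ω → ℂ} (H : IsItoIntegral P F (β j) T V I) :
    ItoRep P F β T (fun t ω => (β l t ω : ℂ) * I t ω) (fun t ω => if l = j then V t ω else 0)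
      (fun k t ω => (if k = j then (β l t ω : ℂ) * V t ω else 0) + if k = l then I t ω else 0) := by
  obtain ⟨Vn, Jn, hE, hV, hJ, hV', hJ'⟩ := H.exists_ae_tendsto
  have hIc := H.continuousOn (hβ.brownian j).cont
  obtain ⟨hK, hKfin⟩ := ofReal_brownian_version hβ l T
  refine ItoRep.of_tendsto hF hβ (fun n => (hE n).itoRep_mul hβ l j) ?_ ?_ ?_ ?_ ?_ ?_
  · filter_upwards [hIc, hβ.continuous l] with ω h1 h2 using h2.continuousOn.mul h1
  · filter_upwards [hJ'] with ω h1 t ht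
    exact (tendsto_of_usup h1 ht).const_mul _
  · filter_upwards [H.engy_lt_top, H.aesm] with ω h1 h2
    by_cases hlj : l = j
    · simpa [hlj] using integrableOn_of_engy h2 h1
    · simp [hlj]
  · filter_upwards [hV', H.aesm] with ω h1 h2
    by_cases hlj : l = j
    · simp only [hlj, if_true]
      exact tendsto_lintegral_enorm_of_engy
        (fun n => ((hE n).measurable_val ω).aestronglyMeasurable.sub h2) h1
    · simp [hlj]
  · intro k
    filter_upwards [hβ.continuous l, H.aesm, hIc] with ω h1 h2 h3
    exact (aestronglyMeasurable_ite _ (h1.aestronglyMeasurable.mul h2)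
      aestronglyMeasurable_const).add (aestronglyMeasurable_ite _
        (h3.aestronglyMeasurable measurableSet_Icc) aestronglyMeasurable_const)
  · intro k
    have h1 : PNull P (fun n ω => 4 * (usup T (fun t ω => (β l t ω : ℂ)) ω ^ 2 *
        engy T (fun s ω => Vn n s ω - V s ω) ω) + 4 * (ENNReal.ofReal T *
          usup T (fun s ω => Jn n s ω - I s ω) ω ^ 2)) :=
      ((hV.mul_tight (hK.pow_const 2) (hKfin.mono fun ω h => by finiteness)).const_mul
        (by norm_num)).add ((hJ.sq.const_mul ENNReal.ofReal_ne_top).const_mul (by norm_num))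
    refine h1.mono fun n => ?_
    filter_upwards [hβ.continuous l, H.aesm, hKfin] with ω h2 h3 h4
    refine (engy_le_add (A := fun s ω => (β l s ω : ℂ) * (Vn n s ω - V s ω))
      (B := fun s ω => Jn n s ω - I s ω) (h2.aestronglyMeasurable.mul
        (((hE n).measurable_val ω).aestronglyMeasurable.sub h3)) (ae_of_all _ fun s => ?_)).trans
      (add_le_add ?_ ?_)
    · have e : ((if k = j then (β l s ω : ℂ) * Vn n s ω else 0) + if k = l then Jn n s ω else 0)
          - ((if k = j then (β l s ω : ℂ) * V s ω else 0) + if k = l then I s ω else 0)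
          = (if k = j then (β l s ω : ℂ) * (Vn n s ω - V s ω) else 0)
            + if k = l then Jn n s ω - I s ω else 0 := by
        split_ifs <;> ring
      rw [e]
      refine (enorm_add_le _ _).trans (add_le_add ?_ ?_)
      · split_ifs <;> simp
      · split_ifs <;> simp
    · refine mul_le_mul_right (engy_le_mul ?_ h4.ne) _
      filter_upwards [ae_pos_Icc T] with s hs
      rw [enorm_mul]
      exact mul_le_mul_left (le_usup (Y := fun t ω => (β l t ω : ℂ)) hs.2) _
    · exact mul_le_mul_right (engy_le_usup _ _) _

/-- Left point rule for `∫ B a` with continuous `B`, evaluated at the right end points. -/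
theorem tendsto_sum_mesh_integral {B g : ℝ≥0 → ℂ} (hB : ContinuousOn B (Icc 0 T))
    (hg : IntegrableOn g (Icc 0 T) leb) {t : ℝ≥0} (ht : t ≤ T) :
    Tendsto (fun n => ∑ i ∈ Finset.range (meshCount T n), B (min (mesh T n (i + 1)) t)
      * (∫ s in Icc 0 (min (mesh T n (i + 1)) t), g s ∂leb
        - ∫ s in Icc 0 (min (mesh T n i) t), g s ∂leb)) atTop (𝓝 (∫ s in Icc 0 t, B s * g s ∂leb)) := by
  have hBg : IntegrableOn (fun s => B s * g s) (Icc 0 T) leb :=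
    hg.continuousOn_mul hB isCompact_Icc
  set K := ∫ s in Icc 0 T, ‖g s‖ ∂leb with hK
  have hK0 : 0 ≤ K := integral_nonneg fun _ => norm_nonneg _
  rw [Metric.tendsto_atTop']
  intro ε hε
  -- K is the integral of |g|; adding 1 avoids division by zero and makes the final bound strict.
  have hε' : 0 < ε / (K + 1) := by positivity
  obtain ⟨δ, hδ, hu⟩ := Metric.uniformContinuousOn_iff.1
    (isCompact_Icc.uniformContinuousOn_of_continuous hB) _ hε'
  have hmesh := tendsto_one_div_add_atTop_nhds_zero_nat (𝕜 := ℝ)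
  obtain ⟨n₀, hn₀⟩ := eventually_atTop.1 (hmesh.eventually (gt_mem_nhds hδ))
  refine ⟨n₀, fun n hn => ?_⟩
  set r : ℕ → ℝ≥0 := fun i => min (mesh T n i) t with hr
  have hrm : ∀ i, r i ≤ r (i + 1) := fun i => min_le_min (mesh_mono T n (Nat.le_succ i)) le_rfl
  have hrT : ∀ i, r i ≤ T := fun i => (min_le_right _ _).trans ht
  have hr0 : r 0 = 0 := by simp [hr, mesh_zero]
  have hrn : r (meshCount T n) = t := by simp [hr, mesh_meshCount, ht]
  have tele : ∀ f : ℝ≥0 → ℂ, IntegrableOn f (Icc 0 T) leb →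
      ∑ i ∈ Finset.range (meshCount T n), ∫ s in Ioc (r i) (r (i + 1)), f s ∂leb
        = ∫ s in Icc 0 t, f s ∂leb := by
    intro f hf
    have h0 : ∫ s in Icc (0 : ℝ≥0) 0, f s ∂leb = 0 := by
      rw [Icc_self, Measure.restrict_singleton]
      simp
    rw [← Finset.sum_congr rfl fun i _ => integral_Icc_sub_integral_Icc hf (hrm i) (hrT (i + 1)),
      Finset.sum_range_sub (fun i => ∫ s in Icc 0 (r i), f s ∂leb), hr0, hrn, h0, sub_zero]
  have hsub : ∀ i, Ioc (r i) (r (i + 1)) ⊆ Icc 0 T := fun i x hx =>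
    ⟨zero_le, hx.2.trans (hrT _)⟩
  have e1 : ∑ i ∈ Finset.range (meshCount T n), B (r (i + 1))
      * (∫ s in Icc 0 (r (i + 1)), g s ∂leb - ∫ s in Icc 0 (r i), g s ∂leb)
      - ∫ s in Icc 0 t, B s * g s ∂leb
      = ∑ i ∈ Finset.range (meshCount T n),
        ∫ s in Ioc (r i) (r (i + 1)), (B (r (i + 1)) - B s) * g s ∂leb := by
    rw [← tele _ hBg, ← Finset.sum_sub_distrib]
    refine Finset.sum_congr rfl fun i _ => ?_
    rw [integral_Icc_sub_integral_Icc hg (hrm i) (hrT (i + 1)), ← integral_const_mul,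
      ← integral_sub ((hg.mono_set (hsub i)).const_mul _) (hBg.mono_set (hsub i))]
    exact integral_congr_ae (ae_of_all _ fun s => by ring)
  have hgn : IntegrableOn (fun s => ((‖g s‖ : ℝ) : ℂ)) (Icc 0 T) leb := hg.norm.ofReal
  have hgr : IntegrableOn (fun s => ‖g s‖) (Icc 0 T) leb := hg.norm
  have e2 : ∀ i, ‖∫ s in Ioc (r i) (r (i + 1)), (B (r (i + 1)) - B s) * g s ∂leb‖
      ≤ ε / (K + 1) * ∫ s in Ioc (r i) (r (i + 1)), ‖g s‖ ∂leb := by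
    intro i
    rw [← integral_const_mul]
    refine norm_integral_le_of_norm_le ((hgr.mono_set (hsub i)).const_mul _) ?_
    filter_upwards [ae_restrict_mem measurableSet_Ioc] with s hs
    rw [norm_mul]
    refine mul_le_mul_of_nonneg_right ?_ (norm_nonneg _)
    rw [← dist_eq_norm]
    refine (hu _ ⟨zero_le, hrT _⟩ _ (hsub i hs) ?_).le
    have h1 : (s : ℝ) ≤ r (i + 1) := hs.2
    have h2 : (r i : ℝ) < s := hs.1
    have h3 : (r (i + 1) : ℝ) - r i ≤ 1 / ((n : ℝ) + 1) := by
      have h4 := mesh_succ_sub_le T n i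
      have h5 : (0 : ℝ) ≤ 1 / ((n : ℝ) + 1) := by positivity
      simp only [hr]
      rcases le_total (mesh T n i) t with h | h
      · rw [min_eq_left h]
        have : ((min (mesh T n (i + 1)) t : ℝ≥0) : ℝ) ≤ mesh T n (i + 1) := min_le_left _ _
        linarith
      · rw [min_eq_right h, min_eq_right (h.trans (mesh_mono T n (Nat.le_succ i)))]
        simpa using h5
    rw [NNReal.dist_eq, abs_of_nonneg (by linarith)]
    linarith [hn₀ n hn.le]
  rw [dist_eq_norm, e1]
  have e3 : ∑ i ∈ Finset.range (meshCount T n), ∫ s in Ioc (r i) (r (i + 1)), ‖g s‖ ∂leb ≤ K := by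
    have h1 := tele _ hgn
    simp only [integral_complex_ofReal] at h1
    norm_cast at h1
    rw [h1]
    exact setIntegral_mono_set hgr (ae_of_all _ fun _ => norm_nonneg _)
      (Icc_subset_Icc_right ht).eventuallyLE
  calc _ ≤ ∑ i ∈ Finset.range (meshCount T n),
        ε / (K + 1) * ∫ s in Ioc (r i) (r (i + 1)), ‖g s‖ ∂leb :=
        (norm_sum_le _ _).trans (Finset.sum_le_sum fun i _ => e2 i)
    _ ≤ ε / (K + 1) * K := by
        rw [← Finset.mul_sum]
        gcongr
    _ < ε := by
        rw [div_mul_eq_mul_div, div_lt_iff₀ (by positivity)]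
        nlinarith

/-- The product rule for a Brownian motion and an adapted absolutely continuous process. -/
theorem itoRep_mul_of_integral (hβ : IsBrownianFamily P F β) (l : Fin N)
    (hXa : ∀ t ≤ T, StronglyMeasurable[F t] (X t))
    (hXc : ∀ᵐ ω ∂P, ContinuousOn (fun t => X t ω) (Icc 0 T))
    (had : ∀ᵐ ω ∂P, IntegrableOn (fun s => a s ω) (Icc 0 T) leb)
    (hX : ∀ᵐ ω ∂P, ∀ t ≤ T, X t ω = X 0 ω + ∫ s in Icc 0 t, a s ω ∂leb) :
    ItoRep P F β T (fun t ω => (β l t ω : ℂ) * X t ω) (fun t ω => (β l t ω : ℂ) * a t ω)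
      (fun k t ω => if k = l then X t ω else 0) where
  adapted t ht := (hβ.adapted_ofReal l t).mul (hXa t ht)
  cont := by
    filter_upwards [hXc, hβ.continuous l] with ω h1 h2 using h2.continuousOn.mul h1
  drift := by
    filter_upwards [had, hβ.continuous l] with ω h1 h2
    exact h1.continuousOn_mul h2.continuousOn isCompact_Icc
  repr := by
    obtain ⟨I, hI, hIr⟩ := exists_isItoIntegral_riemannSum hβ l hXa hXc
    refine ⟨fun k t ω => if k = l then I t ω else 0, fun k => ?_, ?_⟩
    · by_cases hk : k = l
      · subst hk
        simpa using hI
      · simpa [hk] using IsItoIntegral.zero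
    obtain ⟨φ, hφ, hlim⟩ := hIr.exists_seq
    filter_upwards [hlim, had, hX, hβ.continuous l] with ω h1 h2 h3 h4 t ht
    have h5 := tendsto_of_usup h1 ht
    have h6 := (tendsto_sum_mesh_integral h4.continuousOn h2 ht).comp hφ.tendsto_atTop
    have h7 := (h5.add h6).const_add ((β l 0 ω : ℂ) * X 0 ω)
    simp only [Finset.sum_ite_eq', Finset.mem_univ, if_true]
    rw [add_assoc, add_comm (∫ s in Icc 0 t, _ ∂leb)]
    refine tendsto_nhds_unique tendsto_const_nhds (h7.congr fun n => ?_)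
    -- The order of the factors matters: X at left end points against increments of β_l is a Riemann
    -- sum of the Itô integral, while β_l at right end points against increments of X tends to a
    -- Lebesgue integral. Hence no covariation term appears.
    have e := sum_mesh_mul (fun t => X t ω) (fun t => (β l t ω : ℂ)) (φ n) ht
    rw [Function.comp_apply, riemannSum_eq, ← Finset.sum_add_distrib]
    have e2 : ∀ i, X (min (mesh T (φ n) (i + 1)) t) ω - X (min (mesh T (φ n) i) t) ω
        = ∫ s in Icc 0 (min (mesh T (φ n) (i + 1)) t), a s ω ∂leb
          - ∫ s in Icc 0 (min (mesh T (φ n) i) t), a s ω ∂leb := fun i => by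
      rw [h3 _ ((min_le_right _ _).trans ht), h3 (min (mesh T (φ n) i) t)
        ((min_le_right _ _).trans ht)]
      ring
    simp only [e2] at e
    push_cast
    linear_combination -e

/-- The product rule for a Brownian motion and an Itô process. -/
theorem ItoRep.brownian_mul (hF : UsualConditions P F) (hβ : IsBrownianFamily P F β)
    (hX : ItoRep P F β T X a h) (l : Fin N) :
    ItoRep P F β T (fun t ω => (β l t ω : ℂ) * X t ω) (fun t ω => (β l t ω : ℂ) * a t ω + h l t ω)
      (fun k t ω => (β l t ω : ℂ) * h k t ω + if k = l then X t ω else 0) := by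
  obtain ⟨I, hI, hr⟩ := hX.repr
  have hI0 := ae_all_iff.2 fun k => (hI k).eval_zero
  have hIc := ae_all_iff.2 fun k => (hI k).continuousOn (hβ.brownian k).cont
  -- X minus its stochastic integrals is absolutely continuous and has no covariation with β_l. The
  -- integrals are treated one by one, and only that against β_l itself contributes the drift h l.
  have h1 : ItoRep P F β T (fun t ω => (β l t ω : ℂ) * (X t ω - ∑ k, I k t ω))
      (fun t ω => (β l t ω : ℂ) * a t ω) (fun k t ω => if k = l then X t ω - ∑ k, I k t ω else 0) := by
    refine itoRep_mul_of_integral hβ l (fun t ht => ?_) ?_ hX.drift ?_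
    · exact (hX.adapted t ht).sub (Finset.stronglyMeasurable_fun_sum _ fun k _ =>
        (hI k).adapted hF (hβ.adapted k) ht)
    · filter_upwards [hX.cont, hIc] with ω h2 h3
      exact h2.sub (continuousOn_finsetSum _ fun k _ => h3 k)
    · filter_upwards [hr, hI0] with ω h2 h3 t ht
      rw [h2 t ht]
      simp [h3]
  have h2 := h1.add (ItoRep.sum Finset.univ fun k _ => (hI k).itoRep_mul hF hβ l k)
  have e : (fun t ω => (β l t ω : ℂ) * X t ω) = fun t ω => (β l t ω : ℂ) * (X t ω - ∑ k, I k t ω)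
      + ∑ k, (β l t ω : ℂ) * I k t ω := by
    funext t ω
    rw [← Finset.mul_sum]
    ring
  rw [e]
  refine h2.congr (ae_of_all _ fun ω => ae_of_all _ fun s => ?_)
    fun k => ae_of_all _ fun ω => ae_of_all _ fun s => ?_
  · simp
  · simp only [Finset.sum_add_distrib, Finset.sum_ite_eq, Finset.mem_univ, if_true]
    by_cases hk : k = l
    · simp [hk]
      ring
    · simp [hk]

end ProductRule

/-! ### Polynomial approximation of the exponential -/

/-- The Taylor polynomials of the exponential function. -/
noncomputable def expPoly (n : ℕ) : Polynomial ℂ :=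
  ∑ k ∈ Finset.range n, Polynomial.C ((k.factorial : ℂ)⁻¹) * Polynomial.X ^ k

theorem eval_expPoly (n : ℕ) (z : ℂ) :
    (expPoly n).eval z = ∑ k ∈ Finset.range n, z ^ k / k.factorial := by
  simp [expPoly, Polynomial.eval_finsetSum, div_eq_inv_mul]

theorem derivative_expPoly (n : ℕ) : (expPoly (n + 1)).derivative = expPoly n := by
  rw [expPoly, expPoly, Finset.sum_range_succ']
  simp only [Polynomial.derivative_add, Polynomial.derivative_sum, Polynomial.derivative_C_mul,
    Polynomial.derivative_X_pow, pow_zero, Polynomial.derivative_one, mul_zero, add_zero]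
  refine Finset.sum_congr rfl fun k _ => ?_
  rw [← mul_assoc, ← Polynomial.C_mul]
  congr 2
  rw [Nat.factorial_succ]
  push_cast
  have h1 : (k.factorial : ℂ) ≠ 0 := by exact_mod_cast k.factorial_ne_zero
  have h2 : (k : ℂ) + 1 ≠ 0 := by exact_mod_cast k.succ_ne_zero
  simp
  field_simp

/-- The remainder is at most 2 Rⁿ/n! as soon as n ≥ 2R, uniformly on the disc. -/
theorem eventually_eval_expPoly (R : ℝ≥0) {ε : ℝ≥0∞} (hε : 0 < ε) :
    ∀ᶠ n in atTop, ∀ z : ℂ, ‖z‖ₑ ≤ R → ‖(expPoly n).eval z - Complex.exp z‖ₑ ≤ ε := by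
  have h1 : Tendsto (fun n : ℕ => ENNReal.ofReal ((R : ℝ) ^ n / n.factorial * 2)) atTop (𝓝 0) := by
    have := (FloorSemiring.tendsto_pow_div_factorial_atTop (R : ℝ)).mul_const 2
    rw [zero_mul] at this
    simpa using ENNReal.tendsto_ofReal this
  filter_upwards [(ENNReal.tendsto_nhds_zero.1 h1) ε hε, eventually_ge_atTop ⌈2 * (R : ℝ)⌉₊]
    with n h2 h3 z hz
  have hz' : ‖z‖ ≤ R := by
    have : ‖z‖₊ ≤ R := by exact_mod_cast hz
    exact_mod_cast this
  refine le_trans ?_ h2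
  rw [← ofReal_norm]
  refine ENNReal.ofReal_le_ofReal ?_
  rw [eval_expPoly, norm_sub_rev]
  refine (Complex.exp_bound' ?_).trans (by gcongr)
  have h4 : 2 * (R : ℝ) ≤ n := Nat.ceil_le.1 h3
  rw [div_le_iff₀ (by positivity)]
  push_cast
  linarith

/-- Itô's formula involves two derivatives, and differentiation lowers the index of the Taylor
polynomial by one; starting at n + 2 keeps all three within the family. -/
theorem exists_expPoly_bound (R : ℝ≥0) : ∃ c : ℕ → ℝ≥0∞, Tendsto c atTop (𝓝 0) ∧ (∀ n, c n ≠ ∞) ∧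
    ∀ n (z : ℂ), ‖z‖ₑ ≤ R →
      ‖(expPoly (n + 2)).eval z - Complex.exp z‖ₑ ≤ c n ∧
      ‖(expPoly (n + 2)).derivative.eval z - Complex.exp z‖ₑ ≤ c n ∧
      ‖(expPoly (n + 2)).derivative.derivative.eval z - Complex.exp z‖ₑ ≤ c n := by
  let d : ℕ → ℝ≥0∞ := fun n => ⨆ (z : ℂ) (_ : ‖z‖ₑ ≤ R), ‖(expPoly n).eval z - Complex.exp z‖ₑ
  have hd : Tendsto d atTop (𝓝 0) := ENNReal.tendsto_nhds_zero.2 fun ε hε =>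
    (eventually_eval_expPoly R hε).mono fun n hn => iSup₂_le hn
  have hle : ∀ n (z : ℂ), ‖z‖ₑ ≤ R → ‖(expPoly n).eval z - Complex.exp z‖ₑ ≤ d n := fun n z hz =>
    le_iSup₂ (f := fun (z : ℂ) (_ : ‖z‖ₑ ≤ R) => ‖(expPoly n).eval z - Complex.exp z‖ₑ) z hz
  have hfin : ∀ n, d n ≠ ∞ := by
    intro n
    obtain ⟨M, hM⟩ := (isCompact_closedBall (0 : ℂ) R).exists_bound_of_continuousOn
      ((expPoly n).continuous.sub Complex.continuous_exp).continuousOn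
    refine ne_top_of_le_ne_top (ENNReal.ofReal_ne_top (r := M)) (iSup₂_le fun z hz => ?_)
    rw [← ofReal_norm]
    have : ‖z‖₊ ≤ R := by exact_mod_cast hz
    exact ENNReal.ofReal_le_ofReal (hM z (by simpa using (by exact_mod_cast this : ‖z‖ ≤ R)))
  refine ⟨fun n => d (n + 2) + d (n + 1) + d n, ?_, fun n => ?_, fun n z hz => ?_⟩
  · simpa using ((hd.comp (tendsto_add_atTop_nat 2)).add
      (hd.comp (tendsto_add_atTop_nat 1))).add hd
  · exact ENNReal.add_ne_top.2 ⟨ENNReal.add_ne_top.2 ⟨hfin _, hfin _⟩, hfin _⟩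
  · rw [derivative_expPoly, derivative_expPoly]
    refine ⟨(hle _ z hz).trans ?_, (hle _ z hz).trans ?_, (hle _ z hz).trans ?_⟩
    · exact le_self_add.trans le_self_add
    · exact le_add_self.trans le_self_add
    · exact le_add_self

/-! ### Multiplication by the exponential of Brownian motions -/

section ExpTransform

variable {Ω : Type*} {mΩ : MeasurableSpace Ω} {P : Measure Ω} {F : Filtration ℝ≥0 mΩ}
  {T : ℝ≥0} {N : ℕ} {β : Fin N → ℝ≥0 → Ω → ℝ}

/-- The phase `i ∑_l C_l(x) β_l(t)`. -/
noncomputable def brPhase (β : Fin N → ℝ≥0 → Ω → ℝ) (C : Fin N → E3 → ℝ) (t : ℝ≥0) (ω : Ω)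
    (x : E3) : ℂ :=
  ∑ l, (β l t ω : ℂ) * (Complex.I * (C l x : ℂ))

/-- `φ ↦ - i C φ`, so that `⟨v, (- i C) φ⟩ = i C ⟨v, φ⟩`. -/
noncomputable def rotTest (C : E3 → ℝ) (φ : E3 → C6) (x : E3) : C6 :=
  (-Complex.I * (C x : ℂ)) • φ x

/-- The formal image under `M` of `- i C φ` when `M φ = ψ` and `∇ C = G`. -/
noncomputable def rotTestImage (C : E3 → ℝ) (G : E3 → E3) (φ ψ : E3 → C6) (x : E3) : C6 :=
  (-Complex.I * (C x : ℂ)) • ψ x + (-Complex.I) • crossTerm (G x) (φ x)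

theorem inner_rotTest (C : E3 → ℝ) (φ : E3 → C6) (x : E3) (w : C6) :
    inner ℂ (rotTest C φ x) w = (Complex.I * (C x : ℂ)) * inner ℂ (φ x) w := by
  rw [rotTest, inner_smul_left]
  simp

theorem inner_rotTestImage (C : E3 → ℝ) (G : E3 → E3) (φ ψ : E3 → C6) (x : E3) (w : C6) :
    inner ℂ (rotTestImage C G φ ψ x) w = (Complex.I * (C x : ℂ)) * inner ℂ (ψ x) w
      + Complex.I * inner ℂ (crossTerm (G x) (φ x)) w := by
  rw [rotTestImage, inner_add_left, inner_smul_left, inner_smul_left]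
  simp

theorem crossTerm_smul (g : E3) (c : ℂ) (v : C6) : crossTerm g (c • v) = c • crossTerm g v := by
  ext i
  have h1 : sndC (c • v) = c • sndC v := rfl
  have h2 : fstC (c • v) = c • fstC v := rfl
  simp only [crossTerm, pairC, h1, h2, map_smul]
  rcases i with i | i <;> simp [-cross_anticomm]

theorem inner_crossTerm_rotTest (C : E3 → ℝ) (g : E3) (φ : E3 → C6) (x : E3) (w : C6) :
    inner ℂ (crossTerm g (rotTest C φ x)) w
      = (Complex.I * (C x : ℂ)) * inner ℂ (crossTerm g (φ x)) w := by
  rw [rotTest, crossTerm_smul, inner_smul_left]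
  simp

/-- The zeroth order drift density `- ⟨v, ψ⟩ + ⟨f, φ⟩`. -/
noncomputable def driftZero (v f φ ψ : E3 → C6) (x : E3) : ℂ :=
  -inner ℂ (ψ x) (v x) + inner ℂ (φ x) (f x)

/-- The first order drift density `- i ∑ b_l ⟨v, ∇C_l × φ⟩ + ∑ i C_l ⟨g_l, φ⟩`. -/
noncomputable def driftOne (b : Fin N → ℝ) (C : Fin N → E3 → ℝ) (G : Fin N → E3 → E3)
    (v : E3 → C6) (g : Fin N → E3 → C6) (φ : E3 → C6) (x : E3) : ℂ :=
  ∑ l, (-Complex.I * (b l : ℂ) * inner ℂ (crossTerm (G l x) (φ x)) (v x)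
    + Complex.I * (C l x : ℂ) * inner ℂ (φ x) (g l x))

/-- The second order drift density `½ ∑ (i C_l)² ⟨v, φ⟩`. -/
noncomputable def driftTwo (C : Fin N → E3 → ℝ) (v φ : E3 → C6) (x : E3) : ℂ :=
  (1 / 2 : ℂ) * ∑ l, (Complex.I * (C l x : ℂ)) ^ 2 * inner ℂ (φ x) (v x)

/-- The last term is the commutator of M with multiplication by the coefficient, seen on the test
function. -/
theorem driftZero_rot (C : E3 → ℝ) (G : E3 → E3) (v f φ ψ : E3 → C6) (x : E3) :
    driftZero v f (rotTest C φ) (rotTestImage C G φ ψ) x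
      = (Complex.I * (C x : ℂ)) * driftZero v f φ ψ x
        - Complex.I * inner ℂ (crossTerm (G x) (φ x)) (v x) := by
  simp only [driftZero, inner_rotTest, inner_rotTestImage]
  ring

theorem driftOne_rot (b : Fin N → ℝ) (C : Fin N → E3 → ℝ) (G : Fin N → E3 → E3)
    (v : E3 → C6) (g : Fin N → E3 → C6) (φ : E3 → C6) (K : E3 → ℝ) (x : E3) :
    driftOne b C G v g (rotTest K φ) x
      = (Complex.I * (K x : ℂ)) * driftOne b C G v g φ x := by
  simp only [driftOne, inner_rotTest, inner_crossTerm_rotTest, Finset.mul_sum]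
  exact Finset.sum_congr rfl fun l _ => by ring

theorem driftTwo_rot (C : Fin N → E3 → ℝ) (v φ : E3 → C6) (K : E3 → ℝ) (x : E3) :
    driftTwo C v (rotTest K φ) x = (Complex.I * (K x : ℂ)) * driftTwo C v φ x := by
  simp only [driftTwo, inner_rotTest, Finset.mul_sum]
  exact Finset.sum_congr rfl fun l _ => by ring

/-- The second order Leibniz identity behind Itô's formula for `X * p`. -/
theorem sum_drift_rot (p : Polynomial ℂ) (b : Fin N → ℝ) (C : Fin N → E3 → ℝ) (G : Fin N → E3 → E3)
    (v f φ ψ : E3 → C6) (g : Fin N → E3 → C6) (x : E3) (z : ℂ)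
    (hz : z = ∑ l, (b l : ℂ) * (Complex.I * (C l x : ℂ))) :
    ∑ l, ((b l : ℂ) * (p.eval z * driftZero v f (rotTest (C l) φ) (rotTestImage (C l) (G l) φ ψ) x
        + p.derivative.eval z * driftOne b C G v g (rotTest (C l) φ) x
        + p.derivative.derivative.eval z * driftTwo C v (rotTest (C l) φ) x)
      + (p.eval z * inner ℂ (rotTest (C l) φ x) (g l x)
        + p.derivative.eval z * (Complex.I * (C l x : ℂ) * inner ℂ (rotTest (C l) φ x) (v x))))
      = (Polynomial.X * p).eval z * driftZero v f φ ψ x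
        + (Polynomial.X * p).derivative.eval z * driftOne b C G v g φ x
        + (Polynomial.X * p).derivative.derivative.eval z * driftTwo C v φ x := by
  simp only [driftZero_rot, driftOne_rot, driftTwo_rot, inner_rotTest]
  have e : ∀ l, ((b l : ℂ) * (p.eval z * ((Complex.I * (C l x : ℂ)) * driftZero v f φ ψ x
        - Complex.I * inner ℂ (crossTerm (G l x) (φ x)) (v x))
        + p.derivative.eval z * ((Complex.I * (C l x : ℂ)) * driftOne b C G v g φ x)
        + p.derivative.derivative.eval z * ((Complex.I * (C l x : ℂ)) * driftTwo C v φ x))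
      + (p.eval z * ((Complex.I * (C l x : ℂ)) * inner ℂ (φ x) (g l x))
        + p.derivative.eval z * (Complex.I * (C l x : ℂ) *
          ((Complex.I * (C l x : ℂ)) * inner ℂ (φ x) (v x)))))
      = ((b l : ℂ) * (Complex.I * (C l x : ℂ))) * (p.eval z * driftZero v f φ ψ x
          + p.derivative.eval z * driftOne b C G v g φ x
          + p.derivative.derivative.eval z * driftTwo C v φ x)
        + p.eval z * (-Complex.I * (b l : ℂ) * inner ℂ (crossTerm (G l x) (φ x)) (v x)
          + Complex.I * (C l x : ℂ) * inner ℂ (φ x) (g l x))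
        + p.derivative.eval z * ((Complex.I * (C l x : ℂ)) ^ 2 * inner ℂ (φ x) (v x)) := fun l => by
    ring
  simp only [e, Finset.sum_add_distrib, ← Finset.mul_sum, ← Finset.sum_mul]
  rw [← hz]
  -- Since (Xp)' = p + X p' and (Xp)'' = 2 p' + X p'', the terms in excess of the factor z must be p
  -- times the first order density and 2 p' times the second order density.
  have h1 : ∑ l, (-Complex.I * (b l : ℂ) * inner ℂ (crossTerm (G l x) (φ x)) (v x))
      + ∑ l, Complex.I * (C l x : ℂ) * inner ℂ (φ x) (g l x) = driftOne b C G v g φ x := by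
    rw [driftOne, Finset.sum_add_distrib]
  have h2 : (∑ l, (Complex.I * (C l x : ℂ)) ^ 2) * inner ℂ (φ x) (v x)
      = 2 * driftTwo C v φ x := by
    rw [driftTwo, ← mul_assoc, Finset.sum_mul]
    norm_num
  rw [h1, h2]
  simp only [Polynomial.derivative_mul, Polynomial.derivative_X, Polynomial.eval_mul,
    Polynomial.eval_X, Polynomial.eval_add, Polynomial.derivative_add, one_mul]
  ring

end ExpTransform

section ExpTransform

variable {Ω : Type*} {mΩ : MeasurableSpace Ω} {P : Measure Ω} {F : Filtration ℝ≥0 mΩ}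
  {T : ℝ≥0} {N : ℕ} {β : Fin N → ℝ≥0 → Ω → ℝ} {C : Fin N → E3 → ℝ} {G : Fin N → E3 → E3}
  {μ : Measure E3} {v f : ℝ≥0 → Ω → E3 → C6} {g : Fin N → ℝ≥0 → Ω → E3 → C6}
  {𝒯 : (E3 → C6) → (E3 → C6) → Prop} {ω : Ω} {e e' : ℂ → ℂ}

/-- Integrability of the pairings of `v`, `f`, `g` with a class of test functions that is stable
under multiplication by `- i C_l`. -/
structure PairingData (P : Measure Ω) (T : ℝ≥0) (μ : Measure E3) (v f : ℝ≥0 → Ω → E3 → C6)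
    (g : Fin N → ℝ≥0 → Ω → E3 → C6) (C : Fin N → E3 → ℝ) (G : Fin N → E3 → E3)
    (𝒯 : (E3 → C6) → (E3 → C6) → Prop) : Prop where
  measurable_coeff : ∀ l, Measurable (C l)
  bound : ∃ K : ℝ≥0, ∀ l x, ‖Complex.I * (C l x : ℂ)‖ₑ ≤ K
  rot : ∀ l φ ψ, 𝒯 φ ψ → 𝒯 (rotTest (C l) φ) (rotTestImage (C l) (G l) φ ψ)
  slice : ∀ φ ψ, 𝒯 φ ψ → ∀ᵐ ω ∂P, ∀ t ≤ T, Integrable (fun x => inner ℂ (φ x) (v t ω x)) μ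
  drift : ∀ φ ψ, 𝒯 φ ψ → ∀ᵐ ω ∂P, Integrable
    (fun p : ℝ≥0 × E3 => driftZero (v p.1 ω) (f p.1 ω) φ ψ p.2) ((leb.restrict (Icc 0 T)).prod μ)
  cross : ∀ l φ ψ, 𝒯 φ ψ → ∀ᵐ ω ∂P, Integrable
    (fun p : ℝ≥0 × E3 => inner ℂ (crossTerm (G l p.2) (φ p.2)) (v p.1 ω p.2))
    ((leb.restrict (Icc 0 T)).prod μ)
  proc : ∀ φ ψ, 𝒯 φ ψ → ∀ᵐ ω ∂P, Integrable
    (fun p : ℝ≥0 × E3 => inner ℂ (φ p.2) (v p.1 ω p.2)) ((leb.restrict (Icc 0 T)).prod μ)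
  noise : ∀ l φ ψ, 𝒯 φ ψ → ∀ᵐ ω ∂P, Integrable
    (fun p : ℝ≥0 × E3 => inner ℂ (φ p.2) (g l p.1 ω p.2)) ((leb.restrict (Icc 0 T)).prod μ)
  energy : ∀ l φ ψ, 𝒯 φ ψ → ∃ κ : Ω → ℝ≥0∞, AEMeasurable κ P ∧ (∀ᵐ ω ∂P, κ ω < ∞) ∧
    ∀ᵐ ω ∂P, ∫⁻ s in Icc 0 T, (∫⁻ x, ‖inner ℂ (φ x) (g l s ω x)‖ₑ
      + ‖inner ℂ (φ x) (v s ω x)‖ₑ ∂μ) ^ 2 ∂leb ≤ κ ω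

theorem measurable_brPhase (hC : ∀ l, Measurable (C l))
    (hβ : ∀ l, Continuous fun t => (β l t ω : ℂ)) :
    Measurable fun p : ℝ≥0 × E3 => brPhase β C p.1 ω p.2 := by
  unfold brPhase
  refine Finset.measurable_fun_sum _ fun l _ => ?_
  exact ((hβ l).measurable.comp measurable_fst).mul
    ((Complex.measurable_ofReal.comp ((hC l).comp measurable_snd)).const_mul _)

theorem enorm_brPhase_le {K : ℝ≥0} (hK : ∀ l x, ‖Complex.I * (C l x : ℂ)‖ₑ ≤ K) {s : ℝ≥0}
    (hs : s ≤ T) (x : E3) :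
    ‖brPhase β C s ω x‖ₑ ≤ (∑ l, usup T (fun t ω => (β l t ω : ℂ)) ω) * K := by
  rw [Finset.sum_mul]
  refine (enorm_sum_le _ _).trans (Finset.sum_le_sum fun l _ => ?_)
  rw [enorm_mul]
  exact mul_le_mul' (le_usup (Y := fun t ω => (β l t ω : ℂ)) hs) (hK l x)

theorem exists_norm_brPhase_le (hK : ∃ K : ℝ≥0, ∀ l x, ‖Complex.I * (C l x : ℂ)‖ₑ ≤ K)
    (hβ : ∀ l, usup T (fun t ω => (β l t ω : ℂ)) ω < ∞) :
    ∃ R : ℝ, ∀ s ≤ T, ∀ x, ‖brPhase β C s ω x‖ ≤ R := by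
  obtain ⟨K, hK⟩ := hK
  have hfin : (∑ l, usup T (fun t ω => (β l t ω : ℂ)) ω) * K ≠ ∞ :=
    ENNReal.mul_ne_top (ENNReal.sum_ne_top.2 fun l _ => (hβ l).ne) ENNReal.coe_ne_top
  refine ⟨((∑ l, usup T (fun t ω => (β l t ω : ℂ)) ω) * K).toReal, fun s hs x => ?_⟩
  rw [← toReal_enorm]
  exact ENNReal.toReal_mono hfin (enorm_brPhase_le hK hs x)

theorem exists_norm_comp_brPhase_le (he : Continuous e)
    (hK : ∃ K : ℝ≥0, ∀ l x, ‖Complex.I * (C l x : ℂ)‖ₑ ≤ K)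
    (hβ : ∀ l, usup T (fun t ω => (β l t ω : ℂ)) ω < ∞) :
    ∃ M : ℝ, ∀ s ≤ T, ∀ x, ‖e (brPhase β C s ω x)‖ ≤ M := by
  obtain ⟨R, hR⟩ := exists_norm_brPhase_le hK hβ
  obtain ⟨M, hM⟩ := (isCompact_closedBall (0 : ℂ) R).exists_bound_of_continuousOn he.continuousOn
  exact ⟨M, fun s hs x => hM _ (by simpa using hR s hs x)⟩

theorem integrable_bdd_mul_prod {m d : ℝ≥0 × E3 → ℂ} [SFinite μ]
    (hd : Integrable d ((leb.restrict (Icc 0 T)).prod μ)) (hm : Measurable m)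
    (hM : ∃ M : ℝ, ∀ s ≤ T, ∀ x, ‖m (s, x)‖ ≤ M) :
    Integrable (fun p => m p * d p) ((leb.restrict (Icc 0 T)).prod μ) := by
  obtain ⟨M, hM⟩ := hM
  refine hd.bdd_mul (c := M) hm.aestronglyMeasurable ?_
  have h1 : ∀ᵐ p ∂(leb.restrict (Icc 0 T)).prod μ, p.1 ∈ Icc 0 T :=
    Measure.quasiMeasurePreserving_fst.ae (ae_restrict_mem measurableSet_Icc)
  filter_upwards [h1] with p hp using hM p.1 hp.2 p.2

/-- `⟨e(Θ) v(t), φ⟩` with `Θ = i ∑ C_l β_l`. -/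
noncomputable def procDens (β : Fin N → ℝ≥0 → Ω → ℝ) (C : Fin N → E3 → ℝ) (μ : Measure E3)
    (v : ℝ≥0 → Ω → E3 → C6) (e : ℂ → ℂ) (φ : E3 → C6) (t : ℝ≥0) (ω : Ω) : ℂ :=
  ∫ x, e (brPhase β C t ω x) * inner ℂ (φ x) (v t ω x) ∂μ

/-- The drift of `⟨e(Θ) v, φ⟩`; the arguments `e, e₁, e₂` stand for `e` and its derivatives. -/
noncomputable def driftDens (β : Fin N → ℝ≥0 → Ω → ℝ) (C : Fin N → E3 → ℝ) (G : Fin N → E3 → E3)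
    (μ : Measure E3) (v f : ℝ≥0 → Ω → E3 → C6) (g : Fin N → ℝ≥0 → Ω → E3 → C6) (e e₁ e₂ : ℂ → ℂ)
    (φ ψ : E3 → C6) (t : ℝ≥0) (ω : Ω) : ℂ :=
  ∫ x, e (brPhase β C t ω x) * driftZero (v t ω) (f t ω) φ ψ x
    + e₁ (brPhase β C t ω x) * driftOne (fun l => β l t ω) C G (v t ω) (fun l => g l t ω) φ x
    + e₂ (brPhase β C t ω x) * driftTwo C (v t ω) φ x ∂μ

/-- The noise coefficients of `⟨e(Θ) v, φ⟩`. -/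
noncomputable def noiseDens (β : Fin N → ℝ≥0 → Ω → ℝ) (C : Fin N → E3 → ℝ) (μ : Measure E3)
    (v : ℝ≥0 → Ω → E3 → C6) (g : Fin N → ℝ≥0 → Ω → E3 → C6) (e e₁ : ℂ → ℂ)
    (φ : E3 → C6) (j : Fin N) (t : ℝ≥0) (ω : Ω) : ℂ :=
  ∫ x, e (brPhase β C t ω x) * inner ℂ (φ x) (g j t ω x)
    + e₁ (brPhase β C t ω x) * (Complex.I * (C j x : ℂ) * inner ℂ (φ x) (v t ω x)) ∂μ

variable [IsProbabilityMeasure P] [SFinite μ]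

theorem IsBrownianFamily.ae_paths (hβ : IsBrownianFamily P F β) (T : ℝ≥0) :
    ∀ᵐ ω ∂P, (∀ l, Continuous fun t => (β l t ω : ℂ)) ∧
      ∀ l, usup T (fun t ω => (β l t ω : ℂ)) ω < ∞ := by
  filter_upwards [ae_all_iff.2 fun l => hβ.continuous l,
    ae_all_iff.2 fun l => (ofReal_brownian_version hβ l T).2] with ω h1 h2 using ⟨h1, h2⟩

variable {φ ψ : E3 → C6}

theorem PairingData.integrable_driftOne (hβ : IsBrownianFamily P F β)
    (D : PairingData P T μ v f g C G 𝒯) (hφ : 𝒯 φ ψ) : ∀ᵐ ω ∂P, Integrable (fun p : ℝ≥0 × E3 =>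
      driftOne (fun l => β l p.1 ω) C G (v p.1 ω) (fun l => g l p.1 ω) φ p.2)
      ((leb.restrict (Icc 0 T)).prod μ) := by
  filter_upwards [hβ.ae_paths T, ae_all_iff.2 fun l => D.cross l φ ψ hφ,
    ae_all_iff.2 fun l => D.noise l φ ψ hφ] with ω h1 h2 h3
  unfold driftOne
  refine integrable_finsetSum _ fun l _ => ?_
  obtain ⟨K, hK⟩ := D.bound
  refine (integrable_bdd_mul_prod (m := fun p => -Complex.I * (β l p.1 ω : ℂ)) (h2 l)
    (((h1.1 l).measurable.comp measurable_fst).const_mul _) ?_).add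
    (integrable_bdd_mul_prod (m := fun p => Complex.I * (C l p.2 : ℂ)) (h3 l)
      ((Complex.measurable_ofReal.comp ((D.measurable_coeff l).comp measurable_snd)).const_mul _) ?_)
  · refine ⟨(usup T (fun t ω => (β l t ω : ℂ)) ω).toReal, fun s hs x => ?_⟩
    rw [norm_mul, norm_neg, Complex.norm_I, one_mul, ← toReal_enorm]
    exact ENNReal.toReal_mono (h1.2 l).ne (le_usup (Y := fun t ω => (β l t ω : ℂ)) hs)
  · refine ⟨K, fun s hs x => ?_⟩
    rw [← toReal_enorm]
    exact ENNReal.toReal_mono ENNReal.coe_ne_top (hK l x)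

theorem PairingData.integrable_coeff_proc (D : PairingData P T μ v f g C G 𝒯) (hφ : 𝒯 φ ψ)
    (l : Fin N) : ∀ᵐ ω ∂P, Integrable (fun p : ℝ≥0 × E3 =>
      Complex.I * (C l p.2 : ℂ) * inner ℂ (φ p.2) (v p.1 ω p.2))
      ((leb.restrict (Icc 0 T)).prod μ) := by
  filter_upwards [D.proc φ ψ hφ] with ω h1
  obtain ⟨K, hK⟩ := D.bound
  refine integrable_bdd_mul_prod (m := fun p => Complex.I * (C l p.2 : ℂ)) h1
    ((Complex.measurable_ofReal.comp ((D.measurable_coeff l).comp measurable_snd)).const_mul _)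
    ⟨K, fun s hs x => ?_⟩
  rw [← toReal_enorm]
  exact ENNReal.toReal_mono ENNReal.coe_ne_top (hK l x)

theorem PairingData.integrable_driftTwo (D : PairingData P T μ v f g C G 𝒯) (hφ : 𝒯 φ ψ) :
    ∀ᵐ ω ∂P, Integrable (fun p : ℝ≥0 × E3 => driftTwo C (v p.1 ω) φ p.2)
      ((leb.restrict (Icc 0 T)).prod μ) := by
  filter_upwards [ae_all_iff.2 fun l => D.integrable_coeff_proc (D.rot l φ ψ hφ) l] with ω h1
  unfold driftTwo
  refine Integrable.const_mul (integrable_finsetSum _ fun l _ => ?_) _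
  refine (h1 l).congr (ae_of_all _ fun p => ?_)
  simp only [inner_rotTest]
  ring

theorem PairingData.integrable_drift (hβ : IsBrownianFamily P F β)
    (D : PairingData P T μ v f g C G 𝒯) (hφ : 𝒯 φ ψ) {e e₁ e₂ : ℂ → ℂ} (he : Continuous e)
    (he₁ : Continuous e₁) (he₂ : Continuous e₂) : ∀ᵐ ω ∂P, Integrable (fun p : ℝ≥0 × E3 =>
      e (brPhase β C p.1 ω p.2) * driftZero (v p.1 ω) (f p.1 ω) φ ψ p.2
      + e₁ (brPhase β C p.1 ω p.2)
        * driftOne (fun l => β l p.1 ω) C G (v p.1 ω) (fun l => g l p.1 ω) φ p.2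
      + e₂ (brPhase β C p.1 ω p.2) * driftTwo C (v p.1 ω) φ p.2)
      ((leb.restrict (Icc 0 T)).prod μ) := by
  filter_upwards [hβ.ae_paths T, D.drift φ ψ hφ, D.integrable_driftOne hβ hφ,
    D.integrable_driftTwo hφ] with ω h1 h2 h3 h4
  have hm := measurable_brPhase D.measurable_coeff h1.1
  refine ((integrable_bdd_mul_prod h2 (he.measurable.comp hm) ?_).add
    (integrable_bdd_mul_prod h3 (he₁.measurable.comp hm) ?_)).add
    (integrable_bdd_mul_prod h4 (he₂.measurable.comp hm) ?_)
  · exact exists_norm_comp_brPhase_le he D.bound h1.2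
  · exact exists_norm_comp_brPhase_le he₁ D.bound h1.2
  · exact exists_norm_comp_brPhase_le he₂ D.bound h1.2

theorem PairingData.integrable_noise (hβ : IsBrownianFamily P F β)
    (D : PairingData P T μ v f g C G 𝒯) (hφ : 𝒯 φ ψ) {e e₁ : ℂ → ℂ} (he : Continuous e)
    (he₁ : Continuous e₁) (j : Fin N) : ∀ᵐ ω ∂P, Integrable (fun p : ℝ≥0 × E3 =>
      e (brPhase β C p.1 ω p.2) * inner ℂ (φ p.2) (g j p.1 ω p.2)
      + e₁ (brPhase β C p.1 ω p.2) * (Complex.I * (C j p.2 : ℂ) * inner ℂ (φ p.2) (v p.1 ω p.2)))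
      ((leb.restrict (Icc 0 T)).prod μ) := by
  filter_upwards [hβ.ae_paths T, D.noise j φ ψ hφ, D.integrable_coeff_proc hφ j] with ω h1 h2 h3
  have hm := measurable_brPhase D.measurable_coeff h1.1
  refine (integrable_bdd_mul_prod h2 (he.measurable.comp hm) ?_).add
    (integrable_bdd_mul_prod h3 (he₁.measurable.comp hm) ?_)
  · exact exists_norm_comp_brPhase_le he D.bound h1.2
  · exact exists_norm_comp_brPhase_le he₁ D.bound h1.2

theorem PairingData.integrable_proc (hβ : IsBrownianFamily P F β)
    (D : PairingData P T μ v f g C G 𝒯) (hφ : 𝒯 φ ψ) (he : Continuous e) :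
    ∀ᵐ ω ∂P, ∀ t ≤ T, Integrable (fun x => e (brPhase β C t ω x) * inner ℂ (φ x) (v t ω x)) μ := by
  filter_upwards [hβ.ae_paths T, D.slice φ ψ hφ] with ω h1 h2 t ht
  have hm := measurable_brPhase D.measurable_coeff h1.1
  obtain ⟨M, hM⟩ := exists_norm_comp_brPhase_le he D.bound h1.2
  refine (h2 t ht).bdd_mul (c := M) ?_ (ae_of_all _ fun x => hM t ht x)
  exact (he.measurable.comp (hm.comp measurable_prodMk_left)).aestronglyMeasurable

/-- The Itô formula for polynomials of the phase. -/
theorem PairingData.itoRep_polynomial (hF : UsualConditions P F) (hβ : IsBrownianFamily P F β)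
    (D : PairingData P T μ v f g C G 𝒯)
    (H : ∀ φ ψ, 𝒯 φ ψ → ItoRep P F β T (fun t ω => ∫ x, inner ℂ (φ x) (v t ω x) ∂μ)
      (fun t ω => ∫ x, driftZero (v t ω) (f t ω) φ ψ x ∂μ)
      (fun j t ω => ∫ x, inner ℂ (φ x) (g j t ω x) ∂μ)) (p : Polynomial ℂ) :
    ∀ φ ψ, 𝒯 φ ψ → ItoRep P F β T (procDens β C μ v p.eval φ)
      (driftDens β C G μ v f g p.eval p.derivative.eval p.derivative.derivative.eval φ ψ)
      (noiseDens β C μ v g p.eval p.derivative.eval φ) := by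
  have hcont : ∀ p : Polynomial ℂ, Continuous fun z => p.eval z := fun p => p.continuous
  induction p using Polynomial.induction_on with
  | C a =>
    intro φ ψ hφ
    have h1 := (H φ ψ hφ).const_mul a
    refine (h1.congr_of_eqOn fun t _ ω => ?_).congr ?_ fun k => ?_
    · simp [procDens, integral_const_mul]
    · refine ae_of_all _ fun ω => ae_of_all _ fun s => ?_
      simp [driftDens, integral_const_mul]
    · refine ae_of_all _ fun ω => ae_of_all _ fun s => ?_
      simp [noiseDens, integral_const_mul]
  | add p q hp hq =>
    intro φ ψ hφ
    refine (((hp φ ψ hφ).add (hq φ ψ hφ)).congr_process hF ?_).congr ?_ fun k => ?_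
    · filter_upwards [D.integrable_proc hβ hφ (hcont p), D.integrable_proc hβ hφ (hcont q)]
        with ω h1 h2 t ht
      simp only [procDens]
      rw [← integral_add (h1 t ht) (h2 t ht)]
      refine integral_congr_ae (ae_of_all _ fun x => ?_)
      simp only [Polynomial.eval_add]
      ring
    · filter_upwards [D.integrable_drift hβ hφ (hcont p) (hcont _) (hcont p.derivative.derivative),
        D.integrable_drift hβ hφ (hcont q) (hcont _) (hcont q.derivative.derivative)] with ω h1 h2
      filter_upwards [h1.prod_right_ae, h2.prod_right_ae] with s h3 h4
      simp only [driftDens]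
      rw [← integral_add h3 h4]
      refine integral_congr_ae (ae_of_all _ fun x => ?_)
      simp only [Polynomial.eval_add, Polynomial.derivative_add]
      ring
    · filter_upwards [D.integrable_noise hβ hφ (hcont p) (hcont p.derivative) k,
        D.integrable_noise hβ hφ (hcont q) (hcont q.derivative) k] with ω h1 h2
      filter_upwards [h1.prod_right_ae, h2.prod_right_ae] with s h3 h4
      simp only [noiseDens]
      rw [← integral_add h3 h4]
      refine integral_congr_ae (ae_of_all _ fun x => ?_)
      simp only [Polynomial.eval_add, Polynomial.derivative_add]
      ring
  | monomial n a ih =>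
    intro φ ψ hφ
    have hX : Polynomial.C a * Polynomial.X ^ (n + 1)
        = Polynomial.X * (Polynomial.C a * Polynomial.X ^ n) := by ring
    rw [hX]
    generalize Polynomial.C a * Polynomial.X ^ n = p at ih
    -- With z = ∑ β_l · i C_l, the factor i C_l of z p(z) is moved to the test function, where the
    -- induction hypothesis applies, and β_l is a scalar factor handled by the product rule.
    have h1 := ItoRep.sum Finset.univ fun l _ => (ih _ _ (D.rot l φ ψ hφ)).brownian_mul hF hβ l
    refine (h1.congr_process hF ?_).congr ?_ fun k => ?_
    · filter_upwards [ae_all_iff.2 fun l => D.integrable_proc hβ (D.rot l φ ψ hφ) (hcont p)]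
        with ω h2 t ht
      simp only [procDens, ← integral_const_mul]
      rw [← integral_finsetSum _ fun l _ => (h2 l t ht).const_mul _]
      refine integral_congr_ae (ae_of_all _ fun x => ?_)
      simp only [inner_rotTest, Polynomial.eval_mul, Polynomial.eval_X]
      rw [brPhase, Finset.sum_mul, Finset.sum_mul]
      exact Finset.sum_congr rfl fun l _ => by ring
    · filter_upwards [ae_all_iff.2 fun l => D.integrable_drift hβ (D.rot l φ ψ hφ) (hcont p)
        (hcont p.derivative) (hcont p.derivative.derivative), ae_all_iff.2 fun l =>
          D.integrable_noise hβ (D.rot l φ ψ hφ) (hcont p) (hcont p.derivative) l] with ω h2 h3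
      filter_upwards [ae_all_iff.2 fun l => (h2 l).prod_right_ae,
        ae_all_iff.2 fun l => (h3 l).prod_right_ae] with s h4 h5
      simp only [driftDens, noiseDens, ← integral_const_mul]
      rw [Finset.sum_add_distrib, ← integral_finsetSum _ fun l _ => (h4 l).const_mul _,
        ← integral_finsetSum _ fun l _ => h5 l, ← integral_add (integrable_finsetSum _ fun l _ =>
          (h4 l).const_mul _) (integrable_finsetSum _ fun l _ => h5 l)]
      refine integral_congr_ae (ae_of_all _ fun x => ?_)
      beta_reduce
      rw [← Finset.sum_add_distrib]
      exact sum_drift_rot p (fun l => β l s ω) C G (v s ω) (f s ω) φ ψ (fun l => g l s ω) x _ rfl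
    · filter_upwards [ae_all_iff.2 fun l => D.integrable_noise hβ (D.rot l φ ψ hφ) (hcont p)
        (hcont p.derivative) k, D.integrable_proc hβ (D.rot k φ ψ hφ) (hcont p)] with ω h2 h3
      filter_upwards [ae_all_iff.2 fun l => (h2 l).prod_right_ae, ae_pos_Icc T] with s h4 h5
      have h6 := h3 s h5.2
      simp only [procDens, noiseDens, ← integral_const_mul, Finset.sum_add_distrib,
        Finset.sum_ite_eq, Finset.mem_univ, if_true]
      rw [← integral_finsetSum _ fun l _ => (h4 l).const_mul _,
        ← integral_add (integrable_finsetSum _ fun l _ => (h4 l).const_mul _) h6]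
      refine integral_congr_ae (ae_of_all _ fun x => ?_)
      simp only [inner_rotTest, Polynomial.eval_mul, Polynomial.eval_X, Polynomial.derivative_mul,
        Polynomial.derivative_X, Polynomial.eval_add, one_mul]
      set z := brPhase β C s ω x with hz
      have e1 : ∀ l, (β l s ω : ℂ) * (p.eval z * (Complex.I * (C l x : ℂ)
            * inner ℂ (φ x) (g k s ω x)) + p.derivative.eval z * (Complex.I * (C k x : ℂ)
              * (Complex.I * (C l x : ℂ) * inner ℂ (φ x) (v s ω x))))
          = ((β l s ω : ℂ) * (Complex.I * (C l x : ℂ))) * (p.eval z * inner ℂ (φ x) (g k s ω x)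
            + p.derivative.eval z * (Complex.I * (C k x : ℂ) * inner ℂ (φ x) (v s ω x))) :=
        fun l => by ring
      simp only [e1, ← Finset.sum_mul]
      have e2 : ∑ l, (β l s ω : ℂ) * (Complex.I * (C l x : ℂ)) = z := rfl
      rw [e2]
      ring

theorem enorm_add_mul_le {a b c : ℂ} {x y z : ℂ} {δ : ℝ≥0∞} (ha : ‖a‖ₑ ≤ δ) (hb : ‖b‖ₑ ≤ δ)
    (hc : ‖c‖ₑ ≤ δ) : ‖a * x + b * y + c * z‖ₑ ≤ δ * (‖x‖ₑ + ‖y‖ₑ + ‖z‖ₑ) := by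
  refine (enorm_add_le _ _).trans ((add_le_add_left (enorm_add_le _ _) _).trans ?_)
  rw [enorm_mul, enorm_mul, enorm_mul, mul_add, mul_add]
  gcongr

/-- The Itô formula for the exponential of the phase. -/
theorem PairingData.itoRep_exp (hF : UsualConditions P F) (hβ : IsBrownianFamily P F β)
    (D : PairingData P T μ v f g C G 𝒯)
    (H : ∀ φ ψ, 𝒯 φ ψ → ItoRep P F β T (fun t ω => ∫ x, inner ℂ (φ x) (v t ω x) ∂μ)
      (fun t ω => ∫ x, driftZero (v t ω) (f t ω) φ ψ x ∂μ)
      (fun j t ω => ∫ x, inner ℂ (φ x) (g j t ω x) ∂μ)) (hφ : 𝒯 φ ψ)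
    (hc : ∀ᵐ ω ∂P, ContinuousOn (fun t => procDens β C μ v Complex.exp φ t ω) (Icc 0 T)) :
    ItoRep P F β T (procDens β C μ v Complex.exp φ)
      (driftDens β C G μ v f g Complex.exp Complex.exp Complex.exp φ ψ)
      (noiseDens β C μ v g Complex.exp Complex.exp φ) := by
  have hcont : ∀ p : Polynomial ℂ, Continuous fun z => p.eval z := fun p => p.continuous
  have hexp := Complex.continuous_exp
  obtain ⟨K, hK⟩ := D.bound
  have hS : ∀ ω, (∀ l, usup T (fun t ω => (β l t ω : ℂ)) ω < ∞) → ∃ R : ℝ≥0,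
      (∑ l, usup T (fun t ω => (β l t ω : ℂ)) ω) * K = R := by
    intro ω hω
    exact ⟨_, (ENNReal.coe_toNNReal (ENNReal.mul_ne_top
      (ENNReal.sum_ne_top.2 fun l _ => (hω l).ne) (ENNReal.coe_ne_top (r := K)))).symm⟩
  refine ItoRep.of_tendsto hF hβ (fun n => D.itoRep_polynomial hF hβ H (expPoly (n + 2)) φ ψ hφ)
    hc ?_ ?_ ?_ ?_ ?_
  · filter_upwards [hβ.ae_paths T, D.slice φ ψ hφ, D.integrable_proc hβ hφ hexp,
      ae_all_iff.2 fun n => D.integrable_proc hβ hφ (hcont (expPoly (n + 2)))] with ω h1 h2 h3 h4 t ht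
    -- Convergence is required for each path separately, so the radius of the disc containing the
    -- phase may depend on ω.
    obtain ⟨R, hR⟩ := hS ω h1.2
    obtain ⟨c, hc0, hcfin, hcb⟩ := exists_expPoly_bound R
    refine tendsto_integral_of_L1 _ (h3 t ht).1 (Eventually.of_forall fun n => h4 n t ht) ?_
    refine tendsto_of_tendsto_of_tendsto_of_le_of_le (h := fun n => c n *
      ∫⁻ x, ‖inner ℂ (φ x) (v t ω x)‖ₑ ∂μ) tendsto_const_nhds ?_ (fun _ => zero_le) fun n => ?_
    · simpa using ENNReal.Tendsto.mul_const hc0 (Or.inr (h2 t ht).2.ne)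
    · beta_reduce
      rw [← lintegral_const_mul'' _ (h2 t ht).1.enorm]
      refine lintegral_mono fun x => ?_
      rw [← sub_mul, enorm_mul]
      exact mul_le_mul_left ((hcb n _ ((enorm_brPhase_le hK ht x).trans hR.le)).1) _
  · filter_upwards [D.integrable_drift hβ hφ hexp hexp hexp] with ω h1 using h1.integral_prod_left
  · filter_upwards [hβ.ae_paths T, D.integrable_drift hβ hφ hexp hexp hexp,
      ae_all_iff.2 fun n => D.integrable_drift hβ hφ (hcont (expPoly (n + 2))) (hcont _)
        (hcont (expPoly (n + 2)).derivative.derivative), D.drift φ ψ hφ,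
      D.integrable_driftOne hβ hφ, D.integrable_driftTwo hφ] with ω h1 h2 h3 h4 h5 h6
    obtain ⟨R, hR⟩ := hS ω h1.2
    obtain ⟨c, hc0, hcfin, hcb⟩ := exists_expPoly_bound R
    have hfin : ∫⁻ s in Icc 0 T, ∫⁻ x, (‖driftZero (v s ω) (f s ω) φ ψ x‖ₑ
        + ‖driftOne (fun l => β l s ω) C G (v s ω) (fun l => g l s ω) φ x‖ₑ
        + ‖driftTwo C (v s ω) φ x‖ₑ) ∂μ ∂leb ≠ ∞ := by
      have hm : AEMeasurable (fun p : ℝ≥0 × E3 => ‖driftZero (v p.1 ω) (f p.1 ω) φ ψ p.2‖ₑ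
          + ‖driftOne (fun l => β l p.1 ω) C G (v p.1 ω) (fun l => g l p.1 ω) φ p.2‖ₑ
          + ‖driftTwo C (v p.1 ω) φ p.2‖ₑ) ((leb.restrict (Icc 0 T)).prod μ) :=
        (h4.1.enorm.add h5.1.enorm).add h6.1.enorm
      rw [← lintegral_prod _ hm, lintegral_add_right' _ h6.1.enorm, lintegral_add_right' _ h5.1.enorm]
      exact ENNReal.add_ne_top.2 ⟨ENNReal.add_ne_top.2 ⟨h4.2.ne, h5.2.ne⟩, h6.2.ne⟩
    refine tendsto_of_tendsto_of_tendsto_of_le_of_le tendsto_const_nhds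
      (by simpa using ENNReal.Tendsto.mul_const hc0 (Or.inr hfin)) (fun _ => zero_le) fun n => ?_
    beta_reduce
    rw [← lintegral_const_mul' _ _ (hcfin n)]
    refine lintegral_mono_ae ?_
    filter_upwards [h2.prod_right_ae, (h3 n).prod_right_ae, ae_pos_Icc T] with s h7 h8 h9
    simp only [driftDens]
    rw [← integral_sub h8 h7]
    refine (enorm_integral_le_lintegral_enorm _).trans ?_
    rw [← lintegral_const_mul' _ _ (hcfin n)]
    refine lintegral_mono fun x => ?_
    have hz := hcb n _ ((enorm_brPhase_le hK h9.2 x).trans hR.le)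
    refine le_trans (le_of_eq ?_) (enorm_add_mul_le hz.1 hz.2.1 hz.2.2)
    congr 1
    ring
  · intro k
    filter_upwards [D.integrable_noise hβ hφ hexp hexp k] with ω h1
    exact h1.integral_prod_left.1
  · intro k
    obtain ⟨κ, hκ, hκfin, hκb⟩ := D.energy k φ ψ hφ
    have hSm : AEMeasurable (fun ω => ∑ l, usup T (fun t ω => (β l t ω : ℂ)) ω) P :=
      Finset.aemeasurable_fun_sum _ fun l _ => (ofReal_brownian_version hβ l T).1
    -- The noise coefficients must converge in probability, so the radius has to be uniform: the
    -- argument is restricted to the event that the suprema of the Brownian paths add up to at most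
    -- R. The factor 1 + K dominates the weight 1 of g as well as the weight |C_k| of v.
    refine PNull.of_tight fun η hη => ?_
    obtain ⟨R, hR⟩ := tight_of_aemeasurable hSm ((hβ.ae_paths T).mono fun ω hω =>
      ENNReal.sum_lt_top.2 fun l _ => hω.2 l) hη
    obtain ⟨c, hc0, hcfin, hcb⟩ := exists_expPoly_bound (R * K)
    refine ⟨_, hR, fun n ω => κ ω * (c n * (1 + K)) ^ 2, PNull.mul_tight (PNull.const ?_) hκ hκfin,
      fun n => ?_⟩
    · have h1 := ENNReal.Tendsto.mul_const (b := 1 + (K : ℝ≥0∞)) hc0 (Or.inr (by finiteness))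
      simpa using ENNReal.Tendsto.pow (n := 2) h1
    filter_upwards [hκb, D.integrable_noise hβ hφ hexp hexp k,
      D.integrable_noise hβ hφ (hcont (expPoly (n + 2))) (hcont (expPoly (n + 2)).derivative) k]
      with ω h1 h2 h3 hω
    rw [mul_comm]
    refine le_trans ?_ (mul_le_mul_right h1 _)
    have hcK : c n * (1 + K) ≠ ∞ := ENNReal.mul_ne_top (hcfin n) (by finiteness)
    rw [← lintegral_const_mul' _ _ (ENNReal.pow_ne_top hcK)]
    refine lintegral_mono_ae ?_
    filter_upwards [h2.prod_right_ae, h3.prod_right_ae, ae_pos_Icc T] with s h7 h8 h9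
    rw [← mul_pow]
    refine pow_le_pow_left' ?_ 2
    simp only [noiseDens]
    rw [← integral_sub h8 h7]
    refine (enorm_integral_le_lintegral_enorm _).trans ?_
    rw [← lintegral_const_mul' _ _ hcK]
    refine lintegral_mono fun x => ?_
    have hz := hcb n (brPhase β C s ω x) ((enorm_brPhase_le hK h9.2 x).trans (by
      rw [ENNReal.coe_mul]
      exact mul_le_mul_left hω _))
    have e : ∀ a b a' b' y z : ℂ, (a * y + b * z) - (a' * y + b' * z) = (a - a') * y + (b - b') * z :=
      fun a b a' b' y z => by ring
    beta_reduce
    rw [e]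
    refine (enorm_add_le _ _).trans ?_
    rw [enorm_mul, enorm_mul, enorm_mul (Complex.I * _), mul_add]
    refine add_le_add ?_ ?_
    · refine mul_le_mul_left (hz.1.trans ?_) _
      exact le_mul_of_one_le_right zero_le le_self_add
    · rw [← mul_assoc]
      refine mul_le_mul_left (mul_le_mul' hz.2.1 ((hK k x).trans le_add_self)) _

end ExpTransform

/-! ### Shifted mollifiers -/

/-- A bump function centred at `- δ e`. -/
noncomputable def shiftBump (e : E3) (δ : ℝ) {r : ℝ} (hr : 0 < r) : ContDiffBump (-(δ • e)) :=
  ⟨r / 2, r, half_pos hr, half_lt_self hr⟩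

/-- The shifted mollification `x ↦ ∫ f(y) ρ(x - y) dy`, which averages `f` near `x + δ e`. -/
noncomputable def moll (e : E3) (δ : ℝ) {r : ℝ} (hr : 0 < r) (f : E3 → ℝ) (x : E3) : ℝ :=
  ∫ y, f y * (shiftBump e δ hr).normed volume (x - y)

section Moll

variable {e : E3} {δ r : ℝ} {hr : 0 < r} {f : E3 → ℝ}

theorem moll_eq_convolution : moll e δ hr f
    = convolution f ((shiftBump e δ hr).normed volume) (ContinuousLinearMap.lsmul ℝ ℝ) volume := by
  funext x
  simp [moll, convolution]

theorem contDiff_moll (hf : LocallyIntegrable f) : ContDiff ℝ (⊤ : ℕ∞) (moll e δ hr f) := by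
  rw [moll_eq_convolution]
  exact HasCompactSupport.contDiff_convolution_right _ (ContDiffBump.hasCompactSupport_normed _) hf
    (ContDiffBump.contDiff_normed _)

theorem fderiv_moll (hf : LocallyIntegrable f) (x v : E3) :
    fderiv ℝ (moll e δ hr f) x v
      = ∫ y, f y * fderiv ℝ ((shiftBump e δ hr).normed volume) (x - y) v := by
  have hc := (shiftBump e δ hr).hasCompactSupport_normed (μ := volume)
  have hd : ContDiff ℝ 1 ((shiftBump e δ hr).normed volume) :=
    (shiftBump e δ hr).contDiff_normed (n := 1)
  have h1 := hc.hasFDerivAt_convolution_right (ContinuousLinearMap.lsmul ℝ ℝ) hf hd x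
  rw [moll_eq_convolution, h1.fderiv, convolution_precompR_apply _ hf (hc.fderiv ℝ)
    (hd.continuous_fderiv one_ne_zero)]
  simp [convolution]

theorem abs_moll_le {K : ℝ} (hK : ∀ x, |f x| ≤ K) (x : E3) : |moll e δ hr f x| ≤ K := by
  set ρ := (shiftBump e δ hr).normed volume with hρ
  have h1 : ∫ y, ρ (x - y) = 1 := by
    rw [integral_sub_left_eq_self ρ volume x, hρ, ContDiffBump.integral_normed]
  have hi : Integrable (fun y => ρ (x - y)) :=
    ((shiftBump e δ hr).integrable_normed (μ := volume)).comp_sub_left x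
  calc |moll e δ hr f x| ≤ ∫ y, K * ρ (x - y) := by
        rw [← Real.norm_eq_abs]
        refine norm_integral_le_of_norm_le (hi.const_mul K) (ae_of_all _ fun y => ?_)
        rw [norm_mul, Real.norm_eq_abs, Real.norm_eq_abs, abs_of_nonneg (ContDiffBump.nonneg_normed _ _)]
        exact mul_le_mul_of_nonneg_right (hK y) (ContDiffBump.nonneg_normed _ _)
    _ = K := by rw [integral_const_mul, h1, mul_one]

/-- The averaging balls have radius c d and centre x + d e, so they need not contain x; but x stays
within a fixed multiple ‖e‖/c of the radius, and Lebesgue differentiation tolerates such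
eccentricity. The kernel is at most 2^dim divided by the volume of the ball, its inner radius being
half the outer one. -/
theorem ae_tendsto_moll (hf : LocallyIntegrable f) (e : E3) {c : ℝ} (hc : 0 < c) {d : ℕ → ℝ}
    (hd0 : ∀ n, 0 < d n) (hd : Tendsto d atTop (𝓝 0)) :
    ∀ᵐ x, Tendsto (fun n => moll e (d n) (mul_pos hc (hd0 n)) f x) atTop (𝓝 (f x)) := by
  filter_upwards [IsUnifLocDoublingMeasure.ae_tendsto_average_norm_sub volume hf (‖e‖ / c)] with x hx
  have hcd : Tendsto (fun n => c * d n) atTop (𝓝[>] 0) := by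
    refine tendsto_nhdsWithin_iff.2 ⟨by simpa using hd.const_mul c, ?_⟩
    exact Eventually.of_forall fun n => mul_pos hc (hd0 n)
  have h1 := hx (fun n => x + d n • e) (fun n => c * d n) hcd (Eventually.of_forall fun n => by
    rw [Metric.mem_closedBall, dist_eq_norm, sub_add_cancel_left, norm_neg, norm_smul,
      Real.norm_eq_abs, abs_of_pos (hd0 n)]
    refine le_of_eq ?_
    field_simp)
  have h2 := tendsto_integral_smul_of_tendsto_average_norm_sub (μ := volume)
    (a := fun n => Metric.closedBall (x + d n • e) (c * d n))
    (g := fun n y => (shiftBump e (d n) (mul_pos hc (hd0 n))).normed volume (x - y))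
    (f := f) (c := f x) (l := atTop) (2 ^ Module.finrank ℝ E3) h1
    (Eventually.of_forall fun n => hf.integrableOn_isCompact (isCompact_closedBall _ _)) ?_ ?_ ?_
  · refine h2.congr fun n => ?_
    simp [moll, mul_comm]
  · refine tendsto_const_nhds.congr fun n => ?_
    rw [integral_sub_left_eq_self (fun y => (shiftBump e (d n) _).normed volume y) volume x,
      ContDiffBump.integral_normed]
  · refine Eventually.of_forall fun n y hy => ?_
    have : x - y ∈ Function.support ((shiftBump e (d n) (mul_pos hc (hd0 n))).normed volume) := hy
    rw [ContDiffBump.support_normed_eq, Metric.mem_ball, dist_eq_norm] at this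
    rw [Metric.mem_closedBall, dist_eq_norm, ← norm_neg]
    refine le_trans (le_of_eq ?_) this.le
    congr 1
    abel
  · refine Eventually.of_forall fun n y => ?_
    rw [abs_of_nonneg (ContDiffBump.nonneg_normed _ _)]
    refine (ContDiffBump.normed_le_div_measure_closedBall_rOut _ volume 2 ?_ _).trans (le_of_eq ?_)
    · simp [shiftBump]
      linarith
    · rw [Measure.addHaar_real_closedBall_center, Measure.addHaar_real_closedBall_center volume
        (x + d n • e)]
      rfl

end Moll

/-- Near every point, `D` can be shifted inside itself. -/
def ShiftCover (D : Set E3) : Prop :=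
  ∀ p : E3, ∃ r > 0, ∃ e : E3, ∃ c > 0, ∃ δ₀ > 0, ∀ δ : ℝ, 0 < δ → δ < δ₀ →
    ∀ x ∈ D ∩ Metric.ball p r, ∀ w : E3, ‖w - δ • e‖ ≤ c * δ → x + w ∈ D

/-- The kernel y ↦ ρ(x - y) is supported in a ball around x + δ e that lies inside D, so it is an
admissible test function for the weak gradient even if x is close to the boundary. -/
theorem fderiv_moll_eq {D : Set E3} (hD : MeasurableSet D) {b : E3 → ℝ} {G : E3 → E3}
    (hG : HasWeakGradient D b G) (hb : LocallyIntegrable (D.indicator b)) {e : E3} {δ r : ℝ}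
    {hr : 0 < r} {x : E3} (hx : ∀ w : E3, ‖w - δ • e‖ ≤ r → x + w ∈ D) (i : Fin 3) :
    fderiv ℝ (moll e δ hr (D.indicator b)) x (EuclideanSpace.single i 1)
      = moll e δ hr (D.indicator fun y => G y i) x := by
  set ρ := (shiftBump e δ hr).normed volume with hρ
  have hρd : ContDiff ℝ (⊤ : ℕ∞) ρ := (shiftBump e δ hr).contDiff_normed
  have hts : tsupport (fun y => ρ (x - y)) ⊆ Metric.closedBall (x + δ • e) r := by
    refine closure_minimal (fun y hy => ?_) Metric.isClosed_closedBall
    have : x - y ∈ Function.support ρ := hy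
    rw [ContDiffBump.support_normed_eq, Metric.mem_ball, dist_eq_norm] at this
    rw [Metric.mem_closedBall, dist_eq_norm, ← norm_neg]
    refine le_trans (le_of_eq ?_) this.le
    congr 1
    abel
  have h1 := hG (fun y => ρ (x - y)) (hρd.comp (contDiff_const.sub contDiff_id))
    (HasCompactSupport.of_support_subset_isCompact (isCompact_closedBall (x + δ • e) r)
      (subset_closure.trans hts)) (hts.trans fun y hy => by
        have h2 := hx (y - x) (by
          rw [Metric.mem_closedBall, dist_eq_norm] at hy
          rwa [sub_sub])
        simpa using h2) i
  have h2 : ∀ y, fderiv ℝ (fun y => ρ (x - y)) y (EuclideanSpace.single i 1)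
      = -fderiv ℝ ρ (x - y) (EuclideanSpace.single i 1) := by
    intro y
    have h3 : HasFDerivAt (fun y => x - y) (-ContinuousLinearMap.id ℝ E3) y :=
      (hasFDerivAt_id y).const_sub x
    have h4 := ((hρd.differentiable (by simp)) (x - y)).hasFDerivAt.comp y h3
    rw [show (fun y => ρ (x - y)) = ρ ∘ fun y => x - y from rfl, h4.fderiv]
    simp
  simp only [h2, mul_neg, integral_neg, neg_inj] at h1
  rw [← integral_indicator hD, ← integral_indicator hD] at h1
  rw [fderiv_moll hb, moll]
  refine (integral_congr_ae (ae_of_all _ fun y => ?_)).trans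
    (h1.trans (integral_congr_ae (ae_of_all _ fun y => ?_)))
  · by_cases hy : y ∈ D <;> simp [hy, hρ]
  · by_cases hy : y ∈ D <;> simp [hy, hρ]

/-! ### The Leibniz rule for the weak curl -/

theorem curl_smul {s : E3 → ℂ} {Φ : E3 → Fin 3 → ℂ} {x : E3} (hs : DifferentiableAt ℝ s x)
    (hΦ : DifferentiableAt ℝ Φ x) : curl (fun y => s y • Φ y) x = s x • curl Φ x
      + crossProduct (fun i => fderiv ℝ s x (EuclideanSpace.single i 1)) (Φ x) := by
  have h1 : ∀ i k : Fin 3, fderiv ℝ (fun y => s y • Φ y) x (EuclideanSpace.single i 1) k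
      = s x * fderiv ℝ Φ x (EuclideanSpace.single i 1) k
        + fderiv ℝ s x (EuclideanSpace.single i 1) * Φ x k := by
    intro i k
    rw [fderiv_fun_smul hs hΦ]
    simp
  ext k
  fin_cases k <;> simp [curl, h1, cross_apply] <;> ring

theorem curl_eq_zero_of_notMem {Φ : E3 → Fin 3 → ℂ} {x : E3} (hx : x ∉ tsupport Φ) :
    curl Φ x = 0 := by
  have : fderiv ℝ Φ x = 0 := image_eq_zero_of_notMem_tsupport fun h => hx (tsupport_fderiv_subset ℝ h)
  ext k
  fin_cases k <;> simp [curl, this]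

theorem continuous_curl {Φ : E3 → Fin 3 → ℂ} (hΦ : ContDiff ℝ (⊤ : ℕ∞) Φ) : Continuous (curl Φ) := by
  have h1 : Continuous (fderiv ℝ Φ) := hΦ.continuous_fderiv (by simp)
  have h2 : ∀ i k : Fin 3, Continuous fun x => fderiv ℝ Φ x (EuclideanSpace.single i 1) k :=
    fun i k => (continuous_apply k).comp (h1.clm_apply continuous_const)
  refine continuous_pi fun k => ?_
  fin_cases k <;> simp only [curl] <;> simp <;> exact (h2 _ _).sub (h2 _ _)

theorem cross_dot_comm (a b c : Fin 3 → ℂ) :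
    crossProduct a b ⬝ᵥ c = -(b ⬝ᵥ crossProduct a c) := by
  simp [cross_apply, dotProduct, Fin.sum_univ_three]
  ring

section Leibniz

variable {D D' : Set E3} {b : E3 → ℝ} {G : E3 → E3} {K : ℝ} {E : ℝ → ℂ} {g h : E3 → Fin 3 → ℂ}
  {Φ : E3 → Fin 3 → ℂ}

/-- Integrability on the compact subsets of `D'`, intersected with `D`. -/
def IntegrableOnCompacts (D D' : Set E3) (g : E3 → Fin 3 → ℂ) : Prop :=
  ∀ S, IsCompact S → S ⊆ D' → IntegrableOn g (S ∩ D)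

theorem IntegrableOnCompacts.dot (hD : MeasurableSet D) (hg : IntegrableOnCompacts D D' g)
    {Ψ : E3 → Fin 3 → ℂ} (hΨ : Continuous Ψ) {S : Set E3} (hS : IsCompact S) (hSD : S ⊆ D')
    (h0 : ∀ x ∉ S, Ψ x = 0) : IntegrableOn (fun x => Ψ x ⬝ᵥ g x) D := by
  have h1 : IntegrableOn (fun x => Ψ x ⬝ᵥ g x) (S ∩ D) := by
    simp only [dotProduct]
    refine integrable_finsetSum _ fun i _ => ?_
    have h2 : IntegrableOn (fun x => g x i) (S ∩ D) := (hg S hS hSD).eval i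
    obtain ⟨M, hM⟩ := hS.exists_bound_of_continuousOn (hΨ.continuousOn (s := S))
    refine h2.bdd_mul (c := M) ((continuous_apply i).comp hΨ).aestronglyMeasurable ?_
    filter_upwards [ae_restrict_mem (hS.measurableSet.inter hD)] with x hx
    exact (norm_le_pi_norm _ i).trans (hM x hx.1)
  refine h1.of_forall_sdiff_eq_zero hD fun x hx => ?_
  rw [h0 x fun h => hx.2 ⟨h, hx.1⟩, zero_dotProduct]

theorem IntegrableOnCompacts.bdd_smul (hg : IntegrableOnCompacts D D' g) {s : E3 → ℂ}
    (hs : Measurable s) {M : ℝ} (hM : ∀ x, ‖s x‖ ≤ M) :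
    IntegrableOnCompacts D D' fun x => s x • g x := fun S hS hSD =>
  (hg S hS hSD).bdd_smul M hs.aestronglyMeasurable (ae_of_all _ hM)

theorem IntegrableOnCompacts.add (hg : IntegrableOnCompacts D D' g)
    (hh : IntegrableOnCompacts D D' h) : IntegrableOnCompacts D D' fun x => g x + h x :=
  fun S hS hSD => (hg S hS hSD).add (hh S hS hSD)

theorem IntegrableOnCompacts.cross (hg : IntegrableOnCompacts D D' g) (hGm : Measurable G)
    (hGK : ∀ x, ‖G x‖ ≤ K) :
    IntegrableOnCompacts D D' fun x => crossProduct (fun i => (G x i : ℂ)) (g x) := by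
  intro S hS hSD
  have h1 : ∀ i j, IntegrableOn (fun x => (G x i : ℂ) * g x j) (S ∩ D) := by
    intro i j
    refine ((hg S hS hSD).eval j).bdd_mul (c := K) ?_ (ae_of_all _ fun x => ?_)
    · exact (Complex.measurable_ofReal.comp
        ((measurable_pi_apply i).comp ((MeasurableEquiv.toLp 2 _).symm.measurable.comp hGm))
          ).aestronglyMeasurable
    · rw [Complex.norm_real]
      exact (PiLp.norm_apply_le (G x) i).trans (hGK x)
  refine Integrable.of_eval fun k => ?_
  fin_cases k <;> simp only [cross_apply] <;> simp <;> exact (h1 _ _).sub (h1 _ _)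

theorem measurable_coord (hGm : Measurable G) (i : Fin 3) : Measurable fun x => G x i :=
  (measurable_pi_apply i).comp ((MeasurableEquiv.toLp 2 _).symm.measurable.comp hGm)

theorem locallyIntegrable_indicator (hD : MeasurableSet D) (hbm : Measurable b)
    (hbK : ∀ x, |b x| ≤ K) : LocallyIntegrable (D.indicator b) := by
  refine (locallyIntegrable_const K).mono (hbm.indicator hD).aestronglyMeasurable
    (ae_of_all _ fun x => ?_)
  have hK : 0 ≤ K := (abs_nonneg _).trans (hbK x)
  rw [Real.norm_eq_abs, Real.norm_eq_abs, abs_of_nonneg hK]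
  by_cases hx : x ∈ D <;> simp [hx, hbK x, hK]

theorem abs_indicator_le (hbK : ∀ x, |b x| ≤ K) (x : E3) : |D.indicator b x| ≤ K := by
  have hK : 0 ≤ K := (abs_nonneg _).trans (hbK x)
  by_cases hx : x ∈ D <;> simp [hx, hbK x, hK]

/-- Expands in the components of the gradient, so that each of them multiplies a fixed integrable
scalar function. -/
theorem cross_dot_eq_sum (a φ z : Fin 3 → ℂ) : crossProduct a φ ⬝ᵥ z
    = ∑ i, a i * (crossProduct (Pi.single i 1) φ ⬝ᵥ z) := by
  simp [cross_apply, dotProduct, Fin.sum_univ_three, Pi.single_apply]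
  ring

/-- The hypothesis is tested with E(b_n) Φ, where b_n is the shifted mollification of b. The
classical product rule produces E(b_n) curl Φ and E'(b_n) ∇b_n × Φ, where ∇b_n is the mollified G on
the part of D that Φ sees. All factors are bounded and converge almost everywhere, so dominated
convergence applies. The set `D'` fixes the admissible supports: D for the distributional curl, the
whole space for the boundary condition. -/
theorem leibniz_local (hD : MeasurableSet D) (hbm : Measurable b) (hGm : Measurable G)
    (hbK : ∀ x, |b x| ≤ K) (hGK : ∀ x, ‖G x‖ ≤ K) (hG : HasWeakGradient D b G)
    (hE : ContDiff ℝ (⊤ : ℕ∞) E) (hg : IntegrableOnCompacts D D' g)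
    (hh : IntegrableOnCompacts D D' h)
    (H : ∀ Φ : E3 → Fin 3 → ℂ, ContDiff ℝ (⊤ : ℕ∞) Φ → HasCompactSupport Φ → tsupport Φ ⊆ D' →
      ∫ x in D, curl Φ x ⬝ᵥ g x = ∫ x in D, Φ x ⬝ᵥ h x)
    {p e : E3} {r c δ₀ : ℝ} (hc : 0 < c) (hδ₀ : 0 < δ₀)
    (hshift : ∀ δ : ℝ, 0 < δ → δ < δ₀ → ∀ x ∈ D ∩ Metric.ball p r, ∀ w : E3,
      ‖w - δ • e‖ ≤ c * δ → x + w ∈ D)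
    (hΦ : ContDiff ℝ (⊤ : ℕ∞) Φ) (hΦc : HasCompactSupport Φ) (hΦD : tsupport Φ ⊆ D')
    (hΦp : tsupport Φ ⊆ Metric.ball p r) :
    ∫ x in D, curl Φ x ⬝ᵥ (E (b x) • g x) = ∫ x in D, Φ x ⬝ᵥ
      (E (b x) • h x + deriv E (b x) • crossProduct (fun i => (G x i : ℂ)) (g x)) := by
  set d : ℕ → ℝ := fun n => δ₀ / ((n : ℝ) + 2) with hd
  have hd0 : ∀ n, 0 < d n := fun n => by positivity
  have hd1 : ∀ n, d n < δ₀ := fun n => by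
    rw [hd, div_lt_iff₀ (by positivity)]
    nlinarith [(Nat.cast_nonneg n : (0 : ℝ) ≤ n)]
  have hdlim : Tendsto d atTop (𝓝 0) := by
    refine tendsto_const_nhds.div_atTop ?_
    exact tendsto_atTop_add_const_right _ _ tendsto_natCast_atTop_atTop
  have hE' : Continuous (deriv E) := hE.continuous_deriv (by simp)
  have hbl := locallyIntegrable_indicator hD hbm hbK
  have hGiK : ∀ i x, |G x i| ≤ K := fun i x => by
    rw [← Real.norm_eq_abs]
    exact (PiLp.norm_apply_le (G x) i).trans (hGK x)
  have hGl : ∀ i, LocallyIntegrable (D.indicator fun y => G y i) := fun i =>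
    locallyIntegrable_indicator hD (measurable_coord hGm i) (hGiK i)
  set bn : ℕ → E3 → ℝ := fun n => moll e (d n) (mul_pos hc (hd0 n)) (D.indicator b) with hbn
  set Gn : ℕ → Fin 3 → E3 → ℝ := fun n i =>
    moll e (d n) (mul_pos hc (hd0 n)) (D.indicator fun y => G y i) with hGn
  have hbnd : ∀ n, ContDiff ℝ (⊤ : ℕ∞) (bn n) := fun n => contDiff_moll hbl
  have hbnK : ∀ n x, |bn n x| ≤ K := fun n x => abs_moll_le (abs_indicator_le hbK) x
  have hGnK : ∀ n i x, |Gn n i x| ≤ K := fun n i x => abs_moll_le (abs_indicator_le (hGiK i)) x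
  obtain ⟨M, hM⟩ : ∃ M : ℝ, ∀ s, |s| ≤ K → ‖E s‖ ≤ M ∧ ‖deriv E s‖ ≤ M := by
    obtain ⟨M₁, h1⟩ := (isCompact_Icc (a := -K) (b := K)).exists_bound_of_continuousOn
      hE.continuous.continuousOn
    obtain ⟨M₂, h2⟩ := (isCompact_Icc (a := -K) (b := K)).exists_bound_of_continuousOn
      hE'.continuousOn
    exact ⟨max M₁ M₂, fun s hs => ⟨(h1 s (abs_le.1 hs)).trans (le_max_left _ _),
      (h2 s (abs_le.1 hs)).trans (le_max_right _ _)⟩⟩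
  set A : E3 → ℂ := fun x => curl Φ x ⬝ᵥ g x with hA
  set Q : Fin 3 → E3 → ℂ := fun i x => crossProduct (Pi.single i 1) (Φ x) ⬝ᵥ g x with hQ
  set R : E3 → ℂ := fun x => Φ x ⬝ᵥ h x with hR
  have hAi : IntegrableOn A D := hg.dot hD (continuous_curl hΦ) hΦc hΦD
    fun x hx => curl_eq_zero_of_notMem hx
  have hQi : ∀ i, IntegrableOn (Q i) D := fun i => hg.dot hD
    ((LinearMap.continuous_of_finiteDimensional (crossProduct (Pi.single i (1 : ℂ)))).comp
      hΦ.continuous) hΦc hΦD fun x hx => by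
        rw [image_eq_zero_of_notMem_tsupport hx, map_zero]
  have hRi : IntegrableOn R D := hh.dot hD hΦ.continuous hΦc hΦD
    fun x hx => image_eq_zero_of_notMem_tsupport hx
  have hts : ∀ n, tsupport (fun x => E (bn n x) • Φ x) ⊆ tsupport Φ := fun n =>
    closure_mono fun x hx h0 => hx (by simp [h0])
  have hsd : ∀ n, ContDiff ℝ (⊤ : ℕ∞) fun x => E (bn n x) := fun n => hE.comp (hbnd n)
  have key : ∀ n, ∫ x in D, (E (bn n x) * A x + ∑ i, deriv E (bn n x) * (Gn n i x : ℂ) * Q i x)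
      = ∫ x in D, E (bn n x) * R x := by
    intro n
    have h1 := H (fun x => E (bn n x) • Φ x) ((hsd n).smul hΦ)
      (hΦc.mono' (subset_closure.trans (hts n))) ((hts n).trans hΦD)
    refine Eq.trans (setIntegral_congr_fun hD fun x hx => ?_) (h1.trans
      (setIntegral_congr_fun hD fun x _ => ?_))
    · rw [curl_smul (((hsd n).differentiable (by simp)) x) ((hΦ.differentiable (by simp)) x),
        add_dotProduct, smul_dotProduct, smul_eq_mul]
      congr 1
      -- The gradient of b_n is under control only where the shift stays in D, that is, near the
      -- support of Φ; elsewhere the term vanishes with Φ.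
      by_cases hxp : x ∈ tsupport Φ
      · have h2 : ∀ i, fderiv ℝ (fun x => E (bn n x)) x (EuclideanSpace.single i 1)
            = deriv E (bn n x) * (Gn n i x : ℂ) := by
          intro i
          have h3 := ((hE.differentiable (by simp)) (bn n x)).hasDerivAt
          have h4 := (((hbnd n).differentiable (by simp)) x).hasFDerivAt
          have h5 := (h3.hasFDerivAt.comp x h4).fderiv
          have h6 := fderiv_moll_eq hD hG hbl (hr := mul_pos hc (hd0 n))
            (hshift (d n) (hd0 n) (hd1 n) x ⟨hx, hΦp hxp⟩) i
          rw [show (fun x => E (bn n x)) = E ∘ bn n from rfl, h5]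
          simp [hbn, hGn, h6, mul_comm]
        rw [cross_dot_eq_sum]
        simp only [h2, hQ]
      · simp [hQ, image_eq_zero_of_notMem_tsupport hxp]
    · simp [hR]
  have hlimb : ∀ᵐ x ∂volume.restrict D, Tendsto (fun n => bn n x) atTop (𝓝 (b x)) := by
    filter_upwards [ae_restrict_of_ae (ae_tendsto_moll hbl e hc hd0 hdlim), ae_restrict_mem hD]
      with x h1 h2
    simpa [h2] using h1
  have hlimG : ∀ᵐ x ∂volume.restrict D, ∀ i, Tendsto (fun n => Gn n i x) atTop (𝓝 (G x i)) := by
    filter_upwards [ae_restrict_of_ae (ae_all_iff.2 fun i => ae_tendsto_moll (hGl i) e hc hd0 hdlim),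
      ae_restrict_mem hD] with x h1 h2 i
    simpa [h2] using h1 i
  have hm1 : ∀ n, Continuous fun x => E (bn n x) := fun n => (hsd n).continuous
  have hm2 : ∀ n, Continuous fun x => deriv E (bn n x) := fun n => hE'.comp (hbnd n).continuous
  have hm3 : ∀ n i, Continuous fun x => (Gn n i x : ℂ) := fun n i =>
    Complex.continuous_ofReal.comp (contDiff_moll (hGl i)).continuous
  have lim1 : Tendsto (fun n => ∫ x in D, (E (bn n x) * A x
      + ∑ i, deriv E (bn n x) * (Gn n i x : ℂ) * Q i x)) atTop
      (𝓝 (∫ x in D, (E (b x) * A x + ∑ i, deriv E (b x) * (G x i : ℂ) * Q i x))) := by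
    refine tendsto_integral_of_dominated_convergence (fun x => M * ‖A x‖ + ∑ i, M * K * ‖Q i x‖)
      (fun n => ?_) ?_ (fun n => ae_of_all _ fun x => ?_) ?_
    · exact ((hm1 n).aestronglyMeasurable.mul hAi.1).add (Finset.aestronglyMeasurable_fun_sum _
        fun i _ => ((hm2 n).mul (hm3 n i)).aestronglyMeasurable.mul (hQi i).1)
    · exact (hAi.norm.const_mul M).add (integrable_finsetSum _ fun i _ => (hQi i).norm.const_mul _)
    · refine (norm_add_le _ _).trans (add_le_add ?_ ((norm_sum_le _ _).trans
        (Finset.sum_le_sum fun i _ => ?_)))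
      · rw [norm_mul]
        exact mul_le_mul_of_nonneg_right (hM _ (hbnK n x)).1 (norm_nonneg _)
      · rw [norm_mul, norm_mul, Complex.norm_real, Real.norm_eq_abs]
        have hM0 : 0 ≤ M := (norm_nonneg _).trans (hM _ (hbnK n x)).1
        exact mul_le_mul_of_nonneg_right (mul_le_mul (hM _ (hbnK n x)).2 (hGnK n i x)
          (abs_nonneg _) hM0) (norm_nonneg _)
    · filter_upwards [hlimb, hlimG] with x h1 h2
      refine ((((hE.continuous.tendsto _).comp h1)).mul_const _).add (tendsto_finsetSum _ fun i _ => ?_)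
      exact (((hE'.tendsto _).comp h1).mul ((Complex.continuous_ofReal.tendsto _).comp
        (h2 i))).mul_const _
  have lim2 : Tendsto (fun n => ∫ x in D, E (bn n x) * R x) atTop
      (𝓝 (∫ x in D, E (b x) * R x)) := by
    refine tendsto_integral_of_dominated_convergence (fun x => M * ‖R x‖)
      (fun n => (hm1 n).aestronglyMeasurable.mul hRi.1) (hRi.norm.const_mul M)
      (fun n => ae_of_all _ fun x => ?_) ?_
    · rw [norm_mul]
      exact mul_le_mul_of_nonneg_right (hM _ (hbnK n x)).1 (norm_nonneg _)
    · filter_upwards [hlimb] with x h1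
      exact ((hE.continuous.tendsto _).comp h1).mul_const _
  have hfin := tendsto_nhds_unique lim1 (lim2.congr fun n => (key n).symm)
  have hEb : Measurable fun x => E (b x) := hE.continuous.measurable.comp hbm
  have hEb' : Measurable fun x => deriv E (b x) := hE'.measurable.comp hbm
  have i1 : IntegrableOn (fun x => E (b x) * A x) D :=
    hAi.bdd_mul hEb.aestronglyMeasurable (ae_of_all _ fun x => (hM _ (hbK x)).1)
  have i2 : IntegrableOn (fun x => ∑ i, deriv E (b x) * (G x i : ℂ) * Q i x) D := by
    refine integrable_finsetSum _ fun i _ => (hQi i).bdd_mul (c := M * K)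
      (hEb'.mul (Complex.measurable_ofReal.comp (measurable_coord hGm i))).aestronglyMeasurable
      (ae_of_all _ fun x => ?_)
    have hM0 : 0 ≤ M := (norm_nonneg _).trans (hM _ (hbK x)).1
    rw [norm_mul, Complex.norm_real, Real.norm_eq_abs]
    exact mul_le_mul (hM _ (hbK x)).2 (hGiK i x) (abs_nonneg _) hM0
  have i3 : IntegrableOn (fun x => E (b x) * R x) D :=
    hRi.bdd_mul hEb.aestronglyMeasurable (ae_of_all _ fun x => (hM _ (hbK x)).1)
  rw [integral_add i1 i2] at hfin
  have e1 : ∀ x, Φ x ⬝ᵥ (E (b x) • h x + deriv E (b x) • crossProduct (fun i => (G x i : ℂ)) (g x))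
      = E (b x) * R x - ∑ i, deriv E (b x) * (G x i : ℂ) * Q i x := by
    intro x
    rw [dotProduct_add, dotProduct_smul, dotProduct_smul, ← neg_neg (Φ x ⬝ᵥ crossProduct _ _),
      ← cross_dot_comm, cross_dot_eq_sum, smul_neg, smul_eq_mul, smul_eq_mul, Finset.mul_sum,
      sub_eq_add_neg]
    simp only [hQ, hR, mul_assoc]
  simp only [e1, dotProduct_smul, smul_eq_mul]
  rw [integral_sub i3 i2, ← hfin]
  ring

open scoped Manifold in
theorem leibniz_global (hcov : ShiftCover D) (hD : MeasurableSet D) (hbm : Measurable b)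
    (hGm : Measurable G) (hbK : ∀ x, |b x| ≤ K) (hGK : ∀ x, ‖G x‖ ≤ K) (hG : HasWeakGradient D b G)
    (hE : ContDiff ℝ (⊤ : ℕ∞) E) (hg : IntegrableOnCompacts D D' g)
    (hh : IntegrableOnCompacts D D' h)
    (H : ∀ Φ : E3 → Fin 3 → ℂ, ContDiff ℝ (⊤ : ℕ∞) Φ → HasCompactSupport Φ → tsupport Φ ⊆ D' →
      ∫ x in D, curl Φ x ⬝ᵥ g x = ∫ x in D, Φ x ⬝ᵥ h x)
    (hΦ : ContDiff ℝ (⊤ : ℕ∞) Φ) (hΦc : HasCompactSupport Φ) (hΦD : tsupport Φ ⊆ D') :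
    ∫ x in D, curl Φ x ⬝ᵥ (E (b x) • g x) = ∫ x in D, Φ x ⬝ᵥ
      (E (b x) • h x + deriv E (b x) • crossProduct (fun i => (G x i : ℂ)) (g x)) := by
  have hE' : Continuous (deriv E) := hE.continuous_deriv (by simp)
  choose r hr e c hc δ₀ hδ₀ hshift using hcov
  obtain ⟨t, ht⟩ := hΦc.isCompact.elim_nhds_subcover (fun p => Metric.ball p (r p))
    fun p _ => Metric.ball_mem_nhds p (hr p)
  obtain ⟨f, hf⟩ := SmoothPartitionOfUnity.exists_isSubordinate 𝓘(ℝ, E3) (isClosed_tsupport Φ)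
    (fun p : t => Metric.ball (p : E3) (r p)) (fun p => Metric.isOpen_ball) (by
      intro x hx
      obtain ⟨p, hp, hxp⟩ := mem_iUnion₂.1 (ht.2 hx)
      exact mem_iUnion.2 ⟨⟨p, hp⟩, hxp⟩)
  have hfd : ∀ p, ContDiff ℝ (⊤ : ℕ∞) fun x => ((f p x : ℝ) : ℂ) := fun p =>
    Complex.ofRealCLM.contDiff.comp (f p).contMDiff.contDiff
  have hsum : Φ = fun x => ∑ p, ((f p x : ℝ) : ℂ) • Φ x := by
    funext x
    by_cases hx : x ∈ tsupport Φ
    · have h1 := f.sum_eq_one hx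
      rw [finsum_eq_sum_of_fintype] at h1
      rw [← Finset.sum_smul, ← Complex.ofReal_sum, h1, Complex.ofReal_one, one_smul]
    · simp [image_eq_zero_of_notMem_tsupport hx]
  have hts : ∀ p, tsupport (fun x => ((f p x : ℝ) : ℂ) • Φ x) ⊆ tsupport Φ := fun p =>
    closure_mono fun x hx h0 => hx (by simp [h0])
  have hts' : ∀ p, tsupport (fun x => ((f p x : ℝ) : ℂ) • Φ x) ⊆ Metric.ball (p : E3) (r p) :=
    fun p => by
      have h1 : Function.support (fun x => ((f p x : ℝ) : ℂ) • Φ x) ⊆ Function.support (f p) :=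
        fun x hx h0 => hx (by simp [h0])
      exact (closure_mono h1).trans (hf p)
  have hcs : ∀ p, HasCompactSupport fun x => ((f p x : ℝ) : ℂ) • Φ x := fun p =>
    hΦc.mono' (subset_closure.trans (hts p))
  have hsd : ∀ p, ContDiff ℝ (⊤ : ℕ∞) fun x => ((f p x : ℝ) : ℂ) • Φ x := fun p => (hfd p).smul hΦ
  obtain ⟨M, hM⟩ : ∃ M : ℝ, ∀ s, |s| ≤ K → ‖E s‖ ≤ M ∧ ‖deriv E s‖ ≤ M := by
    obtain ⟨M₁, h1⟩ := (isCompact_Icc (a := -K) (b := K)).exists_bound_of_continuousOn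
      hE.continuous.continuousOn
    obtain ⟨M₂, h2⟩ := (isCompact_Icc (a := -K) (b := K)).exists_bound_of_continuousOn
      hE'.continuousOn
    exact ⟨max M₁ M₂, fun s hs => ⟨(h1 s (abs_le.1 hs)).trans (le_max_left _ _),
      (h2 s (abs_le.1 hs)).trans (le_max_right _ _)⟩⟩
  have hEb : Measurable fun x => E (b x) := hE.continuous.measurable.comp hbm
  have hEb' : Measurable fun x => deriv E (b x) := hE'.measurable.comp hbm
  have hg' := hg.bdd_smul hEb fun x => (hM _ (hbK x)).1
  have hh' := (hh.bdd_smul hEb fun x => (hM _ (hbK x)).1).add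
    ((hg.cross hGm hGK).bdd_smul hEb' fun x => (hM _ (hbK x)).2)
  have hloc : ∀ p, ∫ x in D, curl (fun x => ((f p x : ℝ) : ℂ) • Φ x) x ⬝ᵥ (E (b x) • g x)
      = ∫ x in D, (((f p x : ℝ) : ℂ) • Φ x) ⬝ᵥ
        (E (b x) • h x + deriv E (b x) • crossProduct (fun i => (G x i : ℂ)) (g x)) := fun p =>
    leibniz_local hD hbm hGm hbK hGK hG hE hg hh H (hc p) (hδ₀ p) (hshift p) (hsd p) (hcs p)
      ((hts p).trans hΦD) (hts' p)
  have hcurl : ∀ x, curl Φ x = ∑ p, curl (fun x => ((f p x : ℝ) : ℂ) • Φ x) x := by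
    intro x
    have h1 : ∀ i k : Fin 3, fderiv ℝ Φ x (EuclideanSpace.single i 1) k
        = ∑ p, fderiv ℝ (fun x => ((f p x : ℝ) : ℂ) • Φ x) x (EuclideanSpace.single i 1) k := by
      intro i k
      conv_lhs => rw [hsum]
      rw [fderiv_fun_sum fun p _ => ((hsd p).differentiable (by simp)) x]
      simp
    ext k
    fin_cases k <;> simp [curl, h1]
  calc _ = ∑ p, ∫ x in D, curl (fun x => ((f p x : ℝ) : ℂ) • Φ x) x ⬝ᵥ (E (b x) • g x) := by
        rw [← integral_finsetSum]
        · refine integral_congr_ae (ae_of_all _ fun x => ?_)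
          beta_reduce
          rw [hcurl x, sum_dotProduct]
        · intro p _
          exact hg'.dot hD (continuous_curl (hsd p)) (hcs p) ((hts p).trans hΦD)
            fun x hx => curl_eq_zero_of_notMem hx
    _ = ∑ p, ∫ x in D, (((f p x : ℝ) : ℂ) • Φ x) ⬝ᵥ
        (E (b x) • h x + deriv E (b x) • crossProduct (fun i => (G x i : ℂ)) (g x)) :=
        Finset.sum_congr rfl fun p _ => hloc p
    _ = _ := by
        rw [← integral_finsetSum]
        · refine integral_congr_ae (ae_of_all _ fun x => ?_)
          beta_reduce
          rw [← sum_dotProduct]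
          congr 1
          exact (congrFun hsum x).symm
        · intro p _
          exact hh'.dot hD (hsd p).continuous (hcs p) ((hts p).trans hΦD) fun x hx =>
            image_eq_zero_of_notMem_tsupport (f := fun x => ((f p x : ℝ) : ℂ) • Φ x) hx

end Leibniz

theorem shiftCover_univ : ShiftCover univ := fun _ =>
  ⟨1, one_pos, 0, 1, one_pos, 1, one_pos, fun _ _ _ _ _ _ _ => mem_univ _⟩

/-- Inside D no direction is needed, outside its closure nothing is to be shown. At the boundary the
shift follows the vertical axis of the local graph, and a C¹ graph function is Lipschitz nearby, so
a small cone around this axis points into D. -/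
theorem IsBoundedC1Domain.shiftCover {D : Set E3} (hD : IsBoundedC1Domain D) : ShiftCover D := by
  intro p
  by_cases hp : p ∈ D
  · obtain ⟨r, hr, hrD⟩ := Metric.isOpen_iff.1 hD.isOpen p hp
    refine ⟨r / 2, by positivity, 0, 1, one_pos, r / 2, by positivity, fun δ hδ hδ' x hx w hw => ?_⟩
    refine hrD ?_
    have h1 := Metric.mem_ball.1 hx.2
    rw [dist_eq_norm] at h1
    rw [smul_zero, sub_zero, one_mul] at hw
    rw [Metric.mem_ball, dist_eq_norm, add_sub_right_comm]
    exact (norm_add_le _ _).trans_lt (by linarith)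
  by_cases hp' : p ∈ closure D
  · have hpf : p ∈ frontier D := ⟨hp', by rwa [hD.isOpen.interior_eq]⟩
    obtain ⟨r, hr, L, γ, hγ, hset⟩ := hD.boundary p hpf
    obtain ⟨K, t, ht, hK⟩ := (hγ.contDiffAt (x := (L p 0, L p 1))).exists_lipschitzOnWith
    obtain ⟨ρ, hρ, hρt⟩ := Metric.mem_nhds_iff.1 ht
    set m := min r ρ with hm
    have hm0 : 0 < m := lt_min hr hρ
    have hK0 : (0 : ℝ) ≤ K := K.2
    -- A displacement within c δ of δ e raises the graph by at most K c δ and the height by at least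
    -- (1 - c) δ. As (K + 1) c = 1/2, the height wins. The radii m/2 and m/4 below keep the
    -- displaced point in the ball of radius m.
    set c : ℝ := 1 / (2 * ((K : ℝ) + 1)) with hc
    have hc0 : 0 < c := by positivity
    have hcK : ((K : ℝ) + 1) * c = 1 / 2 := by rw [hc]; field_simp
    have hc1 : c ≤ 1 / 2 := by nlinarith
    have hLe : L (L.symm (EuclideanSpace.single 2 1)) = EuclideanSpace.single 2 1 :=
      L.apply_symm_apply _
    refine ⟨m / 2, by positivity, L.symm (EuclideanSpace.single 2 1), c, hc0, m / 4, by positivity,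
      fun δ hδ hδ' x hx w hw => ?_⟩
    have he : ‖L.symm (EuclideanSpace.single (2 : Fin 3) (1 : ℝ))‖ = 1 := by
      rw [LinearIsometryEquiv.norm_map]
      simp
    have hLw : ∀ i, |L w i - δ * (EuclideanSpace.single (2 : Fin 3) (1 : ℝ) : E3) i| ≤ c * δ := by
      intro i
      have h1 : L (w - δ • L.symm (EuclideanSpace.single 2 1)) i
          = L w i - δ * (EuclideanSpace.single (2 : Fin 3) (1 : ℝ) : E3) i := by
        rw [map_sub, map_smul, hLe]
        rfl
      rw [← h1, ← Real.norm_eq_abs]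
      exact (PiLp.norm_apply_le _ i).trans ((L.norm_map _).le.trans hw)
    have h0 : |L w 0| ≤ c * δ := by simpa using hLw 0
    have h1 : |L w 1| ≤ c * δ := by simpa using hLw 1
    have h2 : |L w 2 - δ| ≤ c * δ := by simpa using hLw 2
    have hxp : ‖x - p‖ < m / 2 := by
      rw [← dist_eq_norm]
      exact hx.2
    have hwn : ‖w‖ ≤ δ + c * δ := by
      have : w = (w - δ • L.symm (EuclideanSpace.single 2 1))
          + δ • L.symm (EuclideanSpace.single 2 1) := by abel
      rw [this]
      refine (norm_add_le _ _).trans ?_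
      rw [norm_smul, he, Real.norm_eq_abs, abs_of_pos hδ]
      linarith
    have hxwp : ‖x + w - p‖ < m := by
      rw [add_sub_right_comm]
      refine (norm_add_le _ _).trans_lt ?_
      nlinarith
    have hcoord : ∀ y : E3, ‖y - p‖ < m → (L y 0, L y 1) ∈ t := by
      intro y hy
      refine hρt ?_
      rw [Metric.mem_ball, Prod.dist_eq]
      have h3 : ∀ i, dist (L y i) (L p i) < ρ := fun i => by
        rw [dist_eq_norm]
        have : L y i - L p i = L (y - p) i := by rw [map_sub]; rfl
        rw [this]
        exact ((PiLp.norm_apply_le _ i).trans (L.norm_map _).le).trans_lt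
          (hy.trans_le (min_le_right _ _))
      exact max_lt (h3 0) (h3 1)
    have hx' : x ∈ D ∩ Metric.ball p r :=
      ⟨hx.1, by
        rw [Metric.mem_ball, dist_eq_norm]
        exact hxp.trans ((half_lt_self hm0).trans_le (min_le_left _ _))⟩
    rw [hset] at hx'
    have hlip := hK.dist_le_mul _ (hcoord (x + w) hxwp) _ (hcoord x (by linarith))
    have hadd : ∀ i, L (x + w) i = L x i + L w i := fun i => by rw [map_add]; rfl
    have hdist : dist (L (x + w) 0, L (x + w) 1) (L x 0, L x 1) ≤ c * δ := by
      rw [Prod.dist_eq, hadd, hadd, Real.dist_eq, Real.dist_eq, add_sub_cancel_left,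
        add_sub_cancel_left]
      exact max_le h0 h1
    have hγ' : γ (L (x + w) 0, L (x + w) 1) < L (x + w) 2 := by
      have h3 := (abs_le.1 ((Real.dist_eq _ _).symm.le.trans hlip)).2
      have h4 := hx'.2
      have h5 := (abs_le.1 h2).1
      have h6 : (K : ℝ) * dist (L (x + w) 0, L (x + w) 1) (L x 0, L x 1) ≤ K * (c * δ) :=
        mul_le_mul_of_nonneg_left hdist hK0
      rw [hadd 2]
      nlinarith
    have : x + w ∈ D ∩ Metric.ball p r := by
      rw [hset]
      refine ⟨?_, hγ'⟩
      rw [Metric.mem_ball, dist_eq_norm]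
      exact hxwp.trans_le (min_le_left _ _)
    exact this.1
  · obtain ⟨r, hr, hrD⟩ := Metric.isOpen_iff.1 isClosed_closure.isOpen_compl p hp'
    exact ⟨r, hr, 0, 1, one_pos, 1, one_pos, fun δ _ _ x hx w _ =>
      absurd (subset_closure hx.1) (hrD hx.2)⟩

/-- Setting the function to zero where it exceeds its essential supremum gives a bound at every
point, which the mollification and the phase estimates use. -/
theorem exists_bounded_version {D : Set E3} {E : Type*} [NormedAddCommGroup E] [MeasurableSpace E]
    [BorelSpace E] [SecondCountableTopology E] (f : Lp E ⊤ (volume.restrict D)) :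
    ∃ f' : E3 → E, Measurable f' ∧ (∃ K : ℝ, ∀ x, ‖f' x‖ ≤ K) ∧ f =ᵐ[volume.restrict D] f' := by
  classical
  set m := (Lp.aestronglyMeasurable f).mk f with hm
  have hmm : StronglyMeasurable m := (Lp.aestronglyMeasurable f).stronglyMeasurable_mk
  have hS : MeasurableSet {x | ‖m x‖ ≤ ‖f‖} := measurableSet_le hmm.norm.measurable measurable_const
  refine ⟨{x | ‖m x‖ ≤ ‖f‖}.indicator m, hmm.measurable.indicator hS, ⟨‖f‖, fun x => ?_⟩, ?_⟩
  · by_cases hx : x ∈ {x | ‖m x‖ ≤ ‖f‖}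
    · rw [indicator_of_mem hx]
      exact hx
    · rw [indicator_of_notMem hx, norm_zero]
      exact norm_nonneg _
  · have h1 : ∀ᵐ x ∂volume.restrict D, ‖f x‖ ≤ ‖f‖ := by
      have h2 := ae_le_eLpNormEssSup (f := f) (μ := volume.restrict D)
      filter_upwards [h2] with x hx
      rw [Lp.norm_def, eLpNorm_exponent_top, ← toReal_enorm]
      refine ENNReal.toReal_mono ?_ hx
      rw [← eLpNorm_exponent_top]
      exact (Lp.memLp f).2.ne
    filter_upwards [(Lp.aestronglyMeasurable f).ae_eq_mk, h1] with x h3 h4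
    rw [indicator_of_mem, h3]
    change ‖m x‖ ≤ ‖f‖
    rwa [hm, ← h3]

theorem HasWeakGradient.congr {D : Set E3} {b b' : E3 → ℝ} {G G' : E3 → E3}
    (h : HasWeakGradient D b G) (hb : b =ᵐ[volume.restrict D] b') (hG : G =ᵐ[volume.restrict D] G') :
    HasWeakGradient D b' G' := by
  intro φ h1 h2 h3 i
  have e := integral_congr_ae (μ := volume.restrict D)
    (f := fun x => b x * fderiv ℝ φ x (EuclideanSpace.single i 1))
    (g := fun x => b' x * fderiv ℝ φ x (EuclideanSpace.single i 1))
    (hb.mono fun x hx => by simp only [hx])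
  rw [← e, h φ h1 h2 h3 i]
  congr 1
  exact integral_congr_ae (hG.mono fun x hx => by simp only [hx])

theorem HasWeakGradient.sum_mul {D : Set E3} {N : ℕ} {C : Fin N → E3 → ℝ} {G : Fin N → E3 → E3}
    (h : ∀ l, HasWeakGradient D (C l) (G l)) (hCm : ∀ l, Measurable (C l))
    (hGm : ∀ l, Measurable (G l)) {K : ℝ} (hC : ∀ l x, |C l x| ≤ K) (hG : ∀ l x, ‖G l x‖ ≤ K)
    (c : Fin N → ℝ) :
    HasWeakGradient D (fun x => ∑ l, c l * C l x) (fun x => ∑ l, c l • G l x) := by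
  intro φ h1 h2 h3 i
  have hφ : Integrable φ := h1.continuous.integrable_of_hasCompactSupport h2
  have hφ' : Integrable fun x => fderiv ℝ φ x (EuclideanSpace.single i 1) := by
    refine Continuous.integrable_of_hasCompactSupport
      ((h1.continuous_fderiv (by simp)).clm_apply continuous_const) ?_
    exact (h2.fderiv ℝ).comp_left (g := fun A : E3 →L[ℝ] ℝ => A (EuclideanSpace.single i 1)) rfl
  have e1 : ∀ x, (∑ l, c l * C l x) * fderiv ℝ φ x (EuclideanSpace.single i 1)
      = ∑ l, c l * (C l x * fderiv ℝ φ x (EuclideanSpace.single i 1)) := fun x => by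
    rw [Finset.sum_mul]
    exact Finset.sum_congr rfl fun l _ => mul_assoc _ _ _
  have e2 : ∀ x, (∑ l, c l • G l x) i * φ x = ∑ l, c l * (G l x i * φ x) := fun x => by
    have : (∑ l, c l • G l x) i = ∑ l, c l * G l x i := by simp
    rw [this, Finset.sum_mul]
    exact Finset.sum_congr rfl fun l _ => mul_assoc _ _ _
  simp only [e1, e2]
  rw [integral_finsetSum, integral_finsetSum, ← Finset.sum_neg_distrib]
  · refine Finset.sum_congr rfl fun l _ => ?_
    rw [integral_const_mul, integral_const_mul, h l φ h1 h2 h3 i, mul_neg]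
  · intro l _
    exact (hφ.integrableOn.bdd_mul (c := K) (measurable_coord (hGm l) i).aestronglyMeasurable
      (ae_of_all _ fun x => (PiLp.norm_apply_le (G l x) i).trans (hG l x))).const_mul _
  · intro l _
    exact (hφ'.integrableOn.bdd_mul (c := K) (hCm l).aestronglyMeasurable
      (ae_of_all _ fun x => hC l x)).const_mul _

/-! ### Multiplication operators and the Maxwell operator -/

section Maxwell

variable {D : Set E3} {b : E3 → ℝ} {G : E3 → E3} {K : ℝ} {E : ℝ → ℂ} {v v' z z' : E3 → C6}

theorem integrableOnCompacts_of_locallyIntegrableOn {g : E3 → Fin 3 → ℂ}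
    (hg : LocallyIntegrableOn g D) : IntegrableOnCompacts D D g := fun S hS hSD => by
  rw [inter_eq_left.2 hSD]
  exact hg.integrableOn_compact_subset hSD hS

theorem IntegrableOnCompacts.locallyIntegrableOn (hD : IsOpen D) {g : E3 → Fin 3 → ℂ}
    (hg : IntegrableOnCompacts D D g) : LocallyIntegrableOn g D :=
  (locallyIntegrableOn_iff hD.isLocallyClosed).2 fun S hSD hS => by
    simpa [inter_eq_left.2 hSD] using hg S hS hSD

theorem HasWeakCurl.congr (hD : IsOpen D) {g g' h h' : E3 → Fin 3 → ℂ} (H : HasWeakCurl D g h)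
    (hg : g =ᵐ[volume.restrict D] g') (hh : h =ᵐ[volume.restrict D] h') : HasWeakCurl D g' h' := by
  have hloc : ∀ {k k' : E3 → Fin 3 → ℂ}, k =ᵐ[volume.restrict D] k' → LocallyIntegrableOn k D →
      LocallyIntegrableOn k' D := by
    intro k k' hk h1
    refine IntegrableOnCompacts.locallyIntegrableOn hD fun S hS hSD => ?_
    exact (integrableOnCompacts_of_locallyIntegrableOn h1 S hS hSD).congr
      (ae_mono (Measure.restrict_mono inter_subset_right le_rfl) hk)
  refine ⟨hloc hg H.1, hloc hh H.2.1, fun Φ h1 h2 h3 => ?_⟩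
  have e := integral_congr_ae (μ := volume.restrict D) (f := fun x => curl Φ x ⬝ᵥ g x)
    (g := fun x => curl Φ x ⬝ᵥ g' x) (hg.mono fun x hx => by simp only [hx])
  rw [← e, H.2.2 Φ h1 h2 h3]
  exact integral_congr_ae (hh.mono fun x hx => by simp only [hx])

theorem IsDistribMaxwell.congr (hD : IsOpen D) (H : IsDistribMaxwell D v z)
    (hv : v =ᵐ[volume.restrict D] v') (hz : z =ᵐ[volume.restrict D] z') : IsDistribMaxwell D v' z' :=
  ⟨H.1.congr hD (hv.mono fun x hx => by simp only [hx]) (hz.mono fun x hx => by simp only [hx]),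
    H.2.congr hD (hv.mono fun x hx => by simp only [hx]) (hz.mono fun x hx => by simp only [hx])⟩

theorem sndC_add (a c : C6) : sndC (a + c) = sndC a + sndC c := rfl
theorem fstC_add (a c : C6) : fstC (a + c) = fstC a + fstC c := rfl
theorem sndC_smul (k : ℂ) (a : C6) : sndC (k • a) = k • sndC a := rfl
theorem fstC_smul (k : ℂ) (a : C6) : fstC (k • a) = k • fstC a := rfl
theorem fstC_crossTerm (g : E3) (a : C6) :
    fstC (crossTerm g a) = crossProduct (fun i => (g i : ℂ)) (sndC a) := rfl
theorem sndC_crossTerm (g : E3) (a : C6) :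
    sndC (crossTerm g a) = -crossProduct (fun i => (g i : ℂ)) (fstC a) := rfl

theorem HasWeakCurl.mul (hcov : ShiftCover D) (hD : IsOpen D) (hbm : Measurable b)
    (hGm : Measurable G) (hbK : ∀ x, |b x| ≤ K) (hGK : ∀ x, ‖G x‖ ≤ K) (hG : HasWeakGradient D b G)
    (hE : ContDiff ℝ (⊤ : ℕ∞) E) {g h : E3 → Fin 3 → ℂ} (H : HasWeakCurl D g h) :
    HasWeakCurl D (fun x => E (b x) • g x)
      (fun x => E (b x) • h x + deriv E (b x) • crossProduct (fun i => (G x i : ℂ)) (g x)) := by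
  have hg := integrableOnCompacts_of_locallyIntegrableOn H.1
  have hh := integrableOnCompacts_of_locallyIntegrableOn H.2.1
  have hE' : Continuous (deriv E) := hE.continuous_deriv (by simp)
  obtain ⟨M₁, h1⟩ := (isCompact_Icc (a := -K) (b := K)).exists_bound_of_continuousOn
    hE.continuous.continuousOn
  obtain ⟨M₂, h2⟩ := (isCompact_Icc (a := -K) (b := K)).exists_bound_of_continuousOn
    hE'.continuousOn
  have hEb : Measurable fun x => E (b x) := hE.continuous.measurable.comp hbm
  have hEb' : Measurable fun x => deriv E (b x) := hE'.measurable.comp hbm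
  refine ⟨(hg.bdd_smul hEb fun x => h1 _ (abs_le.1 (hbK x))).locallyIntegrableOn hD,
    ((hh.bdd_smul hEb fun x => h1 _ (abs_le.1 (hbK x))).add ((hg.cross hGm hGK).bdd_smul hEb'
      fun x => h2 _ (abs_le.1 (hbK x)))).locallyIntegrableOn hD, fun Φ h3 h4 h5 => ?_⟩
  exact leibniz_global hcov hD.measurableSet hbm hGm hbK hGK hG hE hg hh H.2.2 h3 h4 h5

theorem IsDistribMaxwell.mul (hcov : ShiftCover D) (hD : IsOpen D) (hbm : Measurable b)
    (hGm : Measurable G) (hbK : ∀ x, |b x| ≤ K) (hGK : ∀ x, ‖G x‖ ≤ K) (hG : HasWeakGradient D b G)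
    (hE : ContDiff ℝ (⊤ : ℕ∞) E) (H : IsDistribMaxwell D v z) :
    IsDistribMaxwell D (fun x => E (b x) • v x)
      (fun x => E (b x) • z x + deriv E (b x) • crossTerm (G x) (v x)) := by
  refine ⟨H.1.mul hcov hD hbm hGm hbK hGK hG hE, ?_⟩
  have h1 := H.2.mul hcov hD hbm hGm hbK hGK hG hE
  simp only [sndC_add, sndC_smul, fstC_smul, sndC_crossTerm, smul_neg, neg_add, neg_neg] at h1 ⊢
  exact h1

theorem integrableOnCompacts_univ {g : E3 → Fin 3 → ℂ}
    (hg : MemLp g 2 (volume.restrict D)) : IntegrableOnCompacts D univ g := fun S hS _ => by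
  have : IsFiniteMeasure (volume.restrict (S ∩ D)) :=
    ⟨by
      rw [Measure.restrict_apply_univ]
      exact (measure_mono inter_subset_left).trans_lt hS.measure_lt_top⟩
  exact (hg.mono_measure (Measure.restrict_mono inter_subset_right le_rfl)).integrable one_le_two

theorem norm_fstC_le (a : C6) : ‖fstC a‖ ≤ ‖a‖ :=
  (pi_norm_le_iff_of_nonneg (norm_nonneg _)).2 fun i => PiLp.norm_apply_le a (Sum.inl i)

theorem norm_sndC_le (a : C6) : ‖sndC a‖ ≤ ‖a‖ :=
  (pi_norm_le_iff_of_nonneg (norm_nonneg _)).2 fun i => PiLp.norm_apply_le a (Sum.inr i)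

theorem continuous_fstC : Continuous fstC :=
  continuous_pi fun i => (continuous_apply (Sum.inl i)).comp (PiLp.continuous_ofLp 2 _)

theorem continuous_sndC : Continuous sndC :=
  continuous_pi fun i => (continuous_apply (Sum.inr i)).comp (PiLp.continuous_ofLp 2 _)

/-- Stability of D(M) under multiplication. The distributional part is the Leibniz rule with
supports in D; the tangential trace is the same rule with arbitrary compact supports, which L²
fields allow because they are integrable on bounded parts of D up to the boundary. -/
theorem MaxwellGraph.mul (hcov : ShiftCover D) (hD : IsOpen D) (hbm : Measurable b)
    (hGm : Measurable G) (hbK : ∀ x, |b x| ≤ K) (hGK : ∀ x, ‖G x‖ ≤ K) (hG : HasWeakGradient D b G)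
    (hE : ContDiff ℝ (⊤ : ℕ∞) E) {φ ψ φ' ψ' : H D} (h : MaxwellGraph D φ ψ)
    (hφ : φ' =ᵐ[volume.restrict D] fun x => E (b x) • φ x)
    (hψ : ψ' =ᵐ[volume.restrict D] fun x => E (b x) • ψ x + deriv E (b x) • crossTerm (G x) (φ x)) :
    MaxwellGraph D φ' ψ' := by
  refine ⟨(h.1.mul hcov hD hbm hGm hbK hGK hG hE).congr hD hφ.symm hψ.symm, fun Φ h1 h2 => ?_⟩
  have hf : MemLp (fun x => fstC (φ x)) 2 (volume.restrict D) :=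
    (Lp.memLp φ).of_le (continuous_fstC.comp_aestronglyMeasurable (Lp.aestronglyMeasurable φ))
      (ae_of_all _ fun x => norm_fstC_le _)
  have hs : MemLp (fun x => -sndC (ψ x)) 2 (volume.restrict D) :=
    ((Lp.memLp ψ).of_le (continuous_sndC.comp_aestronglyMeasurable (Lp.aestronglyMeasurable ψ))
      (ae_of_all _ fun x => norm_sndC_le _)).neg
  have h3 := leibniz_global hcov hD.measurableSet hbm hGm hbK hGK hG hE
    (integrableOnCompacts_univ hf) (integrableOnCompacts_univ hs)
    (fun Φ h1 h2 _ => h.2 Φ h1 h2) h1 h2 (subset_univ _)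
  refine Eq.trans (integral_congr_ae (hφ.mono fun x hx => ?_)) (h3.trans
    (integral_congr_ae (hψ.mono fun x hx => ?_)))
  · simp only [hx, fstC_smul]
  · simp only [hx, sndC_add, sndC_smul, sndC_crossTerm, smul_neg, neg_add, neg_neg]

end Maxwell

/-! ### Jointly measurable versions -/

instance secondCountableTopology_H (D : Set E3) : SecondCountableTopology (H D) :=
  haveI : Fact ((2 : ℝ≥0∞) ≠ ∞) := ⟨ENNReal.ofNat_ne_top⟩
  inferInstance

/-- A sequence converging exponentially fast in `L²(D)⁶` converges almost everywhere. -/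
theorem ae_eq_limUnder {D : Set E3} {d : ℕ → H D} {a : H D}
    (hn : ∀ k, ‖d k - a‖ < (1 / 2) ^ k) :
    a =ᵐ[volume.restrict D] fun x => atTop.limUnder fun k => d k x := by
  have hsm : ∀ k, AEStronglyMeasurable (d k) (volume.restrict D) := fun k =>
    Lp.aestronglyMeasurable (d k)
  have hcau : ∀ N n m : ℕ, N ≤ n → N ≤ m →
      eLpNorm (⇑(d n) - ⇑(d m)) 2 (volume.restrict D) < ENNReal.ofReal (2 * (1 / 2) ^ N) := by
    intro N n m h1 h2
    have h3 : ‖d n - d m‖ < 2 * (1 / 2) ^ N := by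
      have h4 := norm_sub_le_norm_sub_add_norm_sub (d n) a (d m)
      rw [norm_sub_rev a] at h4
      have h5 : ∀ {k : ℕ}, N ≤ k → ((1 : ℝ) / 2) ^ k ≤ (1 / 2) ^ N := fun h =>
        pow_le_pow_of_le_one (by norm_num) (by norm_num) h
      linarith [hn n, hn m, h5 h1, h5 h2]
    rw [← eLpNorm_congr_ae (Lp.coeFn_sub (d n) (d m)), ← Lp.enorm_def, ← ofReal_norm]
    exact (ENNReal.ofReal_lt_ofReal_iff (by positivity)).2 h3
  have hB : ∑' N : ℕ, ENNReal.ofReal (2 * (1 / 2) ^ N) ≠ ∞ := by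
    rw [← ENNReal.ofReal_tsum_of_nonneg (fun n => by positivity)
      ((summable_geometric_of_lt_one (by norm_num) (by norm_num)).mul_left _)]
    exact ENNReal.ofReal_ne_top
  have hlim : ∀ᵐ x ∂volume.restrict D, Tendsto (fun k => d k x) atTop
      (𝓝 (atTop.limUnder fun k => d k x)) := by
    filter_upwards [Lp.ae_tendsto_of_cauchy_eLpNorm hsm one_le_two hB hcau] with x hx
    exact tendsto_nhds_limUnder hx
  have hlm : AEStronglyMeasurable (fun x => atTop.limUnder fun k => d k x)
      (volume.restrict D) := aestronglyMeasurable_of_tendsto_ae atTop hsm hlim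
  have h1 := tendstoInMeasure_of_tendsto_eLpNorm two_ne_zero hsm hlm
    (Lp.cauchy_tendsto_of_tendsto hsm _ hB hcau hlim)
  have h2 : Tendsto d atTop (𝓝 a) := by
    rw [tendsto_iff_norm_sub_tendsto_zero]
    exact squeeze_zero (fun _ => norm_nonneg _) (fun k => (hn k).le)
      (tendsto_pow_atTop_nhds_zero_of_lt_one (by norm_num) (by norm_num))
  exact tendstoInMeasure_ae_unique (tendstoInMeasure_of_tendsto_eLpNorm two_ne_zero hsm
    (Lp.aestronglyMeasurable a) ((Lp.tendsto_Lp_iff_tendsto_eLpNorm' _ _).1 h2)) h1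

/-- A strongly measurable map into a separable normed space is an exponentially fast limit of maps
with values in a fixed sequence. -/
theorem exists_rapid_approx {α E : Type*} [MeasurableSpace α] [NormedAddCommGroup E]
    [SecondCountableTopology E] {V : α → E} (hV : StronglyMeasurable V) :
    ∃ (d : ℕ → E) (n : ℕ → α → ℕ), (∀ k, Measurable (n k)) ∧
      ∀ k a, ‖d (n k a) - V a‖ < (1 / 2) ^ k := by
  classical
  have hd : ∀ (k : ℕ) (a : α), ∃ n, ‖TopologicalSpace.denseSeq E n - V a‖ < (1 / 2) ^ k :=
    fun k a => by
      obtain ⟨n, hn⟩ := (TopologicalSpace.denseRange_denseSeq E).exists_dist_lt (V a)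
        (ε := (1 / 2) ^ k) (by positivity)
      exact ⟨n, by rwa [dist_comm, dist_eq_norm] at hn⟩
  -- Taking the first suitable index makes the choice measurable.
  exact ⟨TopologicalSpace.denseSeq E, fun k a => Nat.find (hd k a), fun k =>
    measurable_find _ fun n => measurableSet_lt
      (stronglyMeasurable_const.sub hV).norm.measurable measurable_const,
    fun k a => Nat.find_spec (hd k a)⟩

/-- A strongly measurable map into `L²(D)⁶` is represented by a jointly measurable function. -/
theorem exists_joint_version {α : Type*} [MeasurableSpace α] {D : Set E3} {V : α → H D}
    (hV : StronglyMeasurable V) : ∃ v : α × E3 → C6, Measurable v ∧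
      ∀ a, V a =ᵐ[volume.restrict D] fun x => v (a, x) := by
  obtain ⟨d, n, hm, hn⟩ := exists_rapid_approx hV
  -- Joint measurability is free here because the index runs through a countable set.
  have h1 : Measurable fun p : ℕ × E3 => d p.1 p.2 :=
    measurable_from_prod_countable_right fun n => (Lp.stronglyMeasurable (d n)).measurable
  have hw : ∀ k, StronglyMeasurable fun p : α × E3 => d (n k p.1) p.2 := fun k =>
    (h1.comp (((hm k).comp measurable_fst).prodMk measurable_snd)).stronglyMeasurable
  have h2 : ∀ a, V a =ᵐ[volume.restrict D] fun x => atTop.limUnder fun k => d (n k a) x :=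
    fun a => ae_eq_limUnder fun k => hn k a
  have h3 : StronglyMeasurable fun p : α × E3 => atTop.limUnder fun k => d (n k p.1) p.2 :=
    StronglyMeasurable.limUnder hw
  exact ⟨_, h3.measurable, h2⟩

/-! ### Square integrable random fields -/

section Fields

variable {Ω : Type*} {mΩ : MeasurableSpace Ω} {P : Measure Ω} {F : Filtration ℝ≥0 mΩ}
  {T : ℝ≥0} {N : ℕ} {β : Fin N → ℝ≥0 → Ω → ℝ} {D : Set E3} {μ : Measure E3}
  {h k v : ℝ≥0 → Ω → E3 → C6}

/-- A jointly measurable field `h` which is almost surely square integrable on `[0,T]`. -/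
structure SqField (P : Measure Ω) (T : ℝ≥0) (μ : Measure E3) (h : ℝ≥0 → Ω → E3 → C6) : Prop where
  measurable : Measurable fun p : (ℝ≥0 × Ω) × E3 => h p.1.1 p.1.2 p.2
  finite : ∀ᵐ ω ∂P, ∫⁻ s in Icc 0 T, ∫⁻ x, ‖h s ω x‖ₑ ^ 2 ∂μ ∂leb < ∞

/-- A jointly measurable scalar field which is almost surely bounded on `[0,T]`. -/
structure BddField (P : Measure Ω) (T : ℝ≥0) (m : ℝ≥0 → Ω → E3 → ℂ) : Prop where
  measurable : Measurable fun p : (ℝ≥0 × Ω) × E3 => m p.1.1 p.1.2 p.2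
  bounded : ∀ᵐ ω ∂P, ∃ M : ℝ, ∀ s ≤ T, ∀ x, ‖m s ω x‖ ≤ M

theorem setLIntegral_Icc_lt_top_of_le {a b : ℝ≥0 → ℝ≥0∞} {c : ℝ≥0∞} (hc : c ≠ ∞)
    (hb : ∫⁻ s in Icc 0 T, b s ∂leb < ∞) (hab : ∀ s ≤ T, a s ≤ c * b s) :
    ∫⁻ s in Icc 0 T, a s ∂leb < ∞ := by
  refine (setLIntegral_mono' measurableSet_Icc fun s hs => hab s hs.2).trans_lt ?_
  rw [lintegral_const_mul' _ _ hc]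
  exact ENNReal.mul_lt_top hc.lt_top hb

theorem SqField.of_le (hk : SqField P T μ k)
    (hm : Measurable fun p : (ℝ≥0 × Ω) × E3 => h p.1.1 p.1.2 p.2)
    (hle : ∀ᵐ ω ∂P, ∃ M : ℝ, ∀ s ≤ T, ∀ x, ‖h s ω x‖ ≤ M * ‖k s ω x‖) : SqField P T μ h := by
  refine ⟨hm, ?_⟩
  filter_upwards [hk.finite, hle] with ω h1 ⟨M, hM⟩
  refine setLIntegral_Icc_lt_top_of_le (c := ENNReal.ofReal M ^ 2)
    (ENNReal.pow_ne_top ENNReal.ofReal_ne_top) h1 fun s hs => ?_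
  rw [← lintegral_const_mul' _ _ (ENNReal.pow_ne_top ENNReal.ofReal_ne_top)]
  refine lintegral_mono fun x => ?_
  rw [← mul_pow]
  gcongr
  rw [← ofReal_norm, ← ofReal_norm, ← ENNReal.ofReal_mul' (norm_nonneg _)]
  exact ENNReal.ofReal_le_ofReal (hM s hs x)

theorem SqField.smul {m : ℝ≥0 → Ω → E3 → ℂ} (hh : SqField P T μ h) (hm : BddField P T m) :
    SqField P T μ fun s ω x => m s ω x • h s ω x := by
  refine hh.of_le (hm.measurable.smul hh.measurable) ?_
  filter_upwards [hm.bounded] with ω ⟨M, hM⟩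
  refine ⟨M, fun s hs x => ?_⟩
  rw [norm_smul]
  exact mul_le_mul_of_nonneg_right (hM s hs x) (norm_nonneg _)

theorem sq_enorm_add_le (a c : C6) : ‖a + c‖ₑ ^ 2 ≤ 4 * (‖a‖ₑ ^ 2 + ‖c‖ₑ ^ 2) := by
  have h1 : ‖a + c‖ₑ ≤ 2 * max ‖a‖ₑ ‖c‖ₑ := (enorm_add_le _ _).trans (by
    rw [two_mul]
    exact add_le_add (le_max_left _ _) (le_max_right _ _))
  refine (pow_le_pow_left' h1 2).trans ?_
  rw [mul_pow]
  have h2 : max ‖a‖ₑ ‖c‖ₑ ^ 2 ≤ ‖a‖ₑ ^ 2 + ‖c‖ₑ ^ 2 := by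
    rcases max_cases ‖a‖ₑ ‖c‖ₑ with h | h <;> rw [h.1]
    · exact le_self_add
    · exact le_add_self
  norm_num
  gcongr

theorem SqField.add [SFinite μ] (hh : SqField P T μ h) (hk : SqField P T μ k) :
    SqField P T μ fun s ω x => h s ω x + k s ω x := by
  refine ⟨hh.measurable.add hk.measurable, ?_⟩
  filter_upwards [hh.finite, hk.finite] with ω h1 h2
  have hsec : Measurable fun p : ℝ≥0 × E3 => ((p.1, ω), p.2) := by fun_prop
  have hm : Measurable fun p : ℝ≥0 × E3 => ‖h p.1 ω p.2‖ₑ ^ 2 :=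
    ((hh.measurable.comp hsec).enorm).pow_const 2
  refine setLIntegral_Icc_lt_top_of_le (c := 4)
    (b := fun s => ∫⁻ x, ‖h s ω x‖ₑ ^ 2 ∂μ + ∫⁻ x, ‖k s ω x‖ₑ ^ 2 ∂μ) (by norm_num) ?_
    fun s _ => ?_
  · rw [lintegral_add_left hm.lintegral_prod_right']
    exact ENNReal.add_lt_top.2 ⟨h1, h2⟩
  · have hms : Measurable fun x => ‖h s ω x‖ₑ ^ 2 :=
      ((hh.measurable.comp (measurable_prodMk_left (x := (s, ω)))).enorm).pow_const 2
    rw [← lintegral_add_left hms, ← lintegral_const_mul' _ _ (by norm_num)]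
    exact lintegral_mono fun x => sq_enorm_add_le _ _

theorem SqField.zero : SqField P T μ fun _ _ _ => 0 :=
  ⟨measurable_const, by simp⟩

theorem SqField.sum [SFinite μ] {ι : Type*} (s : Finset ι) {h : ι → ℝ≥0 → Ω → E3 → C6}
    (hh : ∀ i, SqField P T μ (h i)) : SqField P T μ fun t ω x => ∑ i ∈ s, h i t ω x := by
  classical
  induction s using Finset.induction_on with
  | empty => simpa using SqField.zero
  | insert i s hi ih =>
    simp_rw [Finset.sum_insert hi]
    exact (hh i).add ih

theorem crossTerm_apply_inl (g : E3) (a : C6) (i : Fin 3) :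
    crossTerm g a (Sum.inl i) = crossProduct (fun i => (g i : ℂ)) (sndC a) i := rfl

theorem crossTerm_apply_inr (g : E3) (a : C6) (i : Fin 3) :
    crossTerm g a (Sum.inr i) = -crossProduct (fun i => (g i : ℂ)) (fstC a) i := rfl

theorem norm_crossTerm_le (g : E3) (a : C6) : ‖crossTerm g a‖ ≤ 12 * ‖g‖ * ‖a‖ := by
  have h0 : ∀ (i : Fin 3) (s : Fin 3 ⊕ Fin 3), ‖(g i : ℂ) * a s‖ ≤ ‖g‖ * ‖a‖ := fun i s => by
    rw [norm_mul]
    refine mul_le_mul ?_ (PiLp.norm_apply_le a s) (norm_nonneg _) (norm_nonneg _)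
    rw [Complex.norm_real]
    exact PiLp.norm_apply_le g i
  have h1 : ∀ s, ‖crossTerm g a s‖ ≤ 2 * (‖g‖ * ‖a‖) := by
    intro s
    have h2 : ∀ (i j : Fin 3) (s t : Fin 3 ⊕ Fin 3),
        ‖(g i : ℂ) * a s - (g j : ℂ) * a t‖ ≤ 2 * (‖g‖ * ‖a‖) := fun i j s t => by
      linarith [norm_sub_le ((g i : ℂ) * a s) ((g j : ℂ) * a t), h0 i s, h0 j t]
    rcases s with i | i
    · rw [crossTerm_apply_inl, cross_apply]
      fin_cases i <;> exact h2 _ _ _ _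
    · rw [crossTerm_apply_inr, norm_neg, cross_apply]
      fin_cases i <;> exact h2 _ _ _ _
  have h3 : crossTerm g a = ∑ s, EuclideanSpace.single s (crossTerm g a s) := by
    ext s
    rcases s with i | i <;> simp [Pi.single_apply]
  rw [h3]
  refine (norm_sum_le _ _).trans ?_
  refine (Finset.sum_le_sum fun s _ => (PiLp.norm_single 2 _ s _).le.trans (h1 s)).trans ?_
  simp
  linarith

theorem measurable_crossTerm {α : Type*} [MeasurableSpace α] {g : α → E3} {a : α → C6}
    (hg : Measurable g) (ha : Measurable a) : Measurable fun p => crossTerm (g p) (a p) := by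
  have hc : ∀ i, Measurable fun p => ((g p i : ℝ) : ℂ) := fun i =>
    Complex.measurable_ofReal.comp (((PiLp.continuous_apply 2 _ i).measurable).comp hg)
  have hs : ∀ s, Measurable fun p => a p s := fun s =>
    ((PiLp.continuous_apply 2 _ s).measurable).comp ha
  refine (PiLp.continuous_toLp 2 _).measurable.comp (measurable_pi_iff.2 fun s => ?_)
  rcases s with i | i
  · change Measurable fun p => crossProduct (fun i => ((g p i : ℝ) : ℂ)) (sndC (a p)) i
    simp only [cross_apply]
    fin_cases i
    · exact ((hc 1).mul (hs _)).sub ((hc 2).mul (hs _))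
    · exact ((hc 2).mul (hs _)).sub ((hc 0).mul (hs _))
    · exact ((hc 0).mul (hs _)).sub ((hc 1).mul (hs _))
  · change Measurable fun p => -crossProduct (fun i => ((g p i : ℝ) : ℂ)) (fstC (a p)) i
    simp only [cross_apply]
    fin_cases i
    · exact (((hc 1).mul (hs _)).sub ((hc 2).mul (hs _))).neg
    · exact (((hc 2).mul (hs _)).sub ((hc 0).mul (hs _))).neg
    · exact (((hc 0).mul (hs _)).sub ((hc 1).mul (hs _))).neg

theorem SqField.crossTerm (hh : SqField P T μ h) {G : E3 → E3} (hG : Measurable G) {K : ℝ}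
    (hK : ∀ x, ‖G x‖ ≤ K) : SqField P T μ fun s ω x => crossTerm (G x) (h s ω x) := by
  refine hh.of_le (measurable_crossTerm (hG.comp measurable_snd) hh.measurable)
    (ae_of_all _ fun ω => ⟨12 * K, fun s _ x => ?_⟩)
  refine (norm_crossTerm_le _ _).trans ?_
  gcongr
  exact hK x

/-- For real g the map a ↦ g × a is skew-adjoint; exchanging the two components with opposite signs
makes the block operator self-adjoint. -/
theorem inner_crossTerm (g : E3) (a c : C6) :
    inner ℂ (crossTerm g a) c = inner ℂ a (crossTerm g c) := by
  simp only [PiLp.inner_apply, Fintype.sum_sum_type, crossTerm_apply_inl, crossTerm_apply_inr,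
    cross_apply, Fin.sum_univ_three, fstC, sndC]
  simp
  ring

end Fields

/-! ### Fields representing processes with values in L² -/

section Versions

variable {Ω : Type*} {mΩ : MeasurableSpace Ω} {P : Measure Ω} {F : Filtration ℝ≥0 mΩ}
  {T : ℝ≥0} {N : ℕ} {β : Fin N → ℝ≥0 → Ω → ℝ} {D : Set E3} {μ : Measure E3}

theorem lintegral_sq_enorm (f : H D) : ∫⁻ x in D, ‖f x‖ₑ ^ 2 = ‖f‖ₑ ^ 2 := by
  rw [Lp.enorm_def, eLpNorm_eq_lintegral_rpow_enorm_toReal two_ne_zero ENNReal.ofNat_ne_top,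
    ← ENNReal.rpow_natCast, ← ENNReal.rpow_mul]
  simp

theorem lintegral_sq_enorm_congr {f : H D} {f' : E3 → C6} (h : f =ᵐ[volume.restrict D] f') :
    ∫⁻ x in D, ‖f' x‖ₑ ^ 2 = ‖f‖ₑ ^ 2 := by
  rw [← lintegral_sq_enorm]
  exact lintegral_congr_ae (h.mono fun x hx => by simp only [hx])

theorem leb_Icc_lt_top (T : ℝ≥0) : leb (Icc 0 T) < ∞ := by
  rw [leb_Icc]
  exact ENNReal.ofReal_lt_top

/-- Adapted processes with continuous paths in `L²(D)⁶` are represented by square integrable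
fields. -/
theorem exists_sqField_of_continuousPaths {v : ℝ≥0 → Ω → H D}
    (hv : ∀ t ≤ T, StronglyMeasurable[F t] (v t)) (hc : ContinuousPaths P T v) :
    ∃ v' : ℝ≥0 → Ω → E3 → C6, SqField P T (volume.restrict D) v' ∧
      ∀ᵐ ω ∂P, ∀ t ≤ T, v t ω =ᵐ[volume.restrict D] v' t ω := by
  obtain ⟨Y, hY, hYc, hYv⟩ :=
    exists_continuous_version (fun t ht => (hv t ht).mono (F.le t)) hc
  obtain ⟨w, hw, hwY⟩ := exists_joint_version hY
  refine ⟨fun t ω x => w ((t, ω), x), ⟨hw, ?_⟩, ?_⟩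
  · refine ae_of_all _ fun ω => ?_
    obtain ⟨M, hM⟩ := (isCompact_Icc (a := (0 : ℝ≥0)) (b := T)).exists_bound_of_continuousOn
      (hYc ω).continuousOn
    refine (setLIntegral_mono' (g := fun _ => ENNReal.ofReal M ^ 2) measurableSet_Icc
      fun s hs => ?_).trans_lt ?_
    · rw [lintegral_sq_enorm_congr (hwY (s, ω))]
      gcongr
      rw [← ofReal_norm]
      exact ENNReal.ofReal_le_ofReal (hM s hs)
    · rw [setLIntegral_const]
      exact ENNReal.mul_lt_top (ENNReal.pow_lt_top ENNReal.ofReal_lt_top) (leb_Icc_lt_top T)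
  · filter_upwards [hYv] with ω h1 t ht
    rw [h1 t ht]
    exact hwY (t, ω)

/-- Progressively measurable square integrable processes are represented by square integrable
fields. -/
theorem exists_sqField_of_isL2Process [SFinite P] {J : ℝ≥0 → Ω → H D} (hJ : IsL2Process P F T J) :
    ∃ J' : ℝ≥0 → Ω → E3 → C6, SqField P T (volume.restrict D) J' ∧
      ∀ ω, ∀ t ≤ T, J t ω =ᵐ[volume.restrict D] J' t ω := by
  have h0 : StronglyMeasurable fun p : Iic T × Ω => J p.1 p.2 := by
    refine (hJ.1 T).mono ?_
    exact sup_le_sup le_rfl (MeasurableSpace.comap_mono (F.le T))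
  -- Progressive measurability at T gives joint measurability on [0,T] only; freezing time at T
  -- extends it to the half-line.
  have h1 : StronglyMeasurable fun p : ℝ≥0 × Ω => J (min p.1 T) p.2 := by
    refine h0.comp_measurable (g := fun p : ℝ≥0 × Ω => ((⟨min p.1 T, min_le_right p.1 T⟩ : Iic T), p.2)) ?_
    exact ((measurable_fst.min measurable_const).subtype_mk).prodMk measurable_snd
  obtain ⟨w, hw, hwJ⟩ := exists_joint_version h1
  have h2 : ∀ ω, ∀ t ≤ T, J t ω =ᵐ[volume.restrict D] fun x => w ((t, ω), x) := fun ω t ht => by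
    have h3 := hwJ (t, ω)
    simp only [min_eq_left ht] at h3
    exact h3
  refine ⟨fun t ω x => w ((t, ω), x), ⟨hw, ?_⟩, h2⟩
  have h3 : ∀ ω, ∫⁻ s in Icc 0 T, (∫⁻ x in D, ‖w ((s, ω), x)‖ₑ ^ 2) ∂leb
      = ∫⁻ s in Icc 0 T, ‖J s ω‖ₑ ^ 2 ∂leb := fun ω =>
    setLIntegral_congr_fun measurableSet_Icc fun s hs => lintegral_sq_enorm_congr (h2 ω s hs.2)
  have h4 : Measurable fun ω => ∫⁻ s in Icc 0 T, (∫⁻ x in D, ‖w ((s, ω), x)‖ₑ ^ 2) ∂leb := by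
    have h5 : Measurable fun p : ℝ≥0 × Ω => ∫⁻ x in D, ‖w (p, x)‖ₑ ^ 2 :=
      (hw.enorm.pow_const 2).lintegral_prod_right'
    exact h5.lintegral_prod_left'
  refine ae_lt_top h4 ?_
  simp only [h3]
  exact hJ.2.ne

/-- The Brownian motions have jointly measurable continuous versions. -/
theorem IsBrownianFamily.exists_version (hβ : IsBrownianFamily P F β) (T : ℝ≥0) :
    ∃ β' : Fin N → ℝ≥0 → Ω → ℝ, (∀ l, Measurable (Function.uncurry (β' l))) ∧
      (∀ l ω, Continuous fun t => β' l t ω) ∧ ∀ᵐ ω ∂P, ∀ t ≤ T, ∀ l, β l t ω = β' l t ω := by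
  have h : ∀ l, ∃ Y : ℝ≥0 → Ω → ℝ, StronglyMeasurable (Function.uncurry Y) ∧
      (∀ ω, Continuous fun t => Y t ω) ∧ ∀ᵐ ω ∂P, ∀ t ≤ T, β l t ω = Y t ω := fun l =>
    exists_continuous_version (fun t _ => (hβ.adapted l t).mono (F.le t))
      ((hβ.brownian l).cont.mono fun ω h1 => h1.continuousOn)
  choose Y hY hYc hYβ using h
  refine ⟨Y, fun l => (hY l).measurable, hYc, ?_⟩
  filter_upwards [ae_all_iff.2 hYβ] with ω h1 t ht l using h1 l t ht

theorem bddField_brPhase {C : Fin N → E3 → ℝ} (hC : ∀ l, Measurable (C l)) {K : ℝ}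
    (hK : ∀ l x, |C l x| ≤ K) (hβm : ∀ l, Measurable (Function.uncurry (β l)))
    (hβc : ∀ l ω, Continuous fun t => β l t ω) : BddField P T (brPhase β C) := by
  refine ⟨?_, ae_of_all _ fun ω => ?_⟩
  · unfold brPhase
    refine Finset.measurable_fun_sum _ fun l _ => ?_
    exact (Complex.measurable_ofReal.comp ((hβm l).comp measurable_fst)).mul
      ((Complex.measurable_ofReal.comp ((hC l).comp measurable_snd)).const_mul _)
  · have h1 : ∀ l, ∃ M, ∀ t ∈ Icc 0 T, ‖β l t ω‖ ≤ M := fun l =>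
      isCompact_Icc.exists_bound_of_continuousOn (hβc l ω).continuousOn
    choose M hM using h1
    refine ⟨∑ l, M l * K, fun s hs x => (norm_sum_le _ _).trans (Finset.sum_le_sum fun l _ => ?_)⟩
    rw [norm_mul, norm_mul, Complex.norm_I, one_mul, Complex.norm_real, Complex.norm_real]
    have h2 := hM l s ⟨zero_le, hs⟩
    exact mul_le_mul h2 (hK l x) (norm_nonneg _) ((norm_nonneg _).trans h2)

theorem BddField.comp {m : ℝ≥0 → Ω → E3 → ℂ} (hm : BddField P T m) {e : ℂ → ℂ}
    (he : Continuous e) : BddField P T fun s ω x => e (m s ω x) := by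
  refine ⟨he.measurable.comp hm.measurable, hm.bounded.mono fun ω ⟨M, hM⟩ => ?_⟩
  obtain ⟨R, hR⟩ := (isCompact_closedBall (0 : ℂ) M).exists_bound_of_continuousOn he.continuousOn
  exact ⟨R, fun s hs x => hR _ (by simpa using hM s hs x)⟩

theorem BddField.mul {m k : ℝ≥0 → Ω → E3 → ℂ} (hm : BddField P T m) (hk : BddField P T k) :
    BddField P T fun s ω x => m s ω x * k s ω x := by
  refine ⟨hm.measurable.mul hk.measurable, ?_⟩
  filter_upwards [hm.bounded, hk.bounded] with ω ⟨M, hM⟩ ⟨R, hR⟩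
  refine ⟨M * R, fun s hs x => ?_⟩
  rw [norm_mul]
  exact mul_le_mul (hM s hs x) (hR s hs x) (norm_nonneg _) ((norm_nonneg _).trans (hM s hs x))

theorem bddField_const {c : E3 → ℂ} (hc : Measurable c) {K : ℝ} (hK : ∀ x, ‖c x‖ ≤ K) :
    BddField P T fun _ _ x => c x :=
  ⟨hc.comp measurable_snd, ae_of_all _ fun _ => ⟨K, fun _ _ x => hK x⟩⟩

theorem bddField_brownian (hβm : ∀ l, Measurable (Function.uncurry (β l)))
    (hβc : ∀ l ω, Continuous fun t => β l t ω) (l : Fin N) :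
    BddField P T fun s ω _ => (β l s ω : ℂ) := by
  refine ⟨Complex.measurable_ofReal.comp ((hβm l).comp measurable_fst), ae_of_all _ fun ω => ?_⟩
  obtain ⟨M, hM⟩ := (isCompact_Icc (a := (0 : ℝ≥0)) (b := T)).exists_bound_of_continuousOn
    (hβc l ω).continuousOn
  refine ⟨M, fun s hs _ => ?_⟩
  rw [Complex.norm_real]
  exact hM s ⟨zero_le, hs⟩

/-! ### Integrability of pairings -/

/-- Replacing the smaller of the two numbers by the larger one is enough: only finiteness of the
pairing is needed, not a sharp constant. -/
theorem rpow_young {a b r : ℝ} (ha : 0 ≤ a) (hb : 0 ≤ b) (hr : 1 ≤ r) :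
    a * b ^ (r - 1) ≤ a ^ r + b ^ r := by
  have key : ∀ {c : ℝ}, 0 ≤ c → c * c ^ (r - 1) = c ^ r := fun hc => by
    rw [← Real.rpow_one_add' hc (by linarith)]
    congr 1
    ring
  rcases le_total a b with h | h
  · calc a * b ^ (r - 1) ≤ b * b ^ (r - 1) := by gcongr
      _ ≤ a ^ r + b ^ r := by rw [key hb]; exact le_add_of_nonneg_left (by positivity)
  · calc a * b ^ (r - 1) ≤ a * a ^ (r - 1) := by gcongr
      _ ≤ a ^ r + b ^ r := by rw [key ha]; exact le_add_of_nonneg_right (by positivity)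

/-- Pairing of an L^r test function with a field of size |w|^(r-1), where w is in L^r. It is used
with r = 2 for square integrable fields and with r = q + 2 for the nonlinearity. -/
theorem integrable_inner_prod [SFinite μ] {r : ℝ} (hr : 1 ≤ r) {φ : E3 → C6}
    (hφ : MemLp φ (ENNReal.ofReal r) μ) {k w : ℝ≥0 × E3 → C6} (hk : Measurable k)
    (hw : Measurable w) (hle : ∀ p, ‖k p‖ ≤ ‖w p‖ ^ (r - 1))
    (hfin : ∫⁻ s in Icc 0 T, ∫⁻ x, ‖w (s, x)‖ₑ ^ r ∂μ ∂leb < ∞) :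
    Integrable (fun p => inner ℂ (φ p.2) (k p)) ((leb.restrict (Icc 0 T)).prod μ) := by
  have hφs : AEStronglyMeasurable (fun p : ℝ≥0 × E3 => φ p.2) ((leb.restrict (Icc 0 T)).prod μ) :=
    hφ.1.comp_snd
  refine ⟨hφs.inner hk.aestronglyMeasurable, ?_⟩
  have hpt : ∀ p : ℝ≥0 × E3, ‖inner ℂ (φ p.2) (k p)‖ₑ ≤ ‖φ p.2‖ₑ ^ r + ‖w p‖ₑ ^ r := fun p => by
    rw [← ofReal_norm, ← ofReal_norm, ← ofReal_norm,
      ENNReal.ofReal_rpow_of_nonneg (norm_nonneg _) (by linarith),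
      ENNReal.ofReal_rpow_of_nonneg (norm_nonneg _) (by linarith),
      ← ENNReal.ofReal_add (by positivity) (by positivity)]
    refine ENNReal.ofReal_le_ofReal ((norm_inner_le_norm _ _).trans ?_)
    refine (mul_le_mul_of_nonneg_left (hle p) (norm_nonneg _)).trans ?_
    exact rpow_young (norm_nonneg _) (norm_nonneg _) hr
  have hwm : Measurable fun p => ‖w p‖ₑ ^ r := hw.enorm.pow_const r
  refine (lintegral_mono hpt).trans_lt ?_
  rw [lintegral_add_right _ hwm, lintegral_prod _ hwm.aemeasurable,
    lintegral_prod _ (hφs.enorm.pow_const r)]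
  refine ENNReal.add_lt_top.2 ⟨?_, hfin⟩
  have h1 := hφ.2
  have hr0 : (0 : ℝ) < r := by linarith
  rw [eLpNorm_lt_top_iff_lintegral_rpow_enorm_lt_top (by simpa using hr0) ENNReal.ofReal_ne_top,
    ENNReal.toReal_ofReal hr0.le] at h1
  change ∫⁻ _ in Icc 0 T, (∫⁻ y, ‖φ y‖ₑ ^ r ∂μ) ∂leb < ∞
  rw [setLIntegral_const]
  exact ENNReal.mul_lt_top h1 (leb_Icc_lt_top T)

variable {h k v : ℝ≥0 → Ω → E3 → C6}

theorem measurable_slice (hm : Measurable fun p : (ℝ≥0 × Ω) × E3 => h p.1.1 p.1.2 p.2) (ω : Ω) :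
    Measurable fun p : ℝ≥0 × E3 => h p.1 ω p.2 :=
  hm.comp (by fun_prop : Measurable fun p : ℝ≥0 × E3 => ((p.1, ω), p.2))

theorem SqField.integrable_inner [SFinite μ] (hh : SqField P T μ h) {φ : E3 → C6}
    (hφ : MemLp φ 2 μ) : ∀ᵐ ω ∂P, Integrable (fun p : ℝ≥0 × E3 => inner ℂ (φ p.2) (h p.1 ω p.2))
      ((leb.restrict (Icc 0 T)).prod μ) := by
  filter_upwards [hh.finite] with ω h1
  have hm := measurable_slice hh.measurable ω
  refine integrable_inner_prod (r := 2) (by norm_num) (by simpa using hφ) hm hm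
    (fun p => ?_) (by simpa only [ENNReal.rpow_two] using h1)
  norm_num

theorem norm_powerNL {q : ℝ} (hq : 0 < q) (a : C6) : ‖powerNL q a‖ = ‖a‖ ^ (q + 1) := by
  rw [powerNL, norm_smul, Complex.norm_real, Real.norm_of_nonneg (by positivity),
    Real.rpow_add_one' (norm_nonneg _) (by linarith)]

theorem measurable_powerNL {α : Type*} [MeasurableSpace α] {q : ℝ} {a : α → C6}
    (ha : Measurable a) : Measurable fun p => powerNL q (a p) := by
  unfold powerNL
  exact (Complex.measurable_ofReal.comp (ha.norm.pow_const q)).smul ha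

theorem integrable_inner_powerNL [SFinite μ] {q : ℝ} (hq : 0 < q)
    (hm : Measurable fun p : (ℝ≥0 × Ω) × E3 => v p.1.1 p.1.2 p.2)
    (hfin : ∀ᵐ ω ∂P, ∫⁻ s in Icc 0 T, ∫⁻ x, ‖v s ω x‖ₑ ^ (q + 2) ∂μ ∂leb < ∞) {φ : E3 → C6}
    (hφ : MemLp φ (ENNReal.ofReal (q + 2)) μ) : ∀ᵐ ω ∂P, Integrable
      (fun p : ℝ≥0 × E3 => inner ℂ (φ p.2) (powerNL q (v p.1 ω p.2)))
      ((leb.restrict (Icc 0 T)).prod μ) := by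
  filter_upwards [hfin] with ω h1
  have hm := measurable_slice hm ω
  refine integrable_inner_prod (r := q + 2) (by linarith) hφ (measurable_powerNL hm) hm
    (fun p => ?_) h1
  rw [norm_powerNL hq]
  exact le_of_eq (by congr 1; ring)

theorem sq_lintegral_mul_le {a b : E3 → ℝ≥0∞} (ha : AEMeasurable a μ) (hb : AEMeasurable b μ) :
    (∫⁻ x, a x * b x ∂μ) ^ 2 ≤ (∫⁻ x, a x ^ 2 ∂μ) * ∫⁻ x, b x ^ 2 ∂μ := by
  have h1 := ENNReal.lintegral_mul_le_Lp_mul_Lq μ Real.HolderConjugate.two_two ha hb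
  simp only [Pi.mul_apply, ENNReal.rpow_two] at h1
  refine (pow_le_pow_left' h1 2).trans ?_
  rw [mul_pow, ← ENNReal.rpow_natCast, ← ENNReal.rpow_natCast, ← ENNReal.rpow_mul,
    ← ENNReal.rpow_mul]
  norm_num

theorem enorm_inner_le_enorm (a c : C6) : ‖inner ℂ a c‖ₑ ≤ ‖a‖ₑ * ‖c‖ₑ := by
  simp only [enorm_eq_nnnorm]
  exact_mod_cast nnnorm_inner_le_nnnorm a c

theorem sq_lintegral_enorm_inner_le {φ a c : E3 → C6} (hφ : AEStronglyMeasurable φ μ)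
    (ha : Measurable a) (hc : Measurable c) :
    (∫⁻ x, ‖inner ℂ (φ x) (a x)‖ₑ + ‖inner ℂ (φ x) (c x)‖ₑ ∂μ) ^ 2
      ≤ (∫⁻ x, ‖φ x‖ₑ ^ 2 ∂μ) * (4 * (∫⁻ x, ‖a x‖ₑ ^ 2 ∂μ + ∫⁻ x, ‖c x‖ₑ ^ 2 ∂μ)) := by
  have h1 : ∫⁻ x, ‖inner ℂ (φ x) (a x)‖ₑ + ‖inner ℂ (φ x) (c x)‖ₑ ∂μ
      ≤ ∫⁻ x, ‖φ x‖ₑ * (‖a x‖ₑ + ‖c x‖ₑ) ∂μ := by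
    refine lintegral_mono fun x => ?_
    rw [mul_add]
    exact add_le_add (enorm_inner_le_enorm _ _) (enorm_inner_le_enorm _ _)
  refine (pow_le_pow_left' h1 2).trans ((sq_lintegral_mul_le hφ.enorm
    (ha.enorm.add hc.enorm).aemeasurable).trans (mul_le_mul_right ?_ _))
  rw [← lintegral_add_left (ha.enorm.pow_const 2), ← lintegral_const_mul' _ _ (by norm_num)]
  refine lintegral_mono fun x => ?_
  have h2 : ‖a x‖ₑ + ‖c x‖ₑ ≤ 2 * max ‖a x‖ₑ ‖c x‖ₑ := by
    rw [two_mul]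
    exact add_le_add (le_max_left _ _) (le_max_right _ _)
  have h3 : max ‖a x‖ₑ ‖c x‖ₑ ^ 2 ≤ ‖a x‖ₑ ^ 2 + ‖c x‖ₑ ^ 2 := by
    rcases max_cases ‖a x‖ₑ ‖c x‖ₑ with h | h <;> rw [h.1]
    · exact le_self_add
    · exact le_add_self
  refine (pow_le_pow_left' h2 2).trans ?_
  rw [mul_pow]
  norm_num
  gcongr

/-- Cauchy–Schwarz in x bounds the energy by a product of L² norms. The bound is measurable in ω and
almost surely finite, as the tightness argument for the noise coefficients requires. -/
theorem SqField.energy [SFinite μ] (hh : SqField P T μ h) (hk : SqField P T μ k) {φ : E3 → C6}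
    (hφ : MemLp φ 2 μ) : ∃ κ : Ω → ℝ≥0∞, AEMeasurable κ P ∧ (∀ᵐ ω ∂P, κ ω < ∞) ∧
      ∀ᵐ ω ∂P, ∫⁻ s in Icc 0 T, (∫⁻ x, ‖inner ℂ (φ x) (h s ω x)‖ₑ
        + ‖inner ℂ (φ x) (k s ω x)‖ₑ ∂μ) ^ 2 ∂leb ≤ κ ω := by
  have hc : ∫⁻ x, ‖φ x‖ₑ ^ 2 ∂μ ≠ ∞ := by
    have h1 := hφ.2
    rw [eLpNorm_lt_top_iff_lintegral_rpow_enorm_lt_top two_ne_zero ENNReal.ofNat_ne_top] at h1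
    simpa using h1.ne
  have hm : ∀ {h : ℝ≥0 → Ω → E3 → C6}, SqField P T μ h →
      Measurable fun p : ℝ≥0 × Ω => ∫⁻ x, ‖h p.1 p.2 x‖ₑ ^ 2 ∂μ := fun hh =>
    (hh.measurable.enorm.pow_const 2).lintegral_prod_right'
  refine ⟨fun ω => (∫⁻ x, ‖φ x‖ₑ ^ 2 ∂μ) * (4 * (∫⁻ s in Icc 0 T, ∫⁻ x, ‖h s ω x‖ₑ ^ 2 ∂μ ∂leb
    + ∫⁻ s in Icc 0 T, ∫⁻ x, ‖k s ω x‖ₑ ^ 2 ∂μ ∂leb)), ?_, ?_, ae_of_all _ fun ω => ?_⟩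
  · exact ((((hm hh).lintegral_prod_left').add ((hm hk).lintegral_prod_left')).const_mul
      _).const_mul _ |>.aemeasurable
  · filter_upwards [hh.finite, hk.finite] with ω h1 h2
    exact ENNReal.mul_lt_top hc.lt_top (ENNReal.mul_lt_top (by norm_num)
      (ENNReal.add_lt_top.2 ⟨h1, h2⟩))
  · beta_reduce
    have hms : Measurable fun s => ∫⁻ x, ‖h s ω x‖ₑ ^ 2 ∂μ := 
      ((measurable_slice hh.measurable ω).enorm.pow_const 2).lintegral_prod_right'
    rw [← lintegral_add_left hms, ← lintegral_const_mul' _ _ (by norm_num),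
      ← lintegral_const_mul' _ _ hc]
    refine lintegral_mono fun s => ?_
    have hhx : Measurable fun x => h s ω x := hh.measurable.comp (measurable_prodMk_left (x := (s, ω)))
    have hkx : Measurable fun x => k s ω x := hk.measurable.comp (measurable_prodMk_left (x := (s, ω)))
    exact sq_lintegral_enorm_inner_le hφ.1 hhx hkx

end Versions

/-! ### Multiplication of weak solutions by the exponential phase -/

section Transformation

variable {Ω : Type*} {mΩ : MeasurableSpace Ω} {P : Measure Ω} {F : Filtration ℝ≥0 mΩ}
  {T : ℝ≥0} {N : ℕ} {β : Fin N → ℝ≥0 → Ω → ℝ} {D : Set E3} {q : ℝ} {u₀ : Ω → H D}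
  {v w : ℝ≥0 → Ω → H D} {f f' : ℝ≥0 → Ω → E3 → C6} {g g' : Fin N → ℝ≥0 → Ω → E3 → C6}
  {C : Fin N → E3 → ℝ} {G : Fin N → E3 → E3} {K : ℝ}

theorem inner_eq_integral {a c : H D} {a' c' : E3 → C6} (ha : a =ᵐ[volume.restrict D] a')
    (hc : c =ᵐ[volume.restrict D] c') : inner ℂ a c = ∫ x in D, inner ℂ (a' x) (c' x) := by
  rw [L2.inner_def]
  refine integral_congr_ae ?_
  filter_upwards [ha, hc] with x h1 h2
  rw [h1, h2]

theorem integrable_inner_of_ae {a c : H D} {a' c' : E3 → C6} (ha : a =ᵐ[volume.restrict D] a')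
    (hc : c =ᵐ[volume.restrict D] c') :
    Integrable (fun x => inner ℂ (a' x) (c' x)) (volume.restrict D) := by
  refine (L2.integrable_inner (𝕜 := ℂ) a c).congr ?_
  filter_upwards [ha, hc] with x h1 h2
  rw [h1, h2]

theorem integral_driftZero {φ ψ a : H D} {b : E3 → C6} {φ' ψ' a' b' : E3 → C6}
    (hφ : φ =ᵐ[volume.restrict D] φ') (hψ : ψ =ᵐ[volume.restrict D] ψ')
    (ha : a =ᵐ[volume.restrict D] a') (hb : b =ᵐ[volume.restrict D] b')
    (hi : Integrable (fun x => inner ℂ (φ' x) (b' x)) (volume.restrict D)) :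
    -inner ℂ ψ a + ∫ x in D, inner ℂ (φ x) (b x) = ∫ x in D, driftZero a' b' φ' ψ' x := by
  simp only [driftZero]
  have hn : Integrable (fun x => -inner ℂ (ψ' x) (a' x)) (volume.restrict D) :=
    (integrable_inner_of_ae hψ ha).neg
  rw [integral_add hn hi, integral_neg, inner_eq_integral hψ ha]
  congr 1
  refine integral_congr_ae ?_
  filter_upwards [hφ, hb] with x h1 h2
  rw [h1, h2]

theorem SolvesWeakly.init [IsProbabilityMeasure P] (hs : SolvesWeakly P F β D T q u₀ f g v)
    {φ ψ : H D} (hφ : MaxwellGraph D φ ψ)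
    (hφq : MemLp φ (ENNReal.ofReal (q + 2)) (volume.restrict D)) :
    ∀ᵐ ω ∂P, inner ℂ φ (v 0 ω - u₀ ω) = 0 := by
  obtain ⟨I, hI, hr⟩ := hs.2 φ ψ hφ hφq
  filter_upwards [hr, ae_all_iff.2 fun j => (hI j).eval_zero] with ω h1 h2
  have h3 : leb (Icc 0 (0 : ℝ≥0)) = 0 := by simp
  rw [h1 0 zero_le, setIntegral_measure_zero _ h3]
  simp [h2]

theorem SolvesWeakly.itoRep [IsProbabilityMeasure P] (hs : SolvesWeakly P F β D T q u₀ f g v)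
    (hc : ContinuousPaths P T v) {φ ψ : H D} (hφ : MaxwellGraph D φ ψ)
    (hφq : MemLp φ (ENNReal.ofReal (q + 2)) (volume.restrict D))
    (hint : ∀ᵐ ω ∂P, IntegrableOn
      (fun s => -inner ℂ ψ (v s ω) + ∫ x in D, inner ℂ (φ x) (f s ω x)) (Icc 0 T) leb) :
    ItoRep P F β T (fun t ω => inner ℂ φ (v t ω))
      (fun s ω => -inner ℂ ψ (v s ω) + ∫ x in D, inner ℂ (φ x) (f s ω x))
      (fun j s ω => ∫ x in D, inner ℂ (φ x) (g j s ω x)) where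
  adapted t ht := stronglyMeasurable_const.inner (hs.1 t ht)
  cont := hc.mono fun ω h1 => continuousOn_const.inner h1
  drift := hint
  repr := by
    obtain ⟨I, hI, hr⟩ := hs.2 φ ψ hφ hφq
    refine ⟨I, hI, ?_⟩
    filter_upwards [hr, hs.init hφ hφq] with ω h1 h2 t ht
    have h3 := h1 t ht
    rw [inner_sub_right] at h2 h3
    linear_combination h3 - h2

theorem solvesWeakly_of_itoRep (hw : ∀ t ≤ T, StronglyMeasurable[F t] (w t))
    (H : ∀ φ ψ : H D, MaxwellGraph D φ ψ →
      MemLp φ (ENNReal.ofReal (q + 2)) (volume.restrict D) →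
      ItoRep P F β T (fun t ω => inner ℂ φ (w t ω))
        (fun s ω => -inner ℂ ψ (w s ω) + ∫ x in D, inner ℂ (φ x) (f s ω x))
        (fun j s ω => ∫ x in D, inner ℂ (φ x) (g j s ω x)) ∧
      ∀ᵐ ω ∂P, inner ℂ φ (w 0 ω - u₀ ω) = 0) : SolvesWeakly P F β D T q u₀ f g w := by
  refine ⟨hw, fun φ ψ hφ hφq => ?_⟩
  obtain ⟨h1, h2⟩ := H φ ψ hφ hφq
  obtain ⟨I, hI, hr⟩ := h1.repr
  refine ⟨I, hI, ?_⟩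
  filter_upwards [hr, h2] with ω h3 h4 t ht
  have h5 := h3 t ht
  rw [inner_sub_right] at h4 ⊢
  linear_combination h5 + h4

/-- Representatives of the pairs `(φ, M φ)` with `φ ∈ D(M) ∩ L^{q+2}(D)⁶`. -/
def TestPair (D : Set E3) (q : ℝ) (φ ψ : E3 → C6) : Prop :=
  MemLp φ (ENNReal.ofReal (q + 2)) (volume.restrict D) ∧ ∃ φ' ψ' : H D, MaxwellGraph D φ' ψ' ∧
    φ' =ᵐ[volume.restrict D] φ ∧ ψ' =ᵐ[volume.restrict D] ψ

theorem TestPair.memLp_left {φ ψ : E3 → C6} (h : TestPair D q φ ψ) :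
    MemLp φ 2 (volume.restrict D) := by
  obtain ⟨-, φ', ψ', -, h1, -⟩ := h
  exact (memLp_congr_ae h1).1 (Lp.memLp φ')

theorem TestPair.memLp_right {φ ψ : E3 → C6} (h : TestPair D q φ ψ) :
    MemLp ψ 2 (volume.restrict D) := by
  obtain ⟨-, φ', ψ', -, -, h1⟩ := h
  exact (memLp_congr_ae h1).1 (Lp.memLp ψ')

theorem memLp_rotTest {r : ℝ≥0∞} {c : E3 → ℝ} (hc : Measurable c) (hK : ∀ x, |c x| ≤ K)
    {φ : E3 → C6} (hφ : MemLp φ r (volume.restrict D)) :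
    MemLp (fun x => (-Complex.I * (c x : ℂ)) • φ x) r (volume.restrict D) := by
  refine hφ.of_le_mul (c := K) ?_ (ae_of_all _ fun x => ?_)
  · exact (((Complex.measurable_ofReal.comp hc).const_mul _).aestronglyMeasurable).smul hφ.1
  · rw [norm_smul, norm_mul, norm_neg, Complex.norm_I, one_mul, Complex.norm_real]
    exact mul_le_mul_of_nonneg_right (hK x) (norm_nonneg _)

/-- The Leibniz rule with the smooth function s ↦ -i s; membership in L^{q+2} survives because the
coefficient is bounded. -/
theorem TestPair.rot (hcov : ShiftCover D) (hD : IsOpen D) {c : E3 → ℝ} {γ : E3 → E3}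
    (hcm : Measurable c) (hγm : Measurable γ) (hcK : ∀ x, |c x| ≤ K) (hγK : ∀ x, ‖γ x‖ ≤ K)
    (hc : HasWeakGradient D c γ) {φ ψ : E3 → C6} (h : TestPair D q φ ψ) :
    TestPair D q (rotTest c φ) (rotTestImage c γ φ ψ) := by
  have h1 : MemLp (rotTest c φ) 2 (volume.restrict D) := memLp_rotTest hcm hcK h.memLp_left
  have h2 : MemLp (rotTestImage c γ φ ψ) 2 (volume.restrict D) := by
    refine (memLp_rotTest hcm hcK h.memLp_right).add (MemLp.const_smul (c := -Complex.I) ?_)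
    refine h.memLp_left.of_le_mul (c := 12 * K) ?_ (ae_of_all _ fun x => ?_)
    · obtain ⟨φ₀, h3, h4⟩ := h.memLp_left.1
      refine ⟨fun x => crossTerm (γ x) (φ₀ x),
        (measurable_crossTerm hγm h3.measurable).stronglyMeasurable, h4.mono fun x hx => ?_⟩
      simp only [hx]
    · refine (norm_crossTerm_le _ _).trans ?_
      gcongr
      exact hγK x
  refine ⟨memLp_rotTest hcm hcK h.1, h1.toLp _, h2.toLp _, ?_, h1.coeFn_toLp, h2.coeFn_toLp⟩
  obtain ⟨-, φ', ψ', h3, h4, h5⟩ := h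
  have hE : ContDiff ℝ (⊤ : ℕ∞) fun s : ℝ => -Complex.I * (s : ℂ) :=
    contDiff_const.mul Complex.ofRealCLM.contDiff
  have hE' : ∀ s : ℝ, deriv (fun s : ℝ => -Complex.I * (s : ℂ)) s = -Complex.I := fun s => by
    have h6 := (Complex.ofRealCLM.hasDerivAt (x := s)).const_mul (-Complex.I)
    simpa using h6.deriv
  refine h3.mul hcov hD hcm hγm hcK hγK hc hE ?_ ?_
  · filter_upwards [h1.coeFn_toLp, h4] with x h6 h7
    rw [h6, h7, rotTest]
  · filter_upwards [h2.coeFn_toLp, h4, h5] with x h6 h7 h8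
    rw [h6, h7, h8, hE', rotTestImage]

variable {v' h' : ℝ≥0 → Ω → E3 → C6}

/-- The drift is split into the nonlinearity, which pairs with φ in L^{q+2}, and a square integrable
remainder, which pairs with φ in L². This is why test functions carry both integrability conditions.
-/
theorem pairingData (hcov : ShiftCover D) (hD : IsOpen D) (hq : 0 < q)
    (hCm : ∀ l, Measurable (C l)) (hGm : ∀ l, Measurable (G l)) (hCK : ∀ l x, |C l x| ≤ K)
    (hGK : ∀ l x, ‖G l x‖ ≤ K) (hCG : ∀ l, HasWeakGradient D (C l) (G l))
    (hv : SqField P T (volume.restrict D) v')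
    (hvs : ∀ᵐ ω ∂P, ∀ t ≤ T, v t ω =ᵐ[volume.restrict D] v' t ω)
    (hvq : ∀ᵐ ω ∂P, ∫⁻ s in Icc 0 T, (∫⁻ x in D, ‖v' s ω x‖ₑ ^ (q + 2)) ∂leb < ∞)
    (hh : SqField P T (volume.restrict D) h') (hg : ∀ l, SqField P T (volume.restrict D) (g l)) :
    PairingData P T (volume.restrict D) v' (fun s ω x => -powerNL q (v' s ω x) + h' s ω x) g C G
      (TestPair D q) where
  measurable_coeff := hCm
  bound := by
    refine ⟨K.toNNReal, fun l x => ?_⟩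
    rw [enorm_mul, ← ofReal_norm, Complex.norm_I, ENNReal.ofReal_one, one_mul, ← ofReal_norm,
      Complex.norm_real]
    exact ENNReal.ofReal_le_ofReal (hCK l x)
  rot l φ ψ hφ := hφ.rot hcov hD (hCm l) (hGm l) (hCK l) (hGK l) (hCG l)
  slice φ ψ hφ := by
    obtain ⟨-, φ', ψ', -, h1, -⟩ := hφ
    filter_upwards [hvs] with ω h2 t ht using integrable_inner_of_ae h1 (h2 t ht)
  drift φ ψ hφ := by
    filter_upwards [hv.integrable_inner hφ.memLp_right, hh.integrable_inner hφ.memLp_left,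
      integrable_inner_powerNL hq hv.measurable hvq hφ.1] with ω h1 h2 h3
    refine (h1.neg.add (h3.neg.add h2)).congr (ae_of_all _ fun p => ?_)
    simp [driftZero]
  cross l φ ψ hφ := by
    filter_upwards [(hv.crossTerm (hGm l) (hGK l)).integrable_inner hφ.memLp_left] with ω h1
    simp only [inner_crossTerm]
    exact h1
  proc φ ψ hφ := hv.integrable_inner hφ.memLp_left
  noise l φ ψ hφ := (hg l).integrable_inner hφ.memLp_left
  energy l φ ψ hφ := (hg l).energy hv hφ.memLp_left

/-- The drift of `e v` in terms of the drift `f` and the noise coefficients `g` of `v`. -/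
noncomputable def rotDrift (b : Fin N → ℝ) (C : Fin N → E3 → ℝ) (G : Fin N → E3 → E3) (e : ℂ)
    (v f : C6) (g : Fin N → C6) (x : E3) : C6 :=
  e • (f + ∑ l, ((-Complex.I * (b l : ℂ)) • crossTerm (G l x) v + (Complex.I * (C l x : ℂ)) • g l)
    + ((1 / 2 : ℂ) * ∑ l, (Complex.I * (C l x : ℂ)) ^ 2) • v)

/-- The commutator was generated on the test function; symmetry of the cross product term transfers
it to the solution, where it becomes part of the drift. -/
theorem driftZero_rotDrift (b : Fin N → ℝ) (C : Fin N → E3 → ℝ) (G : Fin N → E3 → E3)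
    (e : E3 → ℂ) (v f : E3 → C6) (g : Fin N → E3 → C6) (φ ψ : E3 → C6) (x : E3) :
    driftZero (fun x => e x • v x)
      (fun x => rotDrift b C G (e x) (v x) (f x) (fun l => g l x) x) φ ψ x
      = e x * driftZero v f φ ψ x + e x * driftOne b C G v g φ x + e x * driftTwo C v φ x := by
  simp only [driftZero, driftOne, driftTwo, rotDrift, inner_smul_right, inner_add_right, inner_sum,
    inner_crossTerm, ← Finset.sum_mul]
  ring

/-- Multiplication by `exp (i ∑ C_l β_l)` transforms weak solutions into weak solutions. -/
theorem SolvesWeakly.transform [IsProbabilityMeasure P] (hF : UsualConditions P F)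
    (hβ : IsBrownianFamily P F β) (hcov : ShiftCover D) (hD : IsOpen D) (hq : 0 < q)
    (hCm : ∀ l, Measurable (C l)) (hGm : ∀ l, Measurable (G l)) (hCK : ∀ l x, |C l x| ≤ K)
    (hGK : ∀ l x, ‖G l x‖ ≤ K) (hCG : ∀ l, HasWeakGradient D (C l) (G l))
    (hs : SolvesWeakly P F β D T q u₀ f g v) (hvc : ContinuousPaths P T v)
    (hvq : ∀ᵐ ω ∂P, ∫⁻ s in Icc 0 T, (∫⁻ x in D, ‖v s ω x‖ₑ ^ (q + 2)) ∂leb < ∞)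
    (hh : SqField P T (volume.restrict D) h') (hf : ∀ᵐ ω ∂P, ∀ᵐ s ∂leb.restrict (Icc 0 T),
      f s ω =ᵐ[volume.restrict D] fun x => -powerNL q (v s ω x) + h' s ω x)
    {k : Fin N → ℝ≥0 → Ω → E3 → C6} (hk : ∀ l, SqField P T (volume.restrict D) (k l))
    (hg : ∀ l, ∀ᵐ ω ∂P, ∀ᵐ s ∂leb.restrict (Icc 0 T), g l s ω =ᵐ[volume.restrict D] k l s ω)
    (hwa : ∀ t ≤ T, StronglyMeasurable[F t] (w t)) (hwc : ContinuousPaths P T w)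
    (hwv : ∀ᵐ ω ∂P, ∀ t ≤ T, w t ω =ᵐ[volume.restrict D]
      fun x => Complex.exp (brPhase β C t ω x) • v t ω x)
    (hf' : ∀ᵐ ω ∂P, ∀ᵐ s ∂leb.restrict (Icc 0 T), f' s ω =ᵐ[volume.restrict D] fun x =>
      rotDrift (fun l => β l s ω) C G (Complex.exp (brPhase β C s ω x)) (v s ω x) (f s ω x)
        (fun l => g l s ω x) x)
    (hg' : ∀ l, ∀ᵐ ω ∂P, ∀ᵐ s ∂leb.restrict (Icc 0 T), g' l s ω =ᵐ[volume.restrict D] fun x =>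
      Complex.exp (brPhase β C s ω x) • (g l s ω x + (Complex.I * (C l x : ℂ)) • v s ω x)) :
    SolvesWeakly P F β D T q u₀ f' g' w := by
  obtain ⟨v', hv', hvv⟩ := exists_sqField_of_continuousPaths hs.1 hvc
  have hmem : ∀ᵐ s ∂leb.restrict (Icc 0 T), s ≤ T :=
    (ae_restrict_mem measurableSet_Icc).mono fun s hs => hs.2
  have hvq' : ∀ᵐ ω ∂P, ∫⁻ s in Icc 0 T, (∫⁻ x in D, ‖v' s ω x‖ₑ ^ (q + 2)) ∂leb < ∞ := by
    filter_upwards [hvq, hvv] with ω h1 h2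
    refine lt_of_le_of_lt (le_of_eq ?_) h1
    refine setLIntegral_congr_fun measurableSet_Icc fun s hs => lintegral_congr_ae ?_
    filter_upwards [h2 s hs.2] with x hx
    rw [hx]
  have PD := pairingData (v := v) hcov hD hq hCm hGm hCK hGK hCG hv' hvv hvq' hh hk
  have hff : ∀ᵐ ω ∂P, ∀ᵐ s ∂leb.restrict (Icc 0 T),
      f s ω =ᵐ[volume.restrict D] fun x => -powerNL q (v' s ω x) + h' s ω x := by
    filter_upwards [hf, hvv] with ω h1 h2
    filter_upwards [h1, hmem] with s h3 h4
    filter_upwards [h3, h2 s h4] with x h5 h6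
    rw [h5, h6]
  have H : ∀ φ ψ, TestPair D q φ ψ →
      ItoRep P F β T (fun t ω => ∫ x in D, inner ℂ (φ x) (v' t ω x))
        (fun t ω => ∫ x in D, driftZero (v' t ω)
          (fun x => -powerNL q (v' t ω x) + h' t ω x) φ ψ x)
        (fun j t ω => ∫ x in D, inner ℂ (φ x) (k j t ω x)) := by
    intro φ ψ hφ
    obtain ⟨hφq, φ', ψ', h1, h2, h3⟩ := id hφ
    have hfi : ∀ᵐ ω ∂P, ∀ᵐ s ∂leb.restrict (Icc 0 T), Integrable
        (fun x => inner ℂ (φ x) (-powerNL q (v' s ω x) + h' s ω x)) (volume.restrict D) := by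
      filter_upwards [hh.integrable_inner hφ.memLp_left,
        integrable_inner_powerNL hq hv'.measurable hvq' hφq] with ω h4 h5
      filter_upwards [h4.prod_right_ae, h5.prod_right_ae] with s h6 h7
      refine (h7.neg.add h6).congr (ae_of_all _ fun x => ?_)
      simp
    have hd : ∀ᵐ ω ∂P, ∀ᵐ s ∂leb.restrict (Icc 0 T),
        -inner ℂ ψ' (v s ω) + ∫ x in D, inner ℂ (φ' x) (f s ω x) = ∫ x in D, driftZero (v' s ω)
          (fun x => -powerNL q (v' s ω x) + h' s ω x) φ ψ x := by
      filter_upwards [hff, hvv, hfi] with ω h4 h5 h6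
      filter_upwards [h4, hmem, h6] with s h7 h8 h9
      exact integral_driftZero h2 h3 (h5 s h8) h7 h9
    have hint : ∀ᵐ ω ∂P, IntegrableOn
        (fun s => -inner ℂ ψ' (v s ω) + ∫ x in D, inner ℂ (φ' x) (f s ω x)) (Icc 0 T) leb := by
      filter_upwards [PD.drift φ ψ hφ, hd] with ω h4 h5
      exact h4.integral_prod_left.congr (h5.mono fun s hs => hs.symm)
    refine ((hs.itoRep hvc h1 ((memLp_congr_ae h2).2 hφq) hint).congr_process hF ?_).congr hd
      fun l => ?_
    · filter_upwards [hvv] with ω h4 t ht using inner_eq_integral h2 (h4 t ht)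
    · filter_upwards [hg l] with ω h4
      filter_upwards [h4] with s h5
      refine integral_congr_ae ?_
      filter_upwards [h2, h5] with x h6 h7
      rw [h6, h7]
  have hwv' : ∀ᵐ ω ∂P, ∀ t ≤ T, w t ω =ᵐ[volume.restrict D]
      fun x => Complex.exp (brPhase β C t ω x) • v' t ω x := by
    filter_upwards [hwv, hvv] with ω h1 h2 t ht
    filter_upwards [h1 t ht, h2 t ht] with x h3 h4
    rw [h3, h4]
  refine solvesWeakly_of_itoRep hwa fun φ ψ hφ hφq => ⟨?_, ?_⟩
  · have hT : TestPair D q φ ψ := ⟨hφq, φ, ψ, hφ, ae_eq_refl _, ae_eq_refl _⟩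
    have hproc : ∀ᵐ ω ∂P, ∀ t ≤ T,
        procDens β C (volume.restrict D) v' Complex.exp φ t ω = inner ℂ φ (w t ω) := by
      filter_upwards [hwv'] with ω h1 t ht
      rw [inner_eq_integral (ae_eq_refl φ) (h1 t ht)]
      simp only [inner_smul_right, procDens]
    -- Continuity in time of the paired process does not come from the polynomial approximation; it
    -- is supplied by the continuous paths of w in L².
    have hcont : ∀ᵐ ω ∂P, ContinuousOn
        (fun t => procDens β C (volume.restrict D) v' Complex.exp φ t ω) (Icc 0 T) := by
      filter_upwards [hproc, hwc] with ω h1 h2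
      exact (continuousOn_const.inner h2).congr fun t ht => h1 t ht.2
    refine ((PD.itoRep_exp hF hβ H hT hcont).congr_process hF hproc).congr ?_ fun l => ?_
    · filter_upwards [PD.integrable_drift hβ hT Complex.continuous_exp Complex.continuous_exp
        Complex.continuous_exp, hwv', hff, hf', hvv, ae_all_iff.2 hg] with ω h1 h2 h3 h4 h5 h6
      filter_upwards [h1.prod_right_ae, hmem, h3, h4, ae_all_iff.2 h6] with s h7 h8 h9 h10 h11
      have hf2 : f' s ω =ᵐ[volume.restrict D] fun x => rotDrift (fun l => β l s ω) C G
          (Complex.exp (brPhase β C s ω x)) (v' s ω x) (-powerNL q (v' s ω x) + h' s ω x)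
          (fun l => k l s ω x) x := by
        filter_upwards [h10, h9, h5 s h8, ae_all_iff.2 h11] with x h12 h13 h14 h15
        simp only [h12, h13, h14, h15]
      have hpt : ∀ x, driftZero (fun x => Complex.exp (brPhase β C s ω x) • v' s ω x)
          (fun x => rotDrift (fun l => β l s ω) C G
          (Complex.exp (brPhase β C s ω x)) (v' s ω x) (-powerNL q (v' s ω x) + h' s ω x)
          (fun l => k l s ω x) x) φ ψ x = _ := fun x => driftZero_rotDrift (fun l => β l s ω) C G
          (fun x => Complex.exp (brPhase β C s ω x)) (v' s ω)
          (fun x => -powerNL q (v' s ω x) + h' s ω x) (fun l => k l s ω) φ ψ x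
      -- Read off from the integrability of the whole drift density by adding back the pairing of
      -- the solution with ψ.
      have hi : Integrable (fun x => inner ℂ (φ x) (rotDrift (fun l => β l s ω) C G
          (Complex.exp (brPhase β C s ω x)) (v' s ω x) (-powerNL q (v' s ω x) + h' s ω x)
          (fun l => k l s ω x) x)) (volume.restrict D) := by
        refine (h7.add (integrable_inner_of_ae (ae_eq_refl ψ) (h2 s h8))).congr
          (ae_of_all _ fun x => ?_)
        simp only [Pi.add_apply]
        rw [← hpt x, driftZero]
        ring
      rw [integral_driftZero (ae_eq_refl φ) (ae_eq_refl ψ) (h2 s h8) hf2 hi, driftDens]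
      exact integral_congr_ae (ae_of_all _ fun x => (hpt x).symm)
    · filter_upwards [hg l, hg' l, hvv] with ω h1 h2 h3
      filter_upwards [h1, h2, hmem] with s h4 h5 h6
      rw [noiseDens]
      refine integral_congr_ae ?_
      filter_upwards [h4, h5, h3 s h6] with x h7 h8 h9
      rw [h8, h7, h9, inner_smul_right, inner_add_right, inner_smul_right]
      ring
  -- Brownian motions start at zero, so the phase is 1 at time 0 and the initial condition is
  -- unchanged.
  · have h0 : ∀ᵐ ω ∂P, ∀ l, β l 0 ω = 0 :=
      ae_all_iff.2 fun l => (hβ.brownian l).eval_zero_ae_eq_zero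
    filter_upwards [hs.init hφ hφq, hwv, h0] with ω h1 h2 h3
    have h4 : w 0 ω = v 0 ω := Lp.ext <| by
      filter_upwards [h2 0 zero_le] with x hx
      rw [hx]
      simp [brPhase, h3]
    rw [h4, h1]

end Transformation

/-! ### Multiplication by the phase factor -/

section Rescale

variable {D : Set E3} {N : ℕ} (B : Fin N → LInf D) (c c' : Fin N → ℝ) (f f' : H D)

theorem coeFn_rescale : rescale B c f =ᵐ[volume.restrict D] fun x => phase B c x • f x :=
  (memLp_phase_smul B c f).coeFn_toLp

theorem enorm_coeFn_rescale : ∀ᵐ x ∂volume.restrict D, ‖rescale B c f x‖ₑ = ‖f x‖ₑ := by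
  filter_upwards [coeFn_rescale B c f] with x hx
  rw [hx, enorm_smul, ← ofReal_norm, norm_phase, ENNReal.ofReal_one, one_mul]

theorem enorm_rescale : ‖rescale B c f‖ₑ = ‖f‖ₑ := by
  rw [Lp.enorm_def, Lp.enorm_def]
  exact eLpNorm_congr_enorm_ae (enorm_coeFn_rescale B c f)

theorem norm_rescale : ‖rescale B c f‖ = ‖f‖ := by
  rw [← toReal_enorm, enorm_rescale, toReal_enorm]

theorem rescale_sub : rescale B c (f - f') = rescale B c f - rescale B c f' := by
  refine Lp.ext ?_
  filter_upwards [coeFn_rescale B c (f - f'), coeFn_rescale B c f, coeFn_rescale B c f',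
    Lp.coeFn_sub f f', Lp.coeFn_sub (rescale B c f) (rescale B c f')] with x h1 h2 h3 h4 h5
  rw [h1, h5, Pi.sub_apply, h2, h3, h4, Pi.sub_apply, smul_sub]

theorem phase_neg_mul (x : E3) : phase B (-c) x * phase B c x = 1 := by
  rw [phase, phase, ← Complex.exp_add, Complex.exp_eq_one_iff]
  exact ⟨0, by simp⟩

theorem rescale_neg_rescale : rescale B (-c) (rescale B c f) = f := by
  refine Lp.ext ?_
  filter_upwards [coeFn_rescale B (-c) (rescale B c f), coeFn_rescale B c f] with x h1 h2
  rw [h1, h2, smul_smul, phase_neg_mul, one_smul]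

theorem phase_eq (x : E3) :
    phase B c x = Complex.exp (Complex.I * ((-∑ l, B l x * c l : ℝ) : ℂ)) := by
  rw [phase]
  push_cast
  congr 1
  ring

theorem norm_phase_sub_le (x : E3) :
    ‖phase B c x - phase B c' x‖ ≤ ∑ l, |B l x| * |c l - c' l| := by
  have h1 : phase B c x - phase B c' x = phase B c' x
      * (Complex.exp (Complex.I * ((-∑ l, B l x * (c l - c' l) : ℝ) : ℂ)) - 1) := by
    rw [phase_eq, phase_eq, mul_sub, ← Complex.exp_add, mul_one, ← mul_add, ← Complex.ofReal_add]
    congr 5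
    rw [← neg_add, ← Finset.sum_add_distrib]
    congr 1
    exact Finset.sum_congr rfl fun l _ => by ring
  rw [h1, norm_mul, norm_phase, one_mul]
  refine (Real.norm_exp_I_mul_ofReal_sub_one_le).trans ?_
  rw [norm_neg]
  refine (norm_sum_le _ _).trans (Finset.sum_le_sum fun l _ => ?_)
  rw [norm_mul]
  rfl

theorem norm_rescale_sub_le : ‖rescale B c f - rescale B c' f‖
    ≤ (∑ l, ‖B l‖ * |c l - c' l|) * ‖f‖ := by
  have hB : ∀ᵐ x ∂volume.restrict D, ∀ l, |B l x| ≤ ‖B l‖ := ae_all_iff.2 fun l => by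
    have h2 := ae_le_eLpNormEssSup (f := B l) (μ := volume.restrict D)
    filter_upwards [h2] with x hx
    rw [Lp.norm_def, eLpNorm_exponent_top, ← Real.norm_eq_abs, ← toReal_enorm]
    refine ENNReal.toReal_mono ?_ hx
    rw [← eLpNorm_exponent_top]
    exact (Lp.memLp (B l)).2.ne
  refine Lp.norm_le_mul_norm_of_ae_le_mul ?_
  filter_upwards [hB, Lp.coeFn_sub (rescale B c f) (rescale B c' f), coeFn_rescale B c f,
    coeFn_rescale B c' f] with x h1 h2 h3 h4
  rw [h2, Pi.sub_apply, h3, h4, ← sub_smul, norm_smul]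
  refine mul_le_mul_of_nonneg_right ((norm_phase_sub_le B c c' x).trans ?_) (norm_nonneg _)
  exact Finset.sum_le_sum fun l _ => mul_le_mul_of_nonneg_right (h1 l) (abs_nonneg _)

/-- The map is an isometry in f for each c and continuous in c for each f; a uniform Lipschitz bound
in one variable upgrades separate to joint continuity. -/
theorem continuous_rescale : Continuous fun p : (Fin N → ℝ) × H D => rescale B p.1 p.2 := by
  refine continuous_prod_of_continuous_lipschitzWith' _ 1 (fun c => ?_) fun f => ?_
  · refine LipschitzWith.of_dist_le_mul fun a b => ?_
    rw [dist_eq_norm, dist_eq_norm, ← rescale_sub, norm_rescale]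
    simp
  · refine continuous_iff_continuousAt.2 fun c => ?_
    rw [ContinuousAt, tendsto_iff_norm_sub_tendsto_zero]
    refine squeeze_zero (fun _ => norm_nonneg _) (fun c' => norm_rescale_sub_le B c' c f) ?_
    have h1 : Continuous fun c' : Fin N → ℝ => (∑ l, ‖B l‖ * |c' l - c l|) * ‖f‖ := by fun_prop
    simpa using h1.tendsto c

theorem continuousOn_rescale {α : Type*} [TopologicalSpace α] {s : Set α} {c : α → Fin N → ℝ}
    {f : α → H D} (hc : ContinuousOn c s) (hf : ContinuousOn f s) :
    ContinuousOn (fun t => rescale B (c t) (f t)) s := by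
  have key : ∀ R : (Fin N → ℝ) × H D → H D, Continuous R →
      ContinuousOn (fun t => R (c t, f t)) s := fun R hR => hR.comp_continuousOn (hc.prodMk hf)
  have := key _ (continuous_rescale B)
  exact this

theorem stronglyMeasurable_rescale {α : Type*} {m : MeasurableSpace α} {c : α → Fin N → ℝ}
    {f : α → H D} (hc : StronglyMeasurable c) (hf : StronglyMeasurable f) :
    StronglyMeasurable fun t => rescale B (c t) (f t) := by
  have key : ∀ R : (Fin N → ℝ) × H D → H D, Continuous R →
      StronglyMeasurable fun t => R (c t, f t) := fun R hR =>
    hR.comp_stronglyMeasurable (hc.prodMk hf)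
  have := key _ (continuous_rescale B)
  exact this

end Rescale

/-! ### Paths, adaptedness and energy of the transformed process -/

section Transform

variable {Ω : Type*} {mΩ : MeasurableSpace Ω} {P : Measure Ω} {F : Filtration ℝ≥0 mΩ}
  {T : ℝ≥0} {N : ℕ} {β : Fin N → ℝ≥0 → Ω → ℝ} {D : Set E3} {q : ℝ} {B : Fin N → LInf D}
  {u v w : ℝ≥0 → Ω → H D}

theorem continuousPaths_transform [IsProbabilityMeasure P] (hβ : IsBrownianFamily P F β)
    (hu : ContinuousPaths P T u) : ContinuousPaths P T (transform β B u) := by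
  filter_upwards [hu, ae_all_iff.2 fun l => (hβ.brownian l).cont] with ω h1 h2
  exact continuousOn_rescale B (continuous_pi fun l => h2 l).continuousOn h1

theorem stronglyMeasurable_vec {α : Type*} {m : MeasurableSpace α} {b : Fin N → α → ℝ}
    (hb : ∀ l, StronglyMeasurable (b l)) : StronglyMeasurable fun a l => b l a :=
  (measurable_pi_iff.2 fun l => (hb l).measurable).stronglyMeasurable

theorem stronglyMeasurable_brownian_vec (hβ : IsBrownianFamily P F β) (t : ℝ≥0) :
    StronglyMeasurable[F t] fun ω l => β l t ω :=
  stronglyMeasurable_vec fun l => hβ.adapted l t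

theorem adapted_transform (hβ : IsBrownianFamily P F β)
    (hu : ∀ t ≤ T, StronglyMeasurable[F t] (u t)) :
    ∀ t ≤ T, StronglyMeasurable[F t] (transform β B u t) := fun t ht =>
  stronglyMeasurable_rescale B (stronglyMeasurable_brownian_vec hβ t) (hu t ht)

theorem adapted_of_transform (hβ : IsBrownianFamily P F β)
    (hu : ∀ t ≤ T, StronglyMeasurable[F t] (transform β B u t)) :
    ∀ t ≤ T, StronglyMeasurable[F t] (u t) := fun t ht => by
  have h1 : u t = fun ω => rescale B (-fun l => β l t ω) (transform β B u t ω) :=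
    funext fun ω => (rescale_neg_rescale B _ _).symm
  rw [h1]
  exact stronglyMeasurable_rescale B (stronglyMeasurable_brownian_vec hβ t).neg (hu t ht)

theorem finiteEnergy_transform :
    FiniteEnergy P T q (transform β B u) ↔ FiniteEnergy P T q u := by
  have h1 : ∀ t ω, ‖transform β B u t ω‖ₑ = ‖u t ω‖ₑ := fun t ω => enorm_rescale _ _ _
  have h2 : ∀ t ω, ∫⁻ x in D, ‖transform β B u t ω x‖ₑ ^ (q + 2)
      = ∫⁻ x in D, ‖u t ω x‖ₑ ^ (q + 2) := fun t ω =>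
    lintegral_congr_ae ((enorm_coeFn_rescale B (fun l => β l t ω) (u t ω)).mono fun x hx => by
      simp only [transform, hx])
  simp only [FiniteEnergy, h1, h2]

/-- A finite expectation forces almost sure finiteness only for measurable functions, hence the
passage to a jointly measurable representative. -/
theorem FiniteEnergy.ae_lt_top [IsProbabilityMeasure P] (hE : FiniteEnergy P T q v)
    (hv : ∀ t ≤ T, StronglyMeasurable[F t] (v t)) (hc : ContinuousPaths P T v) :
    ∀ᵐ ω ∂P, ∫⁻ s in Icc 0 T, (∫⁻ x in D, ‖v s ω x‖ₑ ^ (q + 2)) ∂leb < ∞ := by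
  obtain ⟨v', hv', hvv⟩ := exists_sqField_of_continuousPaths hv hc
  have h1 : ∀ᵐ ω ∂P, ∫⁻ s in Icc 0 T, (∫⁻ x in D, ‖v s ω x‖ₑ ^ (q + 2)) ∂leb
      = ∫⁻ s in Icc 0 T, (∫⁻ x in D, ‖v' s ω x‖ₑ ^ (q + 2)) ∂leb := by
    filter_upwards [hvv] with ω h2
    refine setLIntegral_congr_fun measurableSet_Icc fun s hs => lintegral_congr_ae ?_
    filter_upwards [h2 s hs.2] with x hx
    rw [hx]
  have h2 : Measurable fun ω => ∫⁻ s in Icc 0 T, (∫⁻ x in D, ‖v' s ω x‖ₑ ^ (q + 2)) ∂leb := by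
    have h3 : Measurable fun p : ℝ≥0 × Ω => ∫⁻ x in D, ‖v' p.1 p.2 x‖ₑ ^ (q + 2) :=
      (hv'.measurable.enorm.pow_const (q + 2)).lintegral_prod_right'
    exact h3.lintegral_prod_left'
  have h4 := ((le_add_self).trans_lt hE).ne
  rw [lintegral_congr_ae h1] at h4
  filter_upwards [h1, MeasureTheory.ae_lt_top h2 h4] with ω h5 h6
  rwa [h5]

end Transform

/-! ### Algebraic identities for the cross product term -/

section Algebra

variable {N : ℕ}

theorem crossTerm_smul_left (r : ℝ) (g : E3) (a : C6) :
    crossTerm (r • g) a = (r : ℂ) • crossTerm g a := by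
  ext s
  rcases s with i | i
  · simp only [PiLp.smul_apply, crossTerm_apply_inl, cross_apply]
    fin_cases i <;> simp <;> ring
  · simp only [PiLp.smul_apply, crossTerm_apply_inr, cross_apply]
    fin_cases i <;> simp <;> ring

theorem crossTerm_add_left (g g' : E3) (a : C6) :
    crossTerm (g + g') a = crossTerm g a + crossTerm g' a := by
  ext s
  rcases s with i | i
  · simp only [PiLp.add_apply, crossTerm_apply_inl, cross_apply]
    fin_cases i <;> simp <;> ring
  · simp only [PiLp.add_apply, crossTerm_apply_inr, cross_apply]
    fin_cases i <;> simp <;> ring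

theorem crossTerm_neg_left (g : E3) (a : C6) : crossTerm (-g) a = -crossTerm g a := by
  rw [← neg_one_smul ℝ g, crossTerm_smul_left]
  simp

theorem crossTerm_sum_smul_left (r : Fin N → ℝ) (g : Fin N → E3) (a : C6) :
    crossTerm (∑ l, r l • g l) a = ∑ l, (r l : ℂ) • crossTerm (g l) a := by
  have h0 : crossTerm 0 a = 0 := by simpa using crossTerm_smul_left 0 0 a
  induction (Finset.univ : Finset (Fin N)) using Finset.induction_on with
  | empty => simpa using h0
  | insert i s hi ih =>
    rw [Finset.sum_insert hi, Finset.sum_insert hi, crossTerm_add_left, crossTerm_smul_left, ih]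

theorem powerNL_smul {e : ℂ} (he : ‖e‖ = 1) (q : ℝ) (a : C6) :
    powerNL q (e • a) = e • powerNL q a := by
  rw [powerNL, powerNL, norm_smul, he, one_mul, smul_comm]

/-- With coefficients -C the Itô correction is -½ ∑ C_l² and the covariation with the noise is -i
C_l (k_l + i C_l a) = -i C_l k_l + C_l² a. Together they give +½ ∑ C_l² and the correction of J. The
summand 0 is the place of the retarded term. -/
theorem rotDrift_neg {e : ℂ} (he : ‖e‖ = 1) (q : ℝ) (b : Fin N → ℝ) (C : Fin N → E3 → ℝ)
    (G : Fin N → E3 → E3) (a J : C6) (k : Fin N → C6) (x : E3) :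
    rotDrift b (fun l x => -C l x) (fun l x => -G l x) e a (-powerNL q a + 0 + J)
        (fun l => k l + (Complex.I * (C l x : ℂ)) • a) x
      = -powerNL q (e • a) + (((1 / 2 : ℂ) * ∑ l, (C l x : ℂ) ^ 2) • e • a
        + ∑ l, (Complex.I * (b l : ℂ)) • crossTerm (G l x) (e • a))
        + e • (J - ∑ l, (Complex.I * (C l x : ℂ)) • k l) := by
  have h1 : ∀ l, (-Complex.I * (b l : ℂ)) • crossTerm (-G l x) a
      + (Complex.I * ((-C l x : ℝ) : ℂ)) • (k l + (Complex.I * (C l x : ℂ)) • a)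
      = (Complex.I * (b l : ℂ)) • crossTerm (G l x) a - (Complex.I * (C l x : ℂ)) • k l
        + (C l x : ℂ) ^ 2 • a := fun l => by
    have h2 : (C l x : ℂ) ^ 2 = -(Complex.I * (C l x : ℂ)) * (Complex.I * (C l x : ℂ)) := by
      linear_combination ((C l x : ℂ) ^ 2) * Complex.I_sq
    rw [crossTerm_neg_left, h2]
    push_cast
    module
  have h3 : ∀ l, (Complex.I * ((-C l x : ℝ) : ℂ)) ^ 2 = -(C l x : ℂ) ^ 2 := fun l => by
    push_cast
    linear_combination ((C l x : ℂ) ^ 2) * Complex.I_sq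
  have h4 : ∑ l, (Complex.I * (b l : ℂ)) • crossTerm (G l x) (e • a)
      = e • ∑ l, (Complex.I * (b l : ℂ)) • crossTerm (G l x) a := by
    rw [Finset.smul_sum]
    exact Finset.sum_congr rfl fun l _ => by rw [crossTerm_smul, smul_comm]
  rw [rotDrift, powerNL_smul he, h4]
  simp only [h1, h3, Finset.sum_add_distrib, Finset.sum_sub_distrib, Finset.sum_neg_distrib,
    ← Finset.sum_smul]
  module

/-- Inverse computation: the correction ½ ∑ (i C_l)² cancels +½ ∑ C_l², the commutator cancels the
gradient terms, and the covariation i C_l e' k_l cancels the correction of J. -/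
theorem rotDrift_pos {e e' : ℂ} (he : ‖e‖ = 1) (hee : e * e' = 1) (q : ℝ) (b : Fin N → ℝ)
    (C : Fin N → E3 → ℝ) (G : Fin N → E3 → E3) (a J : C6) (k : Fin N → C6) (x : E3) :
    rotDrift b C G e a (-powerNL q a + (((1 / 2 : ℂ) * ∑ l, (C l x : ℂ) ^ 2) • a
        + ∑ l, (Complex.I * (b l : ℂ)) • crossTerm (G l x) a)
        + e' • (J - ∑ l, (Complex.I * (C l x : ℂ)) • k l)) (fun l => e' • k l) x
      = -powerNL q (e • a) + 0 + J := by
  have h1 : ∀ l, (-Complex.I * (b l : ℂ)) • crossTerm (G l x) a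
      + (Complex.I * (C l x : ℂ)) • e' • k l
      = -((Complex.I * (b l : ℂ)) • crossTerm (G l x) a)
        + e' • (Complex.I * (C l x : ℂ)) • k l := fun l => by module
  have h3 : ∀ l, (Complex.I * (C l x : ℂ)) ^ 2 = -(C l x : ℂ) ^ 2 := fun l => by
    linear_combination ((C l x : ℂ) ^ 2) * Complex.I_sq
  have h5 : J = (e * e') • J := by rw [hee, one_smul]
  rw [rotDrift, powerNL_smul he]
  simp only [h1, h3, Finset.sum_add_distrib, Finset.sum_neg_distrib, ← Finset.smul_sum]
  conv_rhs => rw [h5]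
  module

end Algebra

/-! ### Regularity of the distribution M u under multiplication by the phase -/

section Regularity

variable {Ω : Type*} {mΩ : MeasurableSpace Ω} {P : Measure Ω} {F : Filtration ℝ≥0 mΩ}
  {T : ℝ≥0} {N : ℕ} {β : Fin N → ℝ≥0 → Ω → ℝ} {D : Set E3} {q : ℝ} {B : Fin N → LInf D}
  {u v w : ℝ≥0 → Ω → H D} {C : Fin N → E3 → ℝ} {G : Fin N → E3 → E3} {K : ℝ}

theorem brPhase_eq (t : ℝ≥0) (ω : Ω) (x : E3) :
    brPhase β C t ω x = Complex.I * ((∑ l, β l t ω * C l x : ℝ) : ℂ) := by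
  rw [brPhase, Complex.ofReal_sum, Finset.mul_sum]
  refine Finset.sum_congr rfl fun l _ => ?_
  push_cast
  ring

theorem norm_exp_brPhase (t : ℝ≥0) (ω : Ω) (x : E3) : ‖Complex.exp (brPhase β C t ω x)‖ = 1 := by
  rw [brPhase_eq, mul_comm, Complex.norm_exp_ofReal_mul_I]

/-- At fixed t and ω the phase is e^{is} evaluated at the real Lipschitz function ∑ β_l(t) C_l, so
the deterministic Leibniz rule applies. -/
theorem IsDistribMaxwell.exp_mul (hcov : ShiftCover D) (hD : IsOpen D)
    (hCm : ∀ l, Measurable (C l)) (hGm : ∀ l, Measurable (G l)) (hCK : ∀ l x, |C l x| ≤ K)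
    (hGK : ∀ l x, ‖G l x‖ ≤ K) (hCG : ∀ l, HasWeakGradient D (C l) (G l)) {a z : E3 → C6}
    (H : IsDistribMaxwell D a z) (t : ℝ≥0) (ω : Ω) :
    IsDistribMaxwell D (fun x => Complex.exp (brPhase β C t ω x) • a x)
      (fun x => Complex.exp (brPhase β C t ω x) • z x + ∑ l, (Complex.I * (β l t ω : ℂ)) •
        crossTerm (G l x) (Complex.exp (brPhase β C t ω x) • a x)) := by
  have hE : ContDiff ℝ (⊤ : ℕ∞) fun s : ℝ => Complex.exp (Complex.I * (s : ℂ)) :=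
    (contDiff_const.mul Complex.ofRealCLM.contDiff).cexp
  have hE' : ∀ s : ℝ, deriv (fun s : ℝ => Complex.exp (Complex.I * (s : ℂ))) s
      = Complex.exp (Complex.I * (s : ℂ)) * Complex.I := fun s => by
    have h6 := ((Complex.ofRealCLM.hasDerivAt (x := s)).const_mul Complex.I).cexp
    simpa using h6.deriv
  have h1 := H.mul (K := ∑ l, |β l t ω| * K) (b := fun x => ∑ l, β l t ω * C l x)
    (G := fun x => ∑ l, β l t ω • G l x) hcov hD
    (Finset.measurable_fun_sum _ fun l _ => (hCm l).const_mul _)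
    (Finset.measurable_fun_sum _ fun l _ => (hGm l).const_smul (β l t ω))
    (fun x => (Finset.abs_sum_le_sum_abs _ _).trans (Finset.sum_le_sum fun l _ => by
      rw [abs_mul]
      exact mul_le_mul_of_nonneg_left (hCK l x) (abs_nonneg _)))
    (fun x => (norm_sum_le _ _).trans (Finset.sum_le_sum fun l _ => by
      rw [norm_smul, Real.norm_eq_abs]
      exact mul_le_mul_of_nonneg_left (hGK l x) (abs_nonneg _)))
    (HasWeakGradient.sum_mul hCG hCm hGm hCK hGK _) hE
  have e1 : ∀ x, Complex.exp (brPhase β C t ω x)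
      = Complex.exp (Complex.I * ((∑ l, β l t ω * C l x : ℝ) : ℂ)) := fun x => by rw [brPhase_eq]
  simp only [e1]
  convert h1 using 3 with x
  rw [hE', crossTerm_sum_smul_left, Finset.smul_sum]
  refine Finset.sum_congr rfl fun l _ => ?_
  rw [crossTerm_smul]
  module

/-- Multiplication by a phase of modulus one preserves both norms of the decomposition. The
commutator is never estimated: it is absorbed in the remainder R', which explains why the gradient
term occurs inside the regularity condition on y. -/
theorem MaxwellRegular.mul [IsProbabilityMeasure P] (hβ : IsBrownianFamily P F β)
    (hcov : ShiftCover D) (hD : IsOpen D)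
    (hCm : ∀ l, Measurable (C l)) (hGm : ∀ l, Measurable (G l)) (hCK : ∀ l x, |C l x| ≤ K)
    (hGK : ∀ l x, ‖G l x‖ ≤ K) (hCG : ∀ l, HasWeakGradient D (C l) (G l))
    {R R' : ℝ≥0 → Ω → E3 → C6} (hv : MaxwellRegular P D T q v R)
    (hwv : ∀ᵐ ω ∂P, ∀ t ≤ T, w t ω =ᵐ[volume.restrict D]
      fun x => Complex.exp (brPhase β C t ω x) • v t ω x)
    (hR : ∀ᵐ ω ∂P, ∀ t ≤ T, R' t ω =ᵐ[volume.restrict D] fun x =>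
      Complex.exp (brPhase β C t ω x) • R t ω x - ∑ l, (Complex.I * (β l t ω : ℂ)) •
        crossTerm (G l x) (Complex.exp (brPhase β C t ω x) • v t ω x)) :
    MaxwellRegular P D T q w R' := by
  -- The two summands must be measurable jointly in ω, t and x, so the phase is built from a jointly
  -- measurable version of β.
  obtain ⟨β', hβm, hβc, hββ⟩ := hβ.exists_version T
  obtain ⟨z₁, z₂, h1, h2, h3, h4⟩ := hv
  have hm : Measurable fun p : Ω × ℝ≥0 × E3 => Complex.exp (brPhase β' C p.2.1 p.1 p.2.2) :=
    ((bddField_brPhase (P := P) (T := T) hCm hCK hβm hβc).comp Complex.continuous_exp).measurable.comp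
      (by fun_prop : Measurable fun p : Ω × ℝ≥0 × E3 => ((p.2.1, p.1), p.2.2))
  refine ⟨fun p => Complex.exp (brPhase β' C p.2.1 p.1 p.2.2) • z₁ p,
    fun p => Complex.exp (brPhase β' C p.2.1 p.1 p.2.2) • z₂ p,
    hm.aestronglyMeasurable.smul h1, ?_, ?_, ?_⟩
  · have h5 : ∀ ω t, eLpNorm (fun x => Complex.exp (brPhase β' C t ω x) • z₁ (ω, t, x)) 2
        (volume.restrict D) = eLpNorm (fun x => z₁ (ω, t, x)) 2 (volume.restrict D) := fun ω t =>
      eLpNorm_congr_norm_ae (ae_of_all _ fun x => by rw [norm_smul, norm_exp_brPhase, one_mul])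
    simpa only [h5] using h2
  · refine h3.of_le (hm.aestronglyMeasurable.smul h3.1) (ae_of_all _ fun p => ?_)
    rw [norm_smul, norm_exp_brPhase, one_mul]
  · filter_upwards [h4, hββ, hwv, hR] with ω h5 h6 h7 h8
    filter_upwards [h5, ae_restrict_mem measurableSet_Icc] with t h9 ht
    have h10 := h9.exp_mul (β := β) hcov hD hCm hGm hCK hGK hCG t ω
    refine h10.congr hD (h7 t ht.2).symm ?_
    have h11 : ∀ x, brPhase β' C t ω x = brPhase β C t ω x := fun x => by
      simp only [brPhase, h6 t ht.2]
    filter_upwards [h8 t ht.2] with x h12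
    rw [h12, h11]
    simp only [smul_sub, smul_add]
    abel

end Regularity

/-! ### Representatives of the coefficients -/

section Coefficients

variable {N : ℕ} {D : Set E3} {B : Fin N → LInf D}

/-- Everywhere bounded and measurable representatives of `B_l` and of their gradients. -/
theorem exists_bounded_versions (hB : ∀ j, MemW1Inf D (B j)) :
    ∃ (C : Fin N → E3 → ℝ) (G : Fin N → E3 → E3) (K : ℝ), (∀ l, Measurable (C l)) ∧
      (∀ l, Measurable (G l)) ∧ (∀ l x, |C l x| ≤ K) ∧ (∀ l x, ‖G l x‖ ≤ K) ∧
      (∀ l, HasWeakGradient D (C l) (G l)) ∧ (∀ l, B l =ᵐ[volume.restrict D] C l) ∧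
      ∀ l, weakGrad D (B l) =ᵐ[volume.restrict D] G l := by
  choose C hCm hCK hBC using fun l => exists_bounded_version (B l)
  choose G hGm hGK hBG using fun l => exists_bounded_version (weakGrad D (B l))
  choose K hK using hCK
  choose K' hK' using hGK
  refine ⟨C, G, ∑ l, (|K l| + |K' l|), hCm, hGm, fun l x => ?_, fun l x => ?_, fun l =>
    (hasWeakGradient_weakGrad (hB l)).congr (hBC l) (hBG l), hBC, hBG⟩
  · refine ((hK l x).trans ((le_abs_self _).trans (le_add_of_nonneg_right (abs_nonneg (K' l))))).trans
      (Finset.single_le_sum (f := fun l => |K l| + |K' l|) (fun l _ => by positivity)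
        (Finset.mem_univ l))
  · refine ((hK' l x).trans ((le_abs_self _).trans (le_add_of_nonneg_left (abs_nonneg (K l))))).trans
      (Finset.single_le_sum (f := fun l => |K l| + |K' l|) (fun l _ => by positivity)
        (Finset.mem_univ l))

theorem HasWeakGradient.neg {b : E3 → ℝ} {g : E3 → E3} (h : HasWeakGradient D b g) :
    HasWeakGradient D (fun x => -b x) (fun x => -g x) := by
  intro φ h1 h2 h3 i
  have h4 := h φ h1 h2 h3 i
  simp only [PiLp.neg_apply, neg_mul, integral_neg, h4]

end Coefficients

/-! ### The two directions of the equivalence -/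

section Main

variable {Ω : Type*} {mΩ : MeasurableSpace Ω} {P : Measure Ω} {F : Filtration ℝ≥0 mΩ}
  {T : ℝ≥0} {N : ℕ} {β : Fin N → ℝ≥0 → Ω → ℝ} {D : Set E3} {q : ℝ} {B : Fin N → LInf D}
  {u₀ : Ω → H D} {J : ℝ≥0 → Ω → H D} {b : Fin N → ℝ≥0 → Ω → H D}
  {u : ℝ≥0 → Ω → H D} {C : Fin N → E3 → ℝ} {G : Fin N → E3 → E3} {K : ℝ}

theorem exp_brPhase_mul (t : ℝ≥0) (ω : Ω) (x : E3) : Complex.exp (brPhase β C t ω x)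
    * Complex.exp (brPhase β (fun l x => -C l x) t ω x) = 1 := by
  rw [← Complex.exp_add, Complex.exp_eq_one_iff]
  exact ⟨0, by simp [brPhase_eq]⟩

theorem transform_ae (hBC : ∀ l, B l =ᵐ[volume.restrict D] C l) (t : ℝ≥0) (ω : Ω) :
    ∀ᵐ x ∂volume.restrict D,
      phase B (fun l => β l t ω) x = Complex.exp (brPhase β (fun l x => -C l x) t ω x) ∧
      transform β B u t ω x = Complex.exp (brPhase β (fun l x => -C l x) t ω x) • u t ω x ∧
      u t ω x = Complex.exp (brPhase β C t ω x) • transform β B u t ω x := by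
  filter_upwards [coeFn_rescale B (fun l => β l t ω) (u t ω), ae_all_iff.2 hBC] with x h1 h2
  have h3 : phase B (fun l => β l t ω) x
      = Complex.exp (brPhase β (fun l x => -C l x) t ω x) := by
    rw [phase_eq, brPhase_eq]
    congr 3
    rw [← Finset.sum_neg_distrib]
    exact Finset.sum_congr rfl fun l _ => by rw [h2]; ring
  have h4 : transform β B u t ω x
      = Complex.exp (brPhase β (fun l x => -C l x) t ω x) • u t ω x := by
    rw [transform, h1, h3]
  exact ⟨h3, h4, by rw [h4, smul_smul, exp_brPhase_mul, one_smul]⟩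

theorem retarded_zero (t : ℝ≥0) (ω : Ω) :
    retarded (0 : ℝ≥0 → Ω → (H D →L[ℂ] H D)) u t ω =ᵐ[volume.restrict D] 0 := by
  have h1 : retarded (0 : ℝ≥0 → Ω → (H D →L[ℂ] H D)) u t ω = 0 := by simp [retarded]
  rw [h1]
  exact Lp.coeFn_zero _ _ _

/-- The transformed process solves the transformed equation. -/
theorem solvesTSEE_of_solves [IsProbabilityMeasure P] (hF : UsualConditions P F)
    (hβ : IsBrownianFamily P F β) (hcov : ShiftCover D) (hD : IsOpen D) (hq : 0 < q)
    (hB : ∀ j, MemW1Inf D (B j)) (hJ : IsL2Process P F T J) (hb : ∀ j, IsL2Process P F T (b j))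
    (hu : ContinuousPaths P T u) (hE : FiniteEnergy P T q u)
    (hs : SolvesWeakly P F β D T q u₀
      (fun t ω x => -powerNL q (u t ω x) + retarded 0 u t ω x + J t ω x)
      (fun j t ω x => b j t ω x + (Complex.I * (B j x : ℂ)) • u t ω x) u) :
    SolvesTSEE P F β D T q B u₀ J b (transform β B u) := by
  obtain ⟨C, G, K, hCm, hGm, hCK, hGK, hCG, hBC, hBG⟩ := exists_bounded_versions hB
  obtain ⟨u', hu', huu⟩ := exists_sqField_of_continuousPaths hs.1 hu
  obtain ⟨J', hJ', hJJ⟩ := exists_sqField_of_isL2Process hJ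
  choose b' hb' hbb using fun j => exists_sqField_of_isL2Process (hb j)
  have hmem : ∀ᵐ s ∂leb.restrict (Icc 0 T), s ≤ T :=
    (ae_restrict_mem measurableSet_Icc).mono fun s hs => hs.2
  have hIC : ∀ l, BddField P T fun _ _ x => Complex.I * (C l x : ℂ) := fun l =>
    bddField_const ((Complex.measurable_ofReal.comp (hCm l)).const_mul _) (K := K) fun x => by
      rw [norm_mul, Complex.norm_I, one_mul, Complex.norm_real]
      exact hCK l x
  -- The square integrable remainder of the drift is J, the retarded term being zero, and the
  -- coefficients -B remove the multiplicative noise.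
  refine hs.transform (C := fun l x => -C l x) (G := fun l x => -G l x) (K := K) hF hβ hcov hD hq
    (fun l => (hCm l).neg) (fun l => (hGm l).neg) (fun l x => by rw [abs_neg]; exact hCK l x)
    (fun l x => by rw [norm_neg]; exact hGK l x) (fun l => (hCG l).neg) hu
    (hE.ae_lt_top hs.1 hu) hJ' ?_ (k := fun l s ω x => b' l s ω x + (Complex.I * (C l x : ℂ)) •
      u' s ω x) (fun l => (hb' l).add (hu'.smul (hIC l))) (fun l => ?_)
    (adapted_transform hβ hs.1) (continuousPaths_transform hβ hu) ?_ ?_ fun l => ?_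
  · refine ae_of_all _ fun ω => ?_
    filter_upwards [hmem] with s hs
    filter_upwards [hJJ ω s hs, retarded_zero (u := u) s ω] with x h1 h2
    rw [h1, h2, Pi.zero_apply, add_zero]
  · filter_upwards [huu] with ω h1
    filter_upwards [hmem] with s hs
    filter_upwards [hbb l ω s hs, h1 s hs, hBC l] with x h2 h3 h4
    rw [h2, h3, h4]
  · exact ae_of_all _ fun ω t _ => (transform_ae hBC t ω).mono fun x hx => hx.2.1
  · refine ae_of_all _ fun ω => ae_of_all _ fun s => ?_
    filter_upwards [transform_ae (β := β) (u := u) hBC s ω, ae_all_iff.2 hBC, ae_all_iff.2 hBG,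
      retarded_zero (u := u) s ω] with x h1 h2 h3 h4
    simp only [h4, h2, opA, gradTerm, tildeJ, h1.1, h1.2.1, h3, Pi.zero_apply]
    exact (rotDrift_neg (norm_exp_brPhase s ω x) q (fun l => β l s ω) C G (u s ω x) (J s ω x)
      (fun l => b l s ω x) x).symm
  · refine ae_of_all _ fun ω => ae_of_all _ fun s => ?_
    filter_upwards [transform_ae (β := β) (u := u) hBC s ω, hBC l] with x h1 h2
    simp only [tildeB, h1.1, h2]
    push_cast
    module

/-- If the transformed process solves the transformed equation, then the process solves the
original one. -/
theorem solves_of_solvesTSEE [IsProbabilityMeasure P] (hF : UsualConditions P F)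
    (hβ : IsBrownianFamily P F β) (hcov : ShiftCover D) (hD : IsOpen D) (hq : 0 < q)
    (hB : ∀ j, MemW1Inf D (B j)) (hJ : IsL2Process P F T J) (hb : ∀ j, IsL2Process P F T (b j))
    (hu : ContinuousPaths P T u) (hE : FiniteEnergy P T q (transform β B u))
    (hs : SolvesTSEE P F β D T q B u₀ J b (transform β B u)) :
    SolvesWeakly P F β D T q u₀
      (fun t ω x => -powerNL q (u t ω x) + retarded 0 u t ω x + J t ω x)
      (fun j t ω x => b j t ω x + (Complex.I * (B j x : ℂ)) • u t ω x) u := by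
  obtain ⟨C, G, K, hCm, hGm, hCK, hGK, hCG, hBC, hBG⟩ := exists_bounded_versions hB
  have hyc := continuousPaths_transform (B := B) hβ hu
  obtain ⟨y', hy', hyy⟩ := exists_sqField_of_continuousPaths hs.1 hyc
  obtain ⟨J', hJ', hJJ⟩ := exists_sqField_of_isL2Process hJ
  choose b' hb' hbb using fun j => exists_sqField_of_isL2Process (hb j)
  obtain ⟨β', hβm, hβc, hββ⟩ := hβ.exists_version T
  have hmem : ∀ᵐ s ∂leb.restrict (Icc 0 T), s ≤ T :=
    (ae_restrict_mem measurableSet_Icc).mono fun s hs => hs.2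
  have hC1 : ∀ l x, ‖(C l x : ℂ)‖ ≤ K := fun l x => by
    rw [Complex.norm_real]
    exact hCK l x
  have hCb : ∀ l, BddField P T fun _ _ x => (C l x : ℂ) := fun l =>
    bddField_const (Complex.measurable_ofReal.comp (hCm l)) (hC1 l)
  have hI : BddField P T fun _ _ _ => Complex.I :=
    bddField_const measurable_const (K := 1) fun _ => by simp
  have hph : BddField P T fun s ω x => Complex.exp (brPhase β' (fun l x => -C l x) s ω x) :=
    (bddField_brPhase (C := fun l x => -C l x) (K := K) (fun l => (hCm l).neg)
      (fun l x => by rw [abs_neg]; exact hCK l x) hβm hβc).comp Complex.continuous_exp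
  -- Everything in the drift of the transformed equation except the nonlinearity is almost surely
  -- square integrable: the zeroth order and gradient terms because β and B are bounded along paths,
  -- the rest because J and b are.
  have hh : SqField P T (volume.restrict D) fun s ω x =>
      (∑ l, ((1 / 2 : ℂ) * ((C l x : ℂ) * (C l x : ℂ))) • y' s ω x
        + ∑ l, (Complex.I * (β' l s ω : ℂ)) • crossTerm (G l x) (y' s ω x))
      + Complex.exp (brPhase β' (fun l x => -C l x) s ω x) • (J' s ω x
        + ∑ l, (-1 : ℂ) • (Complex.I * (C l x : ℂ)) • b' l s ω x) := by
    refine ((SqField.sum _ fun l => ?_).add (SqField.sum _ fun l => ?_)).add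
      (SqField.smul (hJ'.add (SqField.sum _ fun l => ?_)) hph)
    · exact hy'.smul ((bddField_const measurable_const (K := ‖(1 / 2 : ℂ)‖) fun _ => le_rfl).mul
        ((hCb l).mul (hCb l)))
    · exact (hy'.crossTerm (hGm l) (hGK l)).smul (hI.mul (bddField_brownian hβm hβc l))
    · exact ((hb' l).smul (hI.mul (hCb l))).smul
        (bddField_const measurable_const (K := ‖(-1 : ℂ)‖) fun _ => le_rfl)
  refine SolvesWeakly.transform (v := transform β B u) (C := C) (G := G) (K := K) hF hβ hcov hD hq
    hCm hGm hCK hGK hCG hs hyc (hE.ae_lt_top hs.1 hyc) hh ?_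
    (k := fun l s ω x => Complex.exp (brPhase β' (fun l x => -C l x) s ω x) • b' l s ω x)
    (fun l => (hb' l).smul hph) (fun l => ?_) (adapted_of_transform hβ hs.1) hu ?_ ?_ fun l => ?_
  · filter_upwards [hββ, hyy] with ω h1 h2
    filter_upwards [hmem] with s hs
    have h3 : ∀ x, brPhase β' (fun l x => -C l x) s ω x = brPhase β (fun l x => -C l x) s ω x :=
      fun x => by simp only [brPhase, h1 s hs]
    filter_upwards [transform_ae (β := β) (u := u) hBC s ω, ae_all_iff.2 hBC, ae_all_iff.2 hBG, hJJ ω s hs,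
      ae_all_iff.2 fun l => hbb l ω s hs, h2 s hs] with x h4 h5 h6 h7 h8 h9
    simp only [opA, gradTerm, tildeJ, h4.1, h5, h6, h7, h8, h9, h3, ← h1 s hs, ← Finset.sum_smul,
      ← Finset.smul_sum, ← Finset.mul_sum, pow_two]
    module
  · filter_upwards [hββ] with ω h1
    filter_upwards [hmem] with s hs
    filter_upwards [transform_ae (β := β) (u := u) hBC s ω, hbb l ω s hs] with x h2 h3
    rw [tildeB, h2.1, h3]
    simp only [brPhase, h1 s hs]
  · exact ae_of_all _ fun ω t _ => (transform_ae hBC t ω).mono fun x hx => hx.2.2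
  · refine ae_of_all _ fun ω => ae_of_all _ fun s => ?_
    filter_upwards [transform_ae (β := β) (u := u) hBC s ω, ae_all_iff.2 hBC, ae_all_iff.2 hBG,
      retarded_zero (u := u) s ω] with x h1 h2 h3 h4
    rw [h4, Pi.zero_apply, h1.2.2]
    simp only [h2, opA, gradTerm, tildeJ, tildeB, h1.1, h3]
    exact (rotDrift_pos (norm_exp_brPhase s ω x) (exp_brPhase_mul s ω x) q (fun l => β l s ω) C G
      (transform β B u s ω x) (J s ω x) (fun l => b l s ω x) x).symm
  · refine ae_of_all _ fun ω => ae_of_all _ fun s => ?_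
    filter_upwards [transform_ae (β := β) (u := u) hBC s ω, hBC l] with x h1 h2
    rw [h1.2.2, tildeB, h1.1, h2, smul_add, smul_smul _ _ (b l s ω x), exp_brPhase_mul, one_smul,
      smul_comm]

/-- Undoing the phase creates a commutator that cancels the gradient term exactly; applying the
phase to u creates, with coefficients -B, precisely the gradient term of y. -/
theorem maxwellRegular_transform [IsProbabilityMeasure P] (hβ : IsBrownianFamily P F β)
    (hcov : ShiftCover D) (hD : IsOpen D) (hB : ∀ j, MemW1Inf D (B j)) :
    MaxwellRegular P D T q (transform β B u) (gradTerm β B (transform β B u)) ↔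
      MaxwellRegular P D T q u fun _ _ _ => 0 := by
  obtain ⟨C, G, K, hCm, hGm, hCK, hGK, hCG, hBC, hBG⟩ := exists_bounded_versions hB
  constructor <;> intro h
  · refine h.mul hβ hcov hD hCm hGm hCK hGK hCG
      (ae_of_all _ fun ω t _ => (transform_ae hBC t ω).mono fun x hx => hx.2.2)
      (ae_of_all _ fun ω t _ => ?_)
    filter_upwards [ae_all_iff.2 hBG] with x h1
    simp only [gradTerm, h1, crossTerm_smul, Finset.smul_sum]
    rw [← Finset.sum_sub_distrib, Finset.sum_eq_zero fun l _ => ?_]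
    module
  · refine h.mul (C := fun l x => -C l x) (G := fun l x => -G l x) hβ hcov hD
      (fun l => (hCm l).neg) (fun l => (hGm l).neg) (fun l x => by rw [abs_neg]; exact hCK l x)
      (fun l x => by rw [norm_neg]; exact hGK l x) (fun l => (hCG l).neg)
      (ae_of_all _ fun ω t _ => (transform_ae hBC t ω).mono fun x hx => hx.2.1)
      (ae_of_all _ fun ω t _ => ?_)
    filter_upwards [ae_all_iff.2 hBG, transform_ae (β := β) (u := u) hBC t ω] with x h1 h2
    simp only [gradTerm, h1, ← h2.2.1, crossTerm_neg_left, smul_neg, Finset.sum_neg_distrib,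
      smul_zero, zero_sub, neg_neg]

end Main

end StochasticMaxwell

open StochasticMaxwell
theorem mainTheorem5 {Ω : Type*} {mΩ : MeasurableSpace Ω} (P : Measure Ω) [IsProbabilityMeasure P]
    (F : Filtration ℝ≥0 mΩ) (hF : UsualConditions P F)
    {N : ℕ} (β : Fin N → ℝ≥0 → Ω → ℝ) (hβ : IsBrownianFamily P F β)
    (T : ℝ≥0) (hT : 0 < T) (q : ℝ) (hq₁ : 1 < q) (hq₂ : q ≤ 2)
    (D : Set E3) (hD : IsBoundedC1Domain D ∨ D = univ)
    (B : Fin N → LInf D) (hB : ∀ j, MemW1Inf D (B j))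
    (u₀ : Ω → H D) (hu₀ : StronglyMeasurable[F 0] u₀)
    (J : ℝ≥0 → Ω → H D) (hJ : IsL2Process P F T J)
    (b : Fin N → ℝ≥0 → Ω → H D) (hb : ∀ j, IsL2Process P F T (b j))
    (u : ℝ≥0 → Ω → H D) (hu : ContinuousPaths P T u) :
    IsStrongSolutionMSEE P F β D T q B u₀ 0 J b u ↔
      (ContinuousPaths P T (transform β B u) ∧
        FiniteEnergy P T q (transform β B u) ∧
        MaxwellRegular P D T q (transform β B u) (gradTerm β B (transform β B u)) ∧
        SolvesTSEE P F β D T q B u₀ J b (transform β B u)) := by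
  have hcov : ShiftCover D := hD.elim (fun h => h.shiftCover) fun h => h ▸ shiftCover_univ
  have hDo : IsOpen D := hD.elim (fun h => h.isOpen) fun h => h ▸ isOpen_univ
  have hq : 0 < q := one_pos.trans hq₁
  constructor
  · intro h
    exact ⟨continuousPaths_transform hβ hu, finiteEnergy_transform.2 h.finiteEnergy,
      (maxwellRegular_transform hβ hcov hDo hB).2 h.regular,
      solvesTSEE_of_solves hF hβ hcov hDo hq hB hJ hb hu h.finiteEnergy h.solves⟩
  · rintro ⟨-, hE, hR, hs⟩
    exact
      { continuousPaths := hu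
        finiteEnergy := finiteEnergy_transform.1 hE
        solves := solves_of_solvesTSEE hF hβ hcov hDo hq hB hJ hb hu hE hs
        regular := (maxwellRegular_transform hβ hcov hDo hB).1 hR }
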